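/- Conventions. A polyhedron $3_n$ is a simple (i.e. 3-valent) $n$-vertex convex 3-polytope all of whose faces are triangles or hexagons, considered up to combinatorial isomorphism (mirror images identified); equivalently, a finite simple 3-connected 3-valent plane graph with such faces. A fullerene $5_m$ is defined in the same way with pentagons and hexagons, $m$ being the number of vertices. Two distinct faces are adjacent if they share an edge. The symmetry group of such a polyhedron is the group of all automorphisms of the plane graph (including the orientation-reversing ones), regarded as a point group, i.e. a finite subgroup of $O(3)$ up to conjugacy, in Schoenflies notation. Consider the following four forms of a graph $G$ of type $3_n$. (i) $G$ is the Tetrahedron ($n=4$) or the Truncated Tetrahedron ($n=12$). (ii) There are two distinct hexagons, each of which is adjacent to exactly two triangles, these being attached along opposite edges of the hexagon. (iii) There are exactly four hexagons that are adjacent to exactly two triangles along non-opposite and non-adjacent edges, and these four hexagons form two pairs of adjacent hexagons. (iv) The triangles are isolated: no two triangles are adjacent, and each hexagon is adjacent to at most one triangle. **Theorem.** Every $3_n$ has one of the forms (i)–(iv), and only one of them, with a single exception: the Cube truncated at the four vertices of two opposite edges (a $3_{16}$) has both form (ii) and form (iii), and no other $3_n$ has two of the forms. Moreover: (i) The Tetrahedron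 is a $3_4$ and the Truncated Tetrahedron is a $3_{12}$; the latter is the only $3_n$ in which some hexagon is adjacent to more than two triangles. (ii) If a $3_n$ has form (ii), then $8\mid n$, $n\ge 16$, and exactly two hexagons are adjacent to exactly two triangles along opposite edges, unless the graph is the Cube truncated at four pairwise non-adjacent vertices. If $n\equiv 8 \pmod{16}$ and $n\ge 24$, there is exactly one $3_n$ of form (ii), and its symmetry group is $D_2$. If $n\equiv 0\pmod{16}$ and $n\ge 32$, there are exactly two, one with symmetry group $D_{2h}$ and the other with symmetry group $D_{2d}$. For $n=16$ there are exactly two polyhedra $3_{16}$, and both are of form (ii): the Cube truncated at four pairwise non-adjacent vertices, with symmetry group $T_d$, and the Cube truncated at the four vertices of two opposite edges, with symmetry group $D_{2h}$. (iii) If a $3_n$ has form (iii), then $4\mid n$ and $n\ge 16$. For every $n\ge 16$ with $n\equiv 0\pmod 4$ there is exactly one $3_n$ of form (iii); its symmetry group is $D_{2h}$ if $n/4$ is even and $D_{2d}$ if $n/4$ is odd. (iv) Shrinking each triangle to a vertex (so that a triangle surrounded by three hexagons becomes a vertex surrounded by three pentagons) induces a one-to-one correspondence between the isomorphism classes of graphs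 $3_n$ of form (iv) and the isomorphism classes of fullerenes $5_{n-8}$ whose $12$ pentagons can be partitioned into four triples of mutually adjacent pentagons. That is, truncating such a fullerene at four vertices chosen so that the faces around them are pentagons and each pentagon contains exactly one of them gives a graph of form (iv); every graph of form (iv) arises so from a fullerene that is unique up to isomorphism; and every such fullerene has such a choice of vertices and yields, up to isomorphism, only one graph. -/

import Mathlib

/-- A finite combinatorial map (graph with a rotation system).  The darts are the oriented edges;
`rot` sends a dart to the next dart, in counter-clockwise order, around its initial vertex, and
`opp` reverses a dart. -/
structure CombMap where
  Dart : Type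
  [finite : Finite Dart]
  rot : Equiv.Perm Dart
  opp : Equiv.Perm Dart
  opp_opp : ∀ d, opp (opp d) = d
  opp_ne : ∀ d, opp d ≠ d

namespace CombMap

attribute [instance] CombMap.finite

/-- The face permutation: walks along the boundary of the face on the right of a dart. -/
def next (M : CombMap) : Equiv.Perm M.Dart := M.opp.trans M.rot

/-- Vertices are the cycles of `rot`. -/
def Vertex (M : CombMap) : Type := Quotient (Equiv.Perm.SameCycle.setoid M.rot)

/-- Edges are the cycles of `opp`. -/
def Edge (M : CombMap) : Type := Quotient (Equiv.Perm.SameCycle.setoid M.opp)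

/-- Faces are the cycles of `next`. -/
def Face (M : CombMap) : Type := Quotient (Equiv.Perm.SameCycle.setoid M.next)

/-- The initial vertex of a dart. -/
def vert (M : CombMap) (d : M.Dart) : M.Vertex := Quotient.mk _ d

/-- The face on the right of a dart. -/
def face (M : CombMap) (d : M.Dart) : M.Face := Quotient.mk _ d

/-- The number of edge-ends at a vertex. -/
noncomputable def degree (M : CombMap) (v : M.Vertex) : ℕ := {d | M.vert d = v}.ncard

/-- The number of sides of a face. -/
noncomputable def size (M : CombMap) (F : M.Face) : ℕ := {d | M.face d = F}.ncard

/-- The map is connected and drawn on the sphere: this is a connected plane graph, up to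
homeomorphism of the sphere. -/
def IsSpherical (M : CombMap) : Prop :=
  Nonempty M.Dart ∧
  (∀ d e : M.Dart, ∃ g ∈ Subgroup.closure {M.rot, M.opp}, g d = e) ∧
  (Nat.card M.Vertex : ℤ) - Nat.card M.Edge + Nat.card M.Face = 2

/-- No loops and no multiple edges. -/
def IsSimple (M : CombMap) : Prop :=
  (∀ d, M.vert (M.opp d) ≠ M.vert d) ∧
  (∀ d e, M.vert d = M.vert e → M.vert (M.opp d) = M.vert (M.opp e) → d = e)

/-- The underlying graph. -/
def graph (M : CombMap) : SimpleGraph M.Vertex where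
  Adj u v := u ≠ v ∧ ∃ d, M.vert d = u ∧ M.vert (M.opp d) = v
  symm := ⟨fun u v h => by
    obtain ⟨hne, d, hd, hd'⟩ := h
    exact ⟨hne.symm, M.opp d, hd', by rw [M.opp_opp, hd]⟩⟩
  loopless := ⟨fun _ h => h.1 rfl⟩

/-- At least four vertices, and deleting at most two vertices leaves a connected graph. -/
def IsThreeConnected (M : CombMap) : Prop :=
  4 ≤ Nat.card M.Vertex ∧
  ∀ S : Set M.Vertex, S.ncard ≤ 2 → (M.graph.induce Sᶜ).Connected

/-- Same combinatorial type: isomorphic as maps, mirror images being allowed. -/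
def Iso (M N : CombMap) : Prop :=
  ∃ e : M.Dart ≃ N.Dart, (∀ d, e (M.opp d) = N.opp (e d)) ∧
    ((∀ d, e (M.rot d) = N.rot (e d)) ∨ (∀ d, e (M.rot d) = N.rot.symm (e d)))

/-- An `n`-vertex simple polyhedron all of whose faces are `a`-gons or `b`-gons, i.e. (by Steinitz)
a simple 3-connected 3-valent plane graph with such faces. -/
def IsTwoFaced (M : CombMap) (a b n : ℕ) : Prop :=
  M.IsSpherical ∧ M.IsSimple ∧ M.IsThreeConnected ∧
  (∀ v, M.degree v = 3) ∧ (∀ F, M.size F = a ∨ M.size F = b) ∧ Nat.card M.Vertex = n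

/-- A polyhedron `3_n`. -/
def IsThree (M : CombMap) (n : ℕ) : Prop := M.IsTwoFaced 3 6 n

/-- A fullerene `5_n`. -/
def IsFullerene (M : CombMap) (n : ℕ) : Prop := M.IsTwoFaced 5 6 n

/-- Two distinct faces sharing an edge. -/
def FaceAdj (M : CombMap) (F G : M.Face) : Prop :=
  F ≠ G ∧ ∃ d, M.face d = F ∧ M.face (M.opp d) = G

/-- The triangles adjacent to a face. -/
def adjTriangles (M : CombMap) (F : M.Face) : Set M.Face := {T | M.size T = 3 ∧ M.FaceAdj F T}

/-- `F` is a hexagon adjacent to exactly two triangles, and they are attached to sides of `F` that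
are `k` steps apart along its boundary. -/
def IsHexagonWithGap (M : CombMap) (k : ℕ) (F : M.Face) : Prop :=
  M.size F = 6 ∧ ∃ T T' : M.Face, T ≠ T' ∧ M.adjTriangles F = {T, T'} ∧
    ∃ d, M.face d = F ∧ M.face (M.opp d) = T ∧ M.face (M.opp ((M.next ^ k) d)) = T'

/-- The hexagons adjacent to two triangles on opposite sides. -/
def oppositeHexagons (M : CombMap) : Set M.Face := {F | M.IsHexagonWithGap 3 F}

/-- The hexagons adjacent to two triangles on sides that are neither opposite nor adjacent. -/
def skewHexagons (M : CombMap) : Set M.Face := {F | M.IsHexagonWithGap 2 F}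

/-! ### Truncation and the named polyhedra -/

open Classical in
/-- The map `M` truncated at the vertices in `S`.  Every dart of `M` is kept (`Sum.inl d`).  A dart
`d` that starts at a vertex of `S` now starts at a new vertex of its own; `(d, false)` is the side
of the new face that leads from this corner to the corner of `M.rot d`, and `(d, true)` the one
that leads to the corner of `M.rot.symm d`. -/
noncomputable def truncate (M : CombMap) (S : Set M.Vertex) : CombMap where
  Dart := M.Dart ⊕ ({d : M.Dart // M.vert d ∈ S} × Bool)
  rot :=
    { toFun := fun x => match x with
        | Sum.inl d => if h : M.vert d ∈ S then Sum.inr (⟨d, h⟩, false) else Sum.inl (M.rot d)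
        | Sum.inr (d, false) => Sum.inr (d, true)
        | Sum.inr (d, true) => Sum.inl d.1
      invFun := fun x => match x with
        | Sum.inl d => if h : M.vert d ∈ S then Sum.inr (⟨d, h⟩, true) else Sum.inl (M.rot.symm d)
        | Sum.inr (d, true) => Sum.inr (d, false)
        | Sum.inr (d, false) => Sum.inl d.1
      left_inv := by
        have key : ∀ d, M.vert (M.rot d) = M.vert d := fun d =>
          Quotient.sound (Equiv.Perm.sameCycle_apply_left.2 (Equiv.Perm.SameCycle.refl _ _))
        rintro (d | ⟨⟨d, hd⟩, _ | _⟩)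
        · by_cases h : M.vert d ∈ S
          · simp [h]
          · simp [h, key]
        · rfl
        · simp [hd]
      right_inv := by
        have key : ∀ d, M.vert (M.rot.symm d) = M.vert d := fun d =>
          Quotient.sound ⟨1, by simp⟩
        rintro (d | ⟨⟨d, hd⟩, _ | _⟩)
        · by_cases h : M.vert d ∈ S
          · simp [h]
          · simp [h, key]
        · simp [hd]
        · rfl }
  opp :=
    { toFun := fun x => match x with
        | Sum.inl d => Sum.inl (M.opp d)
        | Sum.inr (d, false) => Sum.inr (⟨M.rot d.1, by
            have : M.vert (M.rot d.1) = M.vert d.1 :=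
              Quotient.sound (Equiv.Perm.sameCycle_apply_left.2 (Equiv.Perm.SameCycle.refl _ _))
            rw [this]; exact d.2⟩, true)
        | Sum.inr (d, true) => Sum.inr (⟨M.rot.symm d.1, by
            have : M.vert (M.rot.symm d.1) = M.vert d.1 :=
              Quotient.sound ⟨1, by simp⟩
            rw [this]; exact d.2⟩, false)
      invFun := fun x => match x with
        | Sum.inl d => Sum.inl (M.opp d)
        | Sum.inr (d, false) => Sum.inr (⟨M.rot d.1, by
            have : M.vert (M.rot d.1) = M.vert d.1 :=
              Quotient.sound (Equiv.Perm.sameCycle_apply_left.2 (Equiv.Perm.SameCycle.refl _ _))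
            rw [this]; exact d.2⟩, true)
        | Sum.inr (d, true) => Sum.inr (⟨M.rot.symm d.1, by
            have : M.vert (M.rot.symm d.1) = M.vert d.1 :=
              Quotient.sound ⟨1, by simp⟩
            rw [this]; exact d.2⟩, false)
      left_inv := by
        rintro (d | ⟨⟨d, hd⟩, _ | _⟩) <;> simp [M.opp_opp]
      right_inv := by
        rintro (d | ⟨⟨d, hd⟩, _ | _⟩) <;> simp [M.opp_opp] }
  opp_opp := by
    rintro (d | ⟨⟨d, hd⟩, _ | _⟩) <;> simp [M.opp_opp]
  opp_ne := by
    rintro (d | ⟨⟨d, hd⟩, _ | _⟩) <;> simp [M.opp_ne]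

/-- The Tetrahedron: the vertices are the elements of `ZMod 2 × ZMod 2`, and the dart `(v, i)` leads
from `v` to the sum of `v` and the `i`-th nonzero element. -/
def tetrahedron : CombMap where
  Dart := (ZMod 2 × ZMod 2) × Fin 3
  rot := (Equiv.refl _).prodCongr (Equiv.addRight 1)
  opp := Function.Involutive.toPerm
    (fun x => (x.1 + (![(1, 0), (0, 1), (1, 1)] : Fin 3 → ZMod 2 × ZMod 2) x.2, x.2))
    (by unfold Function.Involutive; decide)
  opp_opp := by decide
  opp_ne := by decide

/-- The Cube: the vertices are the `0`-`1` vectors of length `3`, and the dart `(v, i)` leads from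
`v` along the edge in the `i`-th coordinate direction; the cyclic order of the three directions
around `v`, seen from outside, depends on the parity of `v`. -/
def cube : CombMap where
  Dart := (Fin 3 → ZMod 2) × Fin 3
  rot :=
    { toFun := fun x => (x.1, if x.1 0 + x.1 1 + x.1 2 = 0 then x.2 + 1 else x.2 - 1)
      invFun := fun x => (x.1, if x.1 0 + x.1 1 + x.1 2 = 0 then x.2 - 1 else x.2 + 1)
      left_inv := by unfold Function.LeftInverse; decide
      right_inv := by unfold Function.RightInverse Function.LeftInverse; decide }
  opp := Function.Involutive.toPerm (fun x => (Function.update x.1 x.2 (x.1 x.2 + 1), x.2))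
    (by unfold Function.Involutive; decide)
  opp_opp := by decide
  opp_ne := by decide

/-- The Truncated Tetrahedron. -/
noncomputable def truncatedTetrahedron : CombMap := tetrahedron.truncate Set.univ

/-- The Cube truncated at four pairwise non-adjacent vertices. -/
noncomputable def cubeTruncatedNonadjacent : CombMap :=
  cube.truncate (cube.vert '' {d : (Fin 3 → ZMod 2) × Fin 3 | d.1 0 + d.1 1 + d.1 2 = 0})

/-- The Cube truncated at the four vertices of two opposite edges. -/
noncomputable def cubeTruncatedOppositeEdges : CombMap :=
  cube.truncate (cube.vert '' {d : (Fin 3 → ZMod 2) × Fin 3 | d.1 0 = d.1 1})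

/-! ### The four forms -/

/-- The Tetrahedron or the Truncated Tetrahedron. -/
def FormI (M : CombMap) : Prop := M.Iso tetrahedron ∨ M.Iso truncatedTetrahedron

/-- There are two hexagons, each adjacent to two triangles on opposite edges. -/
def FormII (M : CombMap) : Prop :=
  ∃ F F' : M.Face, F ≠ F' ∧ F ∈ M.oppositeHexagons ∧ F' ∈ M.oppositeHexagons

/-- There are exactly four hexagons adjacent to two triangles on non-opposite and non-adjacent
edges, and they form two adjacent pairs. -/
def FormIII (M : CombMap) : Prop :=
  M.skewHexagons.ncard = 4 ∧ ∃ H₁ H₁' H₂ H₂' : M.Face,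
    M.skewHexagons = {H₁, H₁', H₂, H₂'} ∧ M.FaceAdj H₁ H₁' ∧ M.FaceAdj H₂ H₂'

/-- The triangles are isolated: they are not adjacent to each other, and every hexagon is adjacent
to at most one of them. -/
def FormIV (M : CombMap) : Prop :=
  (∀ F, M.size F = 3 → M.adjTriangles F = ∅) ∧
  (∀ F, M.size F = 6 → (M.adjTriangles F).ncard ≤ 1)

/-! ### Isolated triples of pentagons -/

/-- The pentagons are partitioned into four triples of mutually adjacent ones. -/
def PentagonsInTriples (M : CombMap) : Prop :=
  ∃ P : Set (Set M.Face), P.ncard = 4 ∧ P.PairwiseDisjoint id ∧ ⋃₀ P = {F | M.size F = 5} ∧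
    ∀ t ∈ P, t.ncard = 3 ∧ t.Pairwise M.FaceAdj

/-- `S` selects a centre for each triple: all faces around a vertex of `S` are pentagons, and every
pentagon contains exactly one vertex of `S`. -/
def IsTripleCentres (M : CombMap) (S : Set M.Vertex) : Prop :=
  (∀ d, M.vert d ∈ S → M.size (M.face d) = 5) ∧
  (∀ F, M.size F = 5 → ∃! v, v ∈ S ∧ ∃ d, M.vert d = v ∧ M.face d = F)

/-- `M` is obtained from `H` by truncating the centres of the pentagon triples; equivalently `H` is
obtained from `M` by shrinking each triangle to a vertex, so that each triangle surrounded by three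
hexagons becomes a vertex surrounded by three pentagons. -/
def ShrinksTo (M H : CombMap) : Prop :=
  ∃ S : Set H.Vertex, H.IsTripleCentres S ∧ M.Iso (H.truncate S)

/-! ### Symmetry groups -/

/-- The group of all automorphisms, orientation-preserving or reversing. -/
def symmetryGroup (M : CombMap) : Subgroup (Equiv.Perm M.Dart) where
  carrier := {e | (∀ d, e (M.opp d) = M.opp (e d)) ∧
    ((∀ d, e (M.rot d) = M.rot (e d)) ∨ (∀ d, e (M.rot d) = M.rot.symm (e d)))}
  one_mem' := ⟨fun _ => rfl, Or.inl fun _ => rfl⟩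
  mul_mem' := by
    rintro a b ⟨ha, ha'⟩ ⟨hb, hb'⟩
    have key : ∀ c : Equiv.Perm M.Dart, (∀ d, c (M.rot d) = M.rot.symm (c d)) →
        ∀ d, c (M.rot.symm d) = M.rot (c d) := fun c hc d => by
      have := hc (M.rot.symm d)
      rw [Equiv.apply_symm_apply] at this
      rw [this, Equiv.apply_symm_apply]
    have key' : ∀ c : Equiv.Perm M.Dart, (∀ d, c (M.rot d) = M.rot (c d)) →
        ∀ d, c (M.rot.symm d) = M.rot.symm (c d) := fun c hc d => by
      have := hc (M.rot.symm d)
      rw [Equiv.apply_symm_apply] at this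
      rw [this, Equiv.symm_apply_apply]
    refine ⟨fun d => by simp [ha, hb], ?_⟩
    rcases ha' with ha' | ha' <;> rcases hb' with hb' | hb'
    · exact Or.inl fun d => by simp [ha', hb']
    · exact Or.inr fun d => by simp [key' a ha', hb']
    · exact Or.inr fun d => by simp [ha', hb']
    · exact Or.inl fun d => by simp [key a ha', hb']
  inv_mem' := by
    rintro a ⟨ha, ha'⟩
    have h1 : ∀ d, a (a⁻¹ d) = d := fun d => Equiv.apply_symm_apply a d
    refine ⟨fun d => a.injective (by rw [h1, ha, h1]), ?_⟩
    rcases ha' with ha' | ha'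
    · exact Or.inl fun d => a.injective (by rw [h1, ha', h1])
    · refine Or.inr fun d => a.injective ?_
      have h2 := ha' (M.rot.symm (a⁻¹ d))
      rw [Equiv.apply_symm_apply, h1] at h2
      rw [h1]
      exact ((Equiv.eq_symm_apply _).1 h2).symm.symm

/-- The symmetry group of `M` is the point group `P`: some isomorphism from the automorphism group
of `M` to `P` matches the orientation-preserving automorphisms with the rotations.  For each of the
point groups `D_2`, `D_2h`, `D_2d`, `T_d` this says exactly that `P` is the symmetry group of `M` as
a point group, because a finite subgroup of `O(3)` that is isomorphic to one of these by a
determinant-preserving isomorphism is conjugate to it. -/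
def HasPointGroup (M : CombMap) (P : Subgroup (Matrix.orthogonalGroup (Fin 3) ℝ)) : Prop :=
  ∃ ρ : M.symmetryGroup ≃* P, ∀ f : M.symmetryGroup,
    (∀ d, f.1 (M.rot d) = M.rot (f.1 d)) ↔
      Matrix.det ((ρ f).1 : Matrix (Fin 3) (Fin 3) ℝ) = 1

end CombMap

namespace PointGroup

/-- `D_2`: generated by the rotation by `π` around the `z`-axis and the rotation by `π` around
the `x`-axis. -/
def D2 : Subgroup (Matrix.orthogonalGroup (Fin 3) ℝ) :=
  Subgroup.closure {A | A.1 = !![-1, 0, 0; 0, -1, 0; 0, 0, 1] ∨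
    A.1 = !![1, 0, 0; 0, -1, 0; 0, 0, -1]}

/-- `D_2h`: generated by the rotation by `π` around the `z`-axis, the reflection in the
`xz`-plane, and the rotation by `π` around the `x`-axis, which lies in a plane of symmetry. -/
def D2h : Subgroup (Matrix.orthogonalGroup (Fin 3) ℝ) :=
  Subgroup.closure {A | A.1 = !![-1, 0, 0; 0, -1, 0; 0, 0, 1] ∨
    A.1 = !![1, 0, 0; 0, -1, 0; 0, 0, 1] ∨ A.1 = !![1, 0, 0; 0, -1, 0; 0, 0, -1]}

/-- `D_2d`: generated by the rotation by `π` around the `z`-axis, the reflection in the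
`xz`-plane, and the rotation by `π` around the axis `x = y, z = 0`, which goes between the two
planes of symmetry. -/
def D2d : Subgroup (Matrix.orthogonalGroup (Fin 3) ℝ) :=
  Subgroup.closure {A | A.1 = !![-1, 0, 0; 0, -1, 0; 0, 0, 1] ∨
    A.1 = !![1, 0, 0; 0, -1, 0; 0, 0, 1] ∨ A.1 = !![0, 1, 0; 1, 0, 0; 0, 0, -1]}

/-- The vertices of a regular tetrahedron centred at the origin. -/
def tetrahedronVertices : Set (Fin 3 → ℝ) :=
  {![1, 1, 1], ![1, -1, -1], ![-1, 1, -1], ![-1, -1, 1]}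

/-- `T_d`: the symmetry group of the regular tetrahedron. -/
def Td : Subgroup (Matrix.orthogonalGroup (Fin 3) ℝ) where
  carrier := {A | (fun v => A.1.mulVec v) '' tetrahedronVertices = tetrahedronVertices}
  one_mem' := by simp
  mul_mem' := by
    intro a b ha hb
    simp only [Set.mem_ofPred_eq] at ha hb ⊢
    conv_rhs => rw [← ha, ← hb]
    rw [Set.image_image]
    simp [Matrix.mulVec_mulVec]
  inv_mem' := by
    intro a ha
    simp only [Set.mem_ofPred_eq] at ha ⊢
    conv_lhs => rw [← ha]
    rw [Set.image_image]
    simp [Matrix.mulVec_mulVec]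

end PointGroup

/-! ### Cycles of a permutation of a finite type -/

/-! A polyhedron `3_n` is a folded piece of the hexagonal tiling. Place the face centres of the
tiling at the Eisenstein integers `Eis`. In a cubic map with faces of size 3 and 6, `next` and `opp`
satisfy the relations of the rotation group of the tiling, so the tiling wraps around the map
(`exists_development`). The darts that become equal are exchanged by rotations of the tiling.
Rotations by 60 or 120 degrees would fix a face centre or a vertex and are impossible; what remains
is the group generated by the half-turns about the points of a lattice `L`. Thus the map is
determined by `L` (`exists_dev`, `Dev`): the points of `L` are the centres of the triangles, the
four triangles correspond to `L / 2 L`, and `n` is four times the index of `L`. Conversely every `L`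
of finite index gives a map (`tilingQuotient`), with lattices that are rotated or reflected giving
isomorphic maps. It is simple and 3-connected if `L` contains no unit or `L = ⊤`; if a unit lies in
`L`, two triangles are adjacent, their apices separate the graph, and only the Tetrahedron survives.

The forms are conditions on short vectors of `L`. Two triangles at the same hexagon have centres
that differ by a vector of norm 3 (sides at distance two) or norm 4 (opposite sides). A lattice with
a vector of norm 3 is, up to rotation, `skewLattice k` with `k` its index; `k = 3` is the Truncated
Tetrahedron and `k ≥ 4` is form (iii). A lattice with a vector of norm 4 is, up to rotation,
`lattice 0 m` or `lattice 1 m`, which is form (ii). For odd `m` these two are mirror images, for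
even `m ≥ 4` they are inequivalent. Only at index 4 do both kinds of vectors occur together. Without
short vectors the map has form (iv).

A symmetry lifts to an isometry of the tiling that preserves `L`. It permutes `L / 2 L` by an affine
map, and this permutation together with the orientation determines the symmetry. Matching the four
triangles with the vertices of a regular tetrahedron turns these data into an element of `O(3)`
(`TetrahedralFrame`, `Dev.rep`). The translations give `D_2`; a reflection that preserves `L`
enlarges it to `D_2h` or `D_2d` according to whether `L` has a rectangular or a rhombic basis
adapted to it; the lattice of all even elements has every symmetry of the tiling and gives `T_d`.

For form (iv), truncating one corner of every pentagon makes all old faces hexagons, and shrinking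
the triangles undoes this. The fullerene is recovered from the truncation because the new edges are
exactly those that border a triangle (`iso_of_truncate_iso`). Three mutually adjacent pentagons
always meet at a vertex, since otherwise the belt that they form would enclose a region too small
for pentagons and hexagons (`exists_facesAround`). If a fullerene has two different choices of
centres, each lattice contains a vector of norm 7, and such a lattice is determined by its index up
to rotation and reflection (`iso_of_seven`), so both choices yield the same graph. -/

theorem Equiv.Perm.ncard_sameCycle {α : Type*} [Finite α] (p : Equiv.Perm α) (a : α) :
    {b | p.SameCycle a b}.ncard = Function.minimalPeriod p a := by
  have h : {b | p.SameCycle a b} = MulAction.orbit (Subgroup.zpowers p) a := by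
    ext b
    constructor
    · rintro ⟨i, hi⟩
      exact ⟨⟨p ^ i, i, rfl⟩, hi⟩
    · rintro ⟨⟨_, i, rfl⟩, hi⟩
      exact ⟨i, hi⟩
  have := Fintype.ofFinite (MulAction.orbit (Subgroup.zpowers p) a)
  have h2 := MulAction.minimalPeriod_eq_card (a := p) (b := a)
  rw [h, ← Nat.card_coe_set_eq, Nat.card_eq_fintype_card, ← h2]
  rfl

theorem Set.ncard_preimage_of_fibers {α β : Type*} [Finite α] [Finite β] (f : α → β) (s : Set β)
    (k : ℕ) (hk : ∀ b ∈ s, {a | f a = b}.ncard = k) : (f ⁻¹' s).ncard = k * s.ncard := by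
  classical
  have := Fintype.ofFinite α
  have := Fintype.ofFinite β
  rw [Set.ncard_eq_toFinset_card', Set.ncard_eq_toFinset_card']
  rw [Finset.card_eq_sum_card_fiberwise (f := f) (t := s.toFinset)]
  · rw [Finset.sum_const_nat (m := k), mul_comm]
    intro b hb
    rw [← hk b (by simpa using hb), Set.ncard_eq_toFinset_card']
    congr 1
    ext a
    simp only [Finset.mem_filter, Set.mem_toFinset, Set.mem_preimage, Set.mem_ofPred_eq]
    constructor
    · exact fun h => h.2
    · rintro rfl
      exact ⟨by simpa using hb, rfl⟩
  · intro a ha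
    simpa using ha

/-! ### Darts, vertices and faces of a map -/

namespace CombMap

variable (M : CombMap)

instance : Finite M.Vertex := inferInstanceAs (Finite (Quotient _))
instance : Finite M.Face := inferInstanceAs (Finite (Quotient _))

variable {M}

theorem next_apply (d : M.Dart) : M.next d = M.rot (M.opp d) := rfl

theorem next_opp (d : M.Dart) : M.next (M.opp d) = M.rot d := by rw [next_apply, M.opp_opp]

theorem next_symm_apply (d : M.Dart) : M.next.symm d = M.opp (M.rot.symm d) := by
  rw [Equiv.symm_apply_eq, next_opp, Equiv.apply_symm_apply]

theorem face_eq_iff {d e : M.Dart} : M.face d = M.face e ↔ M.next.SameCycle d e := Quotient.eq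

theorem vert_eq_iff {d e : M.Dart} : M.vert d = M.vert e ↔ M.rot.SameCycle d e := Quotient.eq

theorem face_next (d : M.Dart) : M.face (M.next d) = M.face d :=
  face_eq_iff.2 (Equiv.Perm.sameCycle_apply_left.2 (Equiv.Perm.SameCycle.refl _ _))

theorem face_next_symm (d : M.Dart) : M.face (M.next.symm d) = M.face d := by
  conv_rhs => rw [← M.next.apply_symm_apply d, face_next]

theorem vert_rot (d : M.Dart) : M.vert (M.rot d) = M.vert d :=
  vert_eq_iff.2 (Equiv.Perm.sameCycle_apply_left.2 (Equiv.Perm.SameCycle.refl _ _))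

theorem vert_rot_symm (d : M.Dart) : M.vert (M.rot.symm d) = M.vert d := by
  conv_rhs => rw [← M.rot.apply_symm_apply d, vert_rot]

theorem face_rot (d : M.Dart) : M.face (M.rot d) = M.face (M.opp d) := by
  rw [← next_opp, face_next]

theorem vert_next (d : M.Dart) : M.vert (M.next d) = M.vert (M.opp d) := vert_rot _

theorem face_iterate_next (d : M.Dart) (k : ℕ) : M.face (M.next^[k] d) = M.face d := by
  induction k with
  | zero => rfl
  | succ k ih => rw [Function.iterate_succ_apply', face_next, ih]

theorem face_surj (F : M.Face) : ∃ d, M.face d = F := Quotient.exists_rep F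

theorem vert_surj (v : M.Vertex) : ∃ d, M.vert d = v := Quotient.exists_rep v

theorem size_face (d : M.Dart) : M.size (M.face d) = Function.minimalPeriod M.next d := by
  rw [← Equiv.Perm.ncard_sameCycle]
  unfold size
  congr 1
  ext e
  exact eq_comm.trans face_eq_iff

theorem degree_vert (d : M.Dart) : M.degree (M.vert d) = Function.minimalPeriod M.rot d := by
  rw [← Equiv.Perm.ncard_sameCycle]
  unfold degree
  congr 1
  ext e
  exact eq_comm.trans vert_eq_iff

theorem exists_iterate_next_of_face_eq {d e : M.Dart} (h : M.face d = M.face e) :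
    ∃ k < M.size (M.face d), M.next^[k] d = e := by
  obtain ⟨i, hi⟩ := (face_eq_iff.1 h).exists_nat_pow_eq
  have hp : 0 < Function.minimalPeriod M.next d :=
    Function.minimalPeriod_pos_of_mem_periodicPts
      (Function.Injective.mem_periodicPts M.next.injective d)
  refine ⟨i % Function.minimalPeriod M.next d, by rw [size_face]; exact Nat.mod_lt _ hp, ?_⟩
  rw [Function.iterate_mod_minimalPeriod_eq, ← hi, Equiv.Perm.iterate_eq_pow]

theorem iterate_size (d : M.Dart) : M.next^[M.size (M.face d)] d = d := by
  rw [size_face]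
  exact Function.iterate_minimalPeriod

theorem eq_three_of_minimalPeriod {α : Type*} {p : α → α} {a : α} :
    Function.minimalPeriod p a = 3 ↔ p (p (p a)) = a ∧ p a ≠ a := by
  have h1 : Function.IsPeriodicPt p 3 a ↔ p (p (p a)) = a := Iff.rfl
  constructor
  · intro h
    refine ⟨h1.1 (h ▸ Function.isPeriodicPt_minimalPeriod p a), fun h2 => ?_⟩
    have := Function.minimalPeriod_eq_one_iff_isFixedPt.2 h2
    omega
  · rintro ⟨h2, h3⟩
    have h4 := (h1.2 h2).minimalPeriod_dvd
    rcases (Nat.dvd_prime Nat.prime_three).1 h4 with h | h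
    · exact absurd (Function.minimalPeriod_eq_one_iff_isFixedPt.1 h) h3
    · exact h

/-- All vertices have degree three. -/
def Cubic (M : CombMap) : Prop := ∀ d, M.rot (M.rot (M.rot d)) = d ∧ M.rot d ≠ d

theorem cubic_iff : M.Cubic ↔ ∀ v, M.degree v = 3 := by
  constructor
  · intro h v
    obtain ⟨d, rfl⟩ := vert_surj v
    rw [degree_vert]
    exact eq_three_of_minimalPeriod.2 (h d)
  · intro h d
    have := h (M.vert d)
    rw [degree_vert] at this
    exact eq_three_of_minimalPeriod.1 this

theorem size_eq_three {d : M.Dart} :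
    M.size (M.face d) = 3 ↔ M.next (M.next (M.next d)) = d ∧ M.next d ≠ d := by
  rw [size_face]
  exact eq_three_of_minimalPeriod

/-- A divisor of 6 other than 1 and 2 is 3 or 6. The condition on face sizes thereby becomes a
condition on the permutation `next`, as needed for developments. -/
theorem size_three_or_six {d : M.Dart} :
    (M.size (M.face d) = 3 ∨ M.size (M.face d) = 6) ↔
      M.next^[6] d = d ∧ M.next d ≠ d ∧ M.next (M.next d) ≠ d := by
  rw [size_face]
  have h6 : Function.IsPeriodicPt M.next 6 d ↔ M.next^[6] d = d := Iff.rfl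
  have h2 : Function.IsPeriodicPt M.next 2 d ↔ M.next (M.next d) = d := Iff.rfl
  have h1 : Function.IsPeriodicPt M.next 1 d ↔ M.next d = d := Iff.rfl
  rw [← h6, ne_eq, ← h1, ne_eq, ← h2, Function.isPeriodicPt_iff_minimalPeriod_dvd,
    Function.isPeriodicPt_iff_minimalPeriod_dvd, Function.isPeriodicPt_iff_minimalPeriod_dvd]
  generalize Function.minimalPeriod M.next d = p
  constructor
  · rintro (rfl | rfl) <;> decide
  · rintro ⟨h, h', h''⟩
    have : p ≤ 6 := Nat.le_of_dvd (by norm_num) h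
    interval_cases p <;> revert h h' h'' <;> decide

theorem Cubic.rot_rot (hM : M.Cubic) (d : M.Dart) : M.rot (M.rot d) = M.rot.symm d :=
  (Equiv.eq_symm_apply _).2 (hM d).1

theorem Cubic.rot_ne (hM : M.Cubic) (d : M.Dart) : M.rot d ≠ d := (hM d).2

theorem Cubic.rot_rot_ne (hM : M.Cubic) (d : M.Dart) : M.rot (M.rot d) ≠ d := fun h => by
  have := (hM d).1
  rw [h] at this
  exact (hM d).2 this

theorem Cubic.vert_eq (hM : M.Cubic) {d e : M.Dart} (h : M.vert d = M.vert e) :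
    e = d ∨ e = M.rot d ∨ e = M.rot (M.rot d) := by
  obtain ⟨i, hi⟩ := (vert_eq_iff.1 h).exists_nat_pow_eq
  have h3 : M.rot ^ 3 = 1 := by
    ext x
    exact (hM x).1
  rw [← Nat.mod_add_div i 3, pow_add, pow_mul, h3, one_pow, mul_one] at hi
  have : i % 3 < 3 := Nat.mod_lt _ (by norm_num)
  interval_cases i % 3
  · exact Or.inl hi.symm
  · exact Or.inr (Or.inl hi.symm)
  · exact Or.inr (Or.inr hi.symm)

/-! ### Connectedness -/

/-- Every nonempty set of darts closed under `rot` and `opp` is everything. -/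
theorem connected_iff : (∀ d e : M.Dart, ∃ g ∈ Subgroup.closure {M.rot, M.opp}, g d = e) ↔
    ∀ P : M.Dart → Prop, (∀ d, P d → P (M.rot d)) → (∀ d, P d → P (M.opp d)) →
      (∃ d, P d) → ∀ d, P d := by
  constructor
  · rintro h P hr ho ⟨d, hd⟩ e
    obtain ⟨g, hg, rfl⟩ := h d e
    suffices ∀ x, P x ↔ P (g x) from (this d).1 hd
    -- `rot` has finite order, so its inverse is a power of it.
    have hro : ∀ d, P (M.rot d) → P d := by
      intro d hd
      have key : ∀ k : ℕ, P ((M.rot ^ (k + 1)) d) := by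
        intro k
        induction k with
        | zero => simpa using hd
        | succ k ih => rw [pow_succ']; exact hr _ ih
      have := key (orderOf M.rot - 1)
      have hpos : 0 < orderOf M.rot := orderOf_pos_iff.2 (isOfFinOrder_of_finite M.rot)
      rwa [Nat.sub_add_cancel hpos, pow_orderOf_eq_one] at this
    have hoo : ∀ d, P (M.opp d) → P d := fun d hd => by
      simpa [M.opp_opp] using ho _ hd
    refine Subgroup.closure_induction (p := fun g _ => ∀ x, P x ↔ P (g x)) ?_ ?_ ?_ ?_ hg
    · rintro g (rfl | rfl) x
      · exact ⟨hr x, hro x⟩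
      · exact ⟨ho x, hoo x⟩
    · intro x
      rfl
    · intro a b _ _ ha hb x
      rw [hb x, ha (b x)]
      rfl
    · intro a _ ha x
      rw [ha (a⁻¹ x)]
      exact iff_of_eq (congrArg P (a.apply_symm_apply x).symm)
  · intro h d e
    refine h (fun e => ∃ g ∈ Subgroup.closure {M.rot, M.opp}, g d = e) ?_ ?_
      ⟨d, 1, one_mem _, rfl⟩ e
    · rintro _ ⟨g, hg, rfl⟩
      exact ⟨M.rot * g, mul_mem (Subgroup.subset_closure (by simp)) hg, rfl⟩
    · rintro _ ⟨g, hg, rfl⟩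
      exact ⟨M.opp * g, mul_mem (Subgroup.subset_closure (by simp)) hg, rfl⟩

/-! ### Counting -/

theorem Cubic.card_dart (hM : M.Cubic) : Nat.card M.Dart = 3 * Nat.card M.Vertex := by
  have := Set.ncard_preimage_of_fibers M.vert Set.univ 3 fun v _ => cubic_iff.1 hM v
  rwa [Set.preimage_univ, Set.ncard_univ, Set.ncard_univ] at this

theorem card_dart_edge : Nat.card M.Dart = 2 * Nat.card M.Edge := by
  have := Set.ncard_preimage_of_fibers (fun d => (Quotient.mk _ d : M.Edge)) Set.univ 2 ?_
  · rwa [Set.preimage_univ, Set.ncard_univ, Set.ncard_univ] at this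
  · rintro e -
    obtain ⟨d, rfl⟩ := Quotient.exists_rep e
    have h : {a | (Quotient.mk _ a : M.Edge) = Quotient.mk _ d} = {b | M.opp.SameCycle d b} := by
      ext b
      exact eq_comm.trans Quotient.eq
    rw [h, Equiv.Perm.ncard_sameCycle]
    have h2 : Function.IsPeriodicPt M.opp 2 d := M.opp_opp d
    rcases (Nat.dvd_prime Nat.prime_two).1 h2.minimalPeriod_dvd with h | h
    · exact absurd (Function.minimalPeriod_eq_one_iff_isFixedPt.1 h) (M.opp_ne d)
    · exact h

theorem ncard_darts_of_size (k : ℕ) :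
    {d | M.size (M.face d) = k}.ncard = k * {F | M.size F = k}.ncard :=
  Set.ncard_preimage_of_fibers M.face {F | M.size F = k} k fun _ h => h

theorem euler_of_sizes {a b : ℕ} (hab : a ≠ b)
    (hs : ∀ F, M.size F = a ∨ M.size F = b) :
    Nat.card M.Dart = a * {F | M.size F = a}.ncard + b * {F | M.size F = b}.ncard ∧
    Nat.card M.Face = {F | M.size F = a}.ncard + {F | M.size F = b}.ncard := by
  have hu : {F | M.size F = a} ∪ {F | M.size F = b} = Set.univ :=
    Set.eq_univ_of_forall hs
  have hd : Disjoint {F | M.size F = a} {F | M.size F = b} := by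
    rw [Set.disjoint_left]
    intro F h1 h2
    exact hab (Eq.trans (Eq.symm h1) h2)
  constructor
  · rw [← ncard_darts_of_size, ← ncard_darts_of_size, ← Set.ncard_univ, ← Set.ncard_union_eq]
    · congr 1
      symm
      exact Set.eq_univ_of_forall fun d => hs (M.face d)
    · rw [Set.disjoint_left]
      intro F h1 h2
      exact hab (Eq.trans (Eq.symm h1) h2)
  · rw [← Set.ncard_univ, ← hu, Set.ncard_union_eq hd]

/-- Vertices and edges number a third and a half of the darts, so hexagons cancel from the Euler
characteristic and each triangle contributes one half: there are four triangles, hence 12 darts. -/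
theorem euler_three_six (hM : M.Cubic) (hs : ∀ F, M.size F = 3 ∨ M.size F = 6) :
    (Nat.card M.Vertex : ℤ) - Nat.card M.Edge + Nat.card M.Face = 2 ↔
      {d | M.size (M.face d) = 3}.ncard = 12 := by
  have h1 := hM.card_dart
  have h2 := M.card_dart_edge
  obtain ⟨h3, h4⟩ := euler_of_sizes (M := M) (by norm_num) hs
  rw [ncard_darts_of_size]
  omega

/-- Here each pentagon contributes one sixth to the Euler characteristic: there are 12 pentagons,
hence 60 darts. -/
theorem euler_five_six (hM : M.Cubic) (hs : ∀ F, M.size F = 5 ∨ M.size F = 6) :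
    (Nat.card M.Vertex : ℤ) - Nat.card M.Edge + Nat.card M.Face = 2 ↔
      {d | M.size (M.face d) = 5}.ncard = 60 := by
  have h1 := hM.card_dart
  have h2 := M.card_dart_edge
  obtain ⟨h3, h4⟩ := euler_of_sizes (M := M) (by norm_num) hs
  rw [ncard_darts_of_size]
  omega

end CombMap

/-! ### Simplicity and 3-connectedness from a simple dual -/

namespace CombMap

variable {M : CombMap}

/-- The dual graph has no loops and no multiple edges: no face is adjacent to itself, and two faces
share at most one edge. -/
def DualSimple (M : CombMap) : Prop :=
  (∀ d, M.face d ≠ M.face (M.opp d)) ∧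
  ∀ d e, M.face d = M.face e → M.face (M.opp d) = M.face (M.opp e) → d = e

/-- Two edges with the same ends are consecutive at both ends, as the degree is three. According to
the order at the far end, they are either both common to the same two faces or bound a face with two
sides. -/
theorem DualSimple.isSimple (hc : M.Cubic) (hs : M.DualSimple)
    (h2 : ∀ d, M.next (M.next d) ≠ d) : M.IsSimple := by
  have h1 : ∀ d, M.next d ≠ d := fun d h => h2 d (by rw [h, h])
  have hloop : ∀ d, M.vert (M.opp d) ≠ M.vert d := by
    intro d h
    rcases hc.vert_eq h.symm with h | h | h
    · exact M.opp_ne d h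
    · apply h1 (M.opp d)
      rw [next_opp, h]
    · apply h1 d
      rw [next_apply, h, (hc d).1]
  have key : ∀ d e, e = M.rot d → M.vert (M.opp d) ≠ M.vert (M.opp e) := by
    rintro d e he h
    rcases hc.vert_eq h with h | h | h
    · have := M.opp.injective h
      exact hc.rot_ne d (he ▸ this)
    · have h3 : M.opp e = M.next d := h
      have h4 : M.face e = M.face (M.opp d) := by rw [he, face_rot]
      have h5 : d = M.opp e := by
        apply hs.2
        · rw [h3, face_next]
        · rw [M.opp_opp, h4]
      exact h1 d (by rw [← h3, ← h5])
    · apply h2 e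
      rw [next_apply e, h, (hc _).1, next_opp, he]
  refine ⟨hloop, fun d e h h' => ?_⟩
  rcases hc.vert_eq h with h3 | h3 | h3
  · exact h3.symm
  · exact absurd h' (key d e h3)
  · exact absurd h'.symm (key e d (by rw [h3, (hc d).1]))

/-- Any two of the three corners at a vertex are the two sides of an edge, so they belong to
different faces. -/
theorem DualSimple.eq_of_face_vert (hc : M.Cubic) (hs : M.DualSimple) {d e : M.Dart}
    (hf : M.face d = M.face e) (hv : M.vert d = M.vert e) : d = e := by
  have key : ∀ d, M.face d ≠ M.face (M.rot d) := fun d => by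
    rw [face_rot]
    exact hs.1 d
  rcases hc.vert_eq hv with h | h | h
  · exact h.symm
  · exact absurd hf (h ▸ key d)
  · have := key e
    rw [h, (hc d).1, ← h] at this
    exact absurd hf.symm this

/-- If two vertices lie on two common faces, they are the ends of the common edge. -/
theorem DualSimple.eq_next (hc : M.Cubic) (hs : M.DualSimple) {d e e' : M.Dart}
    (hw : M.vert e = M.vert e') (hde : d ≠ e)
    (hf : M.face d = M.face e) (hf' : M.face (M.rot d) = M.face e') : e = M.next d := by
  rw [face_rot] at hf'
  rcases hc.vert_eq hw with h | h | h
  · exact absurd (hf.trans (h ▸ hf'.symm)) (hs.1 d)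
  · rw [h, face_rot] at hf'
    exact absurd (hs.2 _ _ hf hf') hde
  · have h4 : e = M.rot e' := by rw [h, (hc e).1]
    rw [h4, face_rot] at hf
    have h6 : d = M.opp e' := hs.2 _ _ hf (by rw [hf', M.opp_opp])
    rw [h6, h4, next_opp]

section Colouring

variable {S : Set M.Vertex} {c : M.Vertex → Prop}

theorem colour_walk
    (hcol : ∀ d, M.vert d ∉ S → M.vert (M.opp d) ∉ S → (c (M.vert d) ↔ c (M.vert (M.opp d))))
    (d : M.Dart) (k n : ℕ) (h : ∀ i ≤ n, M.vert (M.next^[k + i] d) ∉ S) :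
    c (M.vert (M.next^[k] d)) ↔ c (M.vert (M.next^[k + n] d)) := by
  induction n with
  | zero => rfl
  | succ n ih =>
    rw [ih fun i hi => h i (by omega)]
    have h1 := h n (by omega)
    have h2 := h (n + 1) le_rfl
    rw [← add_assoc, Function.iterate_succ_apply', vert_next] at h2 ⊢
    exact hcol _ h1 h2

/-- If all vertices of `S` on a face are among `k` consecutive corners, the rest of the boundary is
a path outside `S`, along which a colouring that respects edges is constant. -/
theorem colour_around
    (hcol : ∀ d, M.vert d ∉ S → M.vert (M.opp d) ∉ S → (c (M.vert d) ↔ c (M.vert (M.opp d))))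
    (d : M.Dart) (k : ℕ) (hk : ∀ i < k + 1, 0 < i → M.next^[i] d ≠ d)
    (h : ∀ e, M.face e = M.face d → (∀ i < k, e ≠ M.next^[i] d) → M.vert e ∉ S) :
    c (M.vert (M.next^[k] d)) ↔ c (M.vert (M.next.symm d)) := by
  have hp : 0 < Function.minimalPeriod M.next d :=
    Function.minimalPeriod_pos_of_mem_periodicPts
      (Function.Injective.mem_periodicPts M.next.injective d)
  have hps := Function.iterate_minimalPeriod (f := M.next) (x := d)
  have hlt : ∀ i, 0 < i → i < Function.minimalPeriod M.next d → M.next^[i] d ≠ d :=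
    fun i h0 hi h => Function.not_isPeriodicPt_of_pos_of_lt_minimalPeriod h0.ne' hi h
  generalize Function.minimalPeriod M.next d = s at hp hps hlt
  have hks : k + 1 ≤ s := by
    by_contra hlt
    exact hk s (by omega) hp hps
  obtain ⟨n, rfl⟩ := Nat.exists_eq_add_of_le hks
  have hlast : M.next.symm d = M.next^[k + n] d := by
    rw [Equiv.symm_apply_eq, ← Function.iterate_succ_apply' (M.next : M.Dart → M.Dart)]
    rw [show (k + n).succ = k + 1 + n by omega, hps]
  rw [hlast]
  refine colour_walk hcol d k n fun i hi => h _ (face_iterate_next _ _) fun j hj he => ?_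
  refine hlt (k + i - j) (by omega) (by omega) ?_
  apply M.next.injective.iterate j
  rw [← Function.iterate_add_apply, show j + (k + i - j) = k + i by omega]
  exact he

end Colouring

/-- A two-colouring outside `S` that is constant along edges is extended to `S`: every vertex of `S`
takes the colour of its neighbours outside `S`. These neighbours agree because they are joined along
the faces around the vertex, which contain at most one further vertex of `S`. The extended colouring
respects every edge, so it is constant by connectedness of the whole graph. -/
theorem DualSimple.isThreeConnected (hc : M.Cubic) (hs : M.DualSimple)
    (h2 : ∀ d, M.next (M.next d) ≠ d)
    (hconn : ∀ d e : M.Dart, ∃ g ∈ Subgroup.closure {M.rot, M.opp}, g d = e)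
    (h4 : 4 ≤ Nat.card M.Vertex) : M.IsThreeConnected := by
  refine ⟨h4, fun S hS => ?_⟩
  have hone : ∀ d, M.next d ≠ d := fun d h => h2 d (by rw [h, h])
  have hloop := (hs.isSimple hc h2).1
  have hS3 : ∀ x y z, x ∈ S → y ∈ S → z ∈ S → x ≠ y → x ≠ z → y = z := by
    intro x y z hx hy hz hxy hxz
    by_contra hyz
    have : ({x, y, z} : Set M.Vertex).ncard ≤ S.ncard :=
      Set.ncard_le_ncard (by rintro _ (rfl | rfl | rfl) <;> assumption)
    rw [Set.ncard_eq_three.2 ⟨x, y, z, hxy, hxz, hyz, rfl⟩] at this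
    omega
  obtain ⟨a, ha⟩ : ∃ a, a ∉ S := by
    by_contra! h
    rw [Set.eq_univ_of_forall h, Set.ncard_univ] at hS
    omega
  have main : ∀ c : M.Vertex → Prop,
      (∀ d, M.vert d ∉ S → M.vert (M.opp d) ∉ S → (c (M.vert d) ↔ c (M.vert (M.opp d)))) →
      ∀ v w, v ∉ S → w ∉ S → c v → c w := by
    intro c hcol
    -- a face at a vertex of `S` with no other vertex of `S` joins two neighbours
    have face1 : ∀ d, (∀ e, M.face e = M.face d → e ≠ d → M.vert e ∉ S) →
        (c (M.vert (M.opp d)) ↔ c (M.vert (M.opp (M.rot.symm d)))) := by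
      intro d hd
      have := colour_around hcol d 1 (fun i hi h0 => by
        obtain rfl : i = 1 := by omega
        exact hone d) (fun e he h => hd e he (h 0 (by norm_num)))
      rwa [Function.iterate_one, vert_next, next_symm_apply] at this
    have nbr : ∀ d, M.vert d ∈ S → M.vert (M.opp d) ∉ S → M.vert (M.opp (M.rot d)) ∉ S →
        (c (M.vert (M.opp d)) ↔ c (M.vert (M.opp (M.rot d)))) := by
      intro d hd h h'
      by_cases hf : ∀ e, M.face e = M.face (M.rot d) → e ≠ M.rot d → M.vert e ∉ S
      · have := face1 _ hf
        rw [Equiv.symm_apply_apply] at this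
        exact this.symm
      push Not at hf
      obtain ⟨e, he, hed, heS⟩ := hf
      have hxy : M.vert d ≠ M.vert e := fun hv =>
        hed (hs.eq_of_face_vert hc he (hv.symm.trans (vert_rot d).symm))
      have hy : ∀ f, M.vert f ∈ S → M.vert f ≠ M.vert d → M.vert f = M.vert e :=
        fun f hf hfd => hS3 _ _ _ hd hf heS hfd.symm hxy
      -- The face between the two neighbours contains the second vertex of `S`. The two other faces
      -- at this vertex then avoid it, since two vertices on two common faces are joined by the
      -- common edge, while the far ends of `d` and `M.rot d` lie outside `S`. The detour through
      -- the third neighbour is free.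
      have f1 : ∀ f, M.face f = M.face d → f ≠ d → M.vert f ∉ S := by
        intro f hf hfd hfS
        have hv : M.vert f ≠ M.vert d := fun hv => hfd (hs.eq_of_face_vert hc hf hv)
        have := hs.eq_next hc (hy f hfS hv) hfd.symm hf.symm he.symm
        rw [this, vert_next] at hfS
        exact h hfS
      have f2 : ∀ f, M.face f = M.face (M.rot (M.rot d)) → f ≠ M.rot (M.rot d) →
          M.vert f ∉ S := by
        intro f hf hfd hfS
        have hv : M.vert f ≠ M.vert d := fun hv =>
          hfd (hs.eq_of_face_vert hc hf (by rw [hv, vert_rot, vert_rot]))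
        have := hs.eq_next hc (hy f hfS hv).symm hed.symm he.symm hf.symm
        rw [this, vert_next] at heS
        exact h' heS
      have := face1 _ f1
      rw [this, ← hc.rot_rot, face1 _ f2, Equiv.symm_apply_apply]
    have nbrs : ∀ d e, M.vert d = M.vert e → M.vert d ∈ S → M.vert (M.opp d) ∉ S →
        M.vert (M.opp e) ∉ S → (c (M.vert (M.opp d)) ↔ c (M.vert (M.opp e))) := by
      intro d e hv hd h h'
      rcases hc.vert_eq hv with h3 | h3 | h3
      · rw [h3]
      · subst h3
        exact nbr d hd h h'
      · have h5 : d = M.rot e := by rw [h3, (hc d).1]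
        subst h5
        exact (nbr e (hv ▸ hd) h' h).symm
    let c' : M.Vertex → Prop := fun v =>
      (v ∉ S ∧ c v) ∨ (v ∈ S ∧ ∃ d, M.vert d = v ∧ M.vert (M.opp d) ∉ S ∧ c (M.vert (M.opp d)))
    have c'out : ∀ v, v ∉ S → (c' v ↔ c v) := fun v hv => by simp [c', hv]
    have c'in : ∀ d, M.vert d ∈ S → M.vert (M.opp d) ∉ S →
        (c' (M.vert d) ↔ c (M.vert (M.opp d))) := by
      intro d hd h
      constructor
      · rintro (h3 | ⟨-, e, he, he', hce⟩)
        · exact absurd hd h3.1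
        · exact (nbrs e d he (he ▸ hd) he' h).1 hce
      · exact fun h3 => Or.inr ⟨hd, d, rfl, h, h3⟩
    have c'edge : ∀ d, c' (M.vert d) ↔ c' (M.vert (M.opp d)) := by
      intro d
      by_cases hd : M.vert d ∈ S <;> by_cases hd' : M.vert (M.opp d) ∈ S
      -- The two ends of `d` exhaust `S`, so the rest of the face of `d` joins a neighbour of one
      -- end to a neighbour of the other.
      · have hout : ∀ e, M.face e = M.face d → e ≠ d → e ≠ M.next d → M.vert e ∉ S := by
          intro e he h h' heS
          have hv : M.vert e ≠ M.vert d := fun hv => h (hs.eq_of_face_vert hc he hv)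
          have := hS3 _ _ _ hd heS hd' hv.symm (hloop d).symm
          rw [← vert_next] at this
          exact h' (hs.eq_of_face_vert hc (by rw [he, face_next]) this)
        have hw := colour_around hcol d 2 (fun i hi h0 => by
          obtain rfl | rfl : i = 1 ∨ i = 2 := by omega
          · exact hone d
          · exact h2 d) (fun e he h => hout e he (h 0 (by norm_num)) (h 1 (by norm_num)))
        have e1 : M.vert (M.opp (M.rot.symm d)) ∉ S := by
          rw [← next_symm_apply]
          refine hout (M.next.symm d) (face_next_symm d) ?_ ?_
          · rw [ne_eq, Equiv.symm_apply_eq]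
            exact (hone d).symm
          · rw [ne_eq, Equiv.symm_apply_eq]
            exact (h2 d).symm
        have e2 : M.vert (M.opp (M.next d)) ∉ S := by
          rw [← vert_next]
          refine hout (M.next (M.next d)) (by rw [face_next, face_next]) (h2 d) ?_
          exact fun h => hone _ (M.next.injective h)
        have k1 := c'in (M.rot.symm d) (by rwa [vert_rot_symm]) e1
        have k2 := c'in (M.next d) (by rwa [vert_next]) e2
        rw [vert_rot_symm] at k1
        rw [vert_next] at k2
        rw [k1, k2]
        simp only [Function.iterate_succ_apply', Function.iterate_zero, id, vert_next] at hw
        rw [← next_symm_apply]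
        exact hw.symm
      · rw [c'in d hd hd', c'out _ hd']
      · rw [c'out _ hd]
        have := c'in (M.opp d) hd' (by rwa [M.opp_opp])
        rw [this, M.opp_opp]
      · rw [c'out _ hd, c'out _ hd']
        exact hcol d hd hd'
    intro v w hv hw hcv
    obtain ⟨d, rfl⟩ := vert_surj v
    obtain ⟨e, rfl⟩ := vert_surj w
    rw [← c'out _ hw]
    refine connected_iff.1 hconn (fun e => c' (M.vert e)) ?_ ?_ ⟨d, (c'out _ hv).2 hcv⟩ e
    · intro d hd
      rwa [vert_rot]
    · exact fun d hd => (c'edge d).1 hd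
  have : Nonempty (Sᶜ : Set M.Vertex) := ⟨⟨a, ha⟩⟩
  refine ⟨fun v w => ?_⟩
  have := main (fun w => ∃ h : w ∉ S, (M.graph.induce Sᶜ).Reachable v ⟨w, h⟩) ?_ v w v.2 w.2
    ⟨v.2, SimpleGraph.Reachable.refl _⟩
  · exact this.2
  · intro d hd hd'
    have hadj : (M.graph.induce Sᶜ).Adj ⟨_, hd⟩ ⟨_, hd'⟩ := ⟨(hloop d).symm, d, rfl, rfl⟩
    exact ⟨fun ⟨_, h⟩ => ⟨hd', h.trans hadj.reachable⟩,
      fun ⟨_, h⟩ => ⟨hd, h.trans hadj.symm.reachable⟩⟩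

/-- The two common vertices of two adjacent triangles are separated from the rest. -/
theorem card_vertex_le_four_of_adjacent_triangles (hc : M.Cubic) (hs : M.IsSimple)
    (h3 : M.IsThreeConnected) {d : M.Dart} (hd : M.next (M.next (M.next d)) = d)
    (hd' : M.next (M.next (M.next (M.opp d))) = M.opp d) : Nat.card M.Vertex ≤ 4 := by
  have tri : ∀ d, M.next (M.next (M.next d)) = d →
      M.vert (M.next (M.next d)) = M.vert (M.opp (M.rot.symm d)) := by
    intro d hd
    have : M.next (M.next d) = M.next.symm d := (Equiv.eq_symm_apply _).2 hd
    rw [this, next_symm_apply]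
  set a := M.vert (M.next (M.next d)) with ha
  set b := M.vert (M.next (M.next (M.opp d))) with hb
  have a1 : a ≠ M.vert d := by
    rw [ha, tri d hd, ← vert_rot_symm d]
    exact hs.1 _
  have a2 : a ≠ M.vert (M.opp d) := by
    rw [ha, ← vert_next d, vert_next (M.next d)]
    exact hs.1 _
  have b1 : b ≠ M.vert (M.opp d) := by
    rw [hb, tri _ hd', ← vert_rot_symm (M.opp d)]
    exact hs.1 _
  have b2 : b ≠ M.vert d := by
    have := hs.1 (M.next (M.opp d))
    rwa [← vert_next, vert_next (M.opp d), M.opp_opp] at this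
  have nb : ∀ d, M.next (M.next (M.next d)) = d →
      ∀ e, M.vert e = M.vert d → M.vert (M.opp e) = M.vert (M.opp d) ∨
      M.vert (M.opp e) = M.vert (M.next (M.next d)) ∨
      M.vert (M.opp e) = M.vert (M.next (M.next (M.opp d))) := by
    intro d hd e he
    rcases hc.vert_eq he.symm with h | h | h
    · exact Or.inl (by rw [h])
    · right; right
      rw [next_opp, vert_next, h]
    · right; left
      rw [tri d hd, ← hc.rot_rot, h]
  -- Deleting the apices `a` and `b` of the two triangles leaves their common edge with no
  -- connection to a fifth vertex `z`.
  by_contra! hcard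
  obtain ⟨z, hz⟩ : ∃ z, z ∉ ({a, b, M.vert d, M.vert (M.opp d)} : Set M.Vertex) := by
    by_contra! h
    have h5 := Set.ncard_univ M.Vertex
    rw [← Set.eq_univ_of_forall h] at h5
    have h6 := Set.ncard_insert_le a {b, M.vert d, M.vert (M.opp d)}
    have h7 := Set.ncard_insert_le b {M.vert d, M.vert (M.opp d)}
    have h8 := Set.ncard_insert_le (M.vert d) {M.vert (M.opp d)}
    rw [Set.ncard_singleton] at h8
    omega
  simp only [Set.mem_insert_iff, Set.mem_singleton_iff, not_or] at hz
  have hS : ({a, b} : Set M.Vertex).ncard ≤ 2 := Set.ncard_insert_le _ _ |>.trans (by simp)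
  have hcon := (h3.2 {a, b} hS).preconnected ⟨M.vert d, by simp [a1.symm, b2.symm]⟩
    ⟨z, by simp [hz.1, hz.2.1]⟩
  have key : ∀ v w : (({a, b} : Set M.Vertex)ᶜ : Set M.Vertex),
      (M.graph.induce ({a, b} : Set M.Vertex)ᶜ).Reachable v w →
      (v.1 = M.vert d ∨ v.1 = M.vert (M.opp d)) → (w.1 = M.vert d ∨ w.1 = M.vert (M.opp d)) := by
    rintro v w ⟨p⟩
    induction p with
    | nil => exact id
    | @cons u v w hadj _ ih =>
      intro hu
      apply ih
      obtain ⟨-, e, he, he'⟩ := hadj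
      have hv : v.1 ≠ a ∧ v.1 ≠ b := by
        have : ¬ (v.1 = a ∨ v.1 = b) := v.2
        exact not_or.1 this
      change M.vert e = u.1 at he
      change M.vert (M.opp e) = v.1 at he'
      rcases hu with hu | hu
      · rcases nb d hd e (he.trans hu) with h | h | h
        · exact Or.inr (he' ▸ h)
        · exact absurd (he' ▸ h) hv.1
        · exact absurd (he' ▸ h) hv.2
      · rcases nb _ hd' e (he.trans hu) with h | h | h
        · exact Or.inl (by rw [← he', h, M.opp_opp])
        · exact absurd (he' ▸ h) hv.2
        · rw [M.opp_opp] at h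
          exact absurd (he' ▸ h) hv.1
  rcases key _ _ hcon (Or.inl rfl) with h | h
  · exact hz.2.2.1 h
  · exact hz.2.2.2 h

end CombMap

/-- Two surjections with the same fibres. -/
theorem exists_equiv_of_fibers {X A B : Type*} {f : X → A} {g : X → B}
    (hf : Function.Surjective f) (hg : Function.Surjective g)
    (h : ∀ x y, f x = f y ↔ g x = g y) : ∃ e : A ≃ B, ∀ x, e (f x) = g x := by
  have key : ∀ x, g (Function.surjInv hf (f x)) = g x := fun x =>
    (h _ _).1 (Function.surjInv_eq hf _)
  refine ⟨Equiv.ofBijective (fun a => g (Function.surjInv hf a)) ⟨fun a b hab => ?_, fun b => ?_⟩,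
    key⟩
  · have := (h _ _).2 hab
    rwa [Function.surjInv_eq hf, Function.surjInv_eq hf] at this
  · obtain ⟨x, rfl⟩ := hg b
    exact ⟨f x, key x⟩

/-- The Eisenstein integers, with `ζ = ⟨0, 1⟩` a primitive sixth root of unity. -/
abbrev Eis := QuadraticAlgebra ℤ (-1) 1

/-! ### Eisenstein integers and their sublattices -/

namespace Eis

/-- The units, the powers of `ζ`. -/
def unit (j : ZMod 6) : Eis :=
  (![⟨1, 0⟩, ⟨0, 1⟩, ⟨-1, 1⟩, ⟨-1, 0⟩, ⟨0, -1⟩, ⟨1, -1⟩] : Fin 6 → Eis) j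

theorem unit_zero : unit 0 = 1 := rfl

theorem unit_zero_eq : unit 0 = ⟨1, 0⟩ := rfl
theorem unit_one_eq : unit 1 = ⟨0, 1⟩ := rfl
theorem unit_two_eq : unit 2 = ⟨-1, 1⟩ := rfl
theorem unit_three_eq : unit 3 = ⟨-1, 0⟩ := rfl
theorem unit_four_eq : unit 4 = ⟨0, -1⟩ := rfl
theorem unit_five_eq : unit 5 = ⟨1, -1⟩ := rfl

theorem unit_mul (i j : ZMod 6) : unit i * unit j = unit (i + j) := by
  revert i j; decide

theorem unit_add_three (j : ZMod 6) : unit (j + 3) = -unit j := by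
  revert j; decide

theorem neg_add_three (j : ZMod 6) : -(j + 3) = -j + 3 := by
  revert j; decide

theorem star_unit (j : ZMod 6) : star (unit j) = unit (-j) := by
  revert j; decide

theorem unit_neg_mul (i : ZMod 6) (x : Eis) : unit (-i) * (unit i * x) = x := by
  rw [← mul_assoc, unit_mul, neg_add_cancel, unit_zero, one_mul]

theorem unit_mul_neg (i : ZMod 6) (x : Eis) : unit i * (unit (-i) * x) = x := by
  rw [← mul_assoc, unit_mul, add_neg_cancel, unit_zero, one_mul]

theorem zmod6_cases (j : ZMod 6) : j = 0 ∨ j = 1 ∨ j = 2 ∨ j = 3 ∨ j = 4 ∨ j = 5 := by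
  revert j; decide

/-- The sublattice `2 L`. -/
def dbl (L : AddSubgroup Eis) : AddSubgroup Eis := L.map (nsmulAddMonoidHom 2)

variable {L : AddSubgroup Eis} {x y : Eis}

theorem mem_dbl : x ∈ dbl L ↔ ∃ l ∈ L, l + l = x := by
  simp [dbl, two_mul]

theorem add_self_mem_dbl : x + x ∈ dbl L ↔ x ∈ L := by
  rw [mem_dbl]
  constructor
  · rintro ⟨l, hl, h⟩
    have h1 := congrArg QuadraticAlgebra.re h
    have h2 := congrArg QuadraticAlgebra.im h
    simp only [QuadraticAlgebra.re_add, QuadraticAlgebra.im_add] at h1 h2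
    have : l = x := by ext <;> omega
    rwa [← this]
  · exact fun h => ⟨x, h, rfl⟩

theorem dbl_le : dbl L ≤ L := by
  intro x hx
  obtain ⟨l, hl, rfl⟩ := mem_dbl.1 hx
  exact add_mem hl hl

theorem even_of_mem_dbl (h : x ∈ dbl L) : x.re % 2 = 0 ∧ x.im % 2 = 0 := by
  obtain ⟨l, hl, rfl⟩ := mem_dbl.1 h
  simp only [QuadraticAlgebra.re_add, QuadraticAlgebra.im_add]
  omega

theorem unit_parity (j : ZMod 6) : ¬ ((unit j).re % 2 = 0 ∧ (unit j).im % 2 = 0) := by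
  revert j; decide

/-- Elements of `dbl L` are even and units are not. Geometrically, no half-turn about a point of `L`
exchanges two adjacent faces. -/
theorem add_self_add_unit_notMem (v : Eis) (j : ZMod 6) : v + v + unit j ∉ dbl L := by
  intro h
  have := even_of_mem_dbl h
  have h2 := unit_parity j
  simp only [QuadraticAlgebra.re_add, QuadraticAlgebra.im_add] at this
  omega

theorem unit_notMem_dbl (j : ZMod 6) : unit j ∉ dbl L := by
  simpa using add_self_add_unit_notMem (L := L) 0 j

theorem eq_or_of_sub_even (i j : ZMod 6)
    (h : (unit i - unit j).re % 2 = 0 ∧ (unit i - unit j).im % 2 = 0) : i = j ∨ i = j + 3 := by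
  revert i j; decide

/-- `L` rotated by `ζ ^ (-i)`. -/
def rotate (i : ZMod 6) (L : AddSubgroup Eis) : AddSubgroup Eis :=
  L.comap (AddMonoidHom.mulLeft (unit i))

/-- The mirror image of `L`. -/
def mirror (L : AddSubgroup Eis) : AddSubgroup Eis := L.comap (starAddEquiv : Eis ≃+ Eis).toAddMonoidHom

theorem mem_rotate {i : ZMod 6} : x ∈ rotate i L ↔ unit i * x ∈ L := Iff.rfl

theorem mem_mirror : x ∈ mirror L ↔ star x ∈ L := Iff.rfl

theorem mirror_mirror : mirror (mirror L) = L := by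
  ext x
  rw [mem_mirror, mem_mirror, star_star]

theorem mem_dbl_rotate {i : ZMod 6} : x ∈ dbl (rotate i L) ↔ unit i * x ∈ dbl L := by
  simp only [mem_dbl, mem_rotate]
  constructor
  · rintro ⟨l, hl, rfl⟩
    exact ⟨_, hl, by ring⟩
  · rintro ⟨l, hl, h⟩
    refine ⟨unit (-i) * l, by rwa [unit_mul_neg], ?_⟩
    rw [← mul_add, h, unit_neg_mul]

theorem mem_dbl_mirror : x ∈ dbl (mirror L) ↔ star x ∈ dbl L := by
  simp only [mem_dbl, mem_mirror]
  constructor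
  · rintro ⟨l, hl, rfl⟩
    exact ⟨_, hl, by rw [star_add]⟩
  · rintro ⟨l, hl, h⟩
    refine ⟨star l, by rwa [star_star], ?_⟩
    rw [← star_add, h, star_star]

end Eis

/-! ### Developments along the hexagonal tiling -/

namespace CombMap

open Eis

variable {M N : CombMap} {L : AddSubgroup Eis}

/-- A map from the darts of the hexagonal tiling (the dart `(v, j)` is the `j`-th side of the face
with centre `v`) to those of `M`. -/
def IsDevelopment (M : CombMap) (φ : Eis → ZMod 6 → M.Dart) : Prop :=
  (∀ v j, φ v (j + 1) = M.next (φ v j)) ∧ ∀ v j, φ (v + unit j) (j + 3) = M.opp (φ v j)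

/-- The value at one dart determines the values at all darts of the same face through `next` and at
the neighbouring faces through `opp`, and the units generate `Eis`. This rigidity is what produces
deck transformations and lifts of symmetries. -/
theorem IsDevelopment.eq {φ ψ : Eis → ZMod 6 → M.Dart} (hφ : M.IsDevelopment φ)
    (hψ : M.IsDevelopment ψ) {v₀ : Eis} {j₀ : ZMod 6} (h : φ v₀ j₀ = ψ v₀ j₀) (v : Eis)
    (j : ZMod 6) : φ v j = ψ v j := by
  have key : ∀ v j, φ v j = ψ v j → ∀ i, φ v i = ψ v i := by
    intro v j h i
    have : ∀ k : ℕ, φ v (j + k) = ψ v (j + k) := by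
      intro k
      induction k with
      | zero => simpa using h
      | succ k ih => rw [Nat.cast_succ, ← add_assoc, hφ.1, hψ.1, ih]
    have h2 := this (i - j).val
    rwa [ZMod.natCast_zmod_val, add_sub_cancel] at h2
  have step : ∀ v, (∀ i, φ v i = ψ v i) → ∀ k i, φ (v + unit k) i = ψ (v + unit k) i := by
    intro v hv k
    exact key _ (k + 3) (by rw [hφ.2, hψ.2, hv])
  have hre : ∀ v, (∀ i, φ v i = ψ v i) → ∀ n : ℤ, ∀ i,
      φ (v + n) i = ψ (v + n) i := by
    intro v hv n
    induction n using Int.induction_on with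
    | zero => simpa using hv
    | succ n ih =>
      have := step _ ih 0
      rw [unit_zero] at this
      rwa [Int.cast_add, Int.cast_one, ← add_assoc]
    | pred n ih =>
      have := step _ ih 3
      rw [show unit 3 = -1 from rfl] at this
      rwa [Int.cast_sub, Int.cast_one, sub_eq_add_neg, ← add_assoc]
  have him : ∀ v, (∀ i, φ v i = ψ v i) → ∀ n : ℤ, ∀ i,
      φ (v + n * unit 1) i = ψ (v + n * unit 1) i := by
    intro v hv n
    induction n using Int.induction_on with
    | zero => simpa using hv
    | succ n ih =>
      have := step _ ih 1
      rwa [Int.cast_add, Int.cast_one, add_mul, one_mul, ← add_assoc]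
    | pred n ih =>
      have := step _ ih 4
      rw [show unit 4 = -unit 1 from rfl] at this
      rwa [Int.cast_sub, Int.cast_one, sub_mul, one_mul, sub_eq_add_neg, ← add_assoc]
  have := him _ (hre v₀ (key _ _ h) (v - v₀).re) (v - v₀).im j
  have hv : v₀ + ((v - v₀).re : Eis) + ((v - v₀).im : Eis) * unit 1 = v := by
    ext <;> simp [unit]
  rwa [hv] at this

theorem IsDevelopment.next_iterate {φ : Eis → ZMod 6 → M.Dart} (hφ : M.IsDevelopment φ) (v : Eis)
    (j : ZMod 6) (k : ℕ) : M.next^[k] (φ v j) = φ v (j + k) := by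
  induction k with
  | zero => simp
  | succ k ih => rw [Function.iterate_succ_apply', ih, ← hφ.1, Nat.cast_succ, add_assoc]

theorem IsDevelopment.rot {φ : Eis → ZMod 6 → M.Dart} (hφ : M.IsDevelopment φ) (v : Eis)
    (j : ZMod 6) : M.rot (φ v j) = φ (v + unit j) (j + 4) := by
  rw [← next_opp, ← hφ.2, ← hφ.1, add_assoc]
  rfl

theorem IsDevelopment.rot_rot {φ : Eis → ZMod 6 → M.Dart} (hφ : M.IsDevelopment φ) (v : Eis)
    (j : ZMod 6) : M.rot (M.rot (φ v j)) = φ (v + unit (j + 5)) (j + 2) := by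
  rw [hφ.rot, hφ.rot]
  congr 1
  · rw [add_assoc]
    congr 1
    revert j
    decide
  · revert j
    decide

/-- Precomposing with a rotation of the tiling. -/
theorem IsDevelopment.comp_rotate {φ : Eis → ZMod 6 → M.Dart} (hφ : M.IsDevelopment φ) (c : Eis)
    (i : ZMod 6) : M.IsDevelopment fun v j => φ (unit i * v + c) (i + j) := by
  refine ⟨fun v j => ?_, fun v j => ?_⟩ <;> beta_reduce
  · rw [← add_assoc, hφ.1]
  · rw [← hφ.2, mul_add, unit_mul, ← add_assoc]
    congr 1
    ring

/-- `M` is the quotient of the hexagonal tiling by the group generated by the half-turns around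
the points of `L`. -/
structure Dev (M : CombMap) (L : AddSubgroup Eis) where
  φ : Eis → ZMod 6 → M.Dart
  isDev : M.IsDevelopment φ
  surj : ∀ d, ∃ v j, φ v j = d
  eq_iff : ∀ v j w i, φ v j = φ w i ↔
    (i = j ∧ w - v ∈ dbl L) ∨ (i = j + 3 ∧ v + w ∈ dbl L)

namespace Dev

variable (D : Dev M L)
include D

theorem eq_of_sub {v w : Eis} (h : w - v ∈ dbl L) (j : ZMod 6) : D.φ v j = D.φ w j :=
  (D.eq_iff _ _ _ _).2 (Or.inl ⟨rfl, h⟩)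

theorem eq_of_add {v w : Eis} (h : v + w ∈ dbl L) (j : ZMod 6) : D.φ v j = D.φ w (j + 3) :=
  (D.eq_iff _ _ _ _).2 (Or.inr ⟨rfl, h⟩)

theorem face_eq_iff {v w : Eis} {i j : ZMod 6} :
    M.face (D.φ v j) = M.face (D.φ w i) ↔ w - v ∈ dbl L ∨ v + w ∈ dbl L := by
  constructor
  · intro h
    obtain ⟨k, -, hk⟩ := exists_iterate_next_of_face_eq h
    rw [D.isDev.next_iterate, D.eq_iff] at hk
    exact hk.imp And.right And.right
  · have key : ∀ v j i, M.face (D.φ v j) = M.face (D.φ v i) := by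
      intro v j i
      rw [← face_iterate_next (D.φ v j) (i - j).val, D.isDev.next_iterate, ZMod.natCast_zmod_val,
        add_sub_cancel]
    rintro (h | h)
    · rw [D.eq_of_sub h, key]
    · rw [D.eq_of_add h, key]

theorem face_eq (v : Eis) (j i : ZMod 6) : M.face (D.φ v j) = M.face (D.φ v i) :=
  D.face_eq_iff.2 (Or.inl (by simp))

/-- Three steps along the boundary lead to the opposite side of the same face of the tiling, and the
two sides are identified exactly when the half-turn about `v` belongs to the group. -/
theorem size_three_iff {v : Eis} {j : ZMod 6} : M.size (M.face (D.φ v j)) = 3 ↔ v ∈ L := by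
  rw [size_eq_three]
  have h3 : M.next (M.next (M.next (D.φ v j))) = D.φ v (j + 3) := D.isDev.next_iterate v j 3
  rw [h3, ← D.isDev.1, ne_eq, D.eq_iff, D.eq_iff]
  clear h3
  constructor
  · rintro ⟨⟨h, -⟩ | ⟨-, h⟩, -⟩
    · exact absurd h (by clear h; revert j; decide)
    · exact add_self_mem_dbl.1 h
  · refine fun h => ⟨Or.inr ⟨?_, add_self_mem_dbl.2 h⟩, ?_⟩
    · revert j; decide
    · rintro (⟨h, -⟩ | ⟨h, -⟩)
      · revert h; revert j; decide
      · revert h; revert j; decide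

theorem sizes (F : M.Face) : M.size F = 3 ∨ M.size F = 6 := by
  obtain ⟨d, rfl⟩ := face_surj F
  obtain ⟨v, j, rfl⟩ := D.surj d
  rw [size_three_or_six, D.isDev.next_iterate, ← D.isDev.1, ← D.isDev.1, ne_eq, ne_eq, D.eq_iff,
    D.eq_iff, D.eq_iff]
  refine ⟨Or.inl ⟨?_, by simp⟩, ?_, ?_⟩
  · revert j; decide
  · rintro (⟨h, -⟩ | ⟨h, -⟩) <;> revert h <;> revert j <;> decide
  · rintro (⟨h, -⟩ | ⟨h, -⟩) <;> revert h <;> revert j <;> decide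

theorem size_six_iff {v : Eis} {j : ZMod 6} : M.size (M.face (D.φ v j)) = 6 ↔ v ∉ L := by
  rw [← D.size_three_iff (j := j)]
  have := D.sizes (M.face (D.φ v j))
  omega

theorem cubic : M.Cubic := by
  intro d
  obtain ⟨v, j, rfl⟩ := D.surj d
  constructor
  · rw [D.isDev.rot_rot, D.isDev.rot]
    congr 1
    · rw [add_assoc]
      convert add_zero v using 2
      revert j; decide
    · revert j; decide
  · rw [D.isDev.rot, ne_eq, D.eq_iff]
    rintro (⟨h, -⟩ | ⟨h, -⟩) <;> revert h <;> revert j <;> decide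

theorem connected (d e : M.Dart) : ∃ g ∈ Subgroup.closure {M.rot, M.opp}, g d = e := by
  revert d e
  rw [connected_iff]
  rintro P hr ho ⟨d, hd⟩ e
  obtain ⟨v, j, rfl⟩ := D.surj d
  obtain ⟨w, i, rfl⟩ := D.surj e
  have hn : ∀ d, P d → P (M.next d) := fun d hd => hr _ (ho _ hd)
  have hrotate : ∀ v j, P (D.φ v j) → ∀ i, P (D.φ v i) := by
    intro v j h i
    have : ∀ k : ℕ, P (D.φ v (j + k)) := by
      intro k
      induction k with
      | zero => simpa using h
      | succ k ih => rw [Nat.cast_succ, ← add_assoc, D.isDev.1]; exact hn _ ih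
    have h2 := this (i - j).val
    rwa [ZMod.natCast_zmod_val, add_sub_cancel] at h2
  have step : ∀ v k, (∀ i, P (D.φ v i)) → ∀ i, P (D.φ (v + unit k) i) := by
    intro v k h
    exact hrotate _ (k + 3) (by rw [D.isDev.2]; exact ho _ (h k))
  have hre : ∀ v, (∀ i, P (D.φ v i)) → ∀ n : ℤ, ∀ i, P (D.φ (v + n) i) := by
    intro v hv n
    induction n using Int.induction_on with
    | zero => simpa using hv
    | succ n ih =>
      have := step _ 0 ih
      rw [unit_zero] at this
      rwa [Int.cast_add, Int.cast_one, ← add_assoc]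
    | pred n ih =>
      have := step _ 3 ih
      rw [show unit 3 = -1 from rfl] at this
      rwa [Int.cast_sub, Int.cast_one, sub_eq_add_neg, ← add_assoc]
  have him : ∀ v, (∀ i, P (D.φ v i)) → ∀ n : ℤ, ∀ i, P (D.φ (v + n * unit 1) i) := by
    intro v hv n
    induction n using Int.induction_on with
    | zero => simpa using hv
    | succ n ih =>
      have := step _ 1 ih
      rwa [Int.cast_add, Int.cast_one, add_mul, one_mul, ← add_assoc]
    | pred n ih =>
      have := step _ 4 ih
      rw [show unit 4 = -unit 1 from rfl] at this
      rwa [Int.cast_sub, Int.cast_one, sub_mul, one_mul, sub_eq_add_neg, ← add_assoc]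
  have := him _ (hre v (hrotate _ _ hd) (w - v).re) (w - v).im i
  have hv : v + ((w - v).re : Eis) + ((w - v).im : Eis) * unit 1 = w := by
    ext <;> simp [unit]
  rwa [hv] at this

/-- If two sides of the face `v` lead to the same face, parity modulo 2 makes them equal or
opposite. Opposite sides lead to the same face only if a unit or `v` itself lies in `L`; in both
cases `v` is in `L` and the two sides are one edge of a triangle. -/
theorem dualSimple (hL : ∀ j, unit j ∈ L → L = ⊤) : M.DualSimple := by
  constructor
  · intro d h
    obtain ⟨v, j, rfl⟩ := D.surj d
    rw [← D.isDev.2, D.face_eq_iff] at h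
    rcases h with h | h
    · rw [add_sub_cancel_left] at h
      exact unit_notMem_dbl j h
    · rw [← add_assoc] at h
      exact add_self_add_unit_notMem v j h
  · intro d e h h'
    obtain ⟨v, j, rfl⟩ := D.surj d
    obtain ⟨i, rfl⟩ : ∃ i, D.φ v i = e := by
      obtain ⟨w, i, rfl⟩ := D.surj e
      rcases D.face_eq_iff.1 h with h | h
      · exact ⟨i, D.eq_of_sub h i⟩
      · refine ⟨i + 3, (D.eq_of_add (by rwa [add_comm]) i).symm⟩
    have key : i = j + 3 → v ∈ L → D.φ v j = D.φ v i := by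
      rintro rfl hv
      exact D.eq_of_add (add_self_mem_dbl.2 hv) j
    rw [← D.isDev.2, ← D.isDev.2, D.face_eq_iff] at h'
    rcases h' with h' | h'
    · rw [add_sub_add_left_eq_sub] at h'
      rcases eq_or_of_sub_even i j (even_of_mem_dbl h') with rfl | h2
      · rfl
      · apply key h2
        rw [h2, unit_add_three, ← neg_add', neg_mem_iff, add_self_mem_dbl] at h'
        rw [hL j h']
        trivial
    · have h3 := even_of_mem_dbl h'
      have h4 : (unit i - unit j).re % 2 = 0 ∧ (unit i - unit j).im % 2 = 0 := by
        simp only [QuadraticAlgebra.re_add, QuadraticAlgebra.im_add, QuadraticAlgebra.re_sub,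
          QuadraticAlgebra.im_sub] at h3 ⊢
        omega
      rcases eq_or_of_sub_even i j h4 with rfl | h2
      · rfl
      · apply key h2
        rw [h2, unit_add_three] at h'
        rw [← add_self_mem_dbl]
        convert h' using 1
        ring

omit D

/-- Turning the tiling. -/
def rotate (D : Dev M L) (i : ZMod 6) : Dev M (Eis.rotate i L) where
  φ v j := D.φ (unit i * v + 0) (i + j)
  isDev := D.isDev.comp_rotate 0 i
  surj d := by
    obtain ⟨v, j, rfl⟩ := D.surj d
    exact ⟨unit (-i) * v, j - i, by rw [unit_mul_neg, add_zero, add_sub_cancel]⟩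
  eq_iff v j w k := by
    rw [D.eq_iff, mem_dbl_rotate, mem_dbl_rotate, add_right_inj, add_assoc, add_right_inj,
      add_zero, add_zero, mul_sub, mul_add]

theorem iso (D : Dev M L) (D' : Dev N L) : M.Iso N := by
  obtain ⟨e, he⟩ := exists_equiv_of_fibers (f := fun x : Eis × ZMod 6 => D.φ x.1 x.2)
    (g := fun x : Eis × ZMod 6 => D'.φ x.1 x.2)
    (fun d => by obtain ⟨v, j, h⟩ := D.surj d; exact ⟨(v, j), h⟩)
    (fun d => by obtain ⟨v, j, h⟩ := D'.surj d; exact ⟨(v, j), h⟩)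
    (fun x y => by rw [D.eq_iff, D'.eq_iff])
  have he : ∀ v j, e (D.φ v j) = D'.φ v j := fun v j => he (v, j)
  refine ⟨e, fun d => ?_, Or.inl fun d => ?_⟩
  · obtain ⟨v, j, rfl⟩ := D.surj d
    rw [← D.isDev.2, he, he, D'.isDev.2]
  · obtain ⟨v, j, rfl⟩ := D.surj d
    rw [D.isDev.rot, he, he, D'.isDev.rot]

/-- The face of a dart lies on its right, and a reflection moves it to the left of the image. Hence
conjugation of the tiling has to be combined with `opp`. -/
theorem iso_mirror (D : Dev M L) (D' : Dev N (mirror L)) : M.Iso N := by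
  obtain ⟨e, he⟩ := exists_equiv_of_fibers (f := fun x : Eis × ZMod 6 => D.φ x.1 x.2)
    (g := fun x : Eis × ZMod 6 => N.opp (D'.φ (star x.1) (-x.2)))
    (fun d => by obtain ⟨v, j, h⟩ := D.surj d; exact ⟨(v, j), h⟩)
    (fun d => by
      obtain ⟨v, j, h⟩ := D'.surj (N.opp d)
      refine ⟨(star v, -j), ?_⟩
      simp only [star_star, neg_neg, h, N.opp_opp])
    (fun x y => by
      rw [N.opp.injective.eq_iff, D.eq_iff, D'.eq_iff, mem_dbl_mirror, mem_dbl_mirror, star_sub,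
        star_add, star_star, star_star, neg_inj]
      have : ∀ i j : ZMod 6, i = j + 3 ↔ -i = -j + 3 := by decide
      rw [this])
  have he : ∀ v j, e (D.φ v j) = N.opp (D'.φ (star v) (-j)) := fun v j => he (v, j)
  refine ⟨e, fun d => ?_, Or.inr fun d => ?_⟩
  · obtain ⟨v, j, rfl⟩ := D.surj d
    rw [← D.isDev.2, he, he, star_add, star_unit, neg_add_three, D'.isDev.2]
  · obtain ⟨v, j, rfl⟩ := D.surj d
    rw [Equiv.eq_symm_apply, D.isDev.rot, he, he, star_add, star_unit, ← D'.isDev.2, D'.isDev.rot,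
      ← D'.isDev.2]
    congr 1
    · rw [add_assoc, add_assoc]
      congr 1
      revert j; decide
    · revert j; decide

/-- An isomorphism carries the development over, up to a reflection. -/
theorem of_iso (D : Dev N L) (h : M.Iso N) : Nonempty (Dev M L) ∨ Nonempty (Dev M (mirror L)) := by
  obtain ⟨e, ho, hr | hr⟩ := h
  · left
    have ho' : ∀ d, M.opp (e.symm d) = e.symm (N.opp d) := fun d => by
      rw [Equiv.eq_symm_apply, ho, Equiv.apply_symm_apply]
    refine ⟨⟨fun v j => e.symm (D.φ v j), ⟨fun v j => ?_, fun v j => ?_⟩, fun d => ?_, ?_⟩⟩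
    · rw [Equiv.symm_apply_eq, next_apply, hr, ho, Equiv.apply_symm_apply, D.isDev.1, next_apply]
    · beta_reduce
      rw [ho', D.isDev.2]
    · obtain ⟨v, j, h⟩ := D.surj (e d)
      exact ⟨v, j, by rw [h, Equiv.symm_apply_apply]⟩
    · intro v j w i
      rw [e.symm.injective.eq_iff, D.eq_iff]
  · right
    have ho' : ∀ d, M.opp (e.symm d) = e.symm (N.opp d) := fun d => by
      rw [Equiv.eq_symm_apply, ho, Equiv.apply_symm_apply]
    refine ⟨⟨fun v j => e.symm (N.opp (D.φ (star v) (-j))), ⟨fun v j => ?_, fun v j => ?_⟩,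
      fun d => ?_, ?_⟩⟩
    · beta_reduce
      rw [Equiv.symm_apply_eq, next_apply, hr, ho, Equiv.apply_symm_apply, N.opp_opp,
        Equiv.eq_symm_apply, ← next_apply, ← D.isDev.1]
      congr 1
      ring
    · beta_reduce
      rw [ho', star_add, star_unit, neg_add_three, D.isDev.2]
    · obtain ⟨v, j, h⟩ := D.surj (N.opp (e d))
      exact ⟨star v, -j, by rw [star_star, neg_neg, h, N.opp_opp, Equiv.symm_apply_apply]⟩
    · intro v j w i
      rw [e.symm.injective.eq_iff, N.opp.injective.eq_iff, D.eq_iff, mem_dbl_mirror,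
        mem_dbl_mirror, star_sub, star_add, neg_inj]
      have : ∀ i j : ZMod 6, i = j + 3 ↔ -i = -j + 3 := by decide
      rw [← this]

end Dev

end CombMap

/-! ### Index of the lattice and number of darts -/

namespace Eis

theorem index_dbl (L : AddSubgroup Eis) : (dbl L).index = 4 * L.index := by
  have h4 : (nsmulAddMonoidHom 2 : Eis →+ Eis).range.index = 4 := by
    let f : Eis →+ ZMod 2 × ZMod 2 :=
      { toFun := fun x => (x.re, x.im)
        map_zero' := by simp
        map_add' := fun x y => by simp }
    have hf : (nsmulAddMonoidHom 2 : Eis →+ Eis).range = f.ker := by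
      ext x
      rw [AddMonoidHom.mem_ker]
      constructor
      · rintro ⟨y, rfl⟩
        rw [nsmulAddMonoidHom_apply, two_nsmul, map_add]
        exact CharTwo.add_self_eq_zero _
      · intro h
        have h1 : ((x.re : ℤ) : ZMod 2) = 0 := congrArg Prod.fst h
        have h2 : ((x.im : ℤ) : ZMod 2) = 0 := congrArg Prod.snd h
        obtain ⟨a, ha⟩ := (ZMod.intCast_zmod_eq_zero_iff_dvd _ 2).1 h1
        obtain ⟨b, hb⟩ := (ZMod.intCast_zmod_eq_zero_iff_dvd _ 2).1 h2
        refine ⟨⟨a, b⟩, ?_⟩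
        rw [nsmulAddMonoidHom_apply, two_nsmul]
        ext <;> simp <;> push_cast at ha hb <;> omega
    have hs : Function.Surjective f := by
      intro ⟨a, b⟩
      obtain ⟨a, rfl⟩ := ZMod.intCast_surjective a
      obtain ⟨b, rfl⟩ := ZMod.intCast_surjective b
      exact ⟨⟨a, b⟩, rfl⟩
    rw [hf, AddSubgroup.index_ker, AddMonoidHom.range_eq_top.2 hs, AddSubgroup.card_top]
    simp
  have hk : (nsmulAddMonoidHom 2 : Eis →+ Eis).ker = ⊥ := by
    rw [eq_bot_iff]
    intro x hx
    rw [AddMonoidHom.mem_ker, nsmulAddMonoidHom_apply, two_nsmul] at hx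
    have h1 := congrArg QuadraticAlgebra.re hx
    have h2 := congrArg QuadraticAlgebra.im hx
    simp only [QuadraticAlgebra.re_add, QuadraticAlgebra.im_add, QuadraticAlgebra.re_zero,
      QuadraticAlgebra.im_zero] at h1 h2
    rw [AddSubgroup.mem_bot]
    ext <;> simp <;> omega
  rw [dbl, AddSubgroup.index_map, hk, sup_bot_eq, h4, mul_comm]

end Eis

namespace CombMap

open Eis

namespace Dev

variable {M N : CombMap} {L : AddSubgroup Eis} (D : Dev M L)
include D

/-- The half-turn about the origin identifies the side `j + 3` of the face `v` with the side `j` of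
`-v`. So the darts over `K` are represented by the sides 0, 1, 2, taken modulo translations in `dbl
L`. The cases `K = ⊤` and `K = L` count all darts and the darts of triangles. -/
theorem ncard_darts (K : AddSubgroup Eis) :
    {d | ∃ v ∈ K, ∃ j, D.φ v j = d}.ncard = 3 * (dbl L).relIndex K := by
  obtain ⟨e, -⟩ := exists_equiv_of_fibers
    (f := fun x : K × Fin 3 => ((x.1 : K ⧸ (dbl L).addSubgroupOf K), x.2))
    (g := fun x : K × Fin 3 =>
      (⟨D.φ x.1.1 x.2.1, x.1.1, x.1.2, _, rfl⟩ : {d | ∃ v ∈ K, ∃ j, D.φ v j = d}))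
    (by
      rintro ⟨x, k⟩
      obtain ⟨x, rfl⟩ := QuotientAddGroup.mk_surjective x
      exact ⟨(x, k), rfl⟩)
    (by
      rintro ⟨_, v, hv, j, rfl⟩
      have h3 : ∃ k : Fin 3, j = (k.1 : ZMod 6) ∨ j = (k.1 : ZMod 6) + 3 := by
        revert j; decide
      obtain ⟨k, rfl | rfl⟩ := h3
      · exact ⟨(⟨v, hv⟩, k), rfl⟩
      · refine ⟨(⟨-v, neg_mem hv⟩, k), Subtype.ext ?_⟩
        exact D.eq_of_add (by simp) _)
    (by
      rintro ⟨⟨v, hv⟩, k⟩ ⟨⟨w, hw⟩, l⟩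
      have h3 : ∀ k l : Fin 3, (l.1 : ZMod 6) ≠ (k.1 : ZMod 6) + 3 ∧
        ((l.1 : ZMod 6) = (k.1 : ZMod 6) ↔ k = l) := by decide
      have h4 := h3 k l
      simp only [Prod.mk.injEq, QuotientAddGroup.eq, AddSubgroup.mem_addSubgroupOf, Subtype.mk.injEq]
      rw [D.eq_iff]
      simp only [h4.1, false_and, or_false, h4.2]
      rw [and_comm]
      have : ((-(⟨v, hv⟩ : K) + ⟨w, hw⟩ : K) : Eis) = w - v := by
        simp only [AddSubgroup.coe_add, NegMemClass.coe_neg]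
        ring
      rw [this])
  rw [← Nat.card_coe_set_eq, ← Nat.card_congr e, Nat.card_prod, Nat.card_fin, mul_comm]
  rfl

theorem card_dart : Nat.card M.Dart = 12 * L.index := by
  have := D.ncard_darts ⊤
  rw [AddSubgroup.relIndex_top_right, index_dbl] at this
  have h : {d | ∃ v ∈ (⊤ : AddSubgroup Eis), ∃ j, D.φ v j = d} = Set.univ := by
    refine Set.eq_univ_of_forall fun d => ?_
    obtain ⟨v, j, h⟩ := D.surj d
    exact ⟨v, trivial, j, h⟩
  rw [h, Set.ncard_univ] at this
  omega

theorem index_pos : 0 < L.index := by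
  have h := D.card_dart
  have : 0 < Nat.card M.Dart := Nat.card_pos_iff.2 ⟨⟨D.φ 0 0⟩, inferInstance⟩
  omega

theorem ncard_triangle_darts : {d | M.size (M.face d) = 3}.ncard = 12 := by
  have h := D.ncard_darts L
  have h2 := AddSubgroup.relIndex_mul_index (dbl_le (L := L))
  rw [index_dbl] at h2
  have h3 := Nat.eq_of_mul_eq_mul_right D.index_pos h2
  rw [h3] at h
  convert h using 2
  ext d
  constructor
  · intro hd
    obtain ⟨v, j, rfl⟩ := D.surj d
    exact ⟨v, D.size_three_iff.1 hd, j, rfl⟩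
  · rintro ⟨v, hv, j, rfl⟩
    exact D.size_three_iff.2 hv

theorem card_vertex : Nat.card M.Vertex = 4 * L.index := by
  have h := D.card_dart
  have h2 := D.cubic.card_dart
  omega

theorem isThree (hL : ∀ j, unit j ∈ L → L = ⊤) : M.IsThree (4 * L.index) := by
  have h2 : ∀ d, M.next (M.next d) ≠ d := fun d =>
    (size_three_or_six.1 (D.sizes (M.face d))).2.2
  have hpos := D.index_pos
  refine ⟨⟨⟨D.φ 0 0⟩, D.connected, ?_⟩, ?_, ?_, cubic_iff.1 D.cubic, D.sizes, D.card_vertex⟩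
  · exact (euler_three_six D.cubic D.sizes).2 D.ncard_triangle_darts
  · exact (D.dualSimple hL).isSimple D.cubic h2
  · refine (D.dualSimple hL).isThreeConnected D.cubic h2 D.connected ?_
    rw [D.card_vertex]
    omega

theorem eq_of_isThree {n : ℕ} (h : M.IsThree n) : n = 4 * L.index := by
  rw [← D.card_vertex, h.2.2.2.2.2]

/-- The triangles with centres 0 and `unit j` are adjacent, which limits a 3-connected graph to four
vertices and `L` to index one. -/
theorem top_of_isThree {n : ℕ} (h : M.IsThree n) (j : ZMod 6) (hj : unit j ∈ L) : L = ⊤ := by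
  have key : ∀ {v i}, v ∈ L → M.next (M.next (M.next (D.φ v i))) = D.φ v i := fun hv =>
    (size_eq_three.1 (D.size_three_iff.2 hv)).1
  have := card_vertex_le_four_of_adjacent_triangles D.cubic h.2.1 h.2.2.1 (d := D.φ 0 j)
    (key (zero_mem _)) (by rw [← D.isDev.2]; exact key (by simpa using hj))
  rw [D.card_vertex] at this
  have hpos := D.index_pos
  exact AddSubgroup.index_eq_one.1 (by omega)

end Dev

/-! ### Every map of this kind is a quotient of the hexagonal tiling -/

/-- In a group with `n ^ 6 = o ^ 2 = (n o) ^ 3 = 1`, the conjugates of `n ^ 3 o` by the powers of `n`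
behave like the translations by the units. -/
theorem translations {G : Type*} [Group G] {n o x y : G} (hn : n ^ 6 = 1) (ho : o * o = 1)
    (hr : n * o * (n * o) * (n * o) = 1) (hx : x = n ^ 3 * o) (hy : y = n⁻¹ * x * n) :
    x * y = y * x ∧ n⁻¹ * y * n = y * x⁻¹ := by
  set t : ℕ → G := fun i => (n ^ i)⁻¹ * x * n ^ i with ht
  let c : G →* G := (MulAut.conj n⁻¹).toMonoidHom
  have hconj : ∀ i, c (t i) = t (i + 1) := fun i => by
    simp only [c, ht, MulEquiv.toMonoidHom_eq_coe, MonoidHom.coe_coe, MulAut.conj_apply, inv_inv,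
      pow_succ, mul_inv_rev]
    group
  have hn3 : (n ^ 3)⁻¹ = n ^ 3 := by
    rw [inv_eq_iff_mul_eq_one, ← pow_add, hn]
  have h3 : t 3 = (t 0)⁻¹ := by
    have : o⁻¹ = o := inv_eq_iff_mul_eq_one.2 ho
    simp only [ht, pow_zero, inv_one, one_mul, mul_one, hx, mul_inv_rev, this, hn3]
    rw [← mul_assoc (n ^ 3) (n ^ 3), ← pow_add, hn, one_mul]
  have h4 : t 4 = (t 1)⁻¹ := by
    rw [← hconj 3, h3, map_inv, hconj 0]
  have h5 : t 5 = (t 2)⁻¹ := by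
    rw [← hconj 4, h4, map_inv, hconj 1]
  have ho' : o = n ^ 3 * x := by
    rw [hx, ← mul_assoc, ← pow_add, hn, one_mul]
  -- `t i` plays the part of the translation by `unit i`. Written in terms of `x`, the relation `hr`
  -- at a vertex says `t 2 * t 4 * t 0 = 1`: three unit vectors at angles of 120 degrees sum to
  -- zero.
  have h2 : t 2 = (t 0)⁻¹ * t 1 := by
    have e1 : n * o = n ^ 4 * x := by
      rw [ho', ← mul_assoc, ← pow_succ']
    rw [e1] at hr
    have e2 : t 2 = n ^ 4 * x * n ^ 2 := by
      have : (n ^ 2)⁻¹ = n ^ 4 := by rw [inv_eq_iff_mul_eq_one, ← pow_add, hn]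
      simp only [ht, this]
    have e4 : t 4 = n ^ 2 * x * n ^ 4 := by
      have : (n ^ 4)⁻¹ = n ^ 2 := by rw [inv_eq_iff_mul_eq_one, ← pow_add, hn]
      simp only [ht, this]
    have h210 : t 2 * t 4 * t 0 = 1 := by
      rw [e2, e4]
      simp only [ht, pow_zero, inv_one, one_mul, mul_one]
      calc n ^ 4 * x * n ^ 2 * (n ^ 2 * x * n ^ 4) * x
          = n ^ 4 * x * (n ^ 4 * x) * (n ^ 4 * x) := by group
        _ = 1 := hr
    rw [h4] at h210
    have := eq_inv_of_mul_eq_one_left h210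
    rwa [mul_inv_eq_iff_eq_mul] at this
  -- Conjugating the relation three times and using that `t (i + 3)` is inverse to `t i` gives the
  -- same relation with the factors in the other order, whence `t 0` and `t 1` commute.
  have h2' : t 2 = t 1 * (t 0)⁻¹ := by
    have e3 : t 3 = (t 1)⁻¹ * t 2 := by rw [← hconj 2, h2, map_mul, map_inv, hconj, hconj, ← h2]
    have e4 : t 4 = (t 2)⁻¹ * t 3 := by
      rw [← hconj 3, e3, map_mul, map_inv, hconj, hconj, ← e3]
    have e5 : t 5 = (t 3)⁻¹ * t 4 := by
      rw [← hconj 4, e4, map_mul, map_inv, hconj, hconj, ← e4]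
    rw [h5, h3, h4, inv_inv, inv_eq_iff_eq_inv, mul_inv_rev, inv_inv] at e5
    exact e5
  have hx0 : t 0 = x := by simp [ht]
  have hy1 : t 1 = y := by simp [ht, hy]
  have hc1 : n⁻¹ * y * n = t 2 := by
    rw [← hconj 1, hy1]
    simp [c]
  rw [hx0, hy1] at h2 h2'
  refine ⟨?_, hc1.trans h2'⟩
  rw [h2, inv_mul_eq_iff_eq_mul, ← mul_assoc, eq_mul_inv_iff_mul_eq] at h2'
  exact h2'.symm

end CombMap

namespace CombMap

open Eis

variable {M : CombMap}

/-- The rotation group of the tiling acts on the darts through `next` and `opp`. A dart of the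
tiling is reached from the base dart by a translation `τ v` followed by `j` steps around the face,
and the development carries this recipe over to `M`. -/
theorem exists_development (hc : M.Cubic) (h6 : ∀ d, M.next^[6] d = d) (d₀ : M.Dart) :
    ∃ φ, M.IsDevelopment φ ∧ φ 0 0 = d₀ := by
  obtain ⟨n, hn⟩ : ∃ n : Equiv.Perm M.Dart, n = M.next := ⟨_, rfl⟩
  obtain ⟨o, ho⟩ : ∃ o : Equiv.Perm M.Dart, o = M.opp := ⟨_, rfl⟩
  -- Crossing an edge and going half way round the next hexagon leads to the parallel dart: `x`
  -- translates by 1, and its conjugate `y` by `ζ`.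
  obtain ⟨x, hx⟩ : ∃ x, x = n ^ 3 * o := ⟨_, rfl⟩
  obtain ⟨y, hy⟩ : ∃ y, y = n⁻¹ * x * n := ⟨_, rfl⟩
  have hn6 : n ^ 6 = 1 := by
    ext d
    rw [hn, ← Equiv.Perm.iterate_eq_pow, h6]
    rfl
  have ho2 : o * o = 1 := by
    ext d
    rw [ho]
    exact M.opp_opp d
  have hr : n * o * (n * o) * (n * o) = 1 := by
    have : n * o = M.rot := by
      ext d
      rw [hn, ho]
      exact next_opp d
    rw [this]
    ext d
    exact (hc d).1
  obtain ⟨hxy, hyx⟩ := translations hn6 ho2 hr hx hy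
  have hcomm : Commute x y := hxy
  let τ : Eis → Equiv.Perm M.Dart := fun v => x ^ v.re * y ^ v.im
  have hτ : ∀ v w, τ (v + w) = τ v * τ w := by
    intro v w
    simp only [τ, QuadraticAlgebra.re_add, QuadraticAlgebra.im_add, zpow_add]
    rw [mul_assoc, mul_assoc, ← mul_assoc (x ^ w.re), (hcomm.zpow_zpow w.re v.im).eq, mul_assoc]
  have hconj : ∀ v, n⁻¹ * τ v * n = τ (unit 1 * v) := by
    intro v
    have e1 : n⁻¹ * τ v * n = (n⁻¹ * x * n) ^ v.re * (n⁻¹ * y * n) ^ v.im := by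
      have h := fun g k => (conj_zpow (i := k) (a := n⁻¹) (b := g)).symm
      rw [inv_inv] at h
      simp only [τ]
      rw [← h x, ← h y]
      group
    rw [e1, ← hy, hyx, hcomm.symm.inv_right.mul_zpow]
    have e2 : unit 1 * v = ⟨-v.im, v.re + v.im⟩ := by
      ext <;> simp [unit]
    simp only [τ, e2]
    rw [inv_zpow', zpow_add, ← mul_assoc, ((hcomm.zpow_zpow (-v.im) v.re).mul_right
      (hcomm.zpow_zpow (-v.im) v.im)).eq, mul_assoc]
  let p : ZMod 6 → Equiv.Perm M.Dart := fun j => n ^ j.val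
  have hp : ∀ j, p (j + 1) = n * p j := by
    intro j
    simp only [p]
    rw [← pow_succ']
    rcases zmod6_cases j with rfl | rfl | rfl | rfl | rfl | rfl
    all_goals first | rfl | exact hn6.symm
  have hpx : ∀ k : ℕ, x * n ^ k = n ^ k * τ (unit k) := by
    intro k
    induction k with
    | zero => simp [τ, unit]
    | succ k ih =>
      rw [pow_succ, ← mul_assoc, ih, Nat.cast_succ, add_comm (k : ZMod 6), ← unit_mul, ← hconj]
      group
  have hop : ∀ j, o * p j = p (j + 3) * τ (unit j) := by
    intro j
    have e1 : o = n ^ 3 * x := by rw [hx, ← mul_assoc, ← pow_add, hn6, one_mul]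
    have e2 : p (j + 3) = n ^ 3 * p j := by
      rw [show j + 3 = j + 1 + 1 + 1 by ring, hp, hp, hp, pow_succ, pow_two, mul_assoc, mul_assoc]
    have e3 := hpx j.val
    rw [ZMod.natCast_zmod_val] at e3
    rw [e1, e2, mul_assoc, e3, mul_assoc]
  refine ⟨fun v j => p j (τ v d₀), ⟨fun v j => ?_, fun v j => ?_⟩, ?_⟩
  · beta_reduce
    rw [hp, hn]
    rfl
  · have := hop j
    beta_reduce
    rw [add_comm v, hτ, ← ho]
    exact (congrArg (fun f : Equiv.Perm M.Dart => f (τ v d₀)) this).symm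
  · simp [p, τ]

/-- With a triangle as base face, the rotations that leave the development invariant are
translations and half-turns only. The translations form a group `T` of even elements, `L` is half of
it, and the half-turn about the origin supplies all the others. -/
theorem exists_dev (hc : M.Cubic) (hs : ∀ F, M.size F = 3 ∨ M.size F = 6)
    (hconn : ∀ d e : M.Dart, ∃ g ∈ Subgroup.closure {M.rot, M.opp}, g d = e)
    (h3 : ∃ F, M.size F = 3) : ∃ L, Nonempty (Dev M L) := by
  have hd := fun d => size_three_or_six.1 (hs (M.face d))
  obtain ⟨F, hF⟩ := h3
  obtain ⟨d₀, rfl⟩ := face_surj F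
  obtain ⟨φ, hφ, h0⟩ := exists_development hc (fun d => (hd d).1) d₀
  have n1 : ∀ v j, φ v (j + 1) ≠ φ v j := fun v j => by
    rw [hφ.1]
    exact (hd _).2.1
  have n2 : ∀ v j, φ v (j + 2) ≠ φ v j := fun v j => by
    rw [show j + 2 = j + 1 + 1 by ring, hφ.1, hφ.1]
    exact (hd _).2.2
  -- By rigidity, two darts with the same image give a rotation of the tiling under which `φ` is
  -- invariant.
  have deck : ∀ {v j w i}, φ v j = φ w i →
      ∀ x k, φ (unit j * x + v) (j + k) = φ (unit i * x + w) (i + k) := by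
    intro v j w i h x k
    exact (hφ.comp_rotate v j).eq (hφ.comp_rotate w i) (v₀ := 0) (j₀ := 0) (by simpa using h) x k
  have deck3 : ∀ x k, φ (-x) (k + 3) = φ x k := by
    have h03 : φ 0 3 = φ 0 0 := by
      have := hφ.next_iterate 0 0 3
      rw [h0] at this
      have h4 := (size_eq_three.1 hF).1
      have h5 : φ 0 3 = M.next^[3] d₀ := by rw [this]; rfl
      rw [h5, h0]
      exact h4
    intro x k
    have := deck h03 x k
    rw [unit_zero, one_mul, add_zero, add_zero, zero_add, add_comm] at this
    rw [← this]
    congr 1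
    rw [show unit 3 = -1 from rfl]
    ring
  have deck0 : ∀ {c m}, φ c m = φ 0 0 → ∀ x k, φ (unit m * x + c) (m + k) = φ x k := by
    intro c m h x k
    rw [deck h x k, unit_zero, one_mul, add_zero, zero_add]
  -- The rotation `x ↦ ζ x + c` fixes the face centre `ζ c`, and invariance would make one step
  -- around this face trivial.
  have no1 : ∀ c, φ c 1 ≠ φ 0 0 := by
    intro c h
    have := deck0 h (unit 1 * c) 0
    have h2 : unit 1 * (unit 1 * c) + c = unit 1 * c := by
      ext <;> simp [unit_one_eq]
    rw [h2, add_comm] at this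
    exact n1 _ _ this
  -- A rotation by 120 degrees fixes a face centre or a vertex of the tiling. Since `1 - ζ ^ 2` has
  -- norm 3, the residue of `c` modulo 3 decides which: the first residue gives a face on which two
  -- steps would be trivial, the other two a vertex around which `rot` would not have order three.
  have no2 : ∀ c, φ c 2 ≠ φ 0 0 := by
    intro c h
    have solve : ∀ e : Eis, e.re % 3 = e.im % 3 → ∃ x, unit 2 * x + e = x := by
      intro e he
      refine ⟨⟨(e.re - e.im) / 3, (e.re + 2 * e.im) / 3⟩, ?_⟩
      ext <;> simp [unit_two_eq] <;> omega
    have rr : ∀ j, (c - unit (j + 5)).re % 3 = (c - unit (j + 5)).im % 3 → False := by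
      intro j hj
      obtain ⟨x, hx⟩ := solve (c - unit (j + 5)) hj
      have h4 := deck0 h x j
      have h5 : unit 2 * x + c = x + unit (j + 5) := by
        linear_combination hx
      rw [h5, add_comm 2, ← hφ.rot_rot] at h4
      exact hc.rot_rot_ne _ h4
    have h3 : c.re % 3 = c.im % 3 ∨ c.re % 3 = (c.im + 1) % 3 ∨ c.re % 3 = (c.im - 1) % 3 := by
      omega
    rcases h3 with h3 | h3 | h3
    · obtain ⟨x, hx⟩ := solve c h3
      have := deck0 h x 0
      rw [hx, add_comm] at this
      exact n2 _ _ this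
    · apply rr 1
      rw [show (1 + 5 : ZMod 6) = 0 from rfl, unit_zero_eq]
      simp only [QuadraticAlgebra.re_sub, QuadraticAlgebra.im_sub]
      omega
    · apply rr 2
      rw [show (2 + 5 : ZMod 6) = 1 from rfl, unit_one_eq]
      simp only [QuadraticAlgebra.re_sub, QuadraticAlgebra.im_sub]
      omega
  -- The inverse of a rotation by 240 degrees is a rotation by 120 degrees; likewise for 300 and 60
  -- below.
  have no4 : ∀ c, φ c 4 ≠ φ 0 0 := by
    intro c h
    have := deck0 h (unit 5 * c) 2
    have h2 : unit 4 * (unit 5 * c) + c = 0 := by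
      ext <;> simp [unit_four_eq, unit_five_eq]
    rw [h2] at this
    exact no2 _ this.symm
  have no5 : ∀ c, φ c 5 ≠ φ 0 0 := by
    intro c h
    have := deck0 h (unit 4 * c) 1
    have h2 : unit 5 * (unit 4 * c) + c = 0 := by
      ext <;> simp [unit_four_eq, unit_five_eq]
    rw [h2] at this
    exact no1 _ this.symm
  have trans : ∀ {t}, φ t 0 = φ 0 0 → ∀ x k, φ (x + t) k = φ x k := by
    intro t h x k
    have := deck0 h x k
    rwa [unit_zero, one_mul, zero_add] at this
  let T : AddSubgroup Eis :=
    { carrier := {t | φ t 0 = φ 0 0}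
      zero_mem' := rfl
      add_mem' := fun {s t} hs ht => (trans ht s 0).trans hs
      neg_mem' := fun {t} ht => by
        have := trans ht (-t) 0
        rw [neg_add_cancel] at this
        exact this.symm }
  have hT : ∀ t, t ∈ T ↔ φ t 0 = φ 0 0 := fun t => Iff.rfl
  let L : AddSubgroup Eis := T.comap (nsmulAddMonoidHom 2)
  have hL : dbl L = T := by
    ext t
    rw [mem_dbl]
    constructor
    · rintro ⟨l, hl, rfl⟩
      rw [← two_nsmul]
      exact hl
    · intro ht
      -- Composing such a translation with the half-turn about the origin gives the half-turn about
      -- the midpoint of an edge, which would make `opp` fix a dart.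
      have hodd : ∀ x j, t ≠ x + x + unit j := by
        rintro x j rfl
        have e1 := deck3 (-(x + unit j)) j
        have e2 := trans ((hT _).1 ht) (-(x + unit j)) j
        rw [neg_neg] at e1
        rw [show -(x + unit j) + (x + x + unit j) = x by ring, ← e1, hφ.2] at e2
        exact M.opp_ne _ e2.symm
      have hpar : t.re % 2 = 0 ∧ t.im % 2 = 0 := by
        by_contra hcon
        have h3 : (t.re % 2 = 1 ∧ t.im % 2 = 0) ∨ (t.re % 2 = 0 ∧ t.im % 2 = 1) ∨
            (t.re % 2 = 1 ∧ t.im % 2 = 1) := by omega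
        rcases h3 with h3 | h3 | h3
        · refine hodd ⟨t.re / 2, t.im / 2⟩ 0 ?_
          ext <;> simp [unit_zero_eq] <;> omega
        · refine hodd ⟨t.re / 2, t.im / 2⟩ 1 ?_
          ext <;> simp [unit_one_eq] <;> omega
        · refine hodd ⟨t.re / 2 + 1, t.im / 2⟩ 2 ?_
          ext <;> simp [unit_two_eq] <;> omega
      have h2 : (⟨t.re / 2, t.im / 2⟩ : Eis) + ⟨t.re / 2, t.im / 2⟩ = t := by
        ext <;> simp <;> omega
      refine ⟨⟨t.re / 2, t.im / 2⟩, ?_, h2⟩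
      rw [← two_nsmul] at h2
      exact (congrArg (· ∈ T) h2).mpr ht
  refine ⟨L, ⟨φ, hφ, ?_, ?_⟩⟩
  · refine connected_iff.1 hconn (fun d => ∃ v j, φ v j = d) ?_ ?_ ⟨_, 0, 0, rfl⟩
    · rintro _ ⟨v, j, rfl⟩
      exact ⟨_, _, (hφ.rot v j).symm⟩
    · rintro _ ⟨v, j, rfl⟩
      exact ⟨_, _, hφ.2 v j⟩
  · intro v j w i
    rw [hL, hT, hT]
    constructor
    · intro h
      -- The rotation that matches the two darts is normalised so that one of them becomes the base
      -- dart; only the difference `m` of the directions matters.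
      have h1 := deck h (-(unit (-j) * v)) (-j)
      rw [mul_neg, unit_mul_neg, neg_add_cancel, add_neg_cancel, mul_neg, ← mul_assoc, unit_mul,
        ← sub_eq_add_neg] at h1
      obtain ⟨m, rfl⟩ : ∃ m, i = j + m := ⟨i - j, by ring⟩
      rw [add_sub_cancel_left] at h1
      rcases zmod6_cases m with rfl | rfl | rfl | rfl | rfl | rfl
      · left
        rw [unit_zero, one_mul, neg_add_eq_sub] at h1
        exact ⟨add_zero j, h1.symm⟩
      · exact absurd h1.symm (no1 _)
      · exact absurd h1.symm (no2 _)
      · right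
        rw [show unit 3 = -1 from rfl, neg_one_mul, neg_neg] at h1
        refine ⟨rfl, ?_⟩
        have h2 := deck3 (v + w) 0
        have h3 := deck3 (-(v + w)) 0
        rw [neg_neg, zero_add, ← h1] at h3
        exact (T.neg_mem_iff (x := v + w)).1 h3.symm
      · exact absurd h1.symm (no4 _)
      · exact absurd h1.symm (no5 _)
    · rintro (⟨rfl, h⟩ | ⟨rfl, h⟩)
      · rw [← trans h v i, add_sub_cancel]
      · have := deck3 (-w) j
        rw [neg_neg] at this
        rw [this, ← trans h (-w) j]
        congr 1
        ring

end CombMap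

namespace CombMap

open Eis

/-! ### The quotients of the hexagonal tiling -/

/-- Equivalence of the darts of the hexagonal tiling under the half-turns around the points
of `L`. -/
def tilingSetoid (L : AddSubgroup Eis) : Setoid (Eis × ZMod 6) where
  r x y := (y.2 = x.2 ∧ y.1 - x.1 ∈ dbl L) ∨ (y.2 = x.2 + 3 ∧ x.1 + y.1 ∈ dbl L)
  iseqv :=
    { refl := fun x => Or.inl ⟨rfl, by simp⟩
      symm := by
        rintro ⟨v, j⟩ ⟨w, i⟩ (⟨h, h'⟩ | ⟨h, h'⟩)
        · exact Or.inl ⟨h.symm, by simpa using neg_mem h'⟩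
        · refine Or.inr ⟨?_, by rwa [add_comm]⟩
          simp only at h
          subst h
          change j = j + 3 + 3
          clear h'
          revert j; decide
      trans := by
        have h3 : ∀ j : ZMod 6, j + 3 + 3 = j := by decide
        rintro ⟨v, j⟩ ⟨w, i⟩ ⟨x, k⟩ (⟨h, h'⟩ | ⟨h, h'⟩) (⟨g, g'⟩ | ⟨g, g'⟩) <;>
          simp only at h g h' g' <;> subst h <;> subst g
        · exact Or.inl ⟨rfl, by convert add_mem h' g' using 1; simp⟩
        · exact Or.inr ⟨rfl, by convert sub_mem g' h' using 1; simp only; ring⟩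
        · exact Or.inr ⟨rfl, by convert add_mem h' g' using 1; simp only; ring⟩
        · exact Or.inl ⟨h3 _, by convert sub_mem g' h' using 1; simp only; ring⟩ }

/-- The quotient of the hexagonal tiling by the group generated by the half-turns around the points
of `L`. -/
def tilingQuotient (L : AddSubgroup Eis) [hL : L.FiniteIndex] : CombMap where
  Dart := Quotient (tilingSetoid L)
  finite := by
    have : (dbl L).FiniteIndex := ⟨by rw [index_dbl]; have := hL.index_ne_zero; omega⟩
    have : Finite (Eis ⧸ dbl L) := AddSubgroup.finite_quotient_of_finiteIndex
    refine Finite.of_surjective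
      (fun x : (Eis ⧸ dbl L) × ZMod 6 => (Quotient.mk (tilingSetoid L) (x.1.out, x.2))) ?_
    rintro ⟨v, j⟩
    refine ⟨((v : Eis ⧸ dbl L), j), Quotient.sound (Or.inl ⟨rfl, ?_⟩)⟩
    have := QuotientAddGroup.eq.1 (QuotientAddGroup.out_eq' (v : Eis ⧸ dbl L))
    rwa [neg_add_eq_sub] at this
  rot :=
    { toFun := Quotient.map (fun x => (x.1 + unit x.2, x.2 + 4)) (by
        rintro ⟨v, j⟩ ⟨w, i⟩ (⟨h, h'⟩ | ⟨h, h'⟩) <;> simp only at h h' <;> subst h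
        · exact Or.inl ⟨rfl, by simpa using h'⟩
        · refine Or.inr ⟨by ring, ?_⟩
          convert h' using 1
          simp only [unit_add_three]
          ring)
      invFun := Quotient.map (fun x => (x.1 + unit (x.2 + 5), x.2 + 2)) (by
        rintro ⟨v, j⟩ ⟨w, i⟩ (⟨h, h'⟩ | ⟨h, h'⟩) <;> simp only at h h' <;> subst h
        · exact Or.inl ⟨rfl, by simpa using h'⟩
        · refine Or.inr ⟨by ring, ?_⟩
          convert h' using 1
          simp only [add_right_comm j 3, unit_add_three]
          ring)
      left_inv := by
        rintro ⟨v, j⟩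
        refine congrArg (Quotient.mk _) (Prod.ext ?_ ?_)
        · change v + unit j + unit (j + 4 + 5) = v
          rw [add_assoc j, show (4 + 5 : ZMod 6) = 3 from rfl, unit_add_three, add_neg_cancel_right]
        · change j + 4 + 2 = j
          revert j; decide
      right_inv := by
        rintro ⟨v, j⟩
        refine congrArg (Quotient.mk _) (Prod.ext ?_ ?_)
        · change v + unit (j + 5) + unit (j + 2) = v
          rw [show j + 5 = j + 2 + 3 by ring, unit_add_three, neg_add_cancel_right]
        · change j + 2 + 4 = j
          revert j; decide }
  opp := Function.Involutive.toPerm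
    (Quotient.map (fun x => (x.1 + unit x.2, x.2 + 3)) (by
        rintro ⟨v, j⟩ ⟨w, i⟩ (⟨h, h'⟩ | ⟨h, h'⟩) <;> simp only at h h' <;> subst h
        · exact Or.inl ⟨rfl, by simpa using h'⟩
        · refine Or.inr ⟨by ring, ?_⟩
          convert h' using 1
          simp only [unit_add_three]
          ring))
    (by
      rintro ⟨v, j⟩
      refine congrArg (Quotient.mk _) (Prod.ext ?_ ?_)
      · change v + unit j + unit (j + 3) = v
        rw [unit_add_three, add_neg_cancel_right]
      · change j + 3 + 3 = j
        revert j; decide)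
  opp_opp := by
    rintro ⟨v, j⟩
    refine congrArg (Quotient.mk _) (Prod.ext ?_ ?_)
    · change v + unit j + unit (j + 3) = v
      rw [unit_add_three, add_neg_cancel_right]
    · change j + 3 + 3 = j
      revert j; decide
  opp_ne := by
    rintro ⟨v, j⟩ hvj
    rcases Quotient.exact hvj with ⟨h, -⟩ | ⟨-, h⟩
    · clear hvj
      revert h
      change j = j + 3 → False
      revert j; decide
    · change v + unit j + v ∈ dbl L at h
      rw [add_right_comm] at h
      exact add_self_add_unit_notMem v j h

/-- The tautological development. -/
def tilingQuotientDev (L : AddSubgroup Eis) [L.FiniteIndex] : Dev (tilingQuotient L) L where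
  φ v j := Quotient.mk (tilingSetoid L) (v, j)
  isDev := by
    refine ⟨fun v j => ?_, fun v j => rfl⟩
    refine congrArg (Quotient.mk _) (Prod.ext ?_ ?_)
    · change v = v + unit j + unit (j + 3)
      rw [unit_add_three, add_neg_cancel_right]
    · change j + 1 = j + 3 + 4
      revert j; decide
  surj := by
    rintro ⟨v, j⟩
    exact ⟨v, j, rfl⟩
  eq_iff v j w i := Quotient.eq

/-! ### The forms in terms of the lattice -/

namespace Dev

variable {M N : CombMap} {L : AddSubgroup Eis} (D : Dev M L)
include D

theorem exists_eq_of_face_eq {d : M.Dart} {v : Eis} {j : ZMod 6}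
    (h : M.face d = M.face (D.φ v j)) : ∃ i, d = D.φ v i := by
  obtain ⟨w, i, rfl⟩ := D.surj d
  rcases D.face_eq_iff.1 h with h | h
  · exact ⟨i, D.eq_of_sub h i⟩
  · exact ⟨i + 3, D.eq_of_add h i⟩

theorem faceAdj_iff {v : Eis} {j : ZMod 6} {F : M.Face} :
    M.FaceAdj (M.face (D.φ v j)) F ↔ ∃ i, F = M.face (D.φ (v + unit i) 0) := by
  constructor
  · rintro ⟨hne, d, hd, rfl⟩
    obtain ⟨i, rfl⟩ := D.exists_eq_of_face_eq hd
    exact ⟨i, by rw [← D.isDev.2]; exact D.face_eq _ _ _⟩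
  · rintro ⟨i, rfl⟩
    refine ⟨fun h => ?_, D.φ v i, D.face_eq _ _ _, ?_⟩
    · rcases D.face_eq_iff.1 h with h | h
      · rw [add_sub_cancel_left] at h
        exact unit_notMem_dbl i h
      · rw [← add_assoc] at h
        exact add_self_add_unit_notMem v i h
    · rw [← D.isDev.2]
      exact D.face_eq _ _ _

theorem adjTriangles_eq (v : Eis) (j : ZMod 6) :
    M.adjTriangles (M.face (D.φ v j)) =
      {F | ∃ i, v + unit i ∈ L ∧ F = M.face (D.φ (v + unit i) 0)} := by
  ext F
  unfold adjTriangles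
  simp only [Set.mem_ofPred_eq, D.faceAdj_iff]
  constructor
  · rintro ⟨h, i, rfl⟩
    exact ⟨i, D.size_three_iff.1 h, rfl⟩
  · rintro ⟨i, h, rfl⟩
    exact ⟨D.size_three_iff.2 h, i, rfl⟩

end Dev

end CombMap

namespace Eis

theorem unit_sub_unit_succ (i : ZMod 6) : unit (i + 1) - unit i = unit (i + 2) := by
  revert i; decide

theorem unit_sub_unit_pred (i : ZMod 6) : unit (i + 5) - unit i = unit (i + 4) := by
  revert i; decide

theorem unit_sub_unit_two (i : ZMod 6) :
    unit (i + 2) - unit i = unit (i + 2) + unit (i + 2 + 1) := by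
  revert i; decide

theorem unit_sub_unit_three (i : ZMod 6) : unit (i + 3) - unit i = unit (i + 3) + unit (i + 3) := by
  revert i; decide

variable {L : AddSubgroup Eis}

/-- Neighbours of `v` in adjacent directions differ by a unit, so triangles never sit on adjacent
sides of a hexagon. -/
theorem mem_add_unit (hu : ∀ j, unit j ∉ L) {v : Eis} {i i' : ZMod 6} (h : v + unit i ∈ L)
    (h' : v + unit i' ∈ L) : i' = i ∨ i' = i + 2 ∨ i' = i + 3 ∨ i' = i + 4 := by
  have h2 := sub_mem h' h
  rw [add_sub_add_left_eq_sub] at h2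
  obtain ⟨m, rfl⟩ : ∃ m, i' = i + m := ⟨i' - i, by ring⟩
  rcases zmod6_cases m with rfl | rfl | rfl | rfl | rfl | rfl
  · simp
  · rw [unit_sub_unit_succ] at h2
    exact absurd h2 (hu _)
  · simp
  · simp
  · simp
  · rw [unit_sub_unit_pred] at h2
    exact absurd h2 (hu _)

theorem notMem_of_add_unit_mem (hu : ∀ j, unit j ∉ L) {v : Eis} {i : ZMod 6}
    (h : v + unit i ∈ L) : v ∉ L := fun hv => hu i (by simpa using sub_mem h hv)

end Eis

namespace CombMap

open Eis

namespace Dev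

variable {M N : CombMap} {L : AddSubgroup Eis} (D : Dev M L)
include D

theorem triangle_injective (hu : ∀ j, unit j ∉ L) {v : Eis} {i i' : ZMod 6} (h : v + unit i ∈ L)
    (hf : M.face (D.φ (v + unit i) 0) = M.face (D.φ (v + unit i') 0)) : i = i' := by
  have hv := notMem_of_add_unit_mem hu h
  rcases D.face_eq_iff.1 hf with h3 | h3
  · rw [add_sub_add_left_eq_sub] at h3
    rcases eq_or_of_sub_even i' i (even_of_mem_dbl h3) with h4 | rfl
    · exact h4.symm
    · rw [unit_sub_unit_three, add_self_mem_dbl] at h3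
      exact absurd h3 (hu _)
  · have h4 := even_of_mem_dbl h3
    have h5 : (unit i' - unit i).re % 2 = 0 ∧ (unit i' - unit i).im % 2 = 0 := by
      simp only [QuadraticAlgebra.re_add, QuadraticAlgebra.im_add, QuadraticAlgebra.re_sub,
        QuadraticAlgebra.im_sub] at h4 ⊢
      omega
    rcases eq_or_of_sub_even i' i h5 with h4 | rfl
    · exact h4.symm
    · rw [unit_add_three, add_add_add_comm, add_neg_cancel, add_zero, add_self_mem_dbl] at h3
      exact absurd h3 hv

/-- Different directions towards `L` lead to different triangles, so the position of the triangles
around a hexagon can be read off from `L` around its centre. -/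
theorem hasGap_iff (hu : ∀ j, unit j ∉ L) {k : ℕ} (hk : (k : ZMod 6) ≠ 0) {v : Eis} {j : ZMod 6} :
    M.IsHexagonWithGap k (M.face (D.φ v j)) ↔
      ∃ i, ∀ i', v + unit i' ∈ L ↔ i' = i ∨ i' = i + k := by
  constructor
  · rintro ⟨-, T, T', hne, hT, d, hd, rfl, rfl⟩
    obtain ⟨i, rfl⟩ := D.exists_eq_of_face_eq hd
    rw [← Equiv.Perm.iterate_eq_pow, D.isDev.next_iterate, ← D.isDev.2, ← D.isDev.2,
      D.face_eq (v + unit i) _ 0, D.face_eq (v + unit (i + k)) _ 0] at hT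
    rw [D.adjTriangles_eq] at hT
    have e1 : v + unit i ∈ L := by
      obtain ⟨i', h, h'⟩ := hT.symm.subset (Set.mem_insert _ _)
      rwa [← D.triangle_injective hu h h'.symm]
    have e2 : v + unit (i + k) ∈ L := by
      obtain ⟨i', h, h'⟩ := hT.symm.subset (Set.mem_insert_of_mem _ rfl)
      rwa [← D.triangle_injective hu h h'.symm]
    refine ⟨i, fun i' => ⟨fun h => ?_, ?_⟩⟩
    · rcases hT.subset ⟨i', h, rfl⟩ with h' | h'
      · exact Or.inl (D.triangle_injective hu h h')
      · exact Or.inr (D.triangle_injective hu h h')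
    · rintro (rfl | rfl) <;> assumption
  · rintro ⟨i, hi⟩
    have e1 := (hi i).2 (Or.inl rfl)
    have e2 := (hi (i + k)).2 (Or.inr rfl)
    refine ⟨D.size_six_iff.2 (notMem_of_add_unit_mem hu e1), M.face (D.φ (v + unit i) 0),
      M.face (D.φ (v + unit (i + k)) 0), fun h => ?_, ?_, D.φ v i, D.face_eq _ _ _, ?_, ?_⟩
    · have := D.triangle_injective hu e1 h
      exact hk (by simpa using this.symm)
    · rw [D.adjTriangles_eq]
      ext F
      constructor
      · rintro ⟨i', h, rfl⟩
        rcases (hi i').1 h with rfl | rfl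
        · exact Or.inl rfl
        · exact Or.inr rfl
      · rintro (rfl | rfl)
        · exact ⟨_, e1, rfl⟩
        · exact ⟨_, e2, rfl⟩
    · rw [← D.isDev.2]
      exact D.face_eq _ _ _
    · rw [← Equiv.Perm.iterate_eq_pow, D.isDev.next_iterate, ← D.isDev.2]
      exact D.face_eq _ _ _

theorem exists_two_mul_unit_mem (hu : ∀ j, unit j ∉ L) (h : M.oppositeHexagons.Nonempty) :
    ∃ i, unit i + unit i ∈ L := by
  obtain ⟨F, hF⟩ := h
  obtain ⟨d, rfl⟩ := face_surj F
  obtain ⟨v, j, rfl⟩ := D.surj d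
  obtain ⟨i, hi⟩ := (D.hasGap_iff hu (by decide)).1 hF
  have := sub_mem ((hi (i + 3)).2 (Or.inr rfl)) ((hi i).2 (Or.inl rfl))
  rw [add_sub_add_left_eq_sub, unit_sub_unit_three] at this
  exact ⟨_, this⟩

theorem mem_oppositeHexagons (hu : ∀ j, unit j ∉ L) {v : Eis} {i j : ZMod 6} (h : v + unit i ∈ L)
    (h' : v + unit (i + 3) ∈ L) : M.face (D.φ v j) ∈ M.oppositeHexagons := by
  refine (D.hasGap_iff hu (by decide)).2 ⟨i, fun i' => ⟨fun h3 => ?_, ?_⟩⟩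
  · have h4 := mem_add_unit hu h h3
    have h5 := mem_add_unit hu h' h3
    clear h h' h3
    revert i i'
    decide
  · rintro (rfl | rfl) <;> assumption

theorem exists_of_skewHexagons (hu : ∀ j, unit j ∉ L) (h : M.skewHexagons.Nonempty) :
    ∃ v i, ∀ i', v + unit i' ∈ L ↔ i' = i ∨ i' = i + 2 := by
  obtain ⟨F, hF⟩ := h
  obtain ⟨d, rfl⟩ := face_surj F
  obtain ⟨v, j, rfl⟩ := D.surj d
  obtain ⟨i, hi⟩ := (D.hasGap_iff hu (by decide)).1 hF
  exact ⟨v, i, hi⟩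

theorem adjTriangles_of_mem (hu : ∀ j, unit j ∉ L) {v : Eis} {j : ZMod 6} (hv : v ∈ L) :
    M.adjTriangles (M.face (D.φ v j)) = ∅ := by
  rw [D.adjTriangles_eq, Set.eq_empty_iff_forall_notMem]
  rintro F ⟨i, hi, -⟩
  exact notMem_of_add_unit_mem hu hi hv

theorem ncard_adjTriangles_le_one_iff (hu : ∀ j, unit j ∉ L) {v : Eis} {j : ZMod 6} :
    (M.adjTriangles (M.face (D.φ v j))).ncard ≤ 1 ↔
      ∀ i i', v + unit i ∈ L → v + unit i' ∈ L → i = i' := by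
  rw [Set.ncard_le_one, D.adjTriangles_eq]
  constructor
  · intro h i i' hi hi'
    exact D.triangle_injective hu hi (h _ ⟨i, hi, rfl⟩ _ ⟨i', hi', rfl⟩)
  · rintro h _ ⟨i, hi, rfl⟩ _ ⟨i', hi', rfl⟩
    rw [h i i' hi hi']

/-- Two triangles at one hexagon give a vector of norm 3 or 4 in `L`. Conversely such a vector has
the form `unit i + unit i` or `unit i + unit (i + 1)`, and the hexagon with centre `unit i` is
adjacent both to the triangle at the origin and to the one at the end of the vector. -/
theorem formIV_iff (hu : ∀ j, unit j ∉ L) :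
    M.FormIV ↔ ∀ i, unit i + unit i ∉ L ∧ unit i + unit (i + 1) ∉ L := by
  constructor
  · intro h i
    have key : ∀ k, k ≠ 3 → unit i + unit (i + k) ∉ L := by
      intro k hk hmem
      have h1 : unit i + unit (i + 3) ∈ L := by
        rw [unit_add_three, add_neg_cancel]
        exact zero_mem _
      have h2 : unit i ∉ L := hu i
      have h3 := (D.ncard_adjTriangles_le_one_iff hu (j := 0)).1
        (h.2 _ (D.size_six_iff.2 h2)) _ _ h1 hmem
      exact hk (add_left_cancel h3).symm
    exact ⟨by simpa using key 0 (by decide), key 1 (by decide)⟩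
  · intro h
    constructor
    · intro F hF
      obtain ⟨d, rfl⟩ := face_surj F
      obtain ⟨v, j, rfl⟩ := D.surj d
      exact D.adjTriangles_of_mem hu (D.size_three_iff.1 hF)
    · intro F hF
      obtain ⟨d, rfl⟩ := face_surj F
      obtain ⟨v, j, rfl⟩ := D.surj d
      rw [D.ncard_adjTriangles_le_one_iff hu]
      intro i i' hi hi'
      have h2 : unit i' - unit i ∈ L := by
        simpa using sub_mem hi' hi
      rcases mem_add_unit hu hi hi' with rfl | rfl | rfl | rfl
      · rfl
      · rw [unit_sub_unit_two] at h2
        exact absurd h2 (h _).2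
      · rw [unit_sub_unit_three] at h2
        exact absurd h2 (h _).1
      · have h3 := neg_mem h2
        have h4 : -(unit (i + 4) - unit i) = unit (i + 4 + 2) - unit (i + 4) := by
          rw [neg_sub, add_assoc i 4 2, show (4 + 2 : ZMod 6) = 0 from rfl, add_zero]
        rw [h4, unit_sub_unit_two] at h3
        exact absurd h3 (h _).2

omit D

theorem not_formIV_of_top (D : Dev M ⊤) : ¬ M.FormIV := by
  intro h
  have := h.1 _ (D.size_three_iff (v := 0) (j := 0) |>.2 trivial)
  rw [D.adjTriangles_eq] at this
  exact Set.notMem_empty _ (this.subset ⟨0, trivial, rfl⟩)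

theorem no_hexagon_of_top (D : Dev M ⊤) (F : M.Face) : M.size F ≠ 6 := by
  obtain ⟨d, rfl⟩ := face_surj F
  obtain ⟨v, j, rfl⟩ := D.surj d
  exact fun h => D.size_six_iff.1 h trivial

end Dev

end CombMap

namespace Eis

/-! ### Lattices with a short vector -/

/-- The lattice of index `k` that contains the vector `1 + ζ`. -/
def skewLattice (k : ℕ) : AddSubgroup Eis where
  carrier := {x | (k : ℤ) ∣ x.re - x.im}
  zero_mem' := by simp
  add_mem' := fun {x y} hx hy => by
    simp only [Set.mem_ofPred_eq, QuadraticAlgebra.re_add, QuadraticAlgebra.im_add] at hx hy ⊢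
    rw [add_sub_add_comm]
    exact dvd_add hx hy
  neg_mem' := fun {x} hx => by
    simp only [Set.mem_ofPred_eq, QuadraticAlgebra.re_neg, QuadraticAlgebra.im_neg] at hx ⊢
    rw [← neg_sub']
    exact (dvd_neg).2 hx

/-- The lattice generated by `2` and `s + m ζ`. -/
def lattice (s : ℤ) (m : ℕ) : AddSubgroup Eis where
  carrier := {x | ∃ t : ℤ, x.im = m * t ∧ 2 ∣ x.re - s * t}
  zero_mem' := ⟨0, by simp⟩
  add_mem' := by
    rintro x y ⟨t, ht, h⟩ ⟨u, hu, h'⟩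
    refine ⟨t + u, ?_, ?_⟩
    · rw [QuadraticAlgebra.im_add, ht, hu, mul_add]
    · rw [QuadraticAlgebra.re_add, mul_add, add_sub_add_comm]
      exact dvd_add h h'
  neg_mem' := by
    rintro x ⟨t, ht, h⟩
    refine ⟨-t, ?_, ?_⟩
    · rw [QuadraticAlgebra.im_neg, ht, mul_neg]
    · rw [QuadraticAlgebra.re_neg, mul_neg, ← neg_sub']
      exact (dvd_neg).2 h

theorem mem_skewLattice {k : ℕ} {x : Eis} : x ∈ skewLattice k ↔ (k : ℤ) ∣ x.re - x.im := Iff.rfl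

theorem mem_lattice {s : ℤ} {m : ℕ} {x : Eis} :
    x ∈ lattice s m ↔ ∃ t : ℤ, x.im = m * t ∧ 2 ∣ x.re - s * t := Iff.rfl

/-- The index of the kernel of a surjective homomorphism. -/
theorem index_eq_card {G : Type*} [AddGroup G] {L : AddSubgroup Eis} (f : Eis →+ G)
    (hf : Function.Surjective f) (hL : ∀ x, x ∈ L ↔ f x = 0) : L.index = Nat.card G := by
  have : L = f.ker := by
    ext x
    rw [hL, AddMonoidHom.mem_ker]
  rw [this, AddSubgroup.index_ker, AddMonoidHom.range_eq_top.2 hf, AddSubgroup.card_top]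

theorem index_skewLattice (k : ℕ) : (skewLattice k).index = k := by
  let f : Eis →+ ZMod k :=
    { toFun := fun x => ((x.re - x.im : ℤ) : ZMod k)
      map_zero' := by simp
      map_add' := fun x y => by simp; ring }
  rw [index_eq_card f, Nat.card_zmod]
  · intro a
    obtain ⟨a, rfl⟩ := ZMod.intCast_surjective a
    exact ⟨⟨a, 0⟩, by simp [f]⟩
  · intro x
    exact (ZMod.intCast_zmod_eq_zero_iff_dvd _ k).symm

theorem index_lattice_zero (m : ℕ) : (lattice 0 m).index = 2 * m := by
  let f : Eis →+ ZMod 2 × ZMod m :=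
    { toFun := fun x => (x.re, x.im)
      map_zero' := by simp
      map_add' := fun x y => by simp }
  rw [index_eq_card f, Nat.card_prod, Nat.card_zmod, Nat.card_zmod]
  · rintro ⟨a, b⟩
    obtain ⟨a, rfl⟩ := ZMod.intCast_surjective a
    obtain ⟨b, rfl⟩ := ZMod.intCast_surjective b
    exact ⟨⟨a, b⟩, rfl⟩
  · intro x
    rw [mem_lattice, Prod.ext_iff]
    change _ ↔ ((x.re : ℤ) : ZMod 2) = 0 ∧ ((x.im : ℤ) : ZMod m) = 0
    rw [ZMod.intCast_zmod_eq_zero_iff_dvd _ 2, ZMod.intCast_zmod_eq_zero_iff_dvd _ m]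
    constructor
    · rintro ⟨t, ht, h⟩
      exact ⟨by simpa using h, t, ht⟩
    · rintro ⟨h, t, ht⟩
      exact ⟨t, ht, by simpa using h⟩

/-- The quotient is cyclic: the form `im - m * re` modulo `2 * m` vanishes on both generators `2`
and `1 + m ζ`. -/
theorem index_lattice_one {m : ℕ} (hm : m ≠ 0) : (lattice 1 m).index = 2 * m := by
  let f : Eis →+ ZMod (2 * m) :=
    { toFun := fun x => ((x.im - m * x.re : ℤ) : ZMod (2 * m))
      map_zero' := by simp
      map_add' := fun x y => by push_cast; simp; ring }
  rw [index_eq_card f, Nat.card_zmod]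
  · intro a
    obtain ⟨a, rfl⟩ := ZMod.intCast_surjective a
    exact ⟨⟨0, a⟩, by simp [f]⟩
  · intro x
    refine Iff.trans ?_ (ZMod.intCast_zmod_eq_zero_iff_dvd _ (2 * m)).symm
    rw [mem_lattice]
    push_cast
    have hm' : (m : ℤ) ≠ 0 := by exact_mod_cast hm
    constructor
    · rintro ⟨t, ht, c, hc⟩
      exact ⟨-c, by linear_combination ht - m * hc⟩
    · rintro ⟨c, hc⟩
      refine ⟨x.re + 2 * c, by linear_combination hc, -c, by ring⟩

/-- The form `re - im` takes only the values ±1 and ±2 on units. -/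
theorem unit_notMem_skewLattice {k : ℕ} (hk : 3 ≤ k) (j : ZMod 6) : unit j ∉ skewLattice k := by
  rw [mem_skewLattice]
  intro h
  have h1 : (unit j).re - (unit j).im ≠ 0 ∧ |(unit j).re - (unit j).im| ≤ 2 := by
    clear h
    revert j; decide
  have := Int.le_of_dvd (abs_pos.2 h1.1) ((dvd_abs _ _).2 h)
  omega

theorem unit_notMem_lattice {s : ℤ} {m : ℕ} (hm : 2 ≤ m) (j : ZMod 6) : unit j ∉ lattice s m := by
  rintro ⟨t, ht, h⟩
  have h1 : |(unit j).im| ≤ 1 ∧ ((unit j).im = 0 → ¬ 2 ∣ (unit j).re) := by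
    clear ht h
    revert j; decide
  have h0 : t = 0 := by
    by_contra h0
    have := Int.le_of_dvd (b := |(unit j).im|) (by
      rw [abs_pos, ht]
      exact mul_ne_zero (by omega) h0) ((dvd_abs _ _).2 ⟨t, ht⟩)
    omega
  subst h0
  exact h1.2 (by simpa using ht) (by simpa using h)

/-- The vector `1 + ζ` generates the kernel of `re - im`. So `L` is the preimage of a subgroup of
the integers, which is determined by its index. -/
theorem eq_skewLattice {L : AddSubgroup Eis} (h : unit 0 + unit 1 ∈ L) :
    L = skewLattice L.index := by
  have hd : (⟨1, 1⟩ : Eis) ∈ L := h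
  let f : Eis →+ ℤ :=
    { toFun := fun x => x.re - x.im
      map_zero' := by simp
      map_add' := fun x y => by simp; ring }
  obtain ⟨g, hg⟩ := Int.subgroup_cyclic (L.map f)
  have key : ∀ x, x ∈ L ↔ f x ∈ L.map f := by
    intro x
    refine ⟨fun hx => ⟨x, hx, rfl⟩, ?_⟩
    rintro ⟨y, hy, hxy⟩
    have h3 : x = y + (x.im - y.im) • (⟨1, 1⟩ : Eis) := by
      have : y.re - y.im = x.re - x.im := hxy
      ext <;> simp <;> linarith
    rw [h3]
    exact add_mem hy (zsmul_mem hd _)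
  have h2 : L = skewLattice g.natAbs := by
    ext x
    rw [key, hg, mem_skewLattice, Int.natCast_natAbs, abs_dvd, ← AddSubgroup.zmultiples_eq_closure,
      Int.mem_zmultiples_iff]
    rfl
  have h3 := congrArg AddSubgroup.index h2
  rw [index_skewLattice] at h3
  rw [h3]
  exact h2

/-- The imaginary parts of elements of `L` are the multiples of some `m`, and the integers in `L`
are the even ones, because `L` contains 2 but not 1. So `L` is generated by 2 and one element over
`m`, whose real part matters only modulo 2. -/
theorem eq_lattice {L : AddSubgroup Eis} (hu : ∀ j, unit j ∉ L) (h : unit 0 + unit 0 ∈ L)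
    (hi : L.index ≠ 0) :
    ∃ m, 2 ≤ m ∧ L.index = 2 * m ∧ (L = lattice 0 m ∨ L = lattice 1 m) := by
  have hd : (⟨2, 0⟩ : Eis) ∈ L := h
  have h1 : (⟨1, 0⟩ : Eis) ∉ L := hu 0
  let f : Eis →+ ℤ :=
    { toFun := fun x => x.im
      map_zero' := by simp
      map_add' := fun x y => by simp }
  obtain ⟨g, hg⟩ := Int.subgroup_cyclic (L.map f)
  have himf : ∀ x ∈ L, ((g.natAbs : ℕ) : ℤ) ∣ x.im := by
    intro x hx
    have : f x ∈ L.map f := ⟨x, hx, rfl⟩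
    rwa [hg, ← AddSubgroup.zmultiples_eq_closure, Int.mem_zmultiples_iff, ← Int.natAbs_dvd] at this
  obtain ⟨l, hl, hlm⟩ : ∃ l ∈ L, l.im = (g.natAbs : ℕ) := by
    have : ((g.natAbs : ℕ) : ℤ) ∈ L.map f := by
      rw [hg, ← AddSubgroup.zmultiples_eq_closure, Int.mem_zmultiples_iff]
      exact Int.dvd_natAbs_self
    obtain ⟨l, hl, h⟩ := this
    exact ⟨l, hl, h⟩
  generalize g.natAbs = m at himf hlm
  have heven : ∀ r : ℤ, (⟨r, 0⟩ : Eis) ∈ L ↔ 2 ∣ r := by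
    intro r
    constructor
    · intro hr
      by_contra hodd
      apply h1
      have := sub_mem hr (zsmul_mem hd (r / 2))
      convert this using 1
      ext <;> simp
      omega
    · rintro ⟨c, rfl⟩
      have := zsmul_mem hd c
      convert this using 1
      ext <;> simp
      ring
  have hmem : ∀ x, x ∈ L ↔ ∃ t : ℤ, x.im = m * t ∧ 2 ∣ x.re - l.re * t := by
    intro x
    have e1 : ∀ t : ℤ, x.im = m * t → x - t • l = ⟨x.re - l.re * t, 0⟩ := by
      intro t ht
      ext <;> simp [ht, hlm] <;> ring
    constructor
    · intro hx
      obtain ⟨t, ht⟩ := himf x hx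
      refine ⟨t, ht, ?_⟩
      rw [← heven, ← e1 t ht]
      exact sub_mem hx (zsmul_mem hl t)
    · rintro ⟨t, ht, h⟩
      rw [← heven, ← e1 t ht] at h
      simpa using add_mem h (zsmul_mem hl t)
  have hs : L = lattice 0 m ∨ L = lattice 1 m := by
    rcases Int.emod_two_eq_zero_or_one l.re with h2 | h2
    · left
      ext x
      rw [hmem, mem_lattice]
      refine exists_congr fun t => and_congr_right fun _ => ?_
      obtain ⟨c, hc⟩ : ∃ c, l.re = 2 * c := ⟨l.re / 2, by omega⟩
      rw [hc, mul_assoc, zero_mul]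
      omega
    · right
      ext x
      rw [hmem, mem_lattice]
      refine exists_congr fun t => and_congr_right fun _ => ?_
      obtain ⟨c, hc⟩ : ∃ c, l.re = 2 * c + 1 := ⟨l.re / 2, by omega⟩
      rw [hc, add_mul, mul_assoc, one_mul]
      omega
  have hm0 : m ≠ 0 := by
    rintro rfl
    have := himf _ (L.nsmul_index_mem ⟨0, 1⟩)
    simp at this
    exact hi this
  -- For `m = 1` one of the units `ζ` and `ζ ^ 2` would lie in `L`.
  have hm1 : m ≠ 1 := by
    rintro rfl
    rcases hs with rfl | rfl
    · exact hu 1 ⟨1, by simp [unit_one_eq]⟩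
    · exact hu 2 ⟨1, by simp [unit_two_eq]⟩
  refine ⟨m, by omega, ?_, hs⟩
  rcases hs with h | h
  · rw [h, index_lattice_zero]
  · rw [h, index_lattice_one hm0]

/-- Classes modulo `L` of elements with no difference in `L`. -/
theorem card_le_index {L : AddSubgroup Eis} (hi : L.index ≠ 0) {n : ℕ} (f : Fin n → Eis)
    (hf : ∀ i j, i < j → f j - f i ∉ L) : n ≤ L.index := by
  have : L.FiniteIndex := ⟨hi⟩
  have : Finite (Eis ⧸ L) := AddSubgroup.finite_quotient_of_finiteIndex
  have hinj : Function.Injective fun i => (f i : Eis ⧸ L) := by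
    intro i j hij
    have h := QuotientAddGroup.eq.1 hij
    rw [neg_add_eq_sub] at h
    rcases lt_trichotomy i j with h3 | h3 | h3
    · exact absurd h (hf i j h3)
    · exact h3
    · exact absurd (by simpa using neg_mem h) (hf j i h3)
  have := Nat.card_le_card_of_injective _ hinj
  rwa [Nat.card_fin] at this

/-- Otherwise `0`, `1`, `ζ` and `ζ ^ 2` would represent four different classes, as all their
differences have norm 1 or 3. -/
theorem exists_skew_of_index_three {L : AddSubgroup Eis} (hu : ∀ j, unit j ∉ L) (hi : L.index = 3) :
    ∃ i, unit i + unit (i + 1) ∈ L := by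
  by_contra! h
  have := card_le_index (L := L) (by omega) ![0, unit 0, unit 1, unit 2] (by
    intro i j hij
    have h2 : unit 2 - unit 0 ∉ L := h 2
    fin_cases i <;> fin_cases j <;> first | exact absurd hij (by decide) | skip
    · simpa using hu 0
    · simpa using hu 1
    · simpa using hu 2
    · exact hu 2
    · exact h2
    · exact hu 3)
  omega

theorem exists_short_of_index_four {L : AddSubgroup Eis} (hu : ∀ j, unit j ∉ L) (hi : L.index = 4) :
    ∃ i, unit i + unit (i + 1) ∈ L ∨ unit i + unit i ∈ L := by
  by_contra! h
  have := card_le_index (L := L) (by omega) ![0, unit 0, unit 1, unit 2, unit 3] (by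
    intro i j hij
    have h2 : unit 2 - unit 0 ∉ L := (h 2).1
    have h3 : unit 3 - unit 0 ∉ L := (h 3).2
    have h4 : unit 3 - unit 1 ∉ L := (h 3).1
    fin_cases i <;> fin_cases j <;> first | exact absurd hij (by decide) | skip
    · simpa using hu 0
    · simpa using hu 1
    · simpa using hu 2
    · simpa using hu 3
    · exact hu 2
    · exact h2
    · exact h3
    · exact hu 3
    · exact h4
    · exact hu 4)
  omega

/-- Conjugation adds the imaginary part to the real part, so for odd `m` it changes the parity of
the real part in every second row. -/
theorem mirror_lattice {m : ℕ} (hm : Odd m) : mirror (lattice 0 m) = lattice 1 m := by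
  obtain ⟨c, rfl⟩ := hm
  ext x
  rw [mem_mirror, mem_lattice, mem_lattice]
  simp only [QuadraticAlgebra.re_star, QuadraticAlgebra.im_star]
  push_cast
  constructor
  · rintro ⟨t, ht, h⟩
    have e : x.im = 2 * (c * -t) - t := by linear_combination -ht
    refine ⟨-t, by linear_combination -ht, ?_⟩
    omega
  · rintro ⟨t, ht, h⟩
    have e : x.im = 2 * (c * t) + t := by linear_combination ht
    refine ⟨-t, by linear_combination -ht, ?_⟩
    omega

end Eis

namespace Eis

/-- A vector of norm 4 off the real axis has imaginary part ±2, which forces `m = 2`, and its even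
real part then forces `s = 0`. Apart from the lattice of all even elements, the vector 2 is thus
distinguished up to sign. -/
theorem eq_zero_or_three_of_lattice {s : ℤ} {m : ℕ} (hm : 2 ≤ m) (hs : s = 0 ∨ s = 1)
    (h02 : ¬ (s = 0 ∧ m = 2)) {i : ZMod 6} (h : unit i + unit i ∈ lattice s m) : i = 0 ∨ i = 3 := by
  obtain ⟨t, ht, h⟩ := h
  by_contra hi
  have him : |(unit i).im| = 1 := by
    clear ht h
    revert i; decide
  have h4 : (m : ℤ) ∣ 2 := by
    have : (m : ℤ) ∣ |(unit i + unit i).im| := (dvd_abs _ _).2 ⟨t, ht⟩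
    rwa [QuadraticAlgebra.im_add, ← two_mul, abs_mul, him] at this
  have h5 : m = 2 := le_antisymm (by exact_mod_cast Int.le_of_dvd (by norm_num) h4) hm
  subst h5
  have hs1 : s = 1 := by tauto
  subst hs1
  simp only [QuadraticAlgebra.re_add, QuadraticAlgebra.im_add] at ht h
  have h6 : (unit i).im = t := by push_cast at ht; omega
  rw [← h6] at h
  have h7 : ¬ 2 ∣ (unit i).im := fun h => by
    have : (2 : ℤ) ∣ |(unit i).im| := (dvd_abs _ _).2 h
    rw [him] at this
    omega
  omega

end Eis

/-! ### Forms (ii) and (iii) for the explicit lattices -/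

namespace CombMap

open Eis
open scoped QuadraticAlgebra

namespace Dev

variable {M N : CombMap} {L : AddSubgroup Eis}

theorem index_eq {L' : AddSubgroup Eis} (D : Dev M L) (D' : Dev M L') : L.index = L'.index := by
  have h := D.card_dart
  have h' := D'.card_dart
  omega

theorem exists_skewLattice (D : Dev M L) {i : ZMod 6} (h : unit i + unit (i + 1) ∈ L) :
    Nonempty (Dev M (skewLattice L.index)) := by
  have D' := D.rotate i
  have h2 : unit 0 + unit 1 ∈ Eis.rotate i L := by
    rwa [mem_rotate, mul_add, unit_mul, unit_mul, add_zero]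
  rw [D.index_eq D', ← eq_skewLattice h2]
  exact ⟨D'⟩

theorem exists_lattice (D : Dev M L) (hu : ∀ j, unit j ∉ L) {i : ZMod 6}
    (h : unit i + unit i ∈ L) : ∃ m, 2 ≤ m ∧ L.index = 2 * m ∧
      (Nonempty (Dev M (lattice 0 m)) ∨ Nonempty (Dev M (lattice 1 m))) := by
  have D' := D.rotate i
  have h2 : unit 0 + unit 0 ∈ Eis.rotate i L := by
    rwa [mem_rotate, mul_add, unit_mul, add_zero]
  have hu' : ∀ j, unit j ∉ Eis.rotate i L := fun j => by
    rw [mem_rotate, unit_mul]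
    exact hu _
  obtain ⟨m, hm, hi, h3⟩ := eq_lattice hu' h2 D'.index_pos.ne'
  refine ⟨m, hm, by rw [D.index_eq D', hi], ?_⟩
  rcases h3 with h3 | h3
  · exact Or.inl ⟨h3 ▸ D'⟩
  · exact Or.inr ⟨h3 ▸ D'⟩

theorem im_of_mem_dbl_lattice {s : ℤ} {m : ℕ} {x : Eis} (h : x ∈ dbl (lattice s m)) :
    ∃ t : ℤ, x.im = 2 * (m * t) := by
  obtain ⟨l, ⟨t, ht, -⟩, rfl⟩ := mem_dbl.1 h
  exact ⟨t, by rw [QuadraticAlgebra.im_add, ht]; ring⟩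

section FormII

variable {s : ℤ} {m : ℕ} (D : Dev M (lattice s m)) (hm : 2 ≤ m)
include D hm

/-- The two hexagons have their centres half way between 0 and 2 and half way between the translates
of these points in the next row. They differ because the imaginary parts of elements of `2 L` are
multiples of `2 * m`. -/
theorem oppositeHexagons_lattice :
    M.face (D.φ 1 0) ∈ M.oppositeHexagons ∧ M.face (D.φ ⟨1 + s, m⟩ 0) ∈ M.oppositeHexagons ∧
      M.face (D.φ 1 0) ≠ M.face (D.φ ⟨1 + s, m⟩ 0) := by
  have hu := fun j => unit_notMem_lattice (s := s) hm j
  have hodd : ∀ t : ℤ, (m : ℤ) ≠ 2 * (m * t) := by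
    intro t h
    have : (m : ℤ) * (2 * t) = m * 1 := by linear_combination -h
    have := mul_left_cancel₀ (by exact_mod_cast (by omega : m ≠ 0)) this
    omega
  refine ⟨?_, ?_, fun h => ?_⟩
  · exact D.mem_oppositeHexagons hu (i := 0) ⟨0, by simp [unit_zero_eq]⟩
      ⟨0, by simp [unit_three_eq]⟩
  · exact D.mem_oppositeHexagons hu (i := 0) ⟨1, by simp [unit_zero_eq], by simp [unit_zero_eq]; omega⟩
      ⟨1, by simp [unit_three_eq], by simp [unit_three_eq]⟩
  · rcases D.face_eq_iff.1 h with h | h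
    · obtain ⟨t, ht⟩ := im_of_mem_dbl_lattice h
      exact hodd t (by simpa using ht)
    · obtain ⟨t, ht⟩ := im_of_mem_dbl_lattice h
      exact hodd t (by simpa using ht)

theorem formII_lattice : M.FormII := by
  obtain ⟨h1, h2, h3⟩ := D.oppositeHexagons_lattice hm
  exact ⟨_, _, h3, h1, h2⟩

theorem ncard_oppositeHexagons (hs : s = 0 ∨ s = 1) (h02 : ¬ (s = 0 ∧ m = 2)) :
    M.oppositeHexagons.ncard = 2 := by
  have hu := fun j => unit_notMem_lattice (s := s) hm j
  obtain ⟨h1, h2, h3⟩ := D.oppositeHexagons_lattice hm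
  have hset : M.oppositeHexagons = {M.face (D.φ 1 0), M.face (D.φ ⟨1 + s, m⟩ 0)} := by
    apply Set.Subset.antisymm
    · intro F hF
      obtain ⟨d, rfl⟩ := face_surj F
      obtain ⟨v, j, rfl⟩ := D.surj d
      obtain ⟨i, hi⟩ := (D.hasGap_iff hu (by decide)).1 hF
      have e1 := (hi i).2 (Or.inl rfl)
      have e2 := (hi (i + 3)).2 (Or.inr rfl)
      have e3 := sub_mem e1 e2
      rw [add_sub_add_left_eq_sub, unit_add_three, sub_neg_eq_add] at e3
      -- The only vectors of norm 4 are ±2, so the two triangles lie to the left and right of `v`.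
      have e4 : v - 1 ∈ lattice s m := by
        rcases eq_zero_or_three_of_lattice hm hs h02 e3 with rfl | rfl
        · exact e2
        · exact e1
      obtain ⟨t, ht, h⟩ := e4
      simp only [QuadraticAlgebra.re_sub, QuadraticAlgebra.im_sub, QuadraticAlgebra.re_one,
        QuadraticAlgebra.im_one, sub_zero] at ht h
      have hdbl : ∀ x : Eis, ∀ u : ℤ, x.im = 2 * (m * u) → 4 ∣ x.re - 2 * (s * u) →
          x ∈ dbl (lattice s m) := by
        intro x u hx h
        refine mem_dbl.2 ⟨⟨x.re / 2, x.im / 2⟩, ⟨u, ?_, ?_⟩, ?_⟩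
        · rw [hx]
          simp
        · simp only
          omega
        · ext <;> simp <;> omega
      -- The parity of the row tells which of the two hexagons this is; the real part modulo 4 tells
      -- whether a translation or a half-turn carries one centre to the other.
      rcases Int.even_or_odd' t with ⟨u, rfl | rfl⟩
      · left
        have e5 : v.im = 2 * (m * u) := by rw [ht]; ring
        have e6 : s * (2 * u) = 2 * (s * u) := by ring
        rw [D.face_eq_iff]
        have e7 : 4 ∣ (1 - v).re - 2 * (s * -u) ∨ 4 ∣ (v + 1).re - 2 * (s * u) := by
          simp only [QuadraticAlgebra.re_sub, QuadraticAlgebra.re_add, QuadraticAlgebra.re_one,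
            mul_neg]
          rw [e6] at h
          omega
        rcases e7 with h7 | h7
        · exact Or.inl (hdbl _ (-u) (by simp [e5]) h7)
        · exact Or.inr (hdbl _ u (by simp [e5]) h7)
      · right
        have e5 : v.im = 2 * (m * u) + m := by rw [ht]; ring
        have e6 : s * (2 * u + 1) = 2 * (s * u) + s := by ring
        have e8 : s * (u + 1) = s * u + s := by ring
        rw [Set.mem_singleton_iff, D.face_eq_iff]
        have e7 : 4 ∣ ((⟨1 + s, m⟩ : Eis) - v).re - 2 * (s * -u) ∨
            4 ∣ (v + ⟨1 + s, m⟩).re - 2 * (s * (u + 1)) := by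
          simp only [QuadraticAlgebra.re_sub, QuadraticAlgebra.re_add, mul_neg, e8]
          rw [e6] at h
          omega
        rcases e7 with h7 | h7
        · refine Or.inl (hdbl _ (-u) ?_ h7)
          simp [e5]
        · refine Or.inr (hdbl _ (u + 1) ?_ h7)
          simp [e5]
          ring
    · rintro _ (rfl | rfl)
      · exact h1
      · exact h2
  rw [hset, Set.ncard_pair h3]

end FormII

section FormIII

variable {k : ℕ}

theorem mem_dbl_skewLattice {x : Eis} : x ∈ dbl (skewLattice k) ↔
    ∃ p q : ℤ, x = ⟨2 * (k * p + q), 2 * q⟩ := by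
  rw [mem_dbl]
  constructor
  · rintro ⟨l, ⟨p, hp⟩, rfl⟩
    refine ⟨p, l.im, ?_⟩
    ext <;> simp <;> linarith
  · rintro ⟨p, q, rfl⟩
    refine ⟨⟨k * p + q, q⟩, ⟨p, by simp⟩, ?_⟩
    ext <;> simp <;> ring

/-- All quantities to be tested are values of `re - im` of size at most 3, so for `k ≥ 4`
divisibility by `k` means vanishing. The skew hexagons are those centred on the lines next to the
lines of triangles; up to the group, four centres remain. -/
theorem formIII_skewLattice (D : Dev M (skewLattice k)) (hk : 4 ≤ k) : M.FormIII := by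
  have hu := unit_notMem_skewLattice (k := k) (by omega)
  have hsmall : ∀ a : ℤ, |a| < k → (k : ℤ) ∣ a → a = 0 := fun a h h' =>
    Int.eq_zero_of_abs_lt_dvd h' h
  have hA : ∀ v : Eis, (k : ℤ) ∣ v.re - v.im + 1 → M.face (D.φ v 0) ∈ M.skewHexagons := by
    intro v hv
    refine (D.hasGap_iff hu (by decide)).2 ⟨4, fun i' => ?_⟩
    rw [mem_skewLattice]
    have e1 : (v + unit i').re - (v + unit i').im =
        (v.re - v.im + 1) + ((unit i').re - (unit i').im - 1) := by simp; ring
    rw [e1, dvd_add_right hv]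
    have e2 : ∀ i' : ZMod 6, |(unit i').re - (unit i').im - 1| ≤ 3 ∧
        ((unit i').re - (unit i').im - 1 = 0 ↔ i' = 4 ∨ i' = 4 + (2 : ℕ)) := by decide
    rw [← (e2 i').2]
    constructor
    · exact hsmall _ (by have := (e2 i').1; omega)
    · intro h
      rw [h]
      exact dvd_zero _
  -- The triangles lie on one side of `v` or on the other; the half-turn about the origin reduces
  -- the second case to the first.
  have hB : ∀ F ∈ M.skewHexagons, ∃ v : Eis, (k : ℤ) ∣ v.re - v.im + 1 ∧ F = M.face (D.φ v 0) := by
    intro F hF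
    obtain ⟨d, rfl⟩ := face_surj F
    obtain ⟨v, j, rfl⟩ := D.surj d
    obtain ⟨i, hi⟩ := (D.hasGap_iff hu (by decide)).1 hF
    have e1 := (hi i).2 (Or.inl rfl)
    have e2 := (hi (i + 2)).2 (Or.inr rfl)
    have e3 := sub_mem e2 e1
    rw [add_sub_add_left_eq_sub, mem_skewLattice] at e3
    have e4 : ∀ i : ZMod 6, |(unit (i + 2) - unit i).re - (unit (i + 2) - unit i).im| ≤ 3 ∧
        ((unit (i + 2) - unit i).re - (unit (i + 2) - unit i).im = 0 →
          (unit i).re - (unit i).im = 1 ∨ (unit i).re - (unit i).im = -1) := by decide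
    rw [mem_skewLattice, QuadraticAlgebra.re_add, QuadraticAlgebra.im_add] at e1
    rcases (e4 i).2 (hsmall _ (by have := (e4 i).1; omega) e3) with h | h
    · exact ⟨v, by convert e1 using 1; linarith, D.face_eq _ _ _⟩
    · refine ⟨-v, ?_, D.face_eq_iff.2 (Or.inr (by simp))⟩
      have e5 : v.re + (unit i).re - (v.im + (unit i).im) = -((-v).re - (-v).im + 1) := by
        simp only [QuadraticAlgebra.re_neg, QuadraticAlgebra.im_neg]
        linarith
      rwa [e5, dvd_neg] at e1
  have hface : ∀ v w : Eis, M.face (D.φ v 0) = M.face (D.φ w 0) ↔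
      (∃ p q : ℤ, w.re - v.re = 2 * (k * p + q) ∧ w.im - v.im = 2 * q) ∨
      (∃ p q : ℤ, v.re + w.re = 2 * (k * p + q) ∧ v.im + w.im = 2 * q) := by
    intro v w
    rw [D.face_eq_iff, mem_dbl_skewLattice, mem_dbl_skewLattice]
    simp only [QuadraticAlgebra.ext_iff, QuadraticAlgebra.re_add, QuadraticAlgebra.im_add,
      QuadraticAlgebra.re_sub, QuadraticAlgebra.im_sub]
  have hkp : ∀ p c : ℤ, c ≠ 0 → |c| < k → (k : ℤ) * p ≠ c := by
    intro p c hc hlt h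
    exact hc (hsmall c hlt ⟨p, h.symm⟩)
  have hkp2 : ∀ p c : ℤ, |c| < k → (k : ℤ) * (2 * p) ≠ k + c := by
    intro p c hlt h
    have h1 := hsmall c hlt ⟨2 * p - 1, by linear_combination -h⟩
    subst h1
    have := mul_left_cancel₀ (by exact_mod_cast (by omega : k ≠ 0)) (h.trans (by ring : _ = (k : ℤ) * 1))
    omega
  have hlt : ∀ c : ℤ, |c| ≤ 3 → |c| < k := fun c h => by omega
  have hset : M.skewHexagons = {M.face (D.φ ⟨0, 1⟩ 0), M.face (D.φ ⟨1, 2⟩ 0),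
      M.face (D.φ ⟨k, 1⟩ 0), M.face (D.φ ⟨k + 1, 2⟩ 0)} := by
    apply Set.Subset.antisymm
    · intro F hF
      obtain ⟨v, ⟨t, ht⟩, rfl⟩ := hB F hF
      simp only [Set.mem_insert_iff, Set.mem_singleton_iff, hface]
      -- Modulo `2 L` only the parities of the line number `t` and of the position `v.im` on the
      -- line matter.
      obtain ⟨u, hu⟩ : ∃ u, t = 2 * u ∨ t = 2 * u + 1 := ⟨t / 2, by omega⟩
      obtain ⟨w, hw⟩ : ∃ w, v.im = 2 * w ∨ v.im = 2 * w + 1 := ⟨v.im / 2, by omega⟩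
      rcases hu with rfl | rfl <;> rcases hw with hw | hw
      · right; left; left
        exact ⟨-u, 1 - w, by linear_combination -hw - ht, by linear_combination -hw⟩
      · left; left
        exact ⟨-u, -w, by linear_combination hw - ht - 2 * hw, by linear_combination -hw⟩
      · right; right; right; left
        exact ⟨-u, 1 - w, by linear_combination -hw - ht, by linear_combination -hw⟩
      · right; right; left; left
        exact ⟨-u, -w, by linear_combination -hw - ht, by linear_combination -hw⟩
    · rintro _ (rfl | rfl | rfl | rfl)
      · exact hA _ (by simp)
      · exact hA _ (by simp)
      · exact hA _ (by simp)
      · exact hA _ ⟨1, by simp; ring⟩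
  have hne : ∀ v w : Eis, (∀ p q : ℤ, w.re - v.re = 2 * (k * p + q) → w.im - v.im = 2 * q → False) →
      (∀ p q : ℤ, v.re + w.re = 2 * (k * p + q) → v.im + w.im = 2 * q → False) →
      M.face (D.φ v 0) ≠ M.face (D.φ w 0) := by
    intro v w h1 h2 h
    rcases (hface v w).1 h with ⟨p, q, h, h'⟩ | ⟨p, q, h, h'⟩
    · exact h1 p q h h'
    · exact h2 p q h h'
  have n12 : M.face (D.φ ⟨0, 1⟩ 0) ≠ M.face (D.φ ⟨1, 2⟩ 0) :=
    hne _ _ (fun p q h h' => by simp at h'; omega) (fun p q h h' => by simp at h'; omega)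
  have n13 : M.face (D.φ ⟨0, 1⟩ 0) ≠ M.face (D.φ ⟨k, 1⟩ 0) :=
    hne _ _ (fun p q h h' => hkp2 p 0 (hlt _ (by norm_num)) (by simp at h h'; subst h'; linarith))
      (fun p q h h' => hkp2 p (-2) (hlt _ (by norm_num)) (by
        simp at h h'; have : q = 1 := by omega
        subst this; linarith))
  have n14 : M.face (D.φ ⟨0, 1⟩ 0) ≠ M.face (D.φ ⟨k + 1, 2⟩ 0) :=
    hne _ _ (fun p q h h' => by simp at h'; omega) (fun p q h h' => by simp at h'; omega)
  have n23 : M.face (D.φ ⟨1, 2⟩ 0) ≠ M.face (D.φ ⟨k, 1⟩ 0) :=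
    hne _ _ (fun p q h h' => by simp at h'; omega) (fun p q h h' => by simp at h'; omega)
  have n24 : M.face (D.φ ⟨1, 2⟩ 0) ≠ M.face (D.φ ⟨k + 1, 2⟩ 0) :=
    hne _ _ (fun p q h h' => hkp2 p 0 (hlt _ (by norm_num)) (by simp at h h'; subst h'; linarith))
      (fun p q h h' => hkp2 p (-2) (hlt _ (by norm_num)) (by
        simp at h h'; have : q = 2 := by omega
        subst this; linarith))
  have n34 : M.face (D.φ ⟨k, 1⟩ 0) ≠ M.face (D.φ ⟨k + 1, 2⟩ 0) :=
    hne _ _ (fun p q h h' => by simp at h'; omega) (fun p q h h' => by simp at h'; omega)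
  refine ⟨?_, _, _, _, _, hset, ?_, ?_⟩
  · rw [hset, Set.ncard_insert_of_notMem, Set.ncard_insert_of_notMem, Set.ncard_pair n34]
    · simp [n23, n24]
    · simp [n12, n13, n14]
  -- The neighbour in direction 5 has centre 1, which the half-turn about `1 + ζ` moves to `1 + 2
  -- ζ`. The second pair is this one shifted by `k`.
  · rw [D.faceAdj_iff]
    refine ⟨5, (hface _ _).2 (Or.inr ⟨0, 1, ?_, ?_⟩)⟩ <;> simp [unit_five_eq]
  · rw [D.faceAdj_iff]
    refine ⟨5, (hface _ _).2 (Or.inr ⟨1, 1, ?_, ?_⟩)⟩ <;> simp [unit_five_eq] <;> ring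

/-- On vectors of norm 4 the form `re - im` takes the values ±2 and ±4. This is the only overlap of
forms (ii) and (iii). -/
theorem eq_four_of_skewLattice (hk : 4 ≤ k) {i : ZMod 6} (h : unit i + unit i ∈ skewLattice k) :
    k = 4 := by
  rw [mem_skewLattice] at h
  have h1 : ∀ i : ZMod 6, (unit i + unit i).re - (unit i + unit i).im ∈ ({2, -2, 4, -4} : Finset ℤ) :=
    by decide
  have h2 : (k : ℤ) ∣ 4 := by
    have h3 := h1 i
    generalize (unit i + unit i).re - (unit i + unit i).im = a at h h3
    have : a ∣ 4 := by
      simp only [Finset.mem_insert, Finset.mem_singleton] at h3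
      rcases h3 with rfl | rfl | rfl | rfl <;> norm_num
    exact h.trans this
  have := Int.le_of_dvd (by norm_num) h2
  omega

end FormIII

/-- At index 3 a hexagon with triangles on sides `i` and `i + 2` has a third one on side `i + 4`, so
no hexagon is skew. -/
theorem exists_of_formIII (D : Dev M L) (hu : ∀ j, unit j ∉ L) (h : M.FormIII) :
    (∃ i, unit i + unit (i + 1) ∈ L) ∧ L.index ≠ 3 := by
  have hne : M.skewHexagons.Nonempty := by
    rw [Set.nonempty_iff_ne_empty]
    intro h0
    have := h.1
    rw [h0, Set.ncard_empty] at this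
    omega
  have hex : ∃ i, unit i + unit (i + 1) ∈ L := by
    obtain ⟨v, i, hi⟩ := D.exists_of_skewHexagons hu hne
    have := sub_mem ((hi (i + 2)).2 (Or.inr rfl)) ((hi i).2 (Or.inl rfl))
    rw [add_sub_add_left_eq_sub, unit_sub_unit_two] at this
    exact ⟨_, this⟩
  refine ⟨hex, fun h3 => ?_⟩
  obtain ⟨i, hi⟩ := hex
  obtain ⟨D'⟩ := D.exists_skewLattice hi
  rw [h3] at D'
  obtain ⟨v, i, hi⟩ := D'.exists_of_skewHexagons (unit_notMem_skewLattice le_rfl) hne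
  have e1 := (hi i).2 (Or.inl rfl)
  have e2 : unit (i + 4) - unit i ∈ skewLattice 3 := by
    rw [mem_skewLattice]
    clear hi e1
    revert i; decide
  have e3 := add_mem e1 e2
  rw [add_assoc, add_sub_cancel, hi] at e3
  clear hi e1 e2
  revert i; decide

end Dev

end CombMap

/-! ### Symmetries of a regular tetrahedron -/

/-- A tetrahedral frame: the vertices of a regular tetrahedron, indexed by the Klein four-group. -/
structure TetrahedralFrame where
  vec : ZMod 2 × ZMod 2 → Fin 3 → ℝ
  sum_mul : ∀ j k, ∑ x, vec x j * vec x k = if j = k then 4 else 0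
  sum_eq : ∀ j, ∑ x, vec x j = 0
  dot : ∀ x y, ∑ j, vec x j * vec y j = if x = y then 3 else -1

namespace TetrahedralFrame

theorem sum_klein {α : Type*} [AddCommMonoid α] (f : ZMod 2 × ZMod 2 → α) :
    ∑ x, f x = f (0, 0) + f (0, 1) + (f (1, 0) + f (1, 1)) := by
  rw [Fintype.sum_prod_type]
  have h : ∀ g : ZMod 2 → α, ∑ x, g x = g 0 + g 1 := fun g => Fin.sum_univ_two g
  rw [h, h, h]

theorem forall_klein {p : ZMod 2 × ZMod 2 → Prop} :
    (∀ x, p x) ↔ p (0, 0) ∧ p (0, 1) ∧ p (1, 0) ∧ p (1, 1) := by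
  constructor
  · exact fun h => ⟨h _, h _, h _, h _⟩
  · rintro ⟨h1, h2, h3, h4⟩ x
    have : x = (0, 0) ∨ x = (0, 1) ∨ x = (1, 0) ∨ x = (1, 1) := by revert x; decide
    rcases this with rfl | rfl | rfl | rfl <;> assumption

variable (v : TetrahedralFrame) (σ τ : Equiv.Perm (ZMod 2 × ZMod 2))

/-- The isometry that permutes the vertices of the frame in a given way. -/
noncomputable def mat : Matrix (Fin 3) (Fin 3) ℝ :=
  Matrix.of fun j k => (∑ x, v.vec (σ x) j * v.vec x k) / 4

/-- The scalar products of the vertices are `4 δ - 1`, so the sum is `v.vec (σ x)` minus the mean of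
all vertices, which is zero. -/
theorem mat_mulVec (x : ZMod 2 × ZMod 2) : (v.mat σ).mulVec (v.vec x) = v.vec (σ x) := by
  ext j
  simp only [Matrix.mulVec, dotProduct, mat, Matrix.of_apply]
  have h1 : ∀ k, (∑ y, v.vec (σ y) j * v.vec y k) / 4 * v.vec x k =
      ∑ y, v.vec (σ y) j / 4 * (v.vec y k * v.vec x k) := by
    intro k
    rw [Finset.sum_div, Finset.sum_mul]
    exact Finset.sum_congr rfl fun y _ => by ring
  simp only [h1]
  rw [Finset.sum_comm]
  simp only [← Finset.mul_sum, v.dot]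
  have h2 : ∀ y, v.vec (σ y) j / 4 * (if y = x then (3 : ℝ) else -1) =
      (if y = x then v.vec (σ y) j else 0) - v.vec (σ y) j / 4 := by
    intro y
    split_ifs <;> ring
  simp only [h2, Finset.sum_sub_distrib, Finset.sum_ite_eq', Finset.mem_univ, if_true]
  rw [← Finset.sum_div, Equiv.sum_comp σ (fun y => v.vec y j), v.sum_eq]
  simp

theorem ext_mulVec {A B : Matrix (Fin 3) (Fin 3) ℝ}
    (h : ∀ x, A.mulVec (v.vec x) = B.mulVec (v.vec x)) : A = B := by
  have key : ∀ (A : Matrix (Fin 3) (Fin 3) ℝ) j k,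
      A j k = (∑ x, A.mulVec (v.vec x) j * v.vec x k) / 4 := by
    intro A j k
    simp only [Matrix.mulVec, dotProduct, Finset.sum_mul]
    rw [Finset.sum_comm]
    simp only [mul_assoc, ← Finset.mul_sum, v.sum_mul]
    simp
  ext j k
  rw [key A, key B]
  simp only [h]

theorem mat_mul : v.mat (σ * τ) = v.mat σ * v.mat τ :=
  v.ext_mulVec fun x => by
    rw [← Matrix.mulVec_mulVec, mat_mulVec, mat_mulVec, mat_mulVec, Equiv.Perm.mul_apply]

theorem mat_one : v.mat 1 = 1 :=
  v.ext_mulVec fun x => by rw [mat_mulVec, Matrix.one_mulVec, Equiv.Perm.one_apply]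

theorem vec_injective : Function.Injective v.vec := by
  intro x y h
  by_contra hne
  have h1 := v.dot x y
  rw [← h, v.dot, if_pos rfl, if_neg hne] at h1
  norm_num at h1

theorem mat_transpose : (v.mat σ).transpose = v.mat σ⁻¹ := by
  ext j k
  simp only [mat, Matrix.transpose_apply, Matrix.of_apply]
  rw [← Equiv.sum_comp σ (fun x => v.vec (σ⁻¹ x) j * v.vec x k)]
  congr 1
  refine Finset.sum_congr rfl fun x _ => ?_
  rw [Equiv.Perm.inv_def, Equiv.symm_apply_apply, mul_comm]

/-- A transposition of two vertices is the reflection along the edge between them, a rank-one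
modification of the identity with determinant -1; transpositions generate. -/
theorem det_mat : (v.mat σ).det = ((Equiv.Perm.sign σ : ℤˣ) : ℤ) := by
  induction σ using Equiv.Perm.swap_induction_on with
  | one => simp [mat_one]
  | swap_mul f x y hxy ih =>
    rw [mat_mul, Matrix.det_mul, ih, Equiv.Perm.sign_mul, Equiv.Perm.sign_swap hxy]
    have h1 : v.mat (Equiv.swap x y) = 1 + Matrix.replicateCol Unit (fun j => v.vec x j - v.vec y j) *
        Matrix.replicateRow Unit (fun j => (v.vec y j - v.vec x j) / 4) := by
      apply v.ext_mulVec
      intro z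
      rw [mat_mulVec, Matrix.add_mulVec, Matrix.one_mulVec, ← Matrix.mulVec_mulVec]
      have h2 : (Matrix.replicateRow Unit (fun j => (v.vec y j - v.vec x j) / 4)).mulVec (v.vec z) =
          fun _ => ((if y = z then 3 else -1) - (if x = z then 3 else -1)) / 4 := by
        ext
        simp only [Matrix.mulVec, dotProduct, Matrix.replicateRow_apply, ← v.dot]
        rw [← Finset.sum_sub_distrib, Finset.sum_div]
        exact Finset.sum_congr rfl fun j _ => by ring
      rw [h2]
      ext j
      simp only [Pi.add_apply, Matrix.mulVec, dotProduct, Matrix.replicateCol_apply,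
        Finset.univ_unique, Finset.sum_singleton]
      rcases eq_or_ne z x with rfl | hx
      · rw [Equiv.swap_apply_left, if_neg hxy.symm, if_pos rfl]
        ring
      · rcases eq_or_ne z y with rfl | hy
        · rw [Equiv.swap_apply_right, if_pos rfl, if_neg hxy]
          ring
        · rw [Equiv.swap_apply_of_ne_of_ne hx hy, if_neg hx.symm, if_neg hy.symm]
          ring
    rw [h1, Matrix.det_one_add_replicateCol_mul_replicateRow]
    have h3 : (fun j => (v.vec y j - v.vec x j) / 4) ⬝ᵥ (fun j => v.vec x j - v.vec y j) = -2 := by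
      have : ∀ j, (v.vec y j - v.vec x j) / 4 * (v.vec x j - v.vec y j) =
        (v.vec y j * v.vec x j + v.vec x j * v.vec y j - v.vec x j * v.vec x j -
          v.vec y j * v.vec y j) / 4 := fun j => by ring
      simp only [dotProduct, this]
      rw [← Finset.sum_div, Finset.sum_sub_distrib, Finset.sum_sub_distrib, Finset.sum_add_distrib,
        v.dot, v.dot, v.dot, v.dot, if_pos rfl, if_pos rfl, if_neg hxy, if_neg hxy.symm]
      norm_num
    rw [h3]
    push_cast
    ring

/-- The isometry that permutes the four axes of the frame and has a given determinant. -/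
noncomputable def isometry (ε : Bool) : Matrix.orthogonalGroup (Fin 3) ℝ :=
  -- In dimension three a sign enters the determinant as its cube, so the factor `sign σ` cancels
  -- the determinant of `v.mat σ` and leaves the sign prescribed by `ε`.
  ⟨(((cond ε (-1) 1 * Equiv.Perm.sign σ : ℤˣ) : ℤ) : ℝ) • v.mat σ, by
    rw [Matrix.mem_orthogonalGroup_iff, Matrix.transpose_smul, mat_transpose, smul_mul_smul_comm, ← mat_mul,
      mul_inv_cancel, mat_one, ← Int.cast_mul, ← Units.val_mul, Int.units_mul_self]
    simp⟩

theorem isometry_coe (ε : Bool) : (v.isometry σ ε).1 =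
    (((cond ε (-1) 1 * Equiv.Perm.sign σ : ℤˣ) : ℤ) : ℝ) • v.mat σ := rfl

theorem det_isometry (ε : Bool) : (v.isometry σ ε).1.det = cond ε (-1) 1 := by
  rw [isometry_coe, Matrix.det_smul, det_mat, Fintype.card_fin]
  have : ∀ s : ℤˣ, ((s : ℤ) : ℝ) ^ 2 = 1 := fun s => by
    rcases Int.units_eq_one_or s with rfl | rfl <;> norm_num
  rw [Units.val_mul, Int.cast_mul, mul_pow, mul_assoc, ← pow_succ]
  have h4 : ((Equiv.Perm.sign σ : ℤ) : ℝ) ^ 4 = 1 := by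
    rw [show 4 = 2 * 2 from rfl, pow_mul, this, one_pow]
  rw [h4]
  cases ε <;> norm_num

theorem isometry_mul (ε δ : Bool) :
    v.isometry (σ * τ) (xor ε δ) = v.isometry σ ε * v.isometry τ δ := by
  apply Subtype.ext
  rw [Submonoid.coe_mul, isometry_coe, isometry_coe, isometry_coe, mat_mul, smul_mul_smul_comm,
    ← Int.cast_mul, ← Units.val_mul, Equiv.Perm.sign_mul]
  congr 3
  rcases Int.units_eq_one_or (Equiv.Perm.sign σ) with h | h <;>
    rcases Int.units_eq_one_or (Equiv.Perm.sign τ) with h' | h' <;> rw [h, h'] <;>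
    cases ε <;> cases δ <;> rfl

theorem isometry_mulVec (ε : Bool) (x : ZMod 2 × ZMod 2) : (v.isometry σ ε).1.mulVec (v.vec x) =
    (((cond ε (-1) 1 * Equiv.Perm.sign σ : ℤˣ) : ℤ) : ℝ) • v.vec (σ x) := by
  rw [isometry_coe, Matrix.smul_mulVec, mat_mulVec]

theorem eq_one_of_isometry_eq_one {ε : Bool} (h : v.isometry σ ε = 1) : ε = false ∧ σ = 1 := by
  constructor
  · have := v.det_isometry σ ε
    rw [h] at this
    cases ε
    · rfl
    · norm_num at this
  · ext1 x
    have h1 := v.isometry_mulVec σ ε x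
    rw [h] at h1
    have h2 := congrArg (fun w => ∑ j, w j * v.vec x j) h1
    simp only [OneMemClass.coe_one, Matrix.one_mulVec, Pi.smul_apply, smul_eq_mul, mul_assoc,
      ← Finset.mul_sum, v.dot] at h2
    rw [Equiv.Perm.one_apply]
    by_contra hne
    rw [if_pos trivial, if_neg hne] at h2
    rcases Int.units_eq_one_or (cond ε (-1) 1 * Equiv.Perm.sign σ) with h | h <;>
      rw [h] at h2 <;> norm_num at h2

end TetrahedralFrame

namespace TetrahedralFrame

theorem isometry_eq_iff (v : TetrahedralFrame) {σ : Equiv.Perm (ZMod 2 × ZMod 2)} {ε : Bool}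
    {A : Matrix.orthogonalGroup (Fin 3) ℝ} : A = v.isometry σ ε ↔ ∀ x, A.1.mulVec (v.vec x) =
      (((cond ε (-1) 1 * Equiv.Perm.sign σ : ℤˣ) : ℤ) : ℝ) • v.vec (σ x) := by
  constructor
  · rintro rfl x
    exact v.isometry_mulVec σ ε x
  · intro h
    apply Subtype.ext
    apply v.ext_mulVec
    intro x
    rw [h, isometry_mulVec]

/-- The frame whose vertices are those of the cube of side two with an even number of negative
coordinates. -/
noncomputable def standard : TetrahedralFrame where
  vec x := if x = (0, 0) then ![1, 1, 1] else if x = (1, 0) then ![1, -1, -1] else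
    if x = (0, 1) then ![-1, 1, -1] else ![-1, -1, 1]
  sum_mul j k := by
    rw [sum_klein]
    fin_cases j <;> fin_cases k <;> simp <;> norm_num
  sum_eq j := by
    rw [sum_klein]
    fin_cases j <;> simp
  dot := by
    simp only [forall_klein, Fin.sum_univ_three]
    simp
    norm_num

theorem standard_vec : standard.vec (0, 0) = ![1, 1, 1] ∧ standard.vec (0, 1) = ![-1, 1, -1] ∧
    standard.vec (1, 0) = ![1, -1, -1] ∧ standard.vec (1, 1) = ![-1, -1, 1] := by
  refine ⟨rfl, ?_, ?_, ?_⟩ <;> simp [standard]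

/-- The standard frame turned by an eighth of a turn around the third axis. -/
noncomputable def turned : TetrahedralFrame where
  vec x := if x = (0, 0) then ![√2, 0, 1] else if x = (1, 0) then ![0, -√2, -1] else
    if x = (0, 1) then ![0, √2, -1] else ![-√2, 0, 1]
  sum_mul j k := by
    rw [sum_klein]
    fin_cases j <;> fin_cases k <;> simp <;> norm_num
  sum_eq j := by
    rw [sum_klein]
    fin_cases j <;> simp
  dot := by
    simp only [forall_klein, Fin.sum_univ_three]
    simp
    norm_num

theorem turned_vec : turned.vec (0, 0) = ![√2, 0, 1] ∧ turned.vec (0, 1) = ![0, √2, -1] ∧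
    turned.vec (1, 0) = ![0, -√2, -1] ∧ turned.vec (1, 1) = ![-√2, 0, 1] := by
  refine ⟨rfl, ?_, ?_, ?_⟩ <;> simp [turned]

theorem sign_addLeft (l : ZMod 2 × ZMod 2) : Equiv.Perm.sign (Equiv.addLeft l) = 1 := by
  revert l; decide

theorem sign_prodComm :
    Equiv.Perm.sign (Equiv.prodComm (ZMod 2) (ZMod 2) : Equiv.Perm (ZMod 2 × ZMod 2)) = -1 := by
  decide

end TetrahedralFrame

namespace TetrahedralFrame

theorem addLeft_apply (l : ZMod 2 × ZMod 2) :
    Equiv.addLeft l (0, 0) = l ∧ Equiv.addLeft l (1, 1) = (l.1 + 1, l.2 + 1) ∧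
    Equiv.addLeft l (0, 1) = (l.1, l.2 + 1) ∧ Equiv.addLeft l (1, 0) = (l.1 + 1, l.2) := by
  revert l; decide

theorem one_add_one_zmod2 : (1 : ZMod 2) + 1 = 0 := rfl

theorem standard_isometry_one_one : (standard.isometry (Equiv.addLeft (1, 1)) false).1 =
    !![-1, 0, 0; 0, -1, 0; 0, 0, 1] := by
  apply standard.ext_mulVec
  obtain ⟨h1, h2, h3, h4⟩ := standard_vec
  obtain ⟨k1, k2, k3, k4⟩ := addLeft_apply (1, 1)
  simp only [one_add_one_zmod2] at k2 k3 k4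
  rw [forall_klein]
  simp only [isometry_mulVec]
  simp only [sign_addLeft, k1, k2, k3, k4, h1, h2, h3, h4]
  refine ⟨?_, ?_, ?_, ?_⟩ <;> ext j <;> fin_cases j <;>
    simp [Matrix.mulVec, dotProduct, Fin.sum_univ_three]

theorem standard_isometry_one_zero : (standard.isometry (Equiv.addLeft (1, 0)) false).1 =
    !![1, 0, 0; 0, -1, 0; 0, 0, -1] := by
  apply standard.ext_mulVec
  obtain ⟨h1, h2, h3, h4⟩ := standard_vec
  obtain ⟨k1, k2, k3, k4⟩ := addLeft_apply (1, 0)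
  simp only [one_add_one_zmod2, zero_add] at k2 k3 k4
  rw [forall_klein]
  simp only [isometry_mulVec]
  simp only [sign_addLeft, k1, k2, k3, k4, h1, h2, h3, h4]
  refine ⟨?_, ?_, ?_, ?_⟩ <;> ext j <;> fin_cases j <;>
    simp [Matrix.mulVec, dotProduct, Fin.sum_univ_three]

theorem standard_isometry_zero_one : (standard.isometry (Equiv.addLeft (0, 1)) true).1 =
    !![1, 0, 0; 0, -1, 0; 0, 0, 1] := by
  apply standard.ext_mulVec
  obtain ⟨h1, h2, h3, h4⟩ := standard_vec
  obtain ⟨k1, k2, k3, k4⟩ := addLeft_apply (0, 1)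
  simp only [one_add_one_zmod2, zero_add] at k2 k3 k4
  rw [forall_klein]
  simp only [isometry_mulVec]
  simp only [sign_addLeft, k1, k2, k3, k4, h1, h2, h3, h4]
  refine ⟨?_, ?_, ?_, ?_⟩ <;> ext j <;> fin_cases j <;>
    simp [Matrix.mulVec, dotProduct, Fin.sum_univ_three]

theorem turned_isometry_one_one : (turned.isometry (Equiv.addLeft (1, 1)) false).1 =
    !![-1, 0, 0; 0, -1, 0; 0, 0, 1] := by
  apply turned.ext_mulVec
  obtain ⟨h1, h2, h3, h4⟩ := turned_vec
  obtain ⟨k1, k2, k3, k4⟩ := addLeft_apply (1, 1)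
  simp only [one_add_one_zmod2] at k2 k3 k4
  rw [forall_klein]
  simp only [isometry_mulVec]
  simp only [sign_addLeft, k1, k2, k3, k4, h1, h2, h3, h4]
  refine ⟨?_, ?_, ?_, ?_⟩ <;> ext j <;> fin_cases j <;>
    simp [Matrix.mulVec, dotProduct, Fin.sum_univ_three]

theorem turned_isometry_zero_one : (turned.isometry (Equiv.addLeft (0, 1)) false).1 =
    !![0, 1, 0; 1, 0, 0; 0, 0, -1] := by
  apply turned.ext_mulVec
  obtain ⟨h1, h2, h3, h4⟩ := turned_vec
  obtain ⟨k1, k2, k3, k4⟩ := addLeft_apply (0, 1)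
  simp only [one_add_one_zmod2, zero_add] at k2 k3 k4
  rw [forall_klein]
  simp only [isometry_mulVec]
  simp only [sign_addLeft, k1, k2, k3, k4, h1, h2, h3, h4]
  refine ⟨?_, ?_, ?_, ?_⟩ <;> ext j <;> fin_cases j <;>
    simp [Matrix.mulVec, dotProduct, Fin.sum_univ_three]

theorem turned_isometry_prodComm :
    (turned.isometry (Equiv.prodComm (ZMod 2) (ZMod 2)) true).1 =
    !![1, 0, 0; 0, -1, 0; 0, 0, 1] := by
  apply turned.ext_mulVec
  obtain ⟨h1, h2, h3, h4⟩ := turned_vec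
  rw [forall_klein]
  simp only [isometry_mulVec]
  simp only [sign_prodComm, Equiv.prodComm_apply, Prod.swap_prod_mk, h1, h2, h3, h4]
  refine ⟨?_, ?_, ?_, ?_⟩ <;> ext j <;> fin_cases j <;>
    simp [Matrix.mulVec, dotProduct, Fin.sum_univ_three]

theorem addLeft_mul (l l' : ZMod 2 × ZMod 2) :
    (Equiv.addLeft l * Equiv.addLeft l' : Equiv.Perm (ZMod 2 × ZMod 2)) = Equiv.addLeft (l + l') := by
  ext1 x
  simp

theorem isometry_addLeft_mem (v : TetrahedralFrame) {P : Subgroup (Matrix.orthogonalGroup (Fin 3) ℝ)}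
    {l l' : ZMod 2 × ZMod 2} (h : l ≠ 0) (h' : l' ≠ 0) (hne : l ≠ l')
    (hl : v.isometry (Equiv.addLeft l) false ∈ P) (hl' : v.isometry (Equiv.addLeft l') false ∈ P)
    (x : ZMod 2 × ZMod 2) : v.isometry (Equiv.addLeft x) false ∈ P := by
  have h1 := mul_mem hl hl'
  have h0 := mul_mem hl hl
  rw [← isometry_mul, addLeft_mul, Bool.xor_self] at h1 h0
  have : x = l + l ∨ x = l ∨ x = l' ∨ x = l + l' := by
    clear h1 h0 hl hl'
    revert x l l'; decide
  rcases this with rfl | rfl | rfl | rfl <;> assumption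

end TetrahedralFrame

/-! ### The point groups as groups of isometries of a frame -/

namespace PointGroup

open TetrahedralFrame

theorem isometry_mem_D2 (l : ZMod 2 × ZMod 2) : standard.isometry (Equiv.addLeft l) false ∈ D2 :=
  isometry_addLeft_mem _ (l := (1, 1)) (l' := (1, 0)) (by decide) (by decide) (by decide)
    (Subgroup.subset_closure (Or.inl standard_isometry_one_one))
    (Subgroup.subset_closure (Or.inr standard_isometry_one_zero)) l

theorem D2_le {G : Subgroup (Matrix.orthogonalGroup (Fin 3) ℝ)}
    (h : ∀ l, standard.isometry (Equiv.addLeft l) false ∈ G) : D2 ≤ G := by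
  refine (Subgroup.closure_le _).2 ?_
  rintro A (hA | hA)
  · rw [← standard_isometry_one_one] at hA
    rw [Subtype.ext hA]
    exact h _
  · rw [← standard_isometry_one_zero] at hA
    rw [Subtype.ext hA]
    exact h _

theorem isometry_mem_D2h (l : ZMod 2 × ZMod 2) (ε : Bool) :
    standard.isometry (Equiv.addLeft l) ε ∈ D2h := by
  have h1 := isometry_addLeft_mem _ (l := (1, 1)) (l' := (1, 0)) (by decide) (by decide) (by decide)
    (Subgroup.subset_closure (Or.inl standard_isometry_one_one))
    (Subgroup.subset_closure (Or.inr (Or.inr standard_isometry_one_zero)) : _ ∈ D2h)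
  cases ε
  · exact h1 l
  · have h2 : standard.isometry (Equiv.addLeft (0, 1)) true ∈ D2h :=
      Subgroup.subset_closure (Or.inr (Or.inl standard_isometry_zero_one))
    have h3 := mul_mem h2 (h1 (l + (0, 1)))
    rw [← isometry_mul, addLeft_mul] at h3
    have h4 : ((0, 1) : ZMod 2 × ZMod 2) + (l + (0, 1)) = l := by
      clear h3
      revert l; decide
    rwa [h4] at h3

theorem D2h_le {G : Subgroup (Matrix.orthogonalGroup (Fin 3) ℝ)}
    (h : ∀ l ε, standard.isometry (Equiv.addLeft l) ε ∈ G) : D2h ≤ G := by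
  refine (Subgroup.closure_le _).2 ?_
  rintro A (hA | hA | hA)
  · rw [← standard_isometry_one_one] at hA
    rw [Subtype.ext hA]
    exact h _ _
  · rw [← standard_isometry_zero_one] at hA
    rw [Subtype.ext hA]
    exact h _ _
  · rw [← standard_isometry_one_zero] at hA
    rw [Subtype.ext hA]
    exact h _ _

theorem isometry_mem_D2d (l : ZMod 2 × ZMod 2) :
    turned.isometry (Equiv.addLeft l) false ∈ D2d :=
  isometry_addLeft_mem _ (l := (1, 1)) (l' := (0, 1)) (by decide) (by decide) (by decide)
    (Subgroup.subset_closure (Or.inl turned_isometry_one_one))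
    (Subgroup.subset_closure (Or.inr (Or.inr turned_isometry_zero_one)) : _ ∈ D2d) l

theorem isometry_prodComm_mem_D2d (l : ZMod 2 × ZMod 2) :
    turned.isometry (Equiv.addLeft l * Equiv.prodComm _ _) true ∈ D2d := by
  have h := mul_mem (isometry_mem_D2d l) (Subgroup.subset_closure
    (Or.inr (Or.inl turned_isometry_prodComm)) : _ ∈ D2d)
  rwa [← isometry_mul] at h

theorem D2d_le {G : Subgroup (Matrix.orthogonalGroup (Fin 3) ℝ)}
    (h : ∀ l, turned.isometry (Equiv.addLeft l) false ∈ G)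
    (h' : turned.isometry (Equiv.prodComm _ _) true ∈ G) : D2d ≤ G := by
  refine (Subgroup.closure_le _).2 ?_
  rintro A (hA | hA | hA)
  · rw [← turned_isometry_one_one] at hA
    rw [Subtype.ext hA]
    exact h _
  · rw [← turned_isometry_prodComm] at hA
    rw [Subtype.ext hA]
    exact h'
  · rw [← turned_isometry_zero_one] at hA
    rw [Subtype.ext hA]
    exact h _

theorem tetrahedronVertices_eq : tetrahedronVertices = Set.range standard.vec := by
  obtain ⟨h1, h2, h3, h4⟩ := standard_vec
  ext w
  have : (∃ x, standard.vec x = w) ↔ ¬ ∀ x, standard.vec x ≠ w := by simp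
  rw [Set.mem_range, this, forall_klein, h1, h2, h3, h4, tetrahedronVertices]
  simp only [Set.mem_insert_iff, Set.mem_singleton_iff, eq_comm (a := w)]
  tauto

theorem mem_Td_iff {A : Matrix.orthogonalGroup (Fin 3) ℝ} :
    A ∈ Td ↔ ∃ σ ε, cond ε (-1) 1 * Equiv.Perm.sign σ = 1 ∧ A = standard.isometry σ ε := by
  have hTd : A ∈ Td ↔ (fun v => A.1.mulVec v) '' tetrahedronVertices = tetrahedronVertices := Iff.rfl
  rw [hTd, tetrahedronVertices_eq, ← Set.range_comp]
  constructor
  · intro h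
    have h1 : ∀ x, ∃ y, standard.vec y = A.1.mulVec (standard.vec x) := fun x => by
      rw [← Set.mem_range, ← h]
      exact ⟨x, rfl⟩
    choose f hf using h1
    have hinj : Function.Injective f := by
      intro x y hxy
      have h2 := hf x
      rw [hxy, hf y] at h2
      have h3 := congrArg (fun w => (A⁻¹).1.mulVec w) h2
      simp only [Matrix.mulVec_mulVec] at h3
      rw [← Submonoid.coe_mul, inv_mul_cancel, OneMemClass.coe_one, Matrix.one_mulVec,
        Matrix.one_mulVec] at h3
      exact standard.vec_injective h3.symm
    let σ := Equiv.ofBijective f ⟨hinj, Finite.surjective_of_injective hinj⟩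
    -- Vertices go to vertices, and not to their negatives, exactly when the scalar is 1; so `ε`
    -- must record the sign of `σ`.
    refine ⟨σ, decide (Equiv.Perm.sign σ = -1), ?_, ?_⟩
    · rcases Int.units_eq_one_or (Equiv.Perm.sign σ) with h | h <;> rw [h] <;> decide
    · rw [isometry_eq_iff]
      intro x
      have : cond (decide (Equiv.Perm.sign σ = -1)) (-1) 1 * Equiv.Perm.sign σ = 1 := by
        rcases Int.units_eq_one_or (Equiv.Perm.sign σ) with h | h <;> rw [h] <;> decide
      rw [this, ← hf]
      simp only [Units.val_one, Int.cast_one, one_smul]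
      rfl
  · rintro ⟨σ, ε, hε, rfl⟩
    have : ((fun v => (standard.isometry σ ε).1.mulVec v) ∘ standard.vec) = standard.vec ∘ σ := by
      ext1 x
      simp only [Function.comp_apply, isometry_mulVec, hε]
      simp
    rw [this, EquivLike.range_comp]

end PointGroup

/-! ### Symmetries as isometries that preserve the lattice -/

namespace Eis

/-- Complex conjugation if `ε` holds, the identity otherwise. -/
def reflect (ε : Bool) (x : Eis) : Eis := cond ε (star x) x

/-- The action of `Eis.reflect` on directions. -/
def turn (ε : Bool) (j : ZMod 6) : ZMod 6 := cond ε (-j) j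

variable {L : AddSubgroup Eis}

theorem reflect_add (ε : Bool) (x y : Eis) : reflect ε (x + y) = reflect ε x + reflect ε y := by
  cases ε
  · rfl
  · exact star_add x y

theorem reflect_sub (ε : Bool) (x y : Eis) : reflect ε (x - y) = reflect ε x - reflect ε y := by
  cases ε
  · rfl
  · exact star_sub x y

theorem reflect_reflect (ε : Bool) (x : Eis) : reflect ε (reflect ε x) = x := by
  cases ε
  · rfl
  · exact star_star x

theorem reflect_unit (ε : Bool) (j : ZMod 6) : reflect ε (unit j) = unit (turn ε j) := by
  cases ε
  · rfl
  · exact star_unit j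

theorem turn_turn (ε : Bool) (j : ZMod 6) : turn ε (turn ε j) = j := by
  cases ε
  · rfl
  · exact neg_neg j

theorem turn_add_three (ε : Bool) (j : ZMod 6) : turn ε (j + 3) = turn ε j + 3 := by
  revert ε j; decide

theorem turn_inj {ε : Bool} {i j : ZMod 6} : turn ε i = turn ε j ↔ i = j := by
  revert ε i j; decide

theorem reflect_intCast_mul (ε : Bool) (a : ℤ) (x : Eis) :
    reflect ε (a * x) = a * reflect ε x := by
  cases ε
  · rfl
  · show star _ = _ * star _
    rw [star_mul', star_intCast]

/-- The isometry `x ↦ ζ ^ i * reflect ε x` preserves `L`. -/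
def Preserves (L : AddSubgroup Eis) (ε : Bool) (i : ZMod 6) : Prop :=
  ∀ x, unit i * reflect ε x ∈ L ↔ x ∈ L

theorem Preserves.mem_dbl {ε : Bool} {i : ZMod 6} (h : Preserves L ε i) {x : Eis} :
    unit i * reflect ε x ∈ dbl L ↔ x ∈ dbl L := by
  cases ε
  · have : rotate i L = L := by
      ext x
      exact h x
    show unit i * x ∈ _ ↔ _
    rw [← mem_dbl_rotate, this]
  · have : mirror (rotate i L) = L := by
      ext x
      exact h x
    show unit i * star x ∈ _ ↔ _
    rw [← mem_dbl_rotate, ← mem_dbl_mirror, this]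

theorem preserves_add_three {ε : Bool} {i : ZMod 6} :
    Preserves L ε (i + 3) ↔ Preserves L ε i := by
  simp only [Preserves, unit_add_three, neg_mul, neg_mem_iff]

end Eis

namespace CombMap

open Eis

variable {M : CombMap} {L : AddSubgroup Eis}

/-- `f` preserves or reverses the orientation, according to `ε`. -/
def Respects (M : CombMap) (f : Equiv.Perm M.Dart) (ε : Bool) : Prop :=
  ∀ d, f (M.rot d) = cond ε (M.rot.symm (f d)) (M.rot (f d))

/-- The opposite dart if `ε` holds, and the dart itself otherwise. -/
def flip (M : CombMap) (ε : Bool) (d : M.Dart) : M.Dart := cond ε (M.opp d) d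

theorem flip_flip (ε δ : Bool) (d : M.Dart) : M.flip ε (M.flip δ d) = M.flip (xor ε δ) d := by
  cases ε <;> cases δ <;> first | rfl | exact M.opp_opp d

theorem exists_respects (f : M.symmetryGroup) : ∃ ε, M.Respects f.1 ε := by
  rcases f.2.2 with h | h
  · exact ⟨false, h⟩
  · exact ⟨true, h⟩

theorem Cubic.respects_unique (hc : M.Cubic) [Nonempty M.Dart] {f : Equiv.Perm M.Dart} {ε δ : Bool}
    (h : M.Respects f ε) (h' : M.Respects f δ) : ε = δ := by
  obtain ⟨d⟩ := ‹Nonempty M.Dart›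
  have h1 := h d
  rw [h' d] at h1
  have h2 : M.rot (f d) ≠ M.rot.symm (f d) := fun h => hc.rot_rot_ne (f d) (by
    rw [h, Equiv.apply_symm_apply])
  cases ε <;> cases δ
  · rfl
  · exact absurd h1.symm h2
  · exact absurd h1 h2
  · rfl

theorem Respects.comp {f g : Equiv.Perm M.Dart} {ε δ : Bool} (hf : M.Respects f ε)
    (hg : M.Respects g δ) : M.Respects (f * g) (xor ε δ) := by
  intro d
  rw [Equiv.Perm.mul_apply, hg d]
  have h2 : ∀ d, f (M.rot.symm d) = cond ε (M.rot (f d)) (M.rot.symm (f d)) := by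
    intro d
    have h1 := hf (M.rot.symm d)
    rw [Equiv.apply_symm_apply] at h1
    rw [h1]
    cases ε <;> simp
  cases δ
  · rw [Bool.xor_false]
    exact hf (g d)
  · simp only [cond_true, h2]
    cases ε <;> rfl

/-- A symmetry composed with a development is again a development once a reversal of orientation is
compensated by conjugating the tiling and taking opposite darts. Comparing it with `φ` will give the
lift. -/
theorem IsDevelopment.flip {φ : Eis → ZMod 6 → M.Dart} (hφ : M.IsDevelopment φ)
    {f : Equiv.Perm M.Dart} {ε : Bool} (ho : ∀ d, f (M.opp d) = M.opp (f d))
    (hf : M.Respects f ε) :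
    M.IsDevelopment fun v j => M.flip ε (f (φ (reflect ε v) (turn ε j))) := by
  constructor
  · intro v j
    cases ε
    · show f (φ v (j + 1)) = M.next (f (φ v j))
      rw [hφ.1, next_apply, hf, next_apply, ho]
      rfl
    · show M.opp (f (φ (star v) (-(j + 1)))) = M.next (M.opp (f (φ (star v) (-j))))
      have h1 : φ (star v) (-j) = M.next (φ (star v) (-(j + 1))) := by
        rw [← hφ.1]
        congr 1
        ring
      rw [h1, next_opp, next_apply, hf]
      show _ = M.rot (M.rot.symm _)
      rw [Equiv.apply_symm_apply, ho]
  · intro v j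
    beta_reduce
    rw [reflect_add, reflect_unit, turn_add_three, hφ.2, ho]
    cases ε <;> rfl

namespace Dev

variable (D : Dev M L)
include D

/-- `f` is induced by the isometry `x ↦ ζ ^ i * reflect ε x + l`. -/
def IsLift (f : Equiv.Perm M.Dart) (ε : Bool) (i : ZMod 6) (l : Eis) : Prop :=
  ∀ v j, M.flip ε (f (D.φ v j)) = D.φ (unit i * reflect ε v + l) (i + turn ε j)

theorem add_three_iff {v : Eis} {j : ZMod 6} : D.φ v (j + 3) = D.φ v j ↔ v ∈ L := by
  rw [D.eq_iff, add_self_mem_dbl]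
  constructor
  · rintro (⟨h, -⟩ | ⟨-, h⟩)
    · exact absurd h (by revert j; decide)
    · exact h
  · refine fun h => Or.inr ⟨?_, h⟩
    revert j; decide

/-- The two developments agree at one dart after a rotation of the tiling, hence everywhere.
Symmetries preserve triangles, so the isometry preserves `L`; the image `l` of the origin lies in
`L` because the origin is a triangle centre. -/
theorem exists_lift {f : Equiv.Perm M.Dart} {ε : Bool} (ho : ∀ d, f (M.opp d) = M.opp (f d))
    (hf : M.Respects f ε) : ∃ i, ∃ l ∈ L, Preserves L ε i ∧ D.IsLift f ε i l := by
  obtain ⟨l, i, hli⟩ := D.surj (M.flip ε (f (D.φ (reflect ε 0) (turn ε 0))))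
  have hdev := D.isDev.flip ho hf
  have h1 := fun v j => (D.isDev.comp_rotate l i).eq hdev (v₀ := 0) (j₀ := 0)
    (by simpa using hli) (reflect ε v) (turn ε j)
  simp only [reflect_reflect, turn_turn] at h1
  have h2 : ∀ v, v ∈ L ↔ unit i * reflect ε v + l ∈ L := by
    intro v
    rw [← D.add_three_iff (j := 0), ← D.add_three_iff (j := i + turn ε 0), add_assoc,
      ← turn_add_three, h1, h1]
    cases ε
    · exact f.injective.eq_iff.symm
    · exact (M.opp.injective.eq_iff.trans f.injective.eq_iff).symm
  have h3 : l ∈ L := by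
    have := (h2 0).1 (zero_mem _)
    cases ε <;> simpa [reflect] using this
  refine ⟨i, l, h3, fun v => ?_, fun v j => (h1 v j).symm⟩
  rw [h2 v, AddSubgroup.add_mem_cancel_right _ h3]

/-- An isometry that preserves `L` normalises the group of half-turns, so it descends to the
quotient. -/
theorem exists_symmetry {ε : Bool} {i : ZMod 6} {l : Eis} (h : Preserves L ε i) (hl : l ∈ L) :
    ∃ f : M.symmetryGroup, M.Respects f.1 ε ∧ D.IsLift f.1 ε i l := by
  obtain ⟨e, he⟩ := exists_equiv_of_fibers (f := fun x : Eis × ZMod 6 => D.φ x.1 x.2)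
    (g := fun x : Eis × ZMod 6 => M.flip ε (D.φ (unit i * reflect ε x.1 + l) (i + turn ε x.2)))
    (fun d => by obtain ⟨v, j, h⟩ := D.surj d; exact ⟨(v, j), h⟩)
    (fun d => by
      obtain ⟨v, j, h⟩ := D.surj (M.flip ε d)
      refine ⟨(reflect ε (unit (-i) * (v - l)), turn ε (j - i)), ?_⟩
      simp only [reflect_reflect, turn_turn, unit_mul_neg, sub_add_cancel, add_sub_cancel, h]
      rw [flip_flip, Bool.xor_self]
      rfl)
    (fun x y => by
      have hinj : Function.Injective (M.flip ε) := by
        cases ε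
        · exact Function.injective_id
        · exact M.opp.injective
      rw [hinj.eq_iff, D.eq_iff, D.eq_iff, add_sub_add_right_eq_sub, ← mul_sub, ← reflect_sub,
        h.mem_dbl, add_assoc, add_right_inj, turn_inj, add_right_inj, ← turn_add_three, turn_inj]
      have h1 : unit i * reflect ε x.1 + l + (unit i * reflect ε y.1 + l) =
          unit i * reflect ε (x.1 + y.1) + (l + l) := by
        rw [reflect_add]
        ring
      rw [h1, AddSubgroup.add_mem_cancel_right _ (add_self_mem_dbl.2 hl), h.mem_dbl])
  have he' : ∀ v j, e (D.φ v j) = M.flip ε (D.φ (unit i * reflect ε v + l) (i + turn ε j)) :=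
    fun v j => he (v, j)
  have ho : ∀ d, e (M.opp d) = M.opp (e d) := by
    intro d
    obtain ⟨v, j, rfl⟩ := D.surj d
    have h1 : D.φ (unit i * reflect ε (v + unit j) + l) (i + turn ε (j + 3)) =
        M.opp (D.φ (unit i * reflect ε v + l) (i + turn ε j)) := by
      rw [← D.isDev.2, reflect_add, reflect_unit, turn_add_three, mul_add, unit_mul]
      congr 1 <;> ring
    rw [← D.isDev.2, he', he', h1]
    cases ε <;> rfl
  have hr : M.Respects e ε := by
    intro d
    obtain ⟨v, j, rfl⟩ := D.surj d
    rw [D.isDev.rot, he', he', reflect_add, reflect_unit, mul_add, unit_mul]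
    cases ε
    · show D.φ _ (i + (j + 4)) = M.rot (D.φ _ _)
      rw [D.isDev.rot]
      congr 1 <;> simp only [turn, reflect, cond_false] <;> ring
    · show M.opp (D.φ _ (i + -(j + 4))) = M.rot.symm (M.opp (D.φ _ _))
      rw [Equiv.eq_symm_apply, ← next_apply, ← D.isDev.1, ← D.isDev.2]
      simp only [turn, reflect, cond_true]
      congr 1
      · ring
      · have : ∀ i j : ZMod 6, i + -(j + 4) + 1 = i + -j + 3 := by decide
        exact this i j
  refine ⟨⟨e, ho, ?_⟩, hr, fun v j => ?_⟩
  · cases ε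
    · exact Or.inl hr
    · exact Or.inr hr
  · show M.flip ε (e _) = _
    rw [he', flip_flip, Bool.xor_self]
    rfl

theorem IsLift.face_eq_iff {f : Equiv.Perm M.Dart} {ε : Bool} {i : ZMod 6} {l : Eis}
    (h : Preserves L ε i) (hl : l ∈ L) (hf : D.IsLift f ε i l) (d e : M.Dart) :
    M.face (M.flip ε (f d)) = M.face (M.flip ε (f e)) ↔ M.face d = M.face e := by
  obtain ⟨v, j, rfl⟩ := D.surj d
  obtain ⟨w, k, rfl⟩ := D.surj e
  rw [hf, hf, D.face_eq_iff, D.face_eq_iff, add_sub_add_right_eq_sub, ← mul_sub, ← reflect_sub,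
    h.mem_dbl]
  have h1 : unit i * reflect ε v + l + (unit i * reflect ε w + l) =
      unit i * reflect ε (v + w) + (l + l) := by
    rw [reflect_add]
    ring
  rw [h1, AddSubgroup.add_mem_cancel_right _ (add_self_mem_dbl.2 hl), h.mem_dbl]

end Dev

end CombMap

/-! ### Action of the symmetries on the four triangles -/

namespace Eis

variable {L : AddSubgroup Eis}

/-- `u`, `w` form a basis of the lattice `L`. -/
structure IsBasis (L : AddSubgroup Eis) (u w : Eis) : Prop where
  mem_iff : ∀ x, x ∈ L ↔ ∃ a b : ℤ, x = a * u + b * w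
  indep : ∀ a b : ℤ, a * u + b * w = 0 → a = 0 ∧ b = 0

namespace IsBasis

variable {u w : Eis} (h : IsBasis L u w)
include h

theorem mem_dbl_iff (a b : ℤ) :
    a * u + b * w ∈ dbl L ↔ (a : ZMod 2) = 0 ∧ (b : ZMod 2) = 0 := by
  rw [ZMod.intCast_zmod_eq_zero_iff_dvd, ZMod.intCast_zmod_eq_zero_iff_dvd, mem_dbl]
  constructor
  · rintro ⟨l, hl, hl'⟩
    obtain ⟨c, d, rfl⟩ := (h.mem_iff l).1 hl
    have h1 := h.indep (2 * c - a) (2 * d - b) (by push_cast; linear_combination hl')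
    exact ⟨⟨c, by push_cast; omega⟩, ⟨d, by push_cast; omega⟩⟩
  · rintro ⟨⟨c, rfl⟩, ⟨d, rfl⟩⟩
    exact ⟨c * u + d * w, (h.mem_iff _).2 ⟨c, d, rfl⟩, by push_cast; ring⟩

end IsBasis

/-- For a rotation other than ±1 the square of `ζ ^ i - 1` is `-ζ ^ i` or `-3 ζ ^ i`, so triviality
on `L / 2 L` would give `ζ ^ i L ⊆ 2 L` and then `L = 2 L`, against finite index. -/
theorem eq_zero_or_three {i : ZMod 6} (hL : L.index ≠ 0) (h : ∀ x ∈ L, unit i * x - x ∈ dbl L) :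
    i = 0 ∨ i = 3 := by
  by_contra hi
  have h1 : (unit i * unit i - unit i - unit i + 1 = -unit i) ∨
      (unit i * unit i - unit i - unit i + 1 = -(unit i + unit i + unit i)) := by
    clear h
    revert i; decide
  have hmem : ∀ x ∈ L, unit i * x ∈ L := fun x hx => by
    simpa using add_mem (dbl_le (h x hx)) hx
  have h2 : ∀ x ∈ L, unit i * x ∈ dbl L := by
    intro x hx
    have h3 := h _ (dbl_le (h x hx))
    have h4 : unit i * (unit i * x - x) - (unit i * x - x) =
      (unit i * unit i - unit i - unit i + 1) * x := by ring
    rw [h4] at h3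
    rcases h1 with h1 | h1 <;> rw [h1] at h3
    · rwa [neg_mul, neg_mem_iff] at h3
    · rw [neg_mul, neg_mem_iff, add_mul, add_mul] at h3
      exact (AddSubgroup.add_mem_cancel_left _ (add_self_mem_dbl.2 (hmem x hx))).1 h3
  have h3 : dbl L = L := le_antisymm dbl_le fun x hx => by
    simpa using sub_mem (h2 x hx) (h x hx)
  have h4 := index_dbl L
  rw [h3] at h4
  omega

end Eis

namespace CombMap

open Eis

variable {M : CombMap} {L : AddSubgroup Eis}

namespace Dev

variable (D : Dev M L) {u w : Eis}

/-- The triangles, indexed by `L / 2 L`. -/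
def triangle (u w : Eis) (x : ZMod 2 × ZMod 2) : M.Face :=
  M.face (D.φ (((x.1.val : ℤ) : Eis) * u + ((x.2.val : ℤ) : Eis) * w) 0)

theorem face_eq_triangle (hb : IsBasis L u w) (a b : ℤ) (j : ZMod 6) :
    M.face (D.φ (a * u + b * w) j) = D.triangle u w (a, b) := by
  rw [triangle, D.face_eq_iff]
  left
  have : (((a : ZMod 2).val : ℤ) : Eis) * u + (((b : ZMod 2).val : ℤ) : Eis) * w -
      (a * u + b * w) = (((a : ZMod 2).val - a : ℤ) : Eis) * u + (((b : ZMod 2).val - b : ℤ) : Eis) * w := by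
    push_cast
    ring
  rw [this, hb.mem_dbl_iff]
  simp

theorem triangle_inj (hb : IsBasis L u w) {x y : ZMod 2 × ZMod 2} :
    D.triangle u w x = D.triangle u w y ↔ x = y := by
  constructor
  · intro h
    rw [triangle, triangle, D.face_eq_iff] at h
    have key : x - y = 0 := by
      rcases h with h | h
      · have : (((y.1.val : ℤ) : Eis) * u + ((y.2.val : ℤ) : Eis) * w) -
          (((x.1.val : ℤ) : Eis) * u + ((x.2.val : ℤ) : Eis) * w) =
          (((y.1.val : ℤ) - x.1.val : ℤ) : Eis) * u + (((y.2.val : ℤ) - x.2.val : ℤ) : Eis) * w := by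
          push_cast
          ring
        rw [this, hb.mem_dbl_iff] at h
        simp at h
        rw [← neg_sub, neg_eq_zero]
        exact Prod.ext h.1 h.2
      · have : (((x.1.val : ℤ) : Eis) * u + ((x.2.val : ℤ) : Eis) * w) +
          (((y.1.val : ℤ) : Eis) * u + ((y.2.val : ℤ) : Eis) * w) =
          (((x.1.val : ℤ) + y.1.val : ℤ) : Eis) * u + (((x.2.val : ℤ) + y.2.val : ℤ) : Eis) * w := by
          push_cast
          ring
        rw [this, hb.mem_dbl_iff] at h
        simp at h
        have h2 : ∀ x y : ZMod 2 × ZMod 2, x.1 + y.1 = 0 → x.2 + y.2 = 0 → x - y = 0 := by decide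
        exact h2 x y h.1 h.2
    exact sub_eq_zero.1 key
  · rintro rfl
    rfl

/-- `f` permutes the triangles by `σ`. -/
def Carries (u w : Eis) (f : Equiv.Perm M.Dart) (ε : Bool) (σ : Equiv.Perm (ZMod 2 × ZMod 2)) : Prop :=
  ∀ x d, M.face d = D.triangle u w x → M.face (M.flip ε (f d)) = D.triangle u w (σ x)

theorem Carries.comp {f g : Equiv.Perm M.Dart} {ε δ : Bool} {σ τ : Equiv.Perm (ZMod 2 × ZMod 2)}
    (ho : ∀ d, f (M.opp d) = M.opp (f d)) (hf : D.Carries u w f ε σ) (hg : D.Carries u w g δ τ) :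
    D.Carries u w (f * g) (xor ε δ) (σ * τ) := by
  intro x d hd
  have h := hf _ _ (hg _ _ hd)
  rw [Equiv.Perm.mul_apply, Equiv.Perm.mul_apply, ← h, ← flip_flip]
  congr 2
  cases δ
  · rfl
  · exact (ho _).symm

theorem Carries.unique (hb : IsBasis L u w) {f : Equiv.Perm M.Dart} {ε : Bool}
    {σ τ : Equiv.Perm (ZMod 2 × ZMod 2)} (h : D.Carries u w f ε σ) (h' : D.Carries u w f ε τ) :
    σ = τ := by
  ext1 x
  rw [← D.triangle_inj hb, ← h x _ rfl, ← h' x _ rfl]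

/-- The permutation of `L / 2 L` induced by an affine map given in coordinates. -/
theorem IsLift.carries {f : Equiv.Perm M.Dart} {ε : Bool} {i : ZMod 6} {l : Eis}
    (hb : IsBasis L u w) (h : Preserves L ε i) (hl : l ∈ L) (hf : D.IsLift f ε i l)
    {a b a' b' c c' : ℤ} (hu : unit i * reflect ε u = a * u + a' * w)
    (hw : unit i * reflect ε w = b * u + b' * w) (hc : l = c * u + c' * w)
    {σ : Equiv.Perm (ZMod 2 × ZMod 2)}
    (hσ : ∀ x, σ x = (a * x.1 + b * x.2 + c, a' * x.1 + b' * x.2 + c')) : D.Carries u w f ε σ := by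
  intro x d hd
  rw [triangle, ← hf.face_eq_iff D h hl, hf] at hd
  rw [hd, reflect_add, reflect_intCast_mul, reflect_intCast_mul, hσ]
  have : unit i * (((x.1.val : ℤ) : Eis) * reflect ε u + ((x.2.val : ℤ) : Eis) * reflect ε w) + l =
      ((a * x.1.val + b * x.2.val + c : ℤ) : Eis) * u +
      ((a' * x.1.val + b' * x.2.val + c' : ℤ) : Eis) * w := by
    push_cast
    linear_combination ((x.1.val : ℤ) : Eis) * hu + ((x.2.val : ℤ) : Eis) * hw + hc
  rw [this, D.face_eq_triangle hb]
  congr 1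
  simp

theorem IsLift.exists_carries {f : Equiv.Perm M.Dart} {ε : Bool} {i : ZMod 6} {l : Eis}
    (hb : IsBasis L u w) (h : Preserves L ε i) (hl : l ∈ L) (hf : D.IsLift f ε i l) :
    ∃ σ, D.Carries u w f ε σ := by
  have h1 : ∀ x : ZMod 2 × ZMod 2, ∃ y, M.face (M.flip ε (f (D.φ (((x.1.val : ℤ) : Eis) * u +
      ((x.2.val : ℤ) : Eis) * w) 0))) = D.triangle u w y := by
    intro x
    rw [hf]
    obtain ⟨a, b, hab⟩ := (hb.mem_iff _).1 (add_mem ((h _).2 ((hb.mem_iff _).2 ⟨_, _, rfl⟩)) hl)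
    exact ⟨(a, b), by rw [hab, D.face_eq_triangle hb]⟩
  choose s hs using h1
  have hinj : Function.Injective s := by
    intro x y hxy
    rw [← D.triangle_inj hb, triangle, triangle, ← hf.face_eq_iff D h hl, hs, hs, hxy]
  refine ⟨Equiv.ofBijective s ⟨hinj, Finite.surjective_of_injective hinj⟩, fun x d hd => ?_⟩
  rw [triangle, ← hf.face_eq_iff D h hl, hs] at hd
  exact hd

theorem exists_respects_carries (hb : IsBasis L u w) (f : M.symmetryGroup) :
    ∃ p : Bool × Equiv.Perm (ZMod 2 × ZMod 2),
      M.Respects f.1 p.1 ∧ D.Carries u w f.1 p.1 p.2 := by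
  obtain ⟨ε, hε⟩ := exists_respects f
  obtain ⟨i, l, hl, h, hf⟩ := D.exists_lift f.2.1 hε
  obtain ⟨σ, hσ⟩ := hf.exists_carries D hb h hl
  exact ⟨(ε, σ), hε, hσ⟩

include D in
theorem nonempty_dart : Nonempty M.Dart := ⟨D.φ 0 0⟩

/-- The representation of the symmetry group by isometries of the octahedron. -/
noncomputable def rep (hb : IsBasis L u w) (v : TetrahedralFrame) :
    M.symmetryGroup →* Matrix.orthogonalGroup (Fin 3) ℝ :=
  MonoidHom.mk' (fun f => v.isometry (D.exists_respects_carries hb f).choose.2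
      (D.exists_respects_carries hb f).choose.1) (by
    intro f g
    have h1 := (D.exists_respects_carries hb f).choose_spec
    have h2 := (D.exists_respects_carries hb g).choose_spec
    have h3 := (D.exists_respects_carries hb (f * g)).choose_spec
    have := D.nonempty_dart
    have h4 := D.cubic.respects_unique h3.1 (h1.1.comp h2.1)
    have h5 := h3.2
    rw [h4] at h5
    have h6 := Carries.unique D hb h5 (Carries.comp D f.2.1 h1.2 h2.2)
    rw [h4, h6, v.isometry_mul])

theorem rep_eq (hb : IsBasis L u w) (v : TetrahedralFrame) {f : M.symmetryGroup} {ε : Bool}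
    {σ : Equiv.Perm (ZMod 2 × ZMod 2)} (hε : M.Respects f.1 ε) (hσ : D.Carries u w f.1 ε σ) :
    D.rep hb v f = v.isometry σ ε := by
  have h1 := (D.exists_respects_carries hb f).choose_spec
  have := D.nonempty_dart
  have h4 := D.cubic.respects_unique hε h1.1
  subst h4
  rw [Carries.unique D hb hσ h1.2]
  rfl

/-- A symmetry in the kernel preserves the orientation and every triangle. Its lift `x ↦ ζ ^ i x +
l` is trivial on `L / 2 L`, which makes `l` an element of `2 L` and `ζ ^ i` a sign. Such isometries
belong to the group by which the tiling was divided. -/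
theorem rep_injective (hb : IsBasis L u w) (v : TetrahedralFrame) :
    Function.Injective (D.rep hb v) := by
  rw [injective_iff_map_eq_one]
  intro f hf
  obtain ⟨⟨ε, σ⟩, hε, hσ⟩ := D.exists_respects_carries hb f
  rw [D.rep_eq hb v hε hσ] at hf
  obtain ⟨rfl, rfl⟩ := v.eq_one_of_isometry_eq_one _ hf
  obtain ⟨i, l, hl, h, hlift⟩ := D.exists_lift f.2.1 hε
  have h1 : ∀ x ∈ L, unit i * x + l - x ∈ dbl L := by
    intro x hx
    obtain ⟨a, b, rfl⟩ := (hb.mem_iff x).1 hx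
    have h2 := hσ _ _ (D.face_eq_triangle hb a b 0)
    rw [hlift, Equiv.Perm.one_apply, ← D.face_eq_triangle hb a b 0, D.face_eq_iff] at h2
    rcases h2 with h2 | h2
    · rwa [← neg_mem_iff, neg_sub] at h2
    · have h3 : unit i * (a * u + b * w) + l - (a * u + b * w) =
          unit i * (a * u + b * w) + l + (a * u + b * w) -
            ((a * u + b * w) + (a * u + b * w)) := by ring
      rw [h3]
      exact sub_mem h2 (add_self_mem_dbl.2 hx)
  have hl2 : l ∈ dbl L := by simpa using h1 0 (zero_mem _)
  have h2 : i = 0 ∨ i = 3 := by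
    refine eq_zero_or_three D.index_pos.ne' fun x hx => ?_
    · have := sub_mem (h1 x hx) hl2
      convert this using 1
      ring
  apply Subtype.ext
  ext1 d
  obtain ⟨y, j, rfl⟩ := D.surj d
  have h3 : f.1 (D.φ y j) = _ := hlift y j
  rw [h3]
  show _ = D.φ y j
  rcases h2 with rfl | rfl
  · refine (D.eq_iff _ _ _ _).2 (Or.inl ⟨by simp [turn], ?_⟩)
    rw [← neg_mem_iff]
    simpa [reflect, unit_zero] using hl2
  · refine (D.eq_iff _ _ _ _).2 (Or.inr ⟨?_, ?_⟩)
    · have : ∀ j : ZMod 6, j = 3 + j + 3 := by decide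
      exact this j
    · convert hl2 using 1
      simp only [reflect, cond_false]
      rw [show unit 3 = -1 from rfl]
      ring

theorem hasPointGroup (hb : IsBasis L u w) (v : TetrahedralFrame)
    {P : Subgroup (Matrix.orthogonalGroup (Fin 3) ℝ)} (h : ∀ f, D.rep hb v f ∈ P)
    (h' : P ≤ (D.rep hb v).range) : M.HasPointGroup P := by
  refine ⟨MulEquiv.ofBijective ((D.rep hb v).codRestrict P h) ⟨fun f g hfg => ?_, fun A => ?_⟩,
    fun f => ?_⟩
  · exact D.rep_injective hb v (congrArg Subtype.val hfg)
  · obtain ⟨f, hf⟩ := h' A.2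
    exact ⟨f, Subtype.ext hf⟩
  · show _ ↔ Matrix.det (D.rep hb v f).1 = 1
    obtain ⟨⟨ε, σ⟩, hε, hσ⟩ := D.exists_respects_carries hb f
    rw [D.rep_eq hb v hε hσ, v.det_isometry]
    have := D.nonempty_dart
    constructor
    · intro h1
      rw [D.cubic.respects_unique hε (show M.Respects f.1 false from h1)]
      rfl
    · intro h1
      cases ε
      · exact hε
      · norm_num at h1

end Dev

end CombMap

/-! ### Adapted bases and isometries of the lattices with a short vector -/

namespace Eis

open scoped QuadraticAlgebra

variable {L : AddSubgroup Eis} {u w : Eis}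

/-- By `hi` the isometry is an involution up to conjugation by the same reflection, so one
inclusion, checked on the basis, suffices. -/
theorem IsBasis.preserves (h : IsBasis L u w) {ε : Bool} {i : ZMod 6} {a b a' b' : ℤ}
    (hu : unit i * reflect ε u = a * u + a' * w) (hw : unit i * reflect ε w = b * u + b' * w)
    (hi : unit i * reflect ε (unit i) = 1) : Preserves L ε i := by
  have key : ∀ x ∈ L, unit i * reflect ε x ∈ L := by
    intro x hx
    obtain ⟨p, q, rfl⟩ := (h.mem_iff x).1 hx
    rw [reflect_add, reflect_intCast_mul, reflect_intCast_mul]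
    refine (h.mem_iff _).2 ⟨p * a + q * b, p * a' + q * b', ?_⟩
    push_cast
    linear_combination (p : Eis) * hu + (q : Eis) * hw
  refine fun x => ⟨fun hx => ?_, key x⟩
  have h1 := key _ hx
  have h2 : reflect ε (unit i * reflect ε x) = reflect ε (unit i) * x := by
    cases ε
    · rfl
    · show star (unit i * star x) = star (unit i) * x
      rw [star_mul', star_star]
  rwa [h2, ← mul_assoc, hi, one_mul] at h1

theorem isBasis_lattice {s t : ℤ} {m : ℕ} (hm : m ≠ 0) (h : 2 ∣ t - s) :
    IsBasis (lattice s m) ⟨2, 0⟩ ⟨t, m⟩ := by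
  obtain ⟨r, hr⟩ := h
  have hm' : (m : ℤ) ≠ 0 := by exact_mod_cast hm
  constructor
  · intro x
    rw [mem_lattice]
    constructor
    · rintro ⟨q, hq, p, hp⟩
      refine ⟨p - r * q, q, ?_⟩
      ext
      · simp
        linear_combination hp - q * hr
      · simp
        linear_combination hq
    · rintro ⟨a, b, rfl⟩
      refine ⟨b, by simp; ring, a + r * b, ?_⟩
      simp
      linear_combination b * hr
  · intro a b h
    have h1 := congrArg QuadraticAlgebra.re h
    have h2 := congrArg QuadraticAlgebra.im h
    simp at h1 h2
    have h3 : b = 0 := h2.resolve_right hm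
    subst h3
    simp at h1
    exact ⟨h1, rfl⟩

/-- For `m = 2 h` the two vectors are conjugate to each other; the sum of the two is the vector 2.
-/
theorem isBasis_lattice_rhombic {s h : ℤ} {m : ℕ} (hm : m ≠ 0) (h2 : 2 ∣ s + h - 1) :
    IsBasis (lattice s m) ⟨1 - h, m⟩ ⟨1 + h, -m⟩ := by
  obtain ⟨r, hr⟩ := h2
  have hm' : (m : ℤ) ≠ 0 := by exact_mod_cast hm
  constructor
  · intro x
    rw [mem_lattice]
    constructor
    · rintro ⟨q, hq, p, hp⟩
      refine ⟨p + q * (1 + r), p + q * r, ?_⟩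
      ext
      · simp
        linear_combination hp + q * hr
      · simp
        linear_combination hq
    · rintro ⟨a, b, rfl⟩
      refine ⟨a - b, by simp; ring, b - (a - b) * r, ?_⟩
      simp
      linear_combination (b - a) * hr
  · intro a b h
    have h1 := congrArg QuadraticAlgebra.re h
    have h2 := congrArg QuadraticAlgebra.im h
    simp at h1 h2
    have h4 : (m : ℤ) * (a - b) = 0 := by linear_combination h2
    have h3 : a - b = 0 := (mul_eq_zero.1 h4).resolve_left hm'
    have h5 : a = b := by omega
    subst h5
    have : a = 0 := by linarith
    exact ⟨this, this⟩

theorem isBasis_skewLattice {k : ℕ} {h : ℤ} (hk : k ≠ 0) (hh : (k : ℤ) = 2 * h) :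
    IsBasis (skewLattice k) ⟨1, 1⟩ ⟨h, -h⟩ := by
  have hk' : (k : ℤ) ≠ 0 := by exact_mod_cast hk
  constructor
  · intro x
    rw [mem_skewLattice]
    constructor
    · rintro ⟨c, hc⟩
      refine ⟨x.re - h * c, c, ?_⟩
      ext
      · simp
        ring
      · simp
        linear_combination -hc - c * hh
    · rintro ⟨a, b, rfl⟩
      exact ⟨b, by simp; linear_combination -b * hh⟩
  · intro a b h0
    have h1 := congrArg QuadraticAlgebra.re h0
    have h2 := congrArg QuadraticAlgebra.im h0
    simp at h1 h2
    have h4 : (k : ℤ) * b = 0 := by linear_combination h1 - h2 + b * hh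
    have h3 : b = 0 := (mul_eq_zero.1 h4).resolve_left hk'
    subst h3
    simp at h1
    exact ⟨h1, rfl⟩

/-- The reflection that fixes `1 + ζ` exchanges these two vectors, whose sum is `1 + ζ`. For even
`k` there is instead a basis of `1 + ζ` and a vector orthogonal to it. -/
theorem isBasis_skewLattice_rhombic {k : ℕ} {h : ℤ} (hh : (k : ℤ) = 2 * h + 1) :
    IsBasis (skewLattice k) ⟨h + 1, -h⟩ ⟨-h, h + 1⟩ := by
  constructor
  · intro x
    rw [mem_skewLattice]
    constructor
    · rintro ⟨c, hc⟩
      refine ⟨x.re - h * c, x.re - h * c - c, ?_⟩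
      ext
      · simp
        ring
      · simp
        linear_combination -hc - c * hh
    · rintro ⟨a, b, rfl⟩
      exact ⟨a - b, by simp; linear_combination -(a - b) * hh⟩
  · intro a b h0
    have h1 := congrArg QuadraticAlgebra.re h0
    have h2 := congrArg QuadraticAlgebra.im h0
    simp at h1 h2
    have h3 : a + b = 0 := by linear_combination h1 + h2
    have h4 : (k : ℤ) * (a - b) = 0 := by linear_combination h1 - h2 + (a - b) * hh
    have hk' : (k : ℤ) ≠ 0 := by omega
    have h5 : a - b = 0 := (mul_eq_zero.1 h4).resolve_left hk'
    omega

theorem preserves_lattice {s : ℤ} {m : ℕ} (hm : 2 ≤ m) (hs : s = 0 ∨ s = 1)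
    (h02 : ¬ (s = 0 ∧ m = 2)) {i : ZMod 6} {ε : Bool} (h : Preserves (lattice s m) ε i) :
    i = 0 ∨ i = 3 := by
  have h2 : unit 0 + unit 0 ∈ lattice s m := ⟨0, by simp [unit_zero_eq], by simp [unit_zero_eq]⟩
  have h3 := (h _).2 h2
  have h4 : reflect ε (unit 0 + unit 0) = unit 0 + unit 0 := by cases ε <;> rfl
  rw [h4, mul_add, unit_mul, add_zero] at h3
  exact eq_zero_or_three_of_lattice hm hs h02 h3

/-- For `k ≥ 4` the vectors `±(1 + ζ)` are the only ones of norm 3 in the lattice, so an isometry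
maps this pair to itself. -/
theorem preserves_skewLattice {k : ℕ} (hk : 4 ≤ k) {i : ZMod 6} {ε : Bool}
    (h : Preserves (skewLattice k) ε i) :
    i = cond ε 1 0 ∨ i = cond ε 4 3 := by
  have h2 : unit 0 + unit 1 ∈ skewLattice k := ⟨0, by simp [unit_zero_eq, unit_one_eq]⟩
  have h3 := (h _).2 h2
  rw [mem_skewLattice] at h3
  have h4 : ∀ i ε, |(unit i * reflect ε (unit 0 + unit 1)).re -
        (unit i * reflect ε (unit 0 + unit 1)).im| ≤ 3 ∧
      ((unit i * reflect ε (unit 0 + unit 1)).re - (unit i * reflect ε (unit 0 + unit 1)).im = 0 →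
        i = cond ε 1 0 ∨ i = cond ε 4 3) := by decide
  exact (h4 i ε).2 (Int.eq_zero_of_abs_lt_dvd h3 (by have := (h4 i ε).1; omega))

end Eis

/-! ### Computation of the symmetry groups -/

namespace CombMap

open Eis TetrahedralFrame

variable {M : CombMap} {L : AddSubgroup Eis}

namespace Dev

variable (D : Dev M L) {u w : Eis}

/-- Composing a lift with the half-turn about the origin gives another lift of the same symmetry. So
linear parts need to be considered only up to sign. -/
theorem IsLift.add_three {f : Equiv.Perm M.Dart} {ε : Bool} {i : ZMod 6} {l : Eis}
    (h : D.IsLift f ε (i + 3) l) : D.IsLift f ε i (-l) := by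
  intro v j
  rw [h, D.eq_iff]
  right
  have h6 : ∀ i t : ZMod 6, i + t = i + 3 + t + 3 := by decide
  refine ⟨h6 _ _, ?_⟩
  rw [unit_add_three]
  convert zero_mem (dbl L) using 1
  ring

theorem exists_lift_of_eq {f : M.symmetryGroup} {ε : Bool} (hε : M.Respects f.1 ε) {r : ZMod 6}
    (h : ∀ i, Preserves L ε i → i = r ∨ i = r + 3) :
    ∃ l ∈ L, Preserves L ε r ∧ D.IsLift f.1 ε r l := by
  obtain ⟨i, l, hl, hp, hf⟩ := D.exists_lift f.2.1 hε
  rcases h i hp with rfl | rfl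
  · exact ⟨l, hl, hp, hf⟩
  · exact ⟨-l, neg_mem hl, preserves_add_three.1 hp, hf.add_three D⟩

theorem preserves_zero : Preserves L false 0 := fun x => by
  rw [unit_zero, one_mul]
  rfl

theorem carries_translation (hb : IsBasis L u w) {f : Equiv.Perm M.Dart} {a b : ℤ}
    (h : D.IsLift f false 0 (a * u + b * w)) :
    D.Carries u w f false (Equiv.addLeft ((a, b) : ZMod 2 × ZMod 2)) := by
  refine h.carries D (a := 1) (b := 0) (a' := 0) (b' := 1) hb preserves_zero
    ((hb.mem_iff _).2 ⟨a, b, rfl⟩) ?_ ?_ rfl ?_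
  · simp [reflect, unit_zero]
  · simp [reflect, unit_zero]
  · intro x
    ext <;> simp [add_comm]

theorem exists_translation (hb : IsBasis L u w) (v : TetrahedralFrame) (x : ZMod 2 × ZMod 2) :
    ∃ f, D.rep hb v f = v.isometry (Equiv.addLeft x) false := by
  obtain ⟨f, hf, hl⟩ := D.exists_symmetry preserves_zero
    ((hb.mem_iff _).2 ⟨(x.1.val : ℤ), (x.2.val : ℤ), rfl⟩)
  refine ⟨f, ?_⟩
  rw [D.rep_eq hb v hf (D.carries_translation hb hl)]
  simp

theorem rep_of_rotation (hb : IsBasis L u w) (v : TetrahedralFrame)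
    (h : ∀ i, Preserves L false i → i = 0 ∨ i = 3) {f : M.symmetryGroup}
    (hf : M.Respects f.1 false) : ∃ x, D.rep hb v f = v.isometry (Equiv.addLeft x) false := by
  obtain ⟨l, hl, -, hlift⟩ := D.exists_lift_of_eq hf (r := 0) h
  obtain ⟨a, b, rfl⟩ := (hb.mem_iff l).1 hl
  exact ⟨_, D.rep_eq hb v hf (D.carries_translation hb hlift)⟩

include D in
theorem hasPointGroup_D2 (hb : IsBasis L u w)
    (h : ∀ ε i, Preserves L ε i → ε = false ∧ (i = 0 ∨ i = 3)) :
    M.HasPointGroup PointGroup.D2 := by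
  refine D.hasPointGroup hb standard (fun f => ?_) (PointGroup.D2_le fun x => ?_)
  · obtain ⟨ε, hε⟩ := exists_respects f
    obtain ⟨i, l, -, hp, -⟩ := D.exists_lift f.2.1 hε
    obtain ⟨rfl, -⟩ := h _ _ hp
    obtain ⟨x, hx⟩ := D.rep_of_rotation hb standard (fun i hi => (h _ _ hi).2) hε
    rw [hx]
    exact PointGroup.isometry_mem_D2 x
  · exact D.exists_translation hb standard x

theorem rep_of_reflection (hb : IsBasis L u w) (v : TetrahedralFrame) {r : ZMod 6}
    (h : ∀ i, Preserves L true i → i = r ∨ i = r + 3) {a b a' b' : ℤ}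
    (hu : unit r * star u = a * u + a' * w) (hw : unit r * star w = b * u + b' * w)
    {σ : Equiv.Perm (ZMod 2 × ZMod 2)} (hσ : ∀ x, σ x = (a * x.1 + b * x.2, a' * x.1 + b' * x.2))
    {f : M.symmetryGroup} (hf : M.Respects f.1 true) :
    ∃ x, D.rep hb v f = v.isometry (Equiv.addLeft x * σ) true := by
  obtain ⟨l, hl, hp, hlift⟩ := D.exists_lift_of_eq hf h
  obtain ⟨c, c', rfl⟩ := (hb.mem_iff l).1 hl
  refine ⟨(c, c'), D.rep_eq hb v hf (hlift.carries D hb hp hl hu hw rfl fun x => ?_)⟩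
  rw [Equiv.Perm.mul_apply, hσ]
  ext <;> simp [add_comm]

theorem exists_reflection (hb : IsBasis L u w) (v : TetrahedralFrame) {r : ZMod 6}
    {a b a' b' : ℤ}
    (hu : unit r * star u = a * u + a' * w) (hw : unit r * star w = b * u + b' * w)
    {σ : Equiv.Perm (ZMod 2 × ZMod 2)} (hσ : ∀ x, σ x = (a * x.1 + b * x.2, a' * x.1 + b' * x.2)) :
    ∃ f, D.rep hb v f = v.isometry σ true := by
  have hp : Preserves L true r := hb.preserves (ε := true) hu hw (by
    show unit r * star (unit r) = 1
    rw [star_unit, unit_mul, add_neg_cancel, unit_zero])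
  obtain ⟨f, hf, hl⟩ := D.exists_symmetry hp (zero_mem L)
  refine ⟨f, D.rep_eq hb v hf (hl.carries D (c := 0) (c' := 0) hb hp (zero_mem L) hu hw (by simp)
    fun x => ?_)⟩
  rw [hσ]
  simp

include D in
-- In a rectangular basis the reflection changes a sign only and is trivial on `L / 2 L`; in the
-- frame it becomes the central inversion.
theorem hasPointGroup_D2h (hb : IsBasis L u w) {r : ZMod 6}
    (h0 : ∀ i, Preserves L false i → i = 0 ∨ i = 3)
    (h : ∀ i, Preserves L true i → i = r ∨ i = r + 3)
    (hu : unit r * star u = u) (hw : unit r * star w = -w) :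
    M.HasPointGroup PointGroup.D2h := by
  have hu' : unit r * star u = (1 : ℤ) * u + (0 : ℤ) * w := by simp [hu]
  have hw' : unit r * star w = (0 : ℤ) * u + (-1 : ℤ) * w := by simp [hw]
  have hσ : ∀ x : ZMod 2 × ZMod 2, (1 : Equiv.Perm (ZMod 2 × ZMod 2)) x =
      (((1 : ℤ) : ZMod 2) * x.1 + ((0 : ℤ) : ZMod 2) * x.2,
        ((0 : ℤ) : ZMod 2) * x.1 + ((-1 : ℤ) : ZMod 2) * x.2) := by decide
  refine D.hasPointGroup hb standard (fun f => ?_) (PointGroup.D2h_le fun x ε => ?_)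
  · obtain ⟨ε, hε⟩ := exists_respects f
    cases ε
    · obtain ⟨x, hx⟩ := D.rep_of_rotation hb standard h0 hε
      rw [hx]
      exact PointGroup.isometry_mem_D2h x _
    · obtain ⟨x, hx⟩ := D.rep_of_reflection hb standard h hu' hw' hσ hε
      rw [hx, mul_one]
      exact PointGroup.isometry_mem_D2h x _
  · cases ε
    · exact D.exists_translation hb standard x
    · obtain ⟨f, hf⟩ := D.exists_translation hb standard x
      obtain ⟨g, hg⟩ := D.exists_reflection hb standard hu' hw' hσ
      refine ⟨f * g, ?_⟩
      rw [map_mul, hf, hg, ← isometry_mul, mul_one]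
      rfl

include D in
-- In a rhombic basis the reflection exchanges the coordinates of `L / 2 L`; in the frame it becomes
-- a mirror through two vertices of the tetrahedron.
theorem hasPointGroup_D2d (hb : IsBasis L u w) {r : ZMod 6}
    (h0 : ∀ i, Preserves L false i → i = 0 ∨ i = 3)
    (h : ∀ i, Preserves L true i → i = r ∨ i = r + 3)
    (hu : unit r * star u = w) (hw : unit r * star w = u) :
    M.HasPointGroup PointGroup.D2d := by
  have hu' : unit r * star u = (0 : ℤ) * u + (1 : ℤ) * w := by simp [hu]
  have hw' : unit r * star w = (1 : ℤ) * u + (0 : ℤ) * w := by simp [hw]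
  have hσ : ∀ x : ZMod 2 × ZMod 2, Equiv.prodComm (ZMod 2) (ZMod 2) x =
      (((0 : ℤ) : ZMod 2) * x.1 + ((1 : ℤ) : ZMod 2) * x.2,
        ((1 : ℤ) : ZMod 2) * x.1 + ((0 : ℤ) : ZMod 2) * x.2) := by decide
  refine D.hasPointGroup hb turned (fun f => ?_) (PointGroup.D2d_le (fun x => ?_) ?_)
  · obtain ⟨ε, hε⟩ := exists_respects f
    cases ε
    · obtain ⟨x, hx⟩ := D.rep_of_rotation hb turned h0 hε
      rw [hx]
      exact PointGroup.isometry_mem_D2d x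
    · obtain ⟨x, hx⟩ := D.rep_of_reflection hb turned h hu' hw' hσ hε
      rw [hx]
      exact PointGroup.isometry_prodComm_mem_D2d x
  · exact D.exists_translation hb turned x
  · exact D.exists_reflection hb turned hu' hw' hσ

end Dev

end CombMap

/-! ### The lattice of even elements and the group `T_d` -/

namespace Eis

open scoped QuadraticAlgebra

/-- The permutation of `Eis / 2` induced by `x ↦ ζ ^ i * reflect ε x + c`, in coordinates. -/
def affinePerm (i : ZMod 6) (ε : Bool) (c : ZMod 2 × ZMod 2) : Equiv.Perm (ZMod 2 × ZMod 2) where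
  toFun x := ((unit i).re * x.1 + (unit (i + turn ε 1)).re * x.2 + c.1,
    (unit i).im * x.1 + (unit (i + turn ε 1)).im * x.2 + c.2)
  invFun x :=
    ((unit (-turn ε i)).re * (x.1 - c.1) + (unit (-turn ε i + turn ε 1)).re * (x.2 - c.2),
    (unit (-turn ε i)).im * (x.1 - c.1) + (unit (-turn ε i + turn ε 1)).im * (x.2 - c.2))
  left_inv := by
    revert i ε c
    unfold Function.LeftInverse
    decide
  right_inv := by
    revert i ε c
    unfold Function.RightInverse Function.LeftInverse
    decide

/-- Rotations and translations act on `L / 2 L` by even permutations and reflections by odd ones.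
This is why the full symmetry group of the even lattice is represented in `T_d`. -/
theorem sign_affinePerm (i : ZMod 6) (ε : Bool) (c : ZMod 2 × ZMod 2) :
    cond ε (-1) 1 * Equiv.Perm.sign (affinePerm i ε c) = 1 := by
  revert i ε c; decide

theorem exists_swap_eq_affinePerm (x y : ZMod 2 × ZMod 2) (h : x ≠ y) :
    ∃ i c, Equiv.swap x y = affinePerm i true c := by
  have : ∀ x y : ZMod 2 × ZMod 2, x ≠ y → ∃ i c, ∀ z, Equiv.swap x y z = affinePerm i true c z := by
    decide
  obtain ⟨i, c, hic⟩ := this x y h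
  exact ⟨i, c, Equiv.ext hic⟩

theorem add_self_eq (z : Eis) : z + z = (z.re : Eis) * ⟨2, 0⟩ + (z.im : Eis) * ⟨0, ((2 : ℕ) : ℤ)⟩ := by
  ext <;> simp <;> ring

theorem mem_lattice_zero_two {x : Eis} : x ∈ lattice 0 2 ↔ ∃ y, x = y + y := by
  rw [mem_lattice]
  constructor
  · rintro ⟨t, ht, p, hp⟩
    refine ⟨⟨p, t⟩, ?_⟩
    ext
    · simp at hp ⊢
      omega
    · simp at ht ⊢
      omega
  · rintro ⟨y, rfl⟩
    exact ⟨y.im, by simp; ring, y.re, by simp; ring⟩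

theorem preserves_lattice_zero_two (i : ZMod 6) (ε : Bool) : Preserves (lattice 0 2) ε i := by
  intro x
  rw [mem_lattice_zero_two, mem_lattice_zero_two]
  constructor
  · rintro ⟨y, hy⟩
    refine ⟨reflect ε (unit (-i) * y), ?_⟩
    rw [← reflect_add, ← mul_add, ← hy, unit_neg_mul, reflect_reflect]
  · rintro ⟨y, rfl⟩
    exact ⟨unit i * reflect ε y, by rw [reflect_add, mul_add]⟩

end Eis

namespace CombMap

open Eis TetrahedralFrame
open scoped QuadraticAlgebra

variable {M : CombMap}

namespace Dev

/-- A reflection would have to fix the direction of the vector 2, hence be conjugation up to sign;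
but conjugation turns `m ζ` into `m - m ζ`, which has the wrong parity. -/
theorem hasPointGroup_lattice_odd {m : ℕ} (D : Dev M (lattice 0 m)) (hm : 3 ≤ m) (hodd : Odd m) :
    M.HasPointGroup PointGroup.D2 := by
  refine D.hasPointGroup_D2 (isBasis_lattice (t := 0) (by omega) (by simp)) fun ε i h => ?_
  have hi := preserves_lattice (by omega) (Or.inl rfl) (by omega) h
  refine ⟨?_, hi⟩
  cases ε
  · rfl
  exfalso
  have h0 : Preserves (lattice 0 m) true 0 := by
    rcases hi with rfl | rfl
    · exact h
    · exact preserves_add_three.1 h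
  have h1 := (h0 ⟨0, m⟩).2 ⟨1, by simp, by simp⟩
  obtain ⟨t, ht, h2⟩ := h1
  simp [reflect, unit_zero] at h2
  obtain ⟨n, rfl⟩ := hodd
  omega

theorem hasPointGroup_lattice_even {s h : ℤ} {m : ℕ} (D : Dev M (lattice s m)) (hm : 2 ≤ m)
    (hs : s = 0 ∨ s = 1) (h02 : ¬ (s = 0 ∧ m = 2)) (hh : (m : ℤ) = 2 * h) :
    (2 ∣ s + h → M.HasPointGroup PointGroup.D2h) ∧
      (2 ∣ s + h - 1 → M.HasPointGroup PointGroup.D2d) := by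
  have h0 : ∀ ε i, Preserves (lattice s m) ε i → i = 0 ∨ i = 3 := fun ε i h =>
    preserves_lattice hm hs h02 h
  constructor
  · intro h2
    refine D.hasPointGroup_D2h (isBasis_lattice (t := -h) (by omega) (by omega)) (r := 0) (h0 _)
      (h0 _) ?_ ?_
    · rw [unit_zero, one_mul]
      ext <;> simp
    · rw [unit_zero, one_mul]
      ext
      · simp
        omega
      · simp
  · intro h2
    refine D.hasPointGroup_D2d (isBasis_lattice_rhombic (by omega) h2) (r := 0) (h0 _) (h0 _) ?_ ?_
    · rw [unit_zero, one_mul]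
      ext
      · simp
        omega
      · simp
    · rw [unit_zero, one_mul]
      ext
      · simp
        omega
      · simp

theorem hasPointGroup_skewLattice {k : ℕ} (D : Dev M (skewLattice k)) (hk : 4 ≤ k) :
    (Even k → M.HasPointGroup PointGroup.D2h) ∧ (Odd k → M.HasPointGroup PointGroup.D2d) := by
  have h0 : ∀ i, Preserves (skewLattice k) false i → i = 0 ∨ i = 3 := fun i h =>
    preserves_skewLattice hk h
  have h1 : ∀ i, Preserves (skewLattice k) true i → i = 1 ∨ i = 1 + 3 := fun i h =>
    preserves_skewLattice hk h
  constructor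
  · rintro ⟨h, hh⟩
    refine D.hasPointGroup_D2h (isBasis_skewLattice (h := h) (by omega) (by omega)) h0 h1 ?_ ?_
    · rw [unit_one_eq]
      ext <;> simp
    · rw [unit_one_eq]
      ext <;> simp
  · rintro ⟨h, hh⟩
    refine D.hasPointGroup_D2d (isBasis_skewLattice_rhombic (h := h) (by omega)) h0 h1 ?_ ?_
    · rw [unit_one_eq]
      ext <;> simp <;> ring
    · rw [unit_one_eq]
      ext <;> simp

theorem exists_affinePerm (D : Dev M (lattice 0 2)) (hb : IsBasis (lattice 0 2) ⟨2, 0⟩ ⟨0, (2 : ℕ)⟩)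
    {f : Equiv.Perm M.Dart} {ε : Bool} {i : ZMod 6} {c c' : ℤ}
    (hf : D.IsLift f ε i (c * ⟨2, 0⟩ + c' * ⟨0, (2 : ℕ)⟩)) :
    D.Carries ⟨2, 0⟩ ⟨0, (2 : ℕ)⟩ f ε (affinePerm i ε (c, c')) := by
  refine hf.carries D hb (preserves_lattice_zero_two _ _) ((hb.mem_iff _).2 ⟨c, c', rfl⟩)
    (a := (unit i).re) (a' := (unit i).im) (b := (unit (i + turn ε 1)).re)
    (b' := (unit (i + turn ε 1)).im) ?_ ?_ rfl fun x => ?_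
  · rw [← add_self_eq, ← mul_one (unit i + unit i), add_mul, ← mul_add]
    congr 1
    cases ε
    · rfl
    · decide
  · rw [← add_self_eq, ← unit_mul, ← mul_add, ← reflect_unit, ← reflect_add]
    rfl
  · rfl

/-- Every isometry of the tiling that fixes the origin preserves the even lattice. Transpositions of
triangles come from reflections, and they generate all of `T_d`. -/
theorem hasPointGroup_lattice_zero_two (D : Dev M (lattice 0 2)) :
    M.HasPointGroup PointGroup.Td := by
  have hb : IsBasis (lattice 0 2) ⟨2, 0⟩ ⟨0, (2 : ℕ)⟩ := isBasis_lattice (by norm_num) (by simp)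
  refine D.hasPointGroup hb standard (fun f => ?_) fun A hA => ?_
  · obtain ⟨ε, hε⟩ := exists_respects f
    obtain ⟨i, l, hl, hp, hlift⟩ := D.exists_lift f.2.1 hε
    obtain ⟨c, c', rfl⟩ := (hb.mem_iff l).1 hl
    rw [D.rep_eq hb standard hε (D.exists_affinePerm hb hlift), PointGroup.mem_Td_iff]
    exact ⟨_, _, sign_affinePerm _ _ _, rfl⟩
  · obtain ⟨σ, ε, hε, rfl⟩ := PointGroup.mem_Td_iff.1 hA
    clear hA
    induction σ using Equiv.Perm.swap_induction_on generalizing ε with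
    | one =>
      have : ε = false := by
        cases ε
        · rfl
        · rw [map_one] at hε
          exact absurd hε (by decide)
      subst this
      convert one_mem (D.rep hb standard).range
      symm
      rw [isometry_eq_iff]
      intro x
      simp
    | swap_mul f x y hxy ih =>
      rw [Equiv.Perm.sign_mul, Equiv.Perm.sign_swap hxy] at hε
      have h1 : xor true (!ε) = ε := by cases ε <;> rfl
      rw [← h1, isometry_mul]
      refine mul_mem ?_ (ih _ ?_)
      · obtain ⟨i, c, hic⟩ := exists_swap_eq_affinePerm x y hxy
        obtain ⟨g, hg, hl⟩ := D.exists_symmetry (preserves_lattice_zero_two i true)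
          ((hb.mem_iff _).2 ⟨(c.1.val : ℤ), (c.2.val : ℤ), rfl⟩)
        refine ⟨g, ?_⟩
        rw [D.rep_eq hb standard hg (D.exists_affinePerm hb hl), hic]
        simp
      · cases ε <;> simpa using hε

/-- Two developments of the same map differ by a rotation. -/
theorem exists_eq_rotate {L L' : AddSubgroup Eis} (D : Dev M L) (D' : Dev M L') :
    ∃ i, L' = Eis.rotate i L := by
  obtain ⟨l, i, hli⟩ := D.surj (D'.φ 0 0)
  have h1 := (D.isDev.comp_rotate l i).eq D'.isDev (v₀ := 0) (j₀ := 0) (by simpa using hli)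
  have h2 : ∀ v, v ∈ L' ↔ unit i * v + l ∈ L := by
    intro v
    rw [← D'.add_three_iff (j := 0), ← D.add_three_iff (j := i + 0), ← h1, ← h1, ← add_assoc]
  have h3 : l ∈ L := by simpa using (h2 0).1 (zero_mem _)
  refine ⟨i, ?_⟩
  ext x
  rw [h2, mem_rotate, AddSubgroup.add_mem_cancel_right _ h3]

end Dev

end CombMap

/-! ### Truncation of a cubic map -/

namespace CombMap

variable {H : CombMap} {S : Set H.Vertex}

/-- A dart of the truncation that is a dart of the original map. -/
abbrev truncOld (S : Set H.Vertex) (d : H.Dart) : (H.truncate S).Dart := Sum.inl d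

/-- A dart of the truncation that is a side of a new triangle. -/
abbrev truncNew (d : H.Dart) (h : H.vert d ∈ S) (b : Bool) : (H.truncate S).Dart :=
  Sum.inr (⟨d, h⟩, b)

theorem truncate_opp_old (d : H.Dart) :
    (H.truncate S).opp (truncOld S d) = truncOld S (H.opp d) := rfl

theorem truncate_opp_false (d : H.Dart) (h : H.vert d ∈ S) :
    (H.truncate S).opp (truncNew d h false) =
      truncNew (H.rot d) (by rwa [vert_rot]) true := rfl

theorem truncate_opp_true (d : H.Dart) (h : H.vert d ∈ S) :
    (H.truncate S).opp (truncNew d h true) =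
      truncNew (H.rot.symm d) (by rwa [vert_rot_symm]) false := rfl

theorem truncate_rot_old_of_mem (d : H.Dart) (h : H.vert d ∈ S) :
    (H.truncate S).rot (truncOld S d) = truncNew d h false := 
  dif_pos h

theorem truncate_rot_old_of_notMem (d : H.Dart) (h : H.vert d ∉ S) :
    (H.truncate S).rot (truncOld S d) = truncOld S (H.rot d) := 
  dif_neg h

theorem truncate_rot_false (d : H.Dart) (h : H.vert d ∈ S) :
    (H.truncate S).rot (truncNew d h false) = truncNew d h true := rfl

theorem truncate_rot_true (d : H.Dart) (h : H.vert d ∈ S) :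
    (H.truncate S).rot (truncNew d h true) = truncOld S d := rfl

theorem truncate_next_old_of_mem (d : H.Dart) (h : H.vert (H.opp d) ∈ S) :
    (H.truncate S).next (truncOld S d) = truncNew (H.opp d) h false :=
  truncate_rot_old_of_mem _ h

theorem truncate_next_old_of_notMem (d : H.Dart) (h : H.vert (H.opp d) ∉ S) :
    (H.truncate S).next (truncOld S d) = truncOld S (H.next d) :=
  truncate_rot_old_of_notMem _ h

theorem truncate_next_false (d : H.Dart) (h : H.vert d ∈ S) :
    (H.truncate S).next (truncNew d h false) = truncOld S (H.rot d) := rfl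

theorem truncate_next_true (d : H.Dart) (h : H.vert d ∈ S) :
    (H.truncate S).next (truncNew d h true) =
      truncNew (H.rot.symm d) (by rwa [vert_rot_symm]) true := rfl

theorem truncNew_inj {d e : H.Dart} {h : H.vert d ∈ S} {h' : H.vert e ∈ S} {b c : Bool} :
    truncNew d h b = truncNew e h' c ↔ d = e ∧ b = c := by
  constructor
  · intro he
    have h1 := Sum.inr_injective he
    exact ⟨congrArg (fun z => z.1.1) h1, congrArg Prod.snd h1⟩
  · rintro ⟨rfl, rfl⟩
    rfl

theorem truncOld_injective : Function.Injective (truncOld S) := fun _ _ h => Sum.inl_injective h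

theorem truncate_cases {p : (H.truncate S).Dart → Prop} (h1 : ∀ d, p (truncOld S d))
    (h2 : ∀ d h, p (truncNew d h false)) (h3 : ∀ d h, p (truncNew d h true)) : ∀ x, p x
  | Sum.inl d => h1 d
  | Sum.inr (⟨d, h⟩, false) => h2 d h
  | Sum.inr (⟨d, h⟩, true) => h3 d h

theorem truncate_face_old_next (d : H.Dart) :
    (H.truncate S).face (truncOld S (H.next d)) = (H.truncate S).face (truncOld S d) := by
  rw [← face_next (truncOld S d)]
  by_cases h : H.vert (H.opp d) ∈ S
  · rw [truncate_next_old_of_mem d h, ← face_next (truncNew (H.opp d) h false)]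
    rfl
  · rw [truncate_next_old_of_notMem d h]

/-- The old face to which a dart of the truncation belongs, if any. -/
def oldFace : (H.truncate S).Dart → Option H.Face
  | Sum.inl d => some (H.face d)
  | Sum.inr (d, false) => some (H.face (H.rot d.1))
  | Sum.inr (_, true) => none

theorem oldFace_next (x : (H.truncate S).Dart) : oldFace ((H.truncate S).next x) = oldFace x := by
  revert x
  refine truncate_cases (fun d => ?_) (fun d h => rfl) fun d h => rfl
  by_cases h : H.vert (H.opp d) ∈ S
  · rw [truncate_next_old_of_mem d h]
    show some (H.face (H.next d)) = some (H.face d)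
    rw [face_next]
  · rw [truncate_next_old_of_notMem d h]
    show some (H.face (H.next d)) = some (H.face d)
    rw [face_next]

theorem oldFace_eq_of_face_eq {x y : (H.truncate S).Dart}
    (h : (H.truncate S).face x = (H.truncate S).face y) : oldFace x = oldFace y := by
  obtain ⟨k, -, rfl⟩ := exists_iterate_next_of_face_eq h
  clear h
  induction k with
  | zero => rfl
  | succ k ih => rw [Function.iterate_succ_apply', oldFace_next, ih]

theorem truncate_face_old_eq_iff {d e : H.Dart} :
    (H.truncate S).face (truncOld S d) = (H.truncate S).face (truncOld S e) ↔
      H.face d = H.face e := by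
  constructor
  · intro h
    exact Option.some_injective _ (oldFace_eq_of_face_eq h)
  · intro h
    obtain ⟨k, -, rfl⟩ := exists_iterate_next_of_face_eq h
    clear h
    induction k with
    | zero => rfl
    | succ k ih => rw [Function.iterate_succ_apply', truncate_face_old_next, ih]

/-- Each truncated corner adds one side to the face: the new side that precedes the old dart
starting at this corner. -/
theorem truncate_size_old (d : H.Dart) :
    (H.truncate S).size ((H.truncate S).face (truncOld S d)) =
      H.size (H.face d) + {e | H.face e = H.face d ∧ H.vert e ∈ S}.ncard := by
  have hset : {x | (H.truncate S).face x = (H.truncate S).face (truncOld S d)} =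
      truncOld S '' {e | H.face e = H.face d} ∪
        (H.truncate S).next.symm '' (truncOld S '' {e | H.face e = H.face d ∧ H.vert e ∈ S}) := by
    ext x
    revert x
    refine truncate_cases (fun e => ?_) (fun e h => ?_) fun e h => ?_
    · simp only [Set.mem_ofPred_eq, truncate_face_old_eq_iff, Set.mem_union, Set.mem_image]
      constructor
      · exact fun h => Or.inl ⟨e, h, rfl⟩
      · rintro (⟨f, h, hf⟩ | ⟨y, ⟨f, ⟨h, hS⟩, rfl⟩, hf⟩)
        · cases hf
          exact h
        · rw [Equiv.symm_apply_eq] at hf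
          by_cases he : H.vert (H.opp e) ∈ S
          · rw [truncate_next_old_of_mem e he] at hf
            cases hf
          · rw [truncate_next_old_of_notMem e he] at hf
            cases hf
            rwa [face_next] at h
    · simp only [Set.mem_ofPred_eq, Set.mem_union, Set.mem_image]
      rw [← face_next (truncNew e h false), truncate_next_false, truncate_face_old_eq_iff]
      constructor
      · intro h1
        refine Or.inr ⟨_, ⟨_, ⟨h1, by rwa [vert_rot]⟩, rfl⟩, ?_⟩
        rw [Equiv.symm_apply_eq, truncate_next_false]
      · rintro (⟨f, h, hf⟩ | ⟨y, ⟨f, ⟨h, hS⟩, rfl⟩, hf⟩)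
        · cases hf
        · rw [Equiv.symm_apply_eq, truncate_next_false] at hf
          cases hf
          exact h
    · simp only [Set.mem_ofPred_eq, Set.mem_union, Set.mem_image]
      constructor
      · intro h1
        cases oldFace_eq_of_face_eq h1
      · rintro (⟨f, h, hf⟩ | ⟨y, ⟨f, ⟨h, hS⟩, rfl⟩, hf⟩)
        · cases hf
        · rw [Equiv.symm_apply_eq, truncate_next_true] at hf
          cases hf
  unfold size
  rw [hset, Set.ncard_union_eq, Set.ncard_image_of_injective _ truncOld_injective,
    Set.ncard_image_of_injective _ (Equiv.injective _),
    Set.ncard_image_of_injective _ truncOld_injective]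
  rw [Set.disjoint_left]
  rintro _ ⟨e, h, rfl⟩ ⟨y, ⟨f, ⟨h', hS⟩, rfl⟩, hf⟩
  rw [Equiv.symm_apply_eq] at hf
  by_cases he : H.vert (H.opp e) ∈ S
  · rw [truncate_next_old_of_mem e he] at hf
    cases hf
  · rw [truncate_next_old_of_notMem e he] at hf
    cases hf
    rw [vert_next] at hS
    exact he hS

theorem truncate_size_false (d : H.Dart) (h : H.vert d ∈ S) :
    (H.truncate S).size ((H.truncate S).face (truncNew d h false)) =
      H.size (H.face (H.opp d)) + {e | H.face e = H.face (H.opp d) ∧ H.vert e ∈ S}.ncard := by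
  rw [← face_next (truncNew d h false), truncate_next_false, truncate_size_old, face_rot]

theorem Cubic.truncate_size_true (hc : H.Cubic) (d : H.Dart) (h : H.vert d ∈ S) :
    (H.truncate S).size ((H.truncate S).face (truncNew d h true)) = 3 := by
  rw [size_eq_three]
  simp only [truncate_next_true, truncNew_inj, and_true, ne_eq]
  constructor
  · rw [← hc.rot_rot (H.rot.symm _), Equiv.apply_symm_apply, Equiv.apply_symm_apply]
  · rw [← hc.rot_rot]
    exact hc.rot_rot_ne d

theorem Cubic.truncate (hc : H.Cubic) (S : Set H.Vertex) : (H.truncate S).Cubic := by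
  refine truncate_cases (fun d => ?_) (fun d h => ?_) fun d h => ?_
  · by_cases h : H.vert d ∈ S
    · rw [truncate_rot_old_of_mem d h]
      exact ⟨rfl, Sum.inr_ne_inl⟩
    · rw [truncate_rot_old_of_notMem d h, truncate_rot_old_of_notMem _ (by rwa [vert_rot]),
        truncate_rot_old_of_notMem _ (by rwa [vert_rot, vert_rot])]
      exact ⟨congrArg _ (hc d).1, fun he => (hc d).2 (Sum.inl_injective he)⟩
  · rw [truncate_rot_false, truncate_rot_true]
    exact ⟨truncate_rot_old_of_mem d h, fun he => by cases (truncNew_inj.1 he).2⟩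
  · rw [truncate_rot_true, truncate_rot_old_of_mem d h]
    exact ⟨rfl, Sum.inl_ne_inr⟩

theorem truncate_connected (S : Set H.Vertex)
    (h : ∀ d e : H.Dart, ∃ g ∈ Subgroup.closure {H.rot, H.opp}, g d = e) :
    ∀ d e : (H.truncate S).Dart,
      ∃ g ∈ Subgroup.closure {(H.truncate S).rot, (H.truncate S).opp}, g d = e := by
  rw [connected_iff] at h ⊢
  intro P hr ho hP
  have hnew : ∀ d hd, (P (truncOld S d) → P (truncNew d hd false)) ∧
      (P (truncNew d hd false) → P (truncNew d hd true)) ∧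
      (P (truncNew d hd true) → P (truncOld S d)) := by
    intro d hd
    refine ⟨fun h => ?_, fun h => hr _ h, fun h => hr _ h⟩
    rw [← truncate_rot_old_of_mem d hd]
    exact hr _ h
  have hold : ∀ d, P (truncOld S d) := by
    refine h _ (fun d hd => ?_) (fun d hd => ho _ hd) ?_
    · by_cases h : H.vert d ∈ S
      · have h1 := ho _ ((hnew d h).1 hd)
        rw [truncate_opp_false] at h1
        exact hr _ h1
      · have := hr _ hd
        rwa [truncate_rot_old_of_notMem d h] at this
    · obtain ⟨x, hx⟩ := hP
      revert hx
      revert x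
      refine truncate_cases (fun d h => ⟨d, h⟩) (fun d h hx => ⟨d, ?_⟩) fun d h hx => ⟨d, ?_⟩
      · exact (hnew d h).2.2 ((hnew d h).2.1 hx)
      · exact (hnew d h).2.2 hx
  exact truncate_cases hold (fun d h => (hnew d h).1 (hold d)) fun d h =>
    (hnew d h).2.1 ((hnew d h).1 (hold d))

theorem card_truncate_dart : Nat.card (H.truncate S).Dart =
    Nat.card H.Dart + 2 * {d | H.vert d ∈ S}.ncard := by
  show Nat.card (H.Dart ⊕ ({d : H.Dart // H.vert d ∈ S} × Bool)) = _
  rw [Nat.card_sum, Nat.card_prod, mul_comm, Nat.card_eq_fintype_card (α := Bool), Fintype.card_bool]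
  rfl

/-- Truncating at `S` makes every old face a hexagon. -/
def TruncatesToHexagons (H : CombMap) (S : Set H.Vertex) : Prop :=
  ∀ d, H.size (H.face d) + {e | H.face e = H.face d ∧ H.vert e ∈ S}.ncard = 6

theorem TruncatesToHexagons.size_three_iff (hc : H.Cubic) (h : H.TruncatesToHexagons S)
    (x : (H.truncate S).Dart) : (H.truncate S).size ((H.truncate S).face x) = 3 ↔
      ∃ d hd, x = truncNew d hd true := by
  revert x
  refine truncate_cases (fun d => ?_) (fun d hd => ?_) fun d hd => ?_
  · rw [truncate_size_old, h]
    simp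
  · rw [truncate_size_false, h]
    refine iff_of_false (by norm_num) ?_
    rintro ⟨e, he, h1⟩
    cases (truncNew_inj.1 h1).2
  · exact iff_of_true (hc.truncate_size_true d hd) ⟨d, hd, rfl⟩

/-- The triangles are exactly the new faces, and across each of their sides lies an old face. So no
two are adjacent, no unit lies in `L`, and the count of triangle darts gives 12 darts at truncated
vertices. -/
theorem TruncatesToHexagons.exists_dev (hc : H.Cubic)
    (hconn : ∀ d e : H.Dart, ∃ g ∈ Subgroup.closure {H.rot, H.opp}, g d = e)
    (h : H.TruncatesToHexagons S) (hS : ∃ d, H.vert d ∈ S) :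
    ∃ L, Nonempty (Dev (H.truncate S) L) ∧ (∀ j, Eis.unit j ∉ L) ∧
      {d | H.vert d ∈ S}.ncard = 12 := by
  have hs : ∀ F, (H.truncate S).size F = 3 ∨ (H.truncate S).size F = 6 := by
    intro F
    obtain ⟨x, rfl⟩ := face_surj F
    revert x
    refine truncate_cases (fun d => Or.inr ?_) (fun d hd => Or.inr ?_) fun d hd => Or.inl ?_
    · rw [truncate_size_old, h]
    · rw [truncate_size_false, h]
    · exact hc.truncate_size_true _ _
  obtain ⟨d, hd⟩ := hS
  obtain ⟨L, ⟨D⟩⟩ := CombMap.exists_dev (hc.truncate S) hs (truncate_connected S hconn)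
    ⟨_, hc.truncate_size_true d hd⟩
  refine ⟨L, ⟨D⟩, fun j hj => ?_, ?_⟩
  · have h1 := (D.size_three_iff (v := 0) (j := j)).2 (zero_mem _)
    have h2 := (D.size_three_iff (v := 0 + Eis.unit j) (j := j + 3)).2 (by rwa [zero_add])
    rw [D.isDev.2] at h2
    obtain ⟨e, he, h3⟩ := (h.size_three_iff hc _).1 h1
    obtain ⟨f, hf, h4⟩ := (h.size_three_iff hc _).1 h2
    rw [h3, truncate_opp_true] at h4
    cases (truncNew_inj.1 h4).2
  · rw [← D.ncard_triangle_darts]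
    have : {x | (H.truncate S).size ((H.truncate S).face x) = 3} =
        (fun d : {d // H.vert d ∈ S} => truncNew d.1 d.2 true) '' Set.univ := by
      ext x
      rw [Set.mem_ofPred_eq, h.size_three_iff hc]
      simp [eq_comm]
    rw [this, Set.ncard_image_of_injective, Set.ncard_univ]
    · rfl
    · intro a b hab
      exact Subtype.ext (truncNew_inj.1 hab).1

theorem size_eq_three_of_equiv {M N : CombMap} {e : M.Dart ≃ N.Dart}
    (ho : ∀ d, e (M.opp d) = N.opp (e d)) (hr : ∀ d, e (M.rot d) = N.rot (e d)) (d : M.Dart) :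
    N.size (N.face (e d)) = 3 ↔ M.size (M.face d) = 3 := by
  have hn : ∀ d, N.next (e d) = e (M.next d) := fun d => by
    rw [next_apply, next_apply, hr, ho]
  rw [size_eq_three, size_eq_three, hn, hn, hn, ne_eq, e.injective.eq_iff, e.injective.eq_iff]

theorem size_eq_three_of_equiv_symm {M N : CombMap} {e : M.Dart ≃ N.Dart}
    (ho : ∀ d, e (M.opp d) = N.opp (e d)) (hr : ∀ d, e (M.rot d) = N.rot.symm (e d)) (d : M.Dart) :
    N.size (N.face (N.opp (e d))) = 3 ↔ M.size (M.face d) = 3 := by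
  have hn : ∀ d, N.next (N.opp (e (M.next d))) = N.opp (e d) := fun d => by
    rw [next_opp, next_apply, hr, Equiv.apply_symm_apply, ho]
  have h1 : N.next (N.next (N.next (N.opp (e (M.next (M.next (M.next d))))))) = N.opp (e d) := by
    rw [hn, hn, hn]
  rw [size_eq_three, size_eq_three]
  conv_lhs => rw [← hn d]
  have h2 : N.next (N.next (N.next (N.next (N.opp (e (M.next d)))))) =
      N.next (N.opp (e (M.next d))) ↔ M.next (M.next (M.next d)) = d := by
    rw [hn]
    nth_rewrite 2 [← h1]
    rw [N.next.injective.eq_iff, N.next.injective.eq_iff, N.next.injective.eq_iff,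
      N.opp.injective.eq_iff, e.injective.eq_iff, eq_comm]
  have h3 : N.next (N.next (N.opp (e (M.next d)))) = N.next (N.opp (e (M.next d))) ↔
      M.next d = d := by
    rw [N.next.injective.eq_iff, hn, N.opp.injective.eq_iff, e.injective.eq_iff, eq_comm]
  rw [h2, ne_eq, h3]

/-- This characterisation of old darts uses triangles only, so every isomorphism of truncations
respects it. -/
theorem TruncatesToHexagons.exists_old_iff (hc : H.Cubic) (h : H.TruncatesToHexagons S)
    (x : (H.truncate S).Dart) : (∃ d, x = truncOld S d) ↔
      ¬ ((H.truncate S).size ((H.truncate S).face x) = 3 ∨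
        (H.truncate S).size ((H.truncate S).face ((H.truncate S).opp x)) = 3) := by
  rw [h.size_three_iff hc, h.size_three_iff hc]
  revert x
  refine truncate_cases (fun d => ?_) (fun d hd => ?_) fun d hd => ?_
  · refine iff_of_true ⟨d, rfl⟩ ?_
    rintro (⟨e, he, h1⟩ | ⟨e, he, h1⟩) <;> cases h1
  · refine iff_of_false ?_ fun h1 => h1 (Or.inr ⟨_, _, truncate_opp_false d hd⟩)
    rintro ⟨e, h1⟩
    cases h1
  · refine iff_of_false ?_ fun h1 => h1 (Or.inl ⟨_, _, rfl⟩)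
    rintro ⟨e, h1⟩
    cases h1

theorem truncate_rot_symm_old_of_mem (d : H.Dart) (h : H.vert d ∈ S) :
    (H.truncate S).rot.symm (truncOld S d) = truncNew d h true := by
  rw [Equiv.symm_apply_eq]
  rfl

theorem truncate_rot_symm_old_of_notMem (d : H.Dart) (h : H.vert d ∉ S) :
    (H.truncate S).rot.symm (truncOld S d) = truncOld S (H.rot.symm d) := by
  rw [Equiv.symm_apply_eq, truncate_rot_old_of_notMem _ (by rwa [vert_rot_symm]),
    Equiv.apply_symm_apply]

/-- An isomorphism of the truncations maps old darts to old darts, and the rotation of the original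
map can be recovered from that of the truncation. -/
theorem TruncatesToHexagons.iso_of_truncate_iso (hc : H.Cubic) (h : H.TruncatesToHexagons S)
    {H' : CombMap} {S' : Set H'.Vertex} (hc' : H'.Cubic) (h' : H'.TruncatesToHexagons S')
    (hiso : (H.truncate S).Iso (H'.truncate S')) : H.Iso H' := by
  obtain ⟨e, ho, hr⟩ := hiso
  have hold : ∀ x, (∃ d, x = truncOld S d) ↔ ∃ d, e x = truncOld S' d := by
    intro x
    rw [h.exists_old_iff hc, h'.exists_old_iff hc']
    rcases hr with hr | hr
    · rw [size_eq_three_of_equiv ho hr, ← ho, size_eq_three_of_equiv ho hr]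
    · rw [size_eq_three_of_equiv_symm ho hr, ← size_eq_three_of_equiv_symm ho hr (CombMap.opp _ x),
        ho, CombMap.opp_opp, or_comm]
  have hf : ∀ d, ∃ d', e (truncOld S d) = truncOld S' d' := fun d => (hold _).1 ⟨d, rfl⟩
  choose f hf using hf
  have hbij : Function.Bijective f := by
    constructor
    · intro d d' hd
      apply truncOld_injective (S := S)
      apply e.injective
      rw [hf, hf, hd]
    · intro d'
      obtain ⟨d, hd⟩ := (hold (e.symm (truncOld S' d'))).2 ⟨d', Equiv.apply_symm_apply _ _⟩
      refine ⟨d, truncOld_injective (S := S') ?_⟩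
      rw [← hf, ← hd, Equiv.apply_symm_apply]
  refine ⟨Equiv.ofBijective f hbij, fun d => ?_, ?_⟩
  · apply truncOld_injective (S := S')
    show truncOld S' (f (H.opp d)) = truncOld S' (H'.opp (f d))
    rw [← hf, ← truncate_opp_old, ho, hf]
    rfl
  · refine hr.imp (fun hr d => ?_) fun hr d => ?_
    · apply truncOld_injective (S := S')
      show truncOld S' (f (H.rot d)) = truncOld S' (H'.rot (f d))
      rw [← hf]
      by_cases hd : H.vert d ∈ S
      -- At a truncated vertex the next old dart is reached by going along one side of the new
      -- triangle.
      · have h1 : truncOld S (H.rot d) = (H.truncate S).rot ((H.truncate S).opp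
            ((H.truncate S).rot (truncOld S d))) := by
          rw [truncate_rot_old_of_mem d hd]
          rfl
        rw [h1, hr, ho, hr, hf]
        by_cases hd' : H'.vert (f d) ∈ S'
        · rw [truncate_rot_old_of_mem _ hd']
          rfl
        · exfalso
          have h2 := (hold ((H.truncate S).rot (truncOld S d))).2
            ⟨H'.rot (f d), by rw [hr, hf, truncate_rot_old_of_notMem _ hd']⟩
          obtain ⟨y, hy⟩ := h2
          rw [truncate_rot_old_of_mem d hd] at hy
          cases hy
      · rw [← truncate_rot_old_of_notMem d hd, hr, hf]
        by_cases hd' : H'.vert (f d) ∈ S'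
        · exfalso
          obtain ⟨y, hy⟩ := (hold _).1 ⟨_, truncate_rot_old_of_notMem d hd⟩
          rw [hr, hf, truncate_rot_old_of_mem _ hd'] at hy
          cases hy
        · rw [truncate_rot_old_of_notMem _ hd']
    · apply truncOld_injective (S := S')
      show truncOld S' (f (H.rot d)) = truncOld S' (H'.rot.symm (f d))
      rw [← hf]
      by_cases hd : H.vert d ∈ S
      · have h1 : truncOld S (H.rot d) = (H.truncate S).rot ((H.truncate S).opp
            ((H.truncate S).rot (truncOld S d))) := by
          rw [truncate_rot_old_of_mem d hd]
          rfl
        rw [h1, hr, ho, hr, hf]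
        by_cases hd' : H'.vert (f d) ∈ S'
        · rw [truncate_rot_symm_old_of_mem _ hd', truncate_opp_true, Equiv.symm_apply_eq,
            truncate_rot_old_of_mem _ (by rwa [vert_rot_symm])]
        · exfalso
          have h2 := (hold ((H.truncate S).rot (truncOld S d))).2
            ⟨H'.rot.symm (f d), by rw [hr, hf, truncate_rot_symm_old_of_notMem _ hd']⟩
          obtain ⟨y, hy⟩ := h2
          rw [truncate_rot_old_of_mem d hd] at hy
          cases hy
      · rw [← truncate_rot_old_of_notMem d hd, hr, hf]
        by_cases hd' : H'.vert (f d) ∈ S'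
        · exfalso
          obtain ⟨y, hy⟩ := (hold _).1 ⟨_, truncate_rot_old_of_notMem d hd⟩
          rw [hr, hf, truncate_rot_symm_old_of_mem _ hd'] at hy
          cases hy
        · rw [truncate_rot_symm_old_of_notMem _ hd']

end CombMap

/-! ### Short vectors in the lattice of a truncation -/

namespace CombMap

open Eis

variable {H : CombMap} {S : Set H.Vertex}

theorem TruncatesToHexagons.exists_new_of_unit (hc : H.Cubic) (h : H.TruncatesToHexagons S)
    {L : AddSubgroup Eis} (D : Dev (H.truncate S) L) {v : Eis} {i : ZMod 6} (hv : v + unit i ∈ L) :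
    ∃ d hd, D.φ v i = truncNew d hd false := by
  have h1 := (D.size_three_iff (j := i + 3)).2 hv
  rw [D.isDev.2] at h1
  obtain ⟨d, hd, h2⟩ := (h.size_three_iff hc _).1 h1
  refine ⟨H.rot.symm d, by rwa [vert_rot_symm], ?_⟩
  rw [← (H.truncate S).opp_opp (D.φ v i), h2]
  rfl

theorem TruncatesToHexagons.unit_mem_of_eq (hc : H.Cubic) (h : H.TruncatesToHexagons S)
    {L : AddSubgroup Eis} (D : Dev (H.truncate S) L) {v : Eis} {i : ZMod 6} {d : H.Dart}
    {hd : H.vert d ∈ S} (he : D.φ v i = truncNew d hd false) : v + unit i ∈ L := by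
  rw [← D.size_three_iff (j := i + 3), D.isDev.2, h.size_three_iff hc, he]
  exact ⟨_, _, rfl⟩

/-- Two truncated vertices are adjacent iff `L` contains a vector of norm three. -/
theorem TruncatesToHexagons.exists_skew_iff (hc : H.Cubic) (h : H.TruncatesToHexagons S)
    {L : AddSubgroup Eis} (D : Dev (H.truncate S) L) :
    (∃ i, unit i + unit (i + 1) ∈ L) ↔ ∃ d, H.vert d ∈ S ∧ H.vert (H.opp d) ∈ S := by
  have hnext : ∀ v i, D.φ v (i + 2) = (H.truncate S).next ((H.truncate S).next (D.φ v i)) := by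
    intro v i
    rw [← D.isDev.1, ← D.isDev.1, add_assoc]
    rfl
  constructor
  · rintro ⟨i, hi⟩
    obtain ⟨d, hd, h1⟩ := h.exists_new_of_unit hc D hi
    have h2 : unit i + unit (i + 3) ∈ L := by
      rw [unit_add_three, add_neg_cancel]
      exact zero_mem _
    obtain ⟨e, he, h3⟩ := h.exists_new_of_unit hc D h2
    refine ⟨H.rot d, by rwa [vert_rot], ?_⟩
    by_contra h4
    rw [show i + 3 = i + 1 + 2 by ring, hnext, h1, truncate_next_false,
      truncate_next_old_of_notMem _ h4] at h3
    cases h3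
  · rintro ⟨d, hd, hd'⟩
    have hr : H.vert (H.rot.symm d) ∈ S := by rwa [vert_rot_symm]
    obtain ⟨v, i, hvi⟩ := D.surj (truncNew (H.rot.symm d) hr false)
    have h1 := h.unit_mem_of_eq hc D hvi
    have h2 : D.φ v (i + 2) = truncNew (H.opp d) hd' false := by
      have : ∀ hr', (H.truncate S).next (truncNew (H.rot.symm d) hr' false) = truncOld S d :=
        fun hr' => by rw [truncate_next_false, Equiv.apply_symm_apply]
      rw [hnext, hvi, this, truncate_next_old_of_mem _ hd']
    have h3 := h.unit_mem_of_eq hc D h2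
    have h4 := sub_mem h3 h1
    rw [add_sub_add_left_eq_sub, unit_sub_unit_two] at h4
    exact ⟨_, h4⟩

/-- If `L` contains twice a unit, some old face has two truncated corners. -/
theorem TruncatesToHexagons.exists_of_two_mul_unit (hc : H.Cubic) (h : H.TruncatesToHexagons S)
    {L : AddSubgroup Eis} (D : Dev (H.truncate S) L) {i : ZMod 6} (hi : unit i + unit i ∈ L) :
    ∃ d, H.vert d ∈ S ∧ (H.vert (H.next d) ∈ S ∨ H.vert (H.next (H.next d)) ∈ S) := by
  obtain ⟨d, hd, h1⟩ := h.exists_new_of_unit hc D hi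
  have h2 : unit i + unit (i + 3) ∈ L := by
    rw [unit_add_three, add_neg_cancel]
    exact zero_mem _
  obtain ⟨e, he, h3⟩ := h.exists_new_of_unit hc D h2
  refine ⟨H.rot d, by rwa [vert_rot], ?_⟩
  by_contra! h4
  rw [show i + 3 = i + 1 + 1 + 1 by ring, D.isDev.1, D.isDev.1, D.isDev.1, h1,
    truncate_next_false, truncate_next_old_of_notMem _ (by rw [← vert_next]; exact h4.1),
    truncate_next_old_of_notMem _ (by rw [← vert_next]; exact h4.2)] at h3
  cases h3

/-! ### The named polyhedra -/

theorem tetrahedron_cubic : tetrahedron.Cubic := by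
  show ∀ d : (ZMod 2 × ZMod 2) × Fin 3, _
  unfold tetrahedron
  decide

theorem tetrahedron_connected (d e : tetrahedron.Dart) :
    ∃ g ∈ Subgroup.closure {tetrahedron.rot, tetrahedron.opp}, g d = e := by
  revert d e
  rw [connected_iff]
  intro P hr ho hP
  have h1 : ∀ d, P d → P (tetrahedron.opp d) ∧ P (tetrahedron.opp (tetrahedron.rot d)) ∧
      P (tetrahedron.opp (tetrahedron.rot (tetrahedron.rot d))) := fun d hd =>
    ⟨ho _ hd, ho _ (hr _ hd), ho _ (hr _ (hr _ hd))⟩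
  have h2 : ∀ d e : (ZMod 2 × ZMod 2) × Fin 3,
      ∃ x ∈ ({d, tetrahedron.opp d, tetrahedron.opp (tetrahedron.rot d),
      tetrahedron.opp (tetrahedron.rot (tetrahedron.rot d))} : Finset ((ZMod 2 × ZMod 2) × Fin 3)),
      e = x ∨ e = tetrahedron.rot x ∨ e = tetrahedron.rot (tetrahedron.rot x) := by
    unfold tetrahedron
    decide
  obtain ⟨d, hd⟩ := hP
  intro e
  obtain ⟨x, hx, he⟩ := h2 d e
  have hPx : P x := by
    rcases Finset.mem_insert.1 hx with rfl | hx
    · exact hd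
    rcases Finset.mem_insert.1 hx with rfl | hx
    · exact (h1 _ hd).1
    rcases Finset.mem_insert.1 hx with rfl | hx
    · exact (h1 _ hd).2.1
    rcases Finset.mem_singleton.1 hx with rfl
    · exact (h1 _ hd).2.2
  rcases he with rfl | rfl | rfl
  · exact hPx
  · exact hr _ hPx
  · exact hr _ (hr _ hPx)

theorem tetrahedron_size (F : tetrahedron.Face) : tetrahedron.size F = 3 := by
  obtain ⟨d, rfl⟩ := face_surj F
  rw [size_eq_three]
  revert d
  show ∀ d : (ZMod 2 × ZMod 2) × Fin 3, _
  unfold tetrahedron next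
  decide

theorem card_tetrahedron_dart : Nat.card tetrahedron.Dart = 12 := by
  show Nat.card ((ZMod 2 × ZMod 2) × Fin 3) = 12
  simp

theorem tetrahedron_dev : Nonempty (Dev tetrahedron ⊤) := by
  obtain ⟨L, ⟨D⟩⟩ := exists_dev tetrahedron_cubic (fun F => Or.inl (tetrahedron_size F))
    tetrahedron_connected ⟨_, tetrahedron_size (tetrahedron.face ((0, 0), 0))⟩
  have h := D.card_dart
  rw [card_tetrahedron_dart] at h
  have : L = ⊤ := AddSubgroup.index_eq_one.1 (by omega)
  exact ⟨this ▸ D⟩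

/-- The 12 darts of the tetrahedron and 24 new ones give index 3, and index 3 without units forces a
vector of norm 3. -/
theorem truncatedTetrahedron_dev : Nonempty (Dev truncatedTetrahedron (skewLattice 3)) := by
  have ht : tetrahedron.TruncatesToHexagons Set.univ := fun d => by
    have : {e | tetrahedron.face e = tetrahedron.face d ∧ tetrahedron.vert e ∈ Set.univ}.ncard =
        tetrahedron.size (tetrahedron.face d) := by simp [size]
    rw [this, tetrahedron_size]
  obtain ⟨L, ⟨D⟩, hu, h12⟩ := ht.exists_dev tetrahedron_cubic tetrahedron_connected
    ⟨((0, 0), 0), trivial⟩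
  have h := D.card_dart
  rw [card_truncate_dart, h12, card_tetrahedron_dart] at h
  have hi : L.index = 3 := by omega
  obtain ⟨i, hi'⟩ := exists_skew_of_index_three hu hi
  rw [← hi]
  exact D.exists_skewLattice hi'

theorem cube_cubic : cube.Cubic := by
  show ∀ d : (Fin 3 → ZMod 2) × Fin 3, _
  unfold cube
  decide

theorem size_eq_four {M : CombMap} {d : M.Dart} (h : M.next (M.next (M.next (M.next d))) = d)
    (h' : M.next (M.next d) ≠ d) : M.size (M.face d) = 4 := by
  rw [size_face]
  have := Fact.mk Nat.prime_two
  exact Function.minimalPeriod_eq_prime_pow (p := 2) (k := 1) h' h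

theorem cube_next : ∀ d : (Fin 3 → ZMod 2) × Fin 3,
    cube.next (cube.next (cube.next (cube.next d))) = d ∧ cube.next (cube.next d) ≠ d := by
  unfold cube next
  decide

theorem cube_connected (d e : cube.Dart) :
    ∃ g ∈ Subgroup.closure {cube.rot, cube.opp}, g d = e := by
  revert d e
  rw [connected_iff]
  intro P hr ho hP
  have hrot : ∀ (v : Fin 3 → ZMod 2) (i j : Fin 3), P (v, i) → P (v, j) := by
    have h1 : ∀ (v : Fin 3 → ZMod 2) (i j : Fin 3), (v, j) = (v, i) ∨
        (v, j) = cube.rot (v, i) ∨ (v, j) = cube.rot (cube.rot (v, i)) := by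
      unfold cube
      decide
    intro v i j h
    rcases h1 v i j with h2 | h2 | h2 <;> rw [h2]
    · exact h
    · exact hr _ h
    · exact hr _ (hr _ h)
  have step : ∀ (v : Fin 3 → ZMod 2) (j : Fin 3) (x : ZMod 2), (∀ i, P (v, i)) →
      ∀ i, P (Function.update v j x, i) := by
    intro v j x h i
    have h1 : ∀ x y : ZMod 2, x = y ∨ x = y + 1 := by decide
    rcases h1 x (v j) with rfl | rfl
    · rw [Function.update_eq_self]
      exact h i
    · exact hrot _ j _ (ho _ (h j))
  obtain ⟨⟨v, i⟩, hv⟩ := hP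
  rintro ⟨w, j⟩
  have h3 := step _ 2 (w 2) (step _ 1 (w 1) (step v 0 (w 0) fun j => hrot v i j hv)) j
  have h4 : Function.update (Function.update (Function.update v 0 (w 0)) 1 (w 1)) 2 (w 2) = w := by
    ext k
    fin_cases k <;> simp [Function.update]
  rwa [h4] at h3

theorem card_cube_dart : Nat.card cube.Dart = 24 := by
  show Nat.card ((Fin 3 → ZMod 2) × Fin 3) = 24
  simp

theorem cube_vert_eq {d e : (Fin 3 → ZMod 2) × Fin 3} (h : cube.vert d = cube.vert e) : d.1 = e.1 := by
  rcases cube_cubic.vert_eq h with rfl | rfl | rfl <;> rfl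

theorem cube_vert_mem_iff {p : (Fin 3 → ZMod 2) → Prop} {d : (Fin 3 → ZMod 2) × Fin 3} :
    cube.vert d ∈ cube.vert '' {d : (Fin 3 → ZMod 2) × Fin 3 | p d.1} ↔ p d.1 := by
  constructor
  · rintro ⟨e, he, h⟩
    rw [← cube_vert_eq h]
    exact he
  · exact fun h => ⟨d, h, rfl⟩

theorem cube_truncatesToHexagons {p : (Fin 3 → ZMod 2) → Prop} [DecidablePred p]
    (h : ∀ d : (Fin 3 → ZMod 2) × Fin 3,
      (Finset.filter (fun e : (Fin 3 → ZMod 2) × Fin 3 => p e.1)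
        {d, cube.next d, cube.next (cube.next d), cube.next (cube.next (cube.next d))}).card = 2) :
    cube.TruncatesToHexagons (cube.vert '' {d : (Fin 3 → ZMod 2) × Fin 3 | p d.1}) := by
  intro d
  have h4 : cube.size (cube.face d) = 4 := size_eq_four (cube_next d).1 (cube_next d).2
  have hset : {e | cube.face e = cube.face d ∧
      cube.vert e ∈ cube.vert '' {d : (Fin 3 → ZMod 2) × Fin 3 | p d.1}} =
      ((Finset.filter (fun e : (Fin 3 → ZMod 2) × Fin 3 => p e.1)
        {d, cube.next d, cube.next (cube.next d), cube.next (cube.next (cube.next d))} :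
          Finset ((Fin 3 → ZMod 2) × Fin 3)) : Set ((Fin 3 → ZMod 2) × Fin 3)) := by
    ext e
    rw [Finset.coe_filter]
    refine and_congr ?_ cube_vert_mem_iff
    constructor
    · intro he
      obtain ⟨k, hk, rfl⟩ := exists_iterate_next_of_face_eq he.symm
      rw [h4] at hk
      interval_cases k
      · exact Finset.mem_insert_self _ _
      · exact Finset.mem_insert_of_mem (Finset.mem_insert_self _ _)
      · exact Finset.mem_insert_of_mem (Finset.mem_insert_of_mem (Finset.mem_insert_self _ _))
      · exact Finset.mem_insert_of_mem (Finset.mem_insert_of_mem (Finset.mem_insert_of_mem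
          (Finset.mem_singleton_self _)))
    · intro he
      rcases Finset.mem_insert.1 he with rfl | he
      · rfl
      rcases Finset.mem_insert.1 he with rfl | he
      · exact face_next _
      rcases Finset.mem_insert.1 he with rfl | he
      · exact (face_next _).trans (face_next _)
      rcases Finset.mem_singleton.1 he with rfl
      exact (face_next _).trans ((face_next _).trans (face_next _))
  have h2 : {e | cube.face e = cube.face d ∧
      cube.vert e ∈ cube.vert '' {d : (Fin 3 → ZMod 2) × Fin 3 | p d.1}}.ncard = 2 := by
    rw [hset]
    exact (Set.ncard_coe_finset _).trans (h d)
  rw [h4, h2]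

theorem cube_truncate_dev {p : (Fin 3 → ZMod 2) → Prop} [DecidablePred p]
    (h : ∀ d : (Fin 3 → ZMod 2) × Fin 3,
      (Finset.filter (fun e : (Fin 3 → ZMod 2) × Fin 3 => p e.1)
        {d, cube.next d, cube.next (cube.next d), cube.next (cube.next (cube.next d))}).card = 2)
    (h0 : ∃ v, p v) :
    ∃ L, Nonempty (Dev (cube.truncate (cube.vert '' {d : (Fin 3 → ZMod 2) × Fin 3 | p d.1})) L) ∧
      (∀ j, unit j ∉ L) ∧ L.index = 4 ∧
      ((∃ i, unit i + unit (i + 1) ∈ L) ↔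
        ∃ d : (Fin 3 → ZMod 2) × Fin 3, p d.1 ∧ p (cube.opp d : (Fin 3 → ZMod 2) × Fin 3).1) := by
  have ht := cube_truncatesToHexagons h
  obtain ⟨v, hv⟩ := h0
  obtain ⟨L, ⟨D⟩, hu, h12⟩ := ht.exists_dev cube_cubic cube_connected
    ⟨(v, 0), cube_vert_mem_iff.2 hv⟩
  have hc := D.card_dart
  rw [card_truncate_dart, h12, card_cube_dart] at hc
  refine ⟨L, ⟨D⟩, hu, by omega, ?_⟩
  rw [ht.exists_skew_iff cube_cubic D]
  exact exists_congr fun d => and_congr cube_vert_mem_iff cube_vert_mem_iff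

theorem cubeTruncatedOppositeEdges_dev :
    Nonempty (Dev cubeTruncatedOppositeEdges (skewLattice 4)) := by
  obtain ⟨L, ⟨D⟩, -, hi, h⟩ := cube_truncate_dev (p := fun v => v 0 = v 1)
    (by unfold cube next; decide) ⟨0, rfl⟩
  obtain ⟨i, hs⟩ := h.2 ⟨(0, 2), rfl, rfl⟩
  rw [← hi]
  exact D.exists_skewLattice hs

/-- No two truncated vertices are adjacent, so the lattice of index 4 has no vector of norm 3 and
must have one of norm 4. This leaves `m = 2`, and `lattice 1 2` is excluded because it contains `ζ +
ζ ^ 2`, of norm 3. -/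
theorem cubeTruncatedNonadjacent_dev :
    Nonempty (Dev cubeTruncatedNonadjacent (lattice 0 2)) := by
  obtain ⟨L, ⟨D⟩, hu, hi, h⟩ := cube_truncate_dev (p := fun v => v 0 + v 1 + v 2 = 0)
    (by unfold cube next; decide) ⟨0, rfl⟩
  have h0 : ¬ ∃ i, unit i + unit (i + 1) ∈ L := by
    rw [h]
    unfold cube
    decide
  obtain ⟨i, hs⟩ := exists_short_of_index_four hu hi
  obtain ⟨m, hm, hi', h1⟩ := D.exists_lattice hu (hs.resolve_left fun h => h0 ⟨i, h⟩)
  have hm2 : m = 2 := by omega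
  subst hm2
  refine h1.resolve_right ?_
  rintro ⟨D'⟩
  obtain ⟨j, rfl⟩ := D'.exists_eq_rotate D
  refine h0 ⟨1 - j, ?_⟩
  rw [mem_rotate, mul_add, unit_mul, unit_mul, show j + (1 - j) = 1 by ring,
    show j + (1 - j + 1) = 2 by ring_nf]
  exact ⟨1, by decide, by decide⟩

end CombMap

/-! ### Classification into the four forms -/

namespace Eis

theorem unit_mem_rotate {L : AddSubgroup Eis} {i j : ZMod 6} :
    unit j ∈ rotate i L ↔ unit (i + j) ∈ L := by rw [mem_rotate, unit_mul]

theorem mirror_top : mirror ⊤ = ⊤ := rfl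

theorem three_le_of_unit_notMem_skewLattice {k : ℕ} (hu : ∀ j, unit j ∉ skewLattice k)
    (hk : k ≠ 0) : 3 ≤ k := by
  by_contra h
  refine hu 2 ?_
  rw [mem_skewLattice, unit_two_eq]
  have : k = 1 ∨ k = 2 := by omega
  rcases this with rfl | rfl <;> decide

theorem two_mul_unit_notMem_skewLattice_three (i : ZMod 6) : unit i + unit i ∉ skewLattice 3 := by
  rw [mem_skewLattice]
  revert i
  decide

theorem mirror_lattice_zero_two : mirror (lattice 0 2) = lattice 0 2 := by
  ext x
  rw [mem_mirror, mem_lattice_zero_two, mem_lattice_zero_two]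
  refine ⟨fun ⟨y, hy⟩ => ⟨star y, ?_⟩, fun ⟨y, hy⟩ => ⟨star y, ?_⟩⟩
  · rw [← star_star x, hy, star_add]
  · rw [hy, star_add]

end Eis

namespace CombMap

open Eis

variable {M N : CombMap} {L : AddSubgroup Eis} {n : ℕ}

theorem IsThree.exists_dev (h : M.IsThree n) :
    ∃ L, Nonempty (Dev M L) ∧ n = 4 * L.index ∧ (L = ⊤ ∨ ∀ j, unit j ∉ L) := by
  have h0 := h
  obtain ⟨⟨_, hconn, heul⟩, _, _, hdeg, hs, _⟩ := h
  have hc := cubic_iff.2 hdeg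
  have h3 : ∃ F, M.size F = 3 := by
    have := (euler_three_six hc hs).1 heul
    obtain ⟨d, hd⟩ := Set.nonempty_of_ncard_ne_zero (this.trans_ne (by norm_num))
    exact ⟨_, hd⟩
  obtain ⟨L, ⟨D⟩⟩ := CombMap.exists_dev hc hs hconn h3
  refine ⟨L, ⟨D⟩, D.eq_of_isThree h0, ?_⟩
  by_cases hu : ∃ j, unit j ∈ L
  · exact .inl (D.top_of_isThree h0 _ hu.choose_spec)
  · exact .inr (not_exists.1 hu)

namespace Dev

theorem unit_notMem {L' : AddSubgroup Eis} (D : Dev M L) (D' : Dev M L') (hu : ∀ j, unit j ∉ L)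
    (j : ZMod 6) : unit j ∉ L' := by
  obtain ⟨i, rfl⟩ := D.exists_eq_rotate D'
  rw [unit_mem_rotate]
  exact hu _

theorem iso_top_iff (D : Dev N ⊤) : M.Iso N ↔ Nonempty (Dev M ⊤) := by
  refine ⟨fun h => ?_, fun ⟨D'⟩ => D'.iso D⟩
  simpa [mirror_top] using D.of_iso h

/-- The mirror image of the lattice also contains a vector of norm 3 and has the same index, so it
is a rotated copy: these maps are not chiral. -/
theorem iso_skewLattice_iff {k : ℕ} (D : Dev N (skewLattice k)) :
    M.Iso N ↔ Nonempty (Dev M (skewLattice k)) := by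
  refine ⟨fun h => ?_, fun ⟨D'⟩ => D'.iso D⟩
  rcases D.of_iso h with h | ⟨⟨D'⟩⟩
  · exact h
  · have hm : unit 5 + unit (5 + 1) ∈ mirror (skewLattice k) := by
      rw [mem_mirror, mem_skewLattice]
      have : star (unit 5 + unit (5 + 1)) = unit 0 + unit 1 := by decide
      rw [this]
      exact ⟨0, rfl⟩
    have := D'.exists_skewLattice hm
    have hi : (mirror (skewLattice k)).index = k := by
      obtain ⟨e, -⟩ := h
      have h1 := D.card_dart
      rw [← Nat.card_congr e, D'.card_dart, index_skewLattice] at h1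
      omega
    rwa [hi] at this

theorem iso_lattice_zero_two_iff (D : Dev N (lattice 0 2)) :
    M.Iso N ↔ Nonempty (Dev M (lattice 0 2)) := by
  refine ⟨fun h => ?_, fun ⟨D'⟩ => D'.iso D⟩
  simpa [mirror_lattice_zero_two] using D.of_iso h

theorem not_formII_of_top (D : Dev M ⊤) : ¬ M.FormII := fun ⟨F, _, _, h, _⟩ =>
  D.no_hexagon_of_top F h.1

theorem nonempty_of_formIII (h : M.FormIII) : M.skewHexagons.Nonempty :=
  Set.nonempty_of_ncard_ne_zero (h.1.trans_ne (by norm_num))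

theorem not_formIII_of_top (D : Dev M ⊤) : ¬ M.FormIII := fun h =>
  have ⟨F, hF⟩ := nonempty_of_formIII h
  D.no_hexagon_of_top F hF.1

theorem exists_of_formII (D : Dev M L) (hu : ∀ j, unit j ∉ L) (h : M.FormII) :
    ∃ i, unit i + unit i ∈ L :=
  D.exists_two_mul_unit_mem hu (let ⟨F, _, _, hF, _⟩ := h; ⟨F, hF⟩)

theorem not_formII_of_skewLattice_three (D : Dev M (skewLattice 3)) : ¬ M.FormII := fun h =>
  have ⟨i, hi⟩ := D.exists_of_formII (unit_notMem_skewLattice le_rfl) h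
  two_mul_unit_notMem_skewLattice_three i hi

theorem not_formIII_of_skewLattice_three (D : Dev M (skewLattice 3)) : ¬ M.FormIII := fun h =>
  (D.exists_of_formIII (unit_notMem_skewLattice le_rfl) h).2 (index_skewLattice 3)

theorem unit_zero_add_unit_one_mem (k : ℕ) : unit 0 + unit (0 + 1) ∈ skewLattice k := ⟨0, rfl⟩

theorem not_formIV_of_skewLattice_three (D : Dev M (skewLattice 3)) : ¬ M.FormIV := fun h =>
  (((D.formIV_iff (unit_notMem_skewLattice le_rfl)).1 h) 0).2 (unit_zero_add_unit_one_mem 3)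

theorem exists_skewLattice_of_mem (D : Dev M L) (hu : ∀ j, unit j ∉ L) {i : ZMod 6}
    (h : unit i + unit (i + 1) ∈ L) : 3 ≤ L.index ∧ Nonempty (Dev M (skewLattice L.index)) := by
  have ⟨D'⟩ := D.exists_skewLattice h
  exact ⟨three_le_of_unit_notMem_skewLattice (D.unit_notMem D' hu) D.index_pos.ne', ⟨D'⟩⟩

theorem formII_of_skewLattice_four (D : Dev M (skewLattice 4)) : M.FormII := by
  have h : unit 2 + unit 2 ∈ skewLattice 4 := by rw [mem_skewLattice]; decide
  obtain ⟨m, hm, -, ⟨⟨D'⟩⟩ | ⟨⟨D'⟩⟩⟩ := D.exists_lattice (unit_notMem_skewLattice (by norm_num)) h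
  exacts [D'.formII_lattice hm, D'.formII_lattice hm]

/-- Three triangles sit on alternate sides of a hexagon. The differences of their centres are
vectors of norm 3 in different directions; after turning the lattice to `skewLattice` at least one
of two such differences has `re - im = ±3`, so the index divides 3. -/
theorem skewLattice_three_of_two_lt (D : Dev M L) (hu : ∀ j, unit j ∉ L)
    (h : ∃ F, M.size F = 6 ∧ 2 < (M.adjTriangles F).ncard) : Nonempty (Dev M (skewLattice 3)) := by
  obtain ⟨F, -, hF⟩ := h
  obtain ⟨d, rfl⟩ := face_surj F
  obtain ⟨v, j, rfl⟩ := D.surj d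
  rw [D.adjTriangles_eq] at hF
  obtain ⟨A, B, C, ⟨a, ha, hA⟩, ⟨b, hb, hB⟩, ⟨c, hc, hC⟩, hAB, hAC, hBC⟩ :=
    (Set.two_lt_ncard_iff (Set.toFinite _)).1 hF
  have hab : a ≠ b := by rintro rfl; exact hAB (hA.trans hB.symm)
  have hac : a ≠ c := by rintro rfl; exact hAC (hA.trans hC.symm)
  have hbc : b ≠ c := by rintro rfl; exact hBC (hB.trans hC.symm)
  have h1 := mem_add_unit hu ha hb
  have h2 := mem_add_unit hu ha hc
  have h3 := mem_add_unit hu hb hc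
  have key : ∃ i, v + unit i ∈ L ∧ v + unit (i + 2) ∈ L ∧ v + unit (i + 4) ∈ L := by
    have : (b = a + 2 ∧ c = a + 4) ∨ (c = a + 2 ∧ b = a + 4) := by
      rcases h1 with rfl | rfl | rfl | rfl
      · exact absurd rfl hab
      · rcases h2 with rfl | rfl | rfl | rfl
        exacts [absurd rfl hac, absurd rfl hbc, absurd h3 (by clear * -; revert a; decide), .inl ⟨rfl, rfl⟩]
      · rcases h2 with rfl | rfl | rfl | rfl
        exacts [absurd rfl hac, absurd h3 (by clear * -; revert a; decide), absurd rfl hbc,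
          absurd h3 (by clear * -; revert a; decide)]
      · rcases h2 with rfl | rfl | rfl | rfl
        exacts [absurd rfl hac, .inr ⟨rfl, rfl⟩, absurd h3 (by clear * -; revert a; decide),
          absurd rfl hbc]
    rcases this with ⟨rfl, rfl⟩ | ⟨rfl, rfl⟩
    exacts [⟨a, ha, hb, hc⟩, ⟨a, ha, hc, hb⟩]
  obtain ⟨i, h1, h2, h3⟩ := key
  have e1 : unit (i + 2) + unit (i + 2 + 1) ∈ L := by
    rw [← unit_sub_unit_two]; simpa using sub_mem h2 h1
  obtain ⟨k3, ⟨D'⟩⟩ := D.exists_skewLattice_of_mem hu e1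
  obtain ⟨r, hr⟩ := D'.exists_eq_rotate D
  have h1' := sub_mem h2 h1
  have h2' := sub_mem h3 h2
  rw [add_sub_add_left_eq_sub, hr, mem_rotate, mem_skewLattice] at h1' h2'
  have h3' : ((L.index : ℕ) : ℤ) ∣ 3 := by
    have : ∀ r i : ZMod 6, 
      ((unit r * (unit (i + 2) - unit i)).re - (unit r * (unit (i + 2) - unit i)).im = 3 ∨
      (unit r * (unit (i + 2) - unit i)).re - (unit r * (unit (i + 2) - unit i)).im = -3) ∨
      ((unit r * (unit (i + 4) - unit (i + 2))).re - (unit r * (unit (i + 4) - unit (i + 2))).im = 3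
       ∨ (unit r * (unit (i + 4) - unit (i + 2))).re -
        (unit r * (unit (i + 4) - unit (i + 2))).im = -3) := by decide
    rcases this r i with (h | h) | (h | h)
    · rwa [h] at h1'
    · rwa [h, dvd_neg] at h1'
    · rwa [h] at h2'
    · rwa [h, dvd_neg] at h2'
  have : L.index = 3 := le_antisymm (Nat.le_of_dvd (by norm_num) (by exact_mod_cast h3')) k3
  rw [this] at D'
  exact ⟨D'⟩

theorem exists_two_lt (D : Dev M (skewLattice 3)) :
    ∃ F, M.size F = 6 ∧ 2 < (M.adjTriangles F).ncard := by
  have hu := unit_notMem_skewLattice (k := 3) le_rfl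
  refine ⟨M.face (D.φ (unit 0) 0), D.size_six_iff.2 (hu 0), ?_⟩
  rw [D.adjTriangles_eq, Set.two_lt_ncard_iff (Set.toFinite _)]
  have h : ∀ i : ZMod 6, i = 1 ∨ i = 3 ∨ i = 5 → unit 0 + unit i ∈ skewLattice 3 := by
    intro i hi
    rw [mem_skewLattice]
    rcases hi with rfl | rfl | rfl <;> decide
  refine ⟨_, _, _, ⟨1, h 1 (by simp), rfl⟩, ⟨3, h 3 (by simp), rfl⟩, ⟨5, h 5 (by simp), rfl⟩, ?_, ?_, ?_⟩
  · exact fun hf => absurd (D.triangle_injective hu (h 1 (by simp)) hf) (by decide)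
  · exact fun hf => absurd (D.triangle_injective hu (h 1 (by simp)) hf) (by decide)
  · exact fun hf => absurd (D.triangle_injective hu (h 3 (by simp)) hf) (by decide)

end Dev

theorem formI_iff : M.FormI ↔ Nonempty (Dev M ⊤) ∨ Nonempty (Dev M (skewLattice 3)) := by
  have ⟨T⟩ := tetrahedron_dev
  have ⟨T'⟩ := truncatedTetrahedron_dev
  rw [FormI, T.iso_top_iff, T'.iso_skewLattice_iff]

theorem IsThree.forms (h : M.IsThree n) :
    (M.FormI ∨ M.FormII ∨ M.FormIII ∨ M.FormIV) ∧
      ¬ (M.FormI ∧ M.FormII) ∧ ¬ (M.FormI ∧ M.FormIII) ∧ ¬ (M.FormI ∧ M.FormIV) ∧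
      ¬ (M.FormII ∧ M.FormIV) ∧ ¬ (M.FormIII ∧ M.FormIV) ∧
      ((M.FormII ∧ M.FormIII) ↔ M.Iso cubeTruncatedOppositeEdges) := by
  have ⟨C⟩ := cubeTruncatedOppositeEdges_dev
  obtain ⟨L, ⟨D⟩, -, rfl | hu⟩ := h.exists_dev
  · refine ⟨.inl (formI_iff.2 (.inl ⟨D⟩)), fun h => D.not_formII_of_top h.2,
      fun h => D.not_formIII_of_top h.2, fun h => D.not_formIV_of_top h.2,
      fun h => D.not_formII_of_top h.1, fun h => D.not_formIII_of_top h.1,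
      fun h => (D.not_formII_of_top h.1).elim, fun h => ?_⟩
    have ⟨D'⟩ := C.iso_skewLattice_iff.1 h
    exact (D.not_formII_of_top D'.formII_of_skewLattice_four).elim
  · have hI : M.FormI ↔ Nonempty (Dev M (skewLattice 3)) := by
      rw [formI_iff, or_iff_right]
      rintro ⟨D'⟩
      exact D.unit_notMem D' hu 0 trivial
    refine ⟨?_, fun ⟨h, h'⟩ => ?_, fun ⟨h, h'⟩ => ?_, fun ⟨h, h'⟩ => ?_, fun ⟨h, h'⟩ => ?_,
      fun ⟨h, h'⟩ => ?_, fun ⟨h, h'⟩ => ?_, fun h => ?_⟩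
    · by_cases h4 : M.FormIV
      · exact .inr (.inr (.inr h4))
      · rw [D.formIV_iff hu] at h4
        obtain ⟨i, hi⟩ := not_forall.1 h4
        rw [not_and_or, not_not, not_not] at hi
        rcases hi with hi | hi
        · obtain ⟨m, hm, -, ⟨⟨D'⟩⟩ | ⟨⟨D'⟩⟩⟩ := D.exists_lattice hu hi
          exacts [.inr (.inl (D'.formII_lattice hm)), .inr (.inl (D'.formII_lattice hm))]
        · obtain ⟨h3, ⟨D'⟩⟩ := D.exists_skewLattice_of_mem hu hi
          rcases h3.eq_or_lt with h3 | h3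
          · rw [← h3] at D'
            exact .inl (hI.2 ⟨D'⟩)
          · exact .inr (.inr (.inl (D'.formIII_skewLattice h3)))
    · exact (hI.1 h).some.not_formII_of_skewLattice_three h'
    · exact (hI.1 h).some.not_formIII_of_skewLattice_three h'
    · exact (hI.1 h).some.not_formIV_of_skewLattice_three h'
    · obtain ⟨i, hi⟩ := D.exists_of_formII hu h
      exact ((D.formIV_iff hu).1 h' i).1 hi
    · obtain ⟨⟨i, hi⟩, -⟩ := D.exists_of_formIII hu h
      exact ((D.formIV_iff hu).1 h' i).2 hi
    · obtain ⟨⟨i, hi⟩, h3⟩ := D.exists_of_formIII hu h'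
      obtain ⟨hk, ⟨D'⟩⟩ := D.exists_skewLattice_of_mem hu hi
      obtain ⟨j, hj⟩ := D'.exists_of_formII (unit_notMem_skewLattice hk) h
      rw [Dev.eq_four_of_skewLattice (by omega) hj] at D'
      exact C.iso_skewLattice_iff.2 ⟨D'⟩
    · have ⟨D'⟩ := C.iso_skewLattice_iff.1 h
      exact ⟨D'.formII_of_skewLattice_four, D'.formIII_skewLattice le_rfl⟩

theorem IsThree.two_lt_iff (h : M.IsThree n) :
    (∃ F, M.size F = 6 ∧ 2 < (M.adjTriangles F).ncard) ↔ M.Iso truncatedTetrahedron := by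
  have ⟨T⟩ := truncatedTetrahedron_dev
  rw [T.iso_skewLattice_iff]
  refine ⟨fun h' => ?_, fun ⟨D⟩ => D.exists_two_lt⟩
  obtain ⟨L, ⟨D⟩, -, rfl | hu⟩ := h.exists_dev
  · obtain ⟨F, hF, -⟩ := h'
    exact (D.no_hexagon_of_top F hF).elim
  · exact D.skewLattice_three_of_two_lt hu h'

theorem tetrahedron_isThree : tetrahedron.IsThree 4 := by
  have ⟨T⟩ := tetrahedron_dev
  simpa using T.isThree fun _ _ => rfl

theorem Dev.isThree_of_unit_notMem (D : Dev M L) (hu : ∀ j, unit j ∉ L) :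
    M.IsThree (4 * L.index) := D.isThree fun j hj => (hu j hj).elim

theorem Dev.isThree_skewLattice {k : ℕ} (D : Dev M (skewLattice k)) (hk : 3 ≤ k) :
    M.IsThree (4 * k) := by
  simpa [index_skewLattice] using D.isThree_of_unit_notMem (unit_notMem_skewLattice hk)

theorem Dev.isThree_lattice_zero {m : ℕ} (D : Dev M (lattice 0 m)) (hm : 2 ≤ m) :
    M.IsThree (8 * m) := by
  have := D.isThree_of_unit_notMem (unit_notMem_lattice hm)
  rwa [index_lattice_zero, ← mul_assoc] at this

/-- The even lattice contains no vector of norm 3, in contrast to `skewLattice 4`. -/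
theorem cubes_not_iso : ¬ cubeTruncatedNonadjacent.Iso cubeTruncatedOppositeEdges := fun h => by
  have ⟨A⟩ := cubeTruncatedNonadjacent_dev
  have ⟨B⟩ := cubeTruncatedOppositeEdges_dev
  have ⟨D⟩ := B.iso_skewLattice_iff.1 h
  obtain ⟨i, hi⟩ := D.exists_eq_rotate A
  have : ∀ i j : ZMod 6, unit i * unit j = unit (i + j) := unit_mul
  have h2 : unit (-i) * (unit 0 + unit 1) ∈ lattice 0 2 := by
    rw [hi, mem_rotate, unit_mul_neg]; exact ⟨0, rfl⟩
  obtain ⟨y, hy⟩ := mem_lattice_zero_two.1 h2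
  have h3 : ∀ i : ZMod 6, ¬ ((unit (-i) * (unit 0 + unit 1)).re % 2 = 0 ∧
    (unit (-i) * (unit 0 + unit 1)).im % 2 = 0) := by decide
  refine h3 i ?_
  rw [hy, QuadraticAlgebra.re_add, QuadraticAlgebra.im_add]
  omega

theorem IsThree.sixteen (h : M.IsThree 16) :
    M.Iso cubeTruncatedNonadjacent ∨ M.Iso cubeTruncatedOppositeEdges := by
  have ⟨A⟩ := cubeTruncatedNonadjacent_dev
  have ⟨B⟩ := cubeTruncatedOppositeEdges_dev
  rw [A.iso_lattice_zero_two_iff, B.iso_skewLattice_iff]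
  obtain ⟨L, ⟨D⟩, hi, rfl | hu⟩ := h.exists_dev
  · simp at hi
  have h4 : L.index = 4 := by omega
  obtain ⟨i, hi | hi⟩ := exists_short_of_index_four hu h4
  · have := D.exists_skewLattice hi
    rw [h4] at this
    exact .inr this
  · obtain ⟨m, hm, hm', h | ⟨⟨D'⟩⟩⟩ := D.exists_lattice hu hi
    · obtain rfl : m = 2 := by omega
      exact .inl h
    · obtain rfl : m = 2 := by omega
      have h12 : unit 1 + unit (1 + 1) ∈ lattice 1 2 := ⟨1, by decide, by decide⟩
      have := D'.exists_skewLattice h12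
      rw [D'.index_eq D, h4] at this
      exact .inr this

end CombMap

/-! ### Enumeration of forms (ii) and (iii) -/

namespace Eis

theorem index_lattice {s : ℤ} {m : ℕ} (hs : s = 0 ∨ s = 1) (hm : m ≠ 0) :
    (lattice s m).index = 2 * m := by
  rcases hs with rfl | rfl
  exacts [index_lattice_zero m, index_lattice_one hm]

theorem mirror_lattice_of_even {s : ℤ} {m : ℕ} (hm : Even m) :
    mirror (lattice s m) = lattice s m := by
  have key : ∀ x ∈ lattice s m, star x ∈ lattice s m := by
    rintro x ⟨t, h1, h2⟩
    obtain ⟨h, rfl⟩ := hm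
    refine ⟨-t, by simp [h1], ?_⟩
    have : (star x).re = x.re + x.im := by simp
    rw [this, h1]
    push_cast
    have e : x.re + (h + h) * t - s * -t = (x.re - s * t) + 2 * (h * t + s * t) := by ring
    rw [e]
    exact dvd_add h2 (dvd_mul_right _ _)
  ext x
  rw [mem_mirror]
  exact ⟨fun h => by simpa using key _ h, key x⟩

end Eis

namespace CombMap

open Eis

variable {M N : CombMap} {L : AddSubgroup Eis} {n : ℕ}

theorem IsThree.exists_lattice (h : M.IsThree n) (h2 : M.FormII) : ∃ m, 2 ≤ m ∧ n = 8 * m ∧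
    (Nonempty (Dev M (lattice 0 m)) ∨ Nonempty (Dev M (lattice 1 m))) := by
  obtain ⟨L, ⟨D⟩, hn, rfl | hu⟩ := h.exists_dev
  · exact (D.not_formII_of_top h2).elim
  · obtain ⟨i, hi⟩ := D.exists_of_formII hu h2
    obtain ⟨m, hm, hm', hD⟩ := D.exists_lattice hu hi
    exact ⟨m, hm, by omega, hD⟩

theorem IsThree.of_formII (h : M.IsThree n) (h2 : M.FormII) :
    8 ∣ n ∧ 16 ≤ n ∧ (M.oppositeHexagons.ncard = 2 ∨ M.Iso cubeTruncatedNonadjacent) := by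
  obtain ⟨m, hm, rfl, hD⟩ := h.exists_lattice h2
  refine ⟨dvd_mul_right _ _, by omega, ?_⟩
  rcases hD with ⟨⟨D⟩⟩ | ⟨⟨D⟩⟩
  · by_cases hm2 : m = 2
    · subst hm2
      have ⟨C⟩ := cubeTruncatedNonadjacent_dev
      exact .inr (D.iso C)
    · exact .inl (D.ncard_oppositeHexagons hm (.inl rfl) (by simp [hm2]))
  · exact .inl (D.ncard_oppositeHexagons hm (.inr rfl) (by simp))

theorem exists_dev_lattice {s : ℤ} {m : ℕ} (hs : s = 0 ∨ s = 1) (hm : 2 ≤ m) :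
    ∃ M : CombMap, Nonempty (Dev M (lattice s m)) ∧ M.IsThree (8 * m) ∧ M.FormII := by
  have : (lattice s m).FiniteIndex := ⟨by rw [index_lattice hs (by omega)]; omega⟩
  have D := tilingQuotientDev (lattice s m)
  refine ⟨_, ⟨D⟩, ?_, D.formII_lattice hm⟩
  have := D.isThree_of_unit_notMem (unit_notMem_lattice hm)
  rwa [index_lattice hs (by omega), ← mul_assoc] at this

theorem exists_formII_of_odd {m : ℕ} (hm : 3 ≤ m) (hodd : Odd m) :
    ∃ M : CombMap, M.IsThree (8 * m) ∧ M.FormII ∧ M.HasPointGroup PointGroup.D2 ∧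
      ∀ M' : CombMap, M'.IsThree (8 * m) → M'.FormII → M'.Iso M := by
  obtain ⟨M, ⟨D⟩, h3, h2⟩ := exists_dev_lattice (.inl rfl) (show 2 ≤ m by omega)
  refine ⟨M, h3, h2, D.hasPointGroup_lattice_odd hm hodd, fun M' h3' h2' => ?_⟩
  obtain ⟨m', -, hm', hD⟩ := h3'.exists_lattice h2'
  obtain rfl : m = m' := by omega
  rcases hD with ⟨⟨D'⟩⟩ | ⟨⟨D'⟩⟩
  · exact D'.iso D
  · rw [← mirror_mirror (L := lattice 0 m), mirror_lattice hodd] at D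
    exact D'.iso_mirror D

/-- For even `m` each lattice is its own mirror image, so an isomorphism amounts to a rotation
between them. It preserves the vectors ±2, hence is ±1, and the lattices would coincide. -/
theorem Dev.not_iso_lattice {s s' : ℤ} {m : ℕ} (D : Dev M (lattice s m))
    (D' : Dev N (lattice s' m)) (hs : s = 0 ∨ s = 1) (hs' : s' = 0 ∨ s' = 1) (hne : s ≠ s')
    (hm : 4 ≤ m) (heven : Even m) : ¬ M.Iso N := fun h => by
  have h' := D'.of_iso h
  rw [mirror_lattice_of_even heven, or_self] at h'
  obtain ⟨D''⟩ := h'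
  obtain ⟨i, hi⟩ := D.exists_eq_rotate D''
  have h2 : unit 0 + unit 0 ∈ lattice s' m := ⟨0, by simp [unit_zero_eq], by simp [unit_zero_eq]⟩
  rw [hi, mem_rotate, mul_add, unit_mul, add_zero] at h2
  have h1 : (⟨s', m⟩ : Eis) ∈ lattice s' m := ⟨1, by simp, by simp⟩
  have h1' : (⟨s', m⟩ : Eis) ∈ lattice s m := by
    rw [hi, mem_rotate] at h1
    rcases eq_zero_or_three_of_lattice (by omega) hs (by omega) h2 with rfl | rfl
    · rwa [unit_zero, one_mul] at h1
    · have : unit 3 = -1 := by decide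
      rw [this, neg_mul, one_mul] at h1
      exact neg_mem_iff.1 h1
  obtain ⟨t, ht, hd⟩ := h1'
  have ht' : t = 1 := by
    have hm0 : (m : ℤ) ≠ 0 := by omega
    have e : (m : ℤ) * 1 = m * t := by simpa using ht
    exact (mul_left_cancel₀ hm0 e).symm
  simp only [ht', mul_one] at hd
  omega

theorem exists_formII_of_even {m : ℕ} (hm : 4 ≤ m) (heven : Even m) :
    ∃ M₁ M₂ : CombMap, M₁.IsThree (8 * m) ∧ M₁.FormII ∧ M₁.HasPointGroup PointGroup.D2h ∧
      M₂.IsThree (8 * m) ∧ M₂.FormII ∧ M₂.HasPointGroup PointGroup.D2d ∧ ¬ M₁.Iso M₂ ∧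
      ∀ M' : CombMap, M'.IsThree (8 * m) → M'.FormII → M'.Iso M₁ ∨ M'.Iso M₂ := by
  obtain ⟨h, hh⟩ := heven
  have hh' : (m : ℤ) = 2 * (h : ℤ) := by omega
  -- Conjugation preserves both lattices. The one with `s + h` even contains the vertical vector `-h
  -- + m ζ` and has a rectangular basis; the other has a rhombic one.
  obtain ⟨s, s', hs, hs', hne, hsh, hsh'⟩ : ∃ s s' : ℤ, (s = 0 ∨ s = 1) ∧ (s' = 0 ∨ s' = 1) ∧
      s ≠ s' ∧ (2 ∣ s + h) ∧ 2 ∣ s' + h - 1 := by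
    rcases Nat.even_or_odd' h with ⟨k, hk | hk⟩
    · exact ⟨0, 1, .inl rfl, .inr rfl, by norm_num, by omega, by omega⟩
    · exact ⟨1, 0, .inr rfl, .inl rfl, by norm_num, by omega, by omega⟩
  obtain ⟨M₁, ⟨D₁⟩, h3, h2⟩ := exists_dev_lattice hs (show 2 ≤ m by omega)
  obtain ⟨M₂, ⟨D₂⟩, h3', h2'⟩ := exists_dev_lattice hs' (show 2 ≤ m by omega)
  refine ⟨M₁, M₂, h3, h2, (D₁.hasPointGroup_lattice_even (by omega) hs (by omega) hh').1 hsh,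
    h3', h2', (D₂.hasPointGroup_lattice_even (by omega) hs' (by omega) hh').2 hsh',
    D₁.not_iso_lattice D₂ hs hs' hne hm ⟨h, hh⟩, fun M' h3 h2 => ?_⟩
  obtain ⟨m', -, hm', hD⟩ := h3.exists_lattice h2
  obtain rfl : m = m' := by omega
  have : (s = 0 ∧ s' = 1) ∨ (s = 1 ∧ s' = 0) := by omega
  rcases this with ⟨rfl, rfl⟩ | ⟨rfl, rfl⟩
  · rcases hD with ⟨⟨D⟩⟩ | ⟨⟨D⟩⟩
    exacts [.inl (D.iso D₁), .inr (D.iso D₂)]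
  · rcases hD with ⟨⟨D⟩⟩ | ⟨⟨D⟩⟩
    exacts [.inr (D.iso D₂), .inl (D.iso D₁)]

theorem IsThree.exists_skewLattice (h : M.IsThree n) (h3 : M.FormIII) :
    ∃ k, 4 ≤ k ∧ n = 4 * k ∧ Nonempty (Dev M (skewLattice k)) := by
  obtain ⟨L, ⟨D⟩, hn, rfl | hu⟩ := h.exists_dev
  · exact (D.not_formIII_of_top h3).elim
  · obtain ⟨⟨i, hi⟩, hk⟩ := D.exists_of_formIII hu h3
    obtain ⟨hk', hD⟩ := D.exists_skewLattice_of_mem hu hi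
    exact ⟨_, by omega, hn, hD⟩

theorem exists_formIII {k : ℕ} (hk : 4 ≤ k) :
    ∃ M : CombMap, M.IsThree (4 * k) ∧ M.FormIII ∧ (Even k → M.HasPointGroup PointGroup.D2h) ∧
      (Odd k → M.HasPointGroup PointGroup.D2d) ∧
      ∀ M' : CombMap, M'.IsThree (4 * k) → M'.FormIII → M'.Iso M := by
  have : (skewLattice k).FiniteIndex := ⟨by rw [index_skewLattice]; omega⟩
  have D := tilingQuotientDev (skewLattice k)
  have hp := D.hasPointGroup_skewLattice hk
  refine ⟨_, D.isThree_skewLattice (by omega), D.formIII_skewLattice hk, hp.1, hp.2,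
    fun M' h3 h => ?_⟩
  obtain ⟨k', -, hk', ⟨D'⟩⟩ := h3.exists_skewLattice h
  obtain rfl : k = k' := by omega
  exact D'.iso D

end CombMap

/-! ### Lattices with a vector of norm seven -/

namespace Eis

open scoped QuadraticAlgebra

variable {L : AddSubgroup Eis}

/-- Modulo the primitive vector `c + ζ` the ring becomes the group of integers, where a subgroup is
determined by its index. -/
theorem eq_of_mem_of_index_eq {L L' : AddSubgroup Eis} {c : ℤ} (h : (⟨c, 1⟩ : Eis) ∈ L)
    (h' : (⟨c, 1⟩ : Eis) ∈ L') (hi : L.index = L'.index) : L = L' := by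
  let f : Eis →+ ℤ :=
    { toFun := fun x => x.re - c * x.im
      map_zero' := by simp
      map_add' := fun x y => by simp; ring }
  let g : ℤ →+ Eis :=
    { toFun := fun n => ⟨n, 0⟩
      map_zero' := by ext <;> simp
      map_add' := fun x y => by ext <;> simp }
  have hf : Function.Surjective f := fun n => ⟨⟨n, 0⟩, by simp [f]⟩
  have key : ∀ K : AddSubgroup Eis, (⟨c, 1⟩ : Eis) ∈ K → K = (K.comap g).comap f := by
    intro K hK
    ext x
    have e : x = g (f x) + x.im • (⟨c, 1⟩ : Eis) := by
      ext <;> simp [f, g]; ring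
    have h2 : x ∈ K ↔ g (f x) ∈ K := by
      conv_lhs => rw [e]
      exact add_mem_cancel_right (zsmul_mem hK _)
    exact h2
  obtain ⟨a, ha⟩ := Int.subgroup_cyclic (L.comap g)
  obtain ⟨b, hb⟩ := Int.subgroup_cyclic (L'.comap g)
  rw [key L h, key L' h'] at hi ⊢
  rw [AddSubgroup.index_comap_of_surjective _ hf, AddSubgroup.index_comap_of_surjective _ hf, ha,
    hb, ← AddSubgroup.zmultiples_eq_closure, ← AddSubgroup.zmultiples_eq_closure,
    Int.index_zmultiples, Int.index_zmultiples] at hi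
  rw [ha, hb, ← AddSubgroup.zmultiples_eq_closure, ← AddSubgroup.zmultiples_eq_closure,
    ← Int.zmultiples_natAbs, hi, Int.zmultiples_natAbs]

/-! ### Vectors of small norm -/

/-- The norm form. -/
def normSq (x : Eis) : ℤ := x.re * x.re + x.re * x.im + x.im * x.im

theorem bounds_of_normSq_le {x : Eis} (h : normSq x ≤ 7) :
    (-3 ≤ x.re ∧ x.re ≤ 3) ∧ -3 ≤ x.im ∧ x.im ≤ 3 := by
  unfold normSq at h
  refine ⟨⟨?_, ?_⟩, ?_, ?_⟩
  · by_contra h'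
    nlinarith [sq_nonneg (x.re + 2 * x.im)]
  · by_contra h'
    nlinarith [sq_nonneg (x.re + 2 * x.im)]
  · by_contra h'
    nlinarith [sq_nonneg (2 * x.re + x.im)]
  · by_contra h'
    nlinarith [sq_nonneg (2 * x.re + x.im)]

theorem cases_of_normSq_le {x : Eis} (h : normSq x ≤ 7) : x = 0 ∨ ∃ i, x = unit i ∨
    x = unit i + unit i ∨ x = unit i + unit (i + 1) ∨ x = unit i * ⟨2, 1⟩ ∨
      x = unit i * star ⟨2, 1⟩ := by
  obtain ⟨⟨h1, h2⟩, h3, h4⟩ := bounds_of_normSq_le h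
  obtain ⟨a, b⟩ := x
  simp only at h1 h2 h3 h4
  have key : ∀ a ∈ Finset.Icc (-3 : ℤ) 3, ∀ b ∈ Finset.Icc (-3 : ℤ) 3,
      a * a + a * b + b * b ≤ 7 → ((⟨a, b⟩ : Eis) = 0 ∨ ∃ i, (⟨a, b⟩ : Eis) = unit i ∨
    (⟨a, b⟩ : Eis) = unit i + unit i ∨ (⟨a, b⟩ : Eis) = unit i + unit (i + 1) ∨
    (⟨a, b⟩ : Eis) = unit i * ⟨2, 1⟩ ∨ (⟨a, b⟩ : Eis) = unit i * star ⟨2, 1⟩) := by decide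
  exact key a (Finset.mem_Icc.2 ⟨h1, h2⟩) b (Finset.mem_Icc.2 ⟨h3, h4⟩) h

/-- Three hexagons around a vertex each have a neighbour in `L`. As these neighbours are not among
the three hexagons, two of them are distinct and at distance of norm at most 7. The nonzero norms up
to 7 are 1, 3, 4 and 7, and the first three are excluded. -/
theorem exists_normSq_seven (hu : ∀ j, unit j ∉ L)
    (hs : ∀ i, unit i + unit i ∉ L ∧ unit i + unit (i + 1) ∉ L) {v : Eis} {a b c : ZMod 6}
    (h1 : v ∉ L) (h2 : v + unit 0 ∉ L) (h3 : v + unit 1 ∉ L) (ha : v + unit a ∈ L)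
    (hb : v + unit 0 + unit b ∈ L) (hc : v + unit 1 + unit c ∈ L) :
    ∃ i, unit i * ⟨2, 1⟩ ∈ L ∨ unit i * star ⟨2, 1⟩ ∈ L := by
  have key : ∀ a b c : ZMod 6,
    (unit a = unit 1 ∨ unit 0 + unit b = unit 1 ∨ unit b = -unit 0 ∨ unit 1 + unit c = unit 0) ∨
    (unit 0 + unit b - unit a ≠ 0 ∧ normSq (unit 0 + unit b - unit a) ≤ 7) ∨
    (unit 1 + unit c - unit a ≠ 0 ∧ normSq (unit 1 + unit c - unit a) ≤ 7) := by decide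
  have fin : ∀ x ∈ L, x ≠ 0 → normSq x ≤ 7 →
      ∃ i, unit i * ⟨2, 1⟩ ∈ L ∨ unit i * star ⟨2, 1⟩ ∈ L := by
    intro x hx h0 hn
    rcases cases_of_normSq_le hn with rfl | ⟨i, rfl | rfl | rfl | rfl | rfl⟩
    exacts [absurd rfl h0, absurd hx (hu i), absurd hx (hs i).1, absurd hx (hs i).2,
      ⟨i, .inl hx⟩, ⟨i, .inr hx⟩]
  rcases key a b c with (h | h | h | h) | ⟨h, h'⟩ | ⟨h, h'⟩
  · exact absurd (h ▸ ha) h3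
  · exact absurd (by rwa [add_assoc, h] at hb) h3
  · exact absurd (by rwa [add_assoc, h, add_neg_cancel, add_zero] at hb) h1
  · exact absurd (by rwa [add_assoc, h] at hc) h2
  · refine fin _ ?_ h h'
    have := sub_mem hb ha
    rwa [add_assoc, add_sub_add_left_eq_sub] at this
  · refine fin _ ?_ h h'
    have := sub_mem hc ha
    rwa [add_assoc, add_sub_add_left_eq_sub] at this

end Eis

namespace CombMap

open Eis

variable {M N : CombMap} {L L' : AddSubgroup Eis} {m n : ℕ}

/-- Up to isomorphism there is at most one development of each index with a vector of norm seven. -/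
theorem Dev.iso_of_seven (D : Dev M L) (D' : Dev N L') (hi : L.index = L'.index)
    (h : ∃ i, unit i * ⟨2, 1⟩ ∈ L ∨ unit i * star ⟨2, 1⟩ ∈ L)
    (h' : ∃ i, unit i * ⟨2, 1⟩ ∈ L' ∨ unit i * star ⟨2, 1⟩ ∈ L') : M.Iso N := by
  obtain ⟨i, h⟩ := h
  obtain ⟨i', h'⟩ := h'
  have E := D.rotate i
  have E' := D'.rotate i'
  rw [D.index_eq E, D'.index_eq E'] at hi
  rw [← mem_rotate, ← mem_rotate] at h h'
  have hm : (mirror (Eis.rotate i L)).index = (Eis.rotate i' L').index :=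
    hi ▸ AddSubgroup.index_comap_of_surjective _ (starAddEquiv : Eis ≃+ Eis).surjective
  -- The conjugate vector is `3 - ζ`; its negative has imaginary part 1, as the comparison of
  -- lattices requires.
  have hneg : ∀ K : AddSubgroup Eis, star ⟨2, 1⟩ ∈ K ↔ (⟨-3, 1⟩ : Eis) ∈ K := fun K => by
    rw [← neg_mem_iff]; rfl
  rcases h with h | h <;> rcases h' with h' | h'
  · exact E.iso (eq_of_mem_of_index_eq h h' hi ▸ E')
  · have h2 : star ⟨2, 1⟩ ∈ mirror (Eis.rotate i L) := by rwa [mem_mirror, star_star]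
    exact E.iso_mirror (eq_of_mem_of_index_eq ((hneg _).1 h2) ((hneg _).1 h') hm ▸ E')
  · exact E.iso_mirror (eq_of_mem_of_index_eq (mem_mirror.2 h) h' hm ▸ E')
  · exact E.iso (eq_of_mem_of_index_eq ((hneg _).1 h) ((hneg _).1 h') hi ▸ E')

/-! ### Truncation of a fullerene at the centres of triples -/

section Centres

variable {H : CombMap} {S S' : Set H.Vertex}

theorem IsTripleCentres.truncatesToHexagons (hH : H.IsFullerene m) (hS : H.IsTripleCentres S) :
    H.TruncatesToHexagons S := by
  obtain ⟨_, ⟨hloop, _⟩, _, hdeg, hs, _⟩ := hH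
  have hc := cubic_iff.2 hdeg
  intro d
  rcases hs (H.face d) with h5 | h6
  · obtain ⟨v, ⟨hv, a, ha, haF⟩, huniq⟩ := hS.2 _ h5
    -- A pentagon is not adjacent to itself: wherever `opp e` sat on its boundary, a loop or a fixed
    -- dart would arise. Hence the pentagon has only one corner at its centre.
    have hopp : ∀ e, H.size (H.face e) = 5 → H.face (H.opp e) ≠ H.face e := by
      intro e he hf
      have hp : H.next^[5] e = e := he ▸ iterate_size e
      obtain ⟨k, hk, hk'⟩ := exists_iterate_next_of_face_eq hf.symm
      rw [he] at hk
      have hl : ∀ e, H.next (H.next e) ≠ H.opp e := by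
        intro e h
        apply hloop (H.next e)
        rw [← vert_next, h, vert_next]
      interval_cases k
      · exact H.opp_ne e hk'.symm
      · exact hc.rot_ne _ hk'
      · exact hl e hk'
      · apply hl (H.opp e)
        rw [H.opp_opp]
        rw [← hk']
        exact hp
      · apply hc.rot_ne e
        rw [← next_opp, ← hk']
        exact hp
    have : {e | H.face e = H.face d ∧ H.vert e ∈ S} = {a} := by
      ext e
      refine ⟨fun ⟨he, heS⟩ => ?_, fun he => ?_⟩
      · have hve : H.vert e = H.vert a := by rw [huniq _ ⟨heS, e, rfl, he⟩, ha]
        rcases hc.vert_eq hve with rfl | rfl | rfl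
        · rfl
        · rw [face_rot, ← he] at haF
          exact (hopp e (he ▸ h5) haF).elim
        · rw [hc.rot_rot] at haF
          have h2 : H.face (H.opp (H.rot.symm e)) = H.face e := by
            rw [← next_symm_apply, face_next_symm]
          refine (hopp (H.rot.symm e) (haF ▸ h5) ?_).elim
          rw [h2, he, haF]
      · rw [he]
        exact ⟨haF, ha ▸ hv⟩
    rw [h5, this, Set.ncard_singleton]
  · have : {e | H.face e = H.face d ∧ H.vert e ∈ S} = ∅ := by
      ext e
      refine ⟨fun ⟨he, heS⟩ => ?_, fun h => h.elim⟩
      have := hS.1 e heS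
      rw [he] at this
      omega
    rw [h6, this, Set.ncard_empty]

theorem IsTripleCentres.exists_dev (hH : H.IsFullerene m) (hS : H.IsTripleCentres S) :
    ∃ L, Nonempty (Dev (H.truncate S) L) ∧ (∀ j, unit j ∉ L) ∧ m + 8 = 4 * L.index ∧
      {d | H.vert d ∈ S}.ncard = 12 := by
  have hT := hS.truncatesToHexagons hH
  obtain ⟨⟨_, hconn, heul⟩, _, _, hdeg, hs, hcard⟩ := hH
  have hc := cubic_iff.2 hdeg
  have hne : ∃ d, H.vert d ∈ S := by
    have h60 := (euler_five_six hc hs).1 heul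
    obtain ⟨d, hd⟩ := Set.nonempty_of_ncard_ne_zero (h60.trans_ne (by norm_num))
    obtain ⟨v, ⟨hv, a, rfl, -⟩, -⟩ := hS.2 _ hd
    exact ⟨a, hv⟩
  obtain ⟨L, ⟨D⟩, hu, h12⟩ := hT.exists_dev hc hconn hne
  refine ⟨L, ⟨D⟩, hu, ?_, h12⟩
  have h1 := D.card_dart
  rw [card_truncate_dart, h12, hc.card_dart, hcard] at h1
  omega

theorem TruncatesToHexagons.eq_of_face_eq (h : H.TruncatesToHexagons S) {d e : H.Dart}
    (h5 : 5 ≤ H.size (H.face d)) (hf : H.face d = H.face e) (hd : H.vert d ∈ S)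
    (he : H.vert e ∈ S) : d = e := by
  have h1 := h d
  have : {e | H.face e = H.face d ∧ H.vert e ∈ S}.ncard ≤ 1 := by omega
  exact (Set.ncard_le_one (Set.toFinite _)).1 this _ ⟨rfl, hd⟩ _ ⟨hf.symm, he⟩

/-- A vector of norm 3 or 4 would yield two truncated corners on one old face, but a face with five
or six sides that becomes a hexagon has at most one. -/
theorem IsTripleCentres.no_short (hH : H.IsFullerene m) (hS : H.IsTripleCentres S)
    (D : Dev (H.truncate S) L) (i : ZMod 6) :
    unit i + unit i ∉ L ∧ unit i + unit (i + 1) ∉ L := by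
  have hT := hS.truncatesToHexagons hH
  have hc := cubic_iff.2 hH.2.2.2.1
  have h5 : ∀ d, 5 ≤ H.size (H.face d) := fun d => by
    rcases hH.2.2.2.2.1 (H.face d) with h | h <;> omega
  have hk : ∀ d k, 0 < k → k < 5 → H.next^[k] d ≠ d := by
    intro d k h0 hk h
    have := Function.IsPeriodicPt.minimalPeriod_le h0 h
    have := h5 d
    rw [size_face] at this
    omega
  refine ⟨fun h => ?_, fun h => ?_⟩
  · obtain ⟨d, hd, hd' | hd'⟩ := hT.exists_of_two_mul_unit hc D h
    · exact hk d 1 (by norm_num) (by norm_num)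
        (hT.eq_of_face_eq (h5 d) (face_next d).symm hd hd').symm
    · exact hk d 2 (by norm_num) (by norm_num)
        (hT.eq_of_face_eq (h5 d) (face_iterate_next d 2).symm hd hd').symm
  · obtain ⟨d, hd, hd'⟩ := (hT.exists_skew_iff hc D).1 ⟨i, h⟩
    rw [← vert_next] at hd'
    exact hk d 1 (by norm_num) (by norm_num)
      (hT.eq_of_face_eq (h5 d) (face_next d).symm hd hd').symm

theorem IsTripleCentres.isThree (hH : H.IsFullerene m) (hS : H.IsTripleCentres S) :
    (H.truncate S).IsThree (m + 8) ∧ (H.truncate S).FormIV := by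
  obtain ⟨L, ⟨D⟩, hu, hm, -⟩ := hS.exists_dev hH
  exact ⟨hm ▸ D.isThree_of_unit_notMem hu, (D.formIV_iff hu).2 (hS.no_short hH D)⟩

theorem TruncatesToHexagons.exists_add_unit_mem (hc : H.Cubic) (h : H.TruncatesToHexagons S)
    (D : Dev (H.truncate S) L) {d : H.Dart} {v : Eis} {j : ZMod 6}
    (hv : D.φ v j = truncOld S d) (hd : H.size (H.face d) = 5) :
    v ∉ L ∧ ∃ i, v + unit i ∈ L := by
  refine ⟨fun hL => ?_, ?_⟩
  · have := D.size_three_iff (j := j).2 hL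
    rw [hv, h.size_three_iff hc] at this
    obtain ⟨e, he, h'⟩ := this
    cases h'
  · have h1 := h d
    have : {e | H.face e = H.face d ∧ H.vert e ∈ S}.ncard ≠ 0 := by omega
    obtain ⟨e, he, heS⟩ := Set.nonempty_of_ncard_ne_zero this
    have hf : H.vert (H.rot.symm e) ∈ S := by rwa [vert_rot_symm]
    have hface : (H.truncate S).face (truncNew (H.rot.symm e) hf false) =
        (H.truncate S).face (D.φ v j) := by
      rw [← face_next, truncate_next_false, Equiv.apply_symm_apply, hv, truncate_face_old_eq_iff, he]
    obtain ⟨i, hi⟩ := D.exists_eq_of_face_eq hface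
    exact ⟨i, h.unit_mem_of_eq hc D hi.symm⟩

/-- A centre for `S'` that is not in `S` remains a vertex of the truncation. The three pentagons
around it have become hexagons, each adjacent to a triangle. -/
theorem IsTripleCentres.exists_seven (hH : H.IsFullerene m) (hS : H.IsTripleCentres S)
    (hS' : H.IsTripleCentres S') (D : Dev (H.truncate S) L) (hu : ∀ j, unit j ∉ L)
    {d : H.Dart} (hd' : H.vert d ∈ S') (hd : H.vert d ∉ S) :
    ∃ i, unit i * ⟨2, 1⟩ ∈ L ∨ unit i * star ⟨2, 1⟩ ∈ L := by
  have hT := hS.truncatesToHexagons hH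
  have hc := cubic_iff.2 hH.2.2.2.1
  obtain ⟨v, j, hv⟩ := D.surj (truncOld S d)
  have h1 : D.φ (v + unit j) (j + 4) = truncOld S (H.rot d) := by
    rw [← D.isDev.rot, hv, truncate_rot_old_of_notMem _ hd]
  have h2 : D.φ (v + unit (j + 5)) (j + 2) = truncOld S (H.rot (H.rot d)) := by
    rw [← D.isDev.rot_rot, hv, truncate_rot_old_of_notMem _ hd,
      truncate_rot_old_of_notMem _ (by rwa [vert_rot])]
  obtain ⟨n0, a, ha⟩ := hT.exists_add_unit_mem hc D hv (hS'.1 _ hd')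
  obtain ⟨n1, b, hb⟩ := hT.exists_add_unit_mem hc D h1 (hS'.1 _ (by rwa [vert_rot]))
  obtain ⟨n2, c, hc'⟩ := hT.exists_add_unit_mem hc D h2 (hS'.1 _ (by rwa [vert_rot, vert_rot]))
  -- With `r = j + 5` the three faces are `v`, `v + unit r` and `v + unit (r + 1)`; turning the
  -- lattice by `r` puts them in standard position.
  have hj : j = j + 5 + 1 := by rw [add_assoc, show (5 : ZMod 6) + 1 = 0 from rfl, add_zero]
  generalize j + 5 = r at *
  subst hj
  have e1 : ∀ x a, x + unit a = unit r * (unit (-r) * x + unit (a - r)) := fun x a => by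
    rw [mul_add, unit_mul_neg, unit_mul, add_sub_cancel]
  have e2 : ∀ x a b, x + unit a + unit b =
      unit r * (unit (-r) * x + unit (a - r) + unit (b - r)) := fun x a b => by
    rw [mul_add, ← e1, unit_mul, add_sub_cancel]
  rw [e1] at n1 n2 ha
  rw [e2] at hb hc'
  rw [add_sub_cancel_left] at n1 hb
  rw [sub_self] at n2 hc'
  rw [← unit_mul_neg r v] at n0
  obtain ⟨i, hi⟩ := exists_normSq_seven (L := Eis.rotate r L)
    (fun i => by rw [unit_mem_rotate]; exact hu _)
    (fun i => by
      rw [mem_rotate, mem_rotate, mul_add, mul_add, unit_mul, unit_mul, ← add_assoc]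
      exact hS.no_short hH D (r + i)) n0 n2 n1 ha hc' hb
  refine ⟨r + i, ?_⟩
  rwa [mem_rotate, mem_rotate, ← mul_assoc, ← mul_assoc, unit_mul] at hi

/-- Both sets are surrounded by 12 darts, so if they differ, each has a vertex outside the other.
Both lattices then contain a vector of norm 7, and they have the same index. -/
theorem IsTripleCentres.truncate_iso (hH : H.IsFullerene m) (hS : H.IsTripleCentres S)
    (hS' : H.IsTripleCentres S') : (H.truncate S).Iso (H.truncate S') := by
  obtain ⟨L, ⟨D⟩, hu, hm, h12⟩ := hS.exists_dev hH
  obtain ⟨L', ⟨D'⟩, hu', hm', h12'⟩ := hS'.exists_dev hH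
  have hsub : ∀ {S S' : Set H.Vertex}, {d | H.vert d ∈ S}.ncard = 12 →
      {d | H.vert d ∈ S'}.ncard = 12 → S ≠ S' → ∃ d, H.vert d ∈ S' ∧ H.vert d ∉ S := by
    intro S S' h h' hne
    by_contra! hcon
    have he := Set.eq_of_subset_of_ncard_le (s := {d | H.vert d ∈ S'}) (t := {d | H.vert d ∈ S})
      hcon (by rw [h, h'])
    apply hne
    ext v
    obtain ⟨d, rfl⟩ := vert_surj v
    exact (Set.ext_iff.1 he d).symm
  by_cases hne : S = S'
  · subst hne
    exact D.iso D
  · obtain ⟨d, hd', hd⟩ := hsub h12 h12' hne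
    obtain ⟨e, he, he'⟩ := hsub h12' h12 (Ne.symm hne)
    exact D.iso_of_seven D' (by omega) (hS.exists_seven hH hS' D hu hd' hd)
      (hS'.exists_seven hH hS D' hu' he he')

end Centres

end CombMap

namespace CombMap

variable {H : CombMap} {m : ℕ}

/-! ### Triples of mutually adjacent faces -/

/-- The three faces around the initial vertex of `d`. -/
def facesAround (H : CombMap) (d : H.Dart) : Set H.Face :=
  {H.face d, H.face (H.rot d), H.face (H.rot (H.rot d))}

section Belt

variable {a b c : H.Dart}

theorem facesAround_eq (h : H.next (H.opp c) = a) (hb : H.face (H.opp a) = H.face b) :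
    H.facesAround c = {H.face a, H.face b, H.face c} := by
  rw [next_opp] at h
  rw [facesAround, h, face_rot, hb, Set.insert_comm, Set.pair_comm (H.face c)]

/-- Three edges that join three faces in a cycle, two consecutive ones being two steps apart along
each face, surround a triangle. -/
theorem Cubic.size_le_three (hc : H.Cubic) (h1 : H.next (H.next (H.opp c)) = a)
    (h2 : H.next (H.next (H.opp a)) = b) (h3 : H.next (H.next (H.opp b)) = c) :
    ∃ d, H.size (H.face d) ≤ 3 := by
  have step : ∀ {c a : H.Dart}, H.next (H.next (H.opp c)) = a →
      H.opp (H.rot c) = H.rot.symm a := by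
    intro c a h
    rw [← h, next_opp, next_apply, Equiv.symm_apply_apply]
  have step' : ∀ {c a b : H.Dart}, H.next (H.next (H.opp c)) = a → H.next (H.next (H.opp a)) = b →
      H.next (H.opp (H.rot a)) = H.opp (H.rot c) := by
    intro c a b h h'
    rw [next_opp, hc.rot_rot, step h]
  refine ⟨H.opp (H.rot c), ?_⟩
  rw [size_face]
  refine Function.IsPeriodicPt.minimalPeriod_le (by norm_num) ?_
  show H.next (H.next (H.next _)) = _
  rw [step' h3 h1, step' h2 h3, step' h1 h2]

/-- The belt encloses a region with four boundary edges, which a single edge enters, at the vertex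
where `rot z` starts. The face inside traverses the four edges and then this edge in both
directions; with five or six sides it has no room to turn round. -/
theorem Cubic.false_of_belt (hc : H.Cubic) (h6 : ∀ d, H.size (H.face d) = 5 ∨ H.size (H.face d) = 6)
    (h1 : H.next (H.next (H.opp c)) = a) (h2 : H.next (H.next (H.opp a)) = b)
    (h3 : H.next (H.next (H.next (H.opp b))) = c) : False := by
  have step : ∀ {c a : H.Dart}, H.next (H.next (H.opp c)) = a →
      H.opp (H.rot c) = H.rot.symm a := by
    intro c a h
    rw [← h, next_opp, next_apply, Equiv.symm_apply_apply]
  set z := H.next (H.rot b) with hz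
  have hzc : H.next z = c := by rw [hz, ← next_opp]; exact h3
  have e1 : H.next (H.opp (H.rot b)) = H.opp (H.rot a) := by rw [next_opp, hc.rot_rot, step h2]
  have e2 : H.next (H.opp (H.rot a)) = H.opp (H.rot c) := by rw [next_opp, hc.rot_rot, step h1]
  have e3 : H.next (H.opp (H.rot c)) = H.opp z := by
    rw [next_opp, hc.rot_rot, ← hzc, next_apply, Equiv.symm_apply_apply]
  have e4 : H.next (H.opp z) = H.rot z := next_opp z
  have e5 : H.next (H.opp (H.rot z)) = H.opp (H.rot b) := by
    rw [next_opp, hc.rot_rot, hz, next_apply, Equiv.symm_apply_apply]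
  rcases h6 (H.opp (H.rot b)) with h | h
  · have hp := iterate_size (H.opp (H.rot b))
    rw [h] at hp
    have hp' : H.next (H.next (H.next (H.next (H.next (H.opp (H.rot b)))))) = _ := hp
    rw [e1, e2, e3, e4, ← e5] at hp'
    exact H.opp_ne _ (H.next.injective hp').symm
  · have hp := iterate_size (H.opp (H.rot b))
    rw [h] at hp
    have hp' : H.next (H.next (H.next (H.next (H.next (H.next (H.opp (H.rot b))))))) = _ := hp
    rw [e1, e2, e3, e4, ← e5] at hp'
    exact hc.rot_ne _ (H.next.injective hp')

/-- A gap of one step means that two consecutive common edges meet at a vertex shared by all three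
faces. Otherwise the gaps are `2, 2, 2` or `2, 2, 3` in some order, and the enclosed region is too
small. -/
theorem Cubic.exists_facesAround_of_le (hc : H.Cubic)
    (h6 : ∀ d, H.size (H.face d) = 5 ∨ H.size (H.face d) = 6) {p q r : ℕ}
    (hp : H.next^[p] (H.opp c) = a) (hq : H.next^[q] (H.opp a) = b)
    (hr : H.next^[r] (H.opp b) = c) (hp0 : 0 < p) (hq0 : 0 < q) (hr0 : 0 < r)
    (hsum : p + q + r ≤ 7) :
    ∃ d, H.facesAround d = {H.face a, H.face b, H.face c} := by
  have ha : H.face (H.opp c) = H.face a := by rw [← hp, face_iterate_next]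
  have hb : H.face (H.opp a) = H.face b := by rw [← hq, face_iterate_next]
  have hc' : H.face (H.opp b) = H.face c := by rw [← hr, face_iterate_next]
  by_cases hp1 : p = 1
  · subst hp1
    exact ⟨c, facesAround_eq hp hb⟩
  by_cases hq1 : q = 1
  · subst hq1
    refine ⟨a, (facesAround_eq hq hc').trans ?_⟩
    rw [Set.pair_comm (H.face c), Set.insert_comm]
  by_cases hr1 : r = 1
  · subst hr1
    refine ⟨b, (facesAround_eq hr ha).trans ?_⟩
    rw [Set.insert_comm, Set.pair_comm (H.face c)]
  exfalso
  have hcases : (p = 2 ∧ q = 2 ∧ r = 2) ∨ (p = 2 ∧ q = 2 ∧ r = 3) ∨ (p = 2 ∧ q = 3 ∧ r = 2) ∨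
    (p = 3 ∧ q = 2 ∧ r = 2) := by omega
  rcases hcases with ⟨rfl, rfl, rfl⟩ | ⟨rfl, rfl, rfl⟩ | ⟨rfl, rfl, rfl⟩ | ⟨rfl, rfl, rfl⟩
  · obtain ⟨d, hd⟩ := hc.size_le_three hp hq hr
    rcases h6 d with h | h <;> omega
  · exact hc.false_of_belt h6 hp hq hr
  · exact hc.false_of_belt h6 hr hp hq
  · exact hc.false_of_belt h6 hq hr hp

theorem Cubic.exists_facesAround (hc : H.Cubic)
    (h6 : ∀ d, H.size (H.face d) = 5 ∨ H.size (H.face d) = 6)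
    (ha : H.face (H.opp c) = H.face a) (hb : H.face (H.opp a) = H.face b)
    (hc' : H.face (H.opp b) = H.face c) (h5a : H.size (H.face a) = 5)
    (h5b : H.size (H.face b) = 5) (h5c : H.size (H.face c) = 5)
    (hab : H.face a ≠ H.face b) (hbc : H.face b ≠ H.face c) (hac : H.face a ≠ H.face c) :
    ∃ d, H.facesAround d = {H.face a, H.face b, H.face c} := by
  have back : ∀ {x y : H.Dart} {k : ℕ}, H.next^[k] x = y → H.size (H.face x) = 5 → k < 5 →
      H.next^[5 - k] y = x := by
    intro x y k h h5 hk
    rw [← h, ← Function.iterate_add_apply, Nat.sub_add_cancel hk.le, ← h5]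
    exact iterate_size x
  obtain ⟨p, hp5, hp⟩ := exists_iterate_next_of_face_eq ha
  obtain ⟨q, hq5, hq⟩ := exists_iterate_next_of_face_eq hb
  obtain ⟨r, hr5, hr⟩ := exists_iterate_next_of_face_eq hc'
  rw [ha, h5a] at hp5
  rw [hb, h5b] at hq5
  rw [hc', h5c] at hr5
  have hp0 : 0 < p := by
    rcases Nat.eq_zero_or_pos p with rfl | h
    · obtain rfl : H.opp c = a := hp
      rw [H.opp_opp] at hb
      exact absurd hb.symm hbc
    · exact h
  have hq0 : 0 < q := by
    rcases Nat.eq_zero_or_pos q with rfl | h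
    · obtain rfl : H.opp a = b := hq
      rw [H.opp_opp] at hc'
      exact absurd hc' hac
    · exact h
  have hr0 : 0 < r := by
    rcases Nat.eq_zero_or_pos r with rfl | h
    · obtain rfl : H.opp b = c := hr
      rw [H.opp_opp] at ha
      exact absurd ha.symm hab
    · exact h
  -- Seen from the other side of the belt the gaps are `5 - p`, `5 - q`, `5 - r`, with total 15
  -- minus the original one; so one of the two sides has total at most 7.
  by_cases hsum : p + q + r ≤ 7
  · exact hc.exists_facesAround_of_le h6 hp hq hr hp0 hq0 hr0 hsum
  · obtain ⟨d, hd⟩ := hc.exists_facesAround_of_le (a := H.opp c) (b := H.opp b) (c := H.opp a) h6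
      (p := 5 - p) (q := 5 - r) (r := 5 - q)
      (by rw [H.opp_opp]; exact back hp (ha ▸ h5a) hp5)
      (by rw [H.opp_opp]; exact back hr (hc' ▸ h5c) hr5)
      (by rw [H.opp_opp]; exact back hq (hb ▸ h5b) hq5) (by omega) (by omega) (by omega) (by omega)
    refine ⟨d, hd.trans ?_⟩
    rw [ha, hb, hc', Set.pair_comm]

end Belt

theorem PentagonsInTriples.exists_isTripleCentres (hH : H.IsFullerene m)
    (hP : H.PentagonsInTriples) : ∃ S, H.IsTripleCentres S := by
  obtain ⟨P, -, hdisj, hU, ht⟩ := hP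
  have hc := cubic_iff.2 hH.2.2.2.1
  have h6 := fun d => hH.2.2.2.2.1 (H.face d)
  have h5 : ∀ t ∈ P, ∀ F ∈ t, H.size F = 5 := fun t htP F hF => by
    have : F ∈ ⋃₀ P := ⟨t, htP, hF⟩
    rwa [hU] at this
  have hd : ∀ t : P, ∃ d, H.facesAround d = t.1 := by
    rintro ⟨t, htP⟩
    obtain ⟨h3, hadj⟩ := ht t htP
    obtain ⟨A, B, C, hAB, hAC, hBC, rfl⟩ := Set.ncard_eq_three.1 h3
    obtain ⟨-, a, rfl, ha⟩ := hadj (by simp) (by simp) hAB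
    obtain ⟨-, b, rfl, hb⟩ := hadj (by simp) (by simp) hBC
    obtain ⟨-, c, rfl, hc'⟩ := hadj (by simp) (by simp) hAC.symm
    exact hc.exists_facesAround h6 hc' ha hb (h5 _ htP _ (by simp)) (h5 _ htP _ (by simp))
      (h5 _ htP _ (by simp)) hAB hBC hAC
  choose δ hδ using hd
  have hmem : ∀ d t, H.vert d = H.vert (δ t) → H.face d ∈ t.1 := by
    intro d t h
    rw [← hδ]
    rcases hc.vert_eq h.symm with rfl | rfl | rfl <;> simp [facesAround]
  refine ⟨{v | ∃ t, H.vert (δ t) = v}, fun d ⟨t, h⟩ => h5 _ t.2 _ (hmem d t h.symm), fun F hF => ?_⟩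
  have : F ∈ ⋃₀ P := by rw [hU]; exact hF
  obtain ⟨t, htP, hFt⟩ := this
  refine ⟨H.vert (δ ⟨t, htP⟩), ⟨⟨_, rfl⟩, ?_⟩, ?_⟩
  · have hFt' : F ∈ (⟨t, htP⟩ : P).1 := hFt
    rw [← hδ] at hFt'
    rcases hFt' with rfl | rfl | rfl
    exacts [⟨_, rfl, rfl⟩, ⟨_, vert_rot _, rfl⟩, ⟨_, (vert_rot _).trans (vert_rot _), rfl⟩]
  · rintro v ⟨⟨t', rfl⟩, d, hdv, rfl⟩
    have h' := hmem d t' hdv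
    have : t'.1 = t := hdisj.elim_set t'.2 htP _ h' hFt
    have h2 : t' = ⟨t, htP⟩ := Subtype.ext this
    rw [h2]

end CombMap

namespace CombMap

open Eis

theorem Iso.symm {M N : CombMap} (h : M.Iso N) : N.Iso M := by
  obtain ⟨e, ho, hr⟩ := h
  refine ⟨e.symm, fun d => ?_, ?_⟩
  · rw [Equiv.symm_apply_eq, ho, Equiv.apply_symm_apply]
  · rcases hr with hr | hr
    · refine .inl fun d => ?_
      rw [Equiv.symm_apply_eq, hr, Equiv.apply_symm_apply]
    · refine .inr fun d => ?_
      have := hr (M.rot.symm (e.symm d))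
      rw [Equiv.apply_symm_apply, Equiv.apply_symm_apply, Equiv.eq_symm_apply] at this
      rw [Equiv.symm_apply_eq, this]

theorem Iso.trans {M N K : CombMap} (h : M.Iso N) (h' : N.Iso K) : M.Iso K := by
  obtain ⟨e, ho, hr⟩ := h
  obtain ⟨f, ho', hr'⟩ := h'
  have hs : ∀ d, f (N.rot.symm d) = K.rot.symm (f d) ∨ f (N.rot.symm d) = K.rot (f d) := fun d => by
    rcases hr' with hr' | hr'
    · left
      rw [Equiv.eq_symm_apply, ← hr', Equiv.apply_symm_apply]
    · right
      have := hr' (N.rot.symm d)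
      rw [Equiv.apply_symm_apply, Equiv.eq_symm_apply] at this
      exact this.symm
  refine ⟨e.trans f, fun d => by simp [ho, ho'], ?_⟩
  rcases hr with hr | hr <;> rcases hr' with hr' | hr'
  · exact .inl fun d => by simp [hr, hr']
  · exact .inr fun d => by simp [hr, hr']
  · refine .inr fun d => ?_
    rw [Equiv.trans_apply, hr, Equiv.trans_apply, Equiv.eq_symm_apply, ← hr', Equiv.apply_symm_apply]
  · refine .inl fun d => ?_
    have := hr' (N.rot.symm (e d))
    rw [Equiv.apply_symm_apply, Equiv.eq_symm_apply] at this
    rw [Equiv.trans_apply, hr, Equiv.trans_apply, this]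

variable {M : CombMap}

/-! ### Shrinking the triangles -/

/-- The face of the dart is a triangle. -/
def InTriangle (M : CombMap) (d : M.Dart) : Prop := M.size (M.face d) = 3

/-- The triangles are pairwise non-adjacent. -/
def TrianglesApart (M : CombMap) : Prop := ∀ d, M.InTriangle d → ¬ M.InTriangle (M.opp d)

theorem inTriangle_rot (d : M.Dart) : M.InTriangle (M.rot d) ↔ M.InTriangle (M.opp d) := by
  rw [InTriangle, InTriangle, face_rot]

theorem inTriangle_next_symm (d : M.Dart) : M.InTriangle (M.next.symm d) ↔ M.InTriangle d := by
  rw [InTriangle, InTriangle, face_next_symm]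

theorem inTriangle_rot_symm (d : M.Dart) :
    M.InTriangle (M.opp (M.rot.symm d)) ↔ M.InTriangle d := by
  rw [← next_symm_apply, inTriangle_next_symm]

/-- The darts that survive when the triangles are shrunk. -/
def Surviving (M : CombMap) (d : M.Dart) : Prop := ¬ M.InTriangle d ∧ ¬ M.InTriangle (M.opp d)

theorem Surviving.opp {d : M.Dart} (h : M.Surviving d) : M.Surviving (M.opp d) :=
  ⟨h.2, by rw [M.opp_opp]; exact h.1⟩

/-- Two of the three edges at a corner of a triangle are its sides; the third leads away, and no
other triangle borders it. -/
theorem TrianglesApart.surviving_rot (hM : M.TrianglesApart) (hc : M.Cubic) {d : M.Dart}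
    (h : M.InTriangle d) : M.Surviving (M.rot d) := by
  refine ⟨by rw [inTriangle_rot]; exact hM d h, ?_⟩
  rw [← inTriangle_rot, hc.rot_rot]
  exact fun h' => hM _ h' ((inTriangle_rot_symm d).2 h)

theorem Surviving.rot_of_not {d : M.Dart} (hc : M.Cubic) (h : M.Surviving d)
    (h' : ¬ M.InTriangle (M.rot.symm d)) : M.Surviving (M.rot d) := by
  rw [Surviving, inTriangle_rot d, ← inTriangle_rot (M.rot d), hc.rot_rot]
  exact ⟨h.2, h'⟩

open Classical in
/-- The next surviving dart around its initial vertex, once the triangles are shrunk. -/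
noncomputable def shrinkStep (hc : M.Cubic) (hM : M.TrianglesApart)
    (d : {d // M.Surviving d}) : {d // M.Surviving d} :=
  if h : M.InTriangle (M.rot.symm d.1) then
    ⟨M.rot (M.next.symm (M.rot.symm d.1)),
      hM.surviving_rot hc ((inTriangle_next_symm _).2 h)⟩
  else ⟨M.rot d.1, d.2.rot_of_not hc h⟩

variable (hc : M.Cubic) (hM : M.TrianglesApart)

theorem shrinkStep_of_mem {d : {d // M.Surviving d}} (h : M.InTriangle (M.rot.symm d.1)) :
    (shrinkStep hc hM d).1 = M.rot (M.next.symm (M.rot.symm d.1)) := by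
  rw [shrinkStep, dif_pos h]

theorem shrinkStep_of_notMem {d : {d // M.Surviving d}} (h : ¬ M.InTriangle (M.rot.symm d.1)) :
    (shrinkStep hc hM d).1 = M.rot d.1 := by
  rw [shrinkStep, dif_neg h]

theorem inTriangle_shrinkStep (d : {d // M.Surviving d}) :
    M.InTriangle (M.rot.symm (shrinkStep hc hM d).1) ↔ M.InTriangle (M.rot.symm d.1) := by
  by_cases h : M.InTriangle (M.rot.symm d.1)
  · rw [shrinkStep_of_mem hc hM h, Equiv.symm_apply_apply, inTriangle_next_symm]
  · rw [shrinkStep_of_notMem hc hM h, Equiv.symm_apply_apply]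
    exact iff_of_false d.2.1 h

/-- At a shrunk triangle the step goes once round the three corners; elsewhere it is `rot`. -/
theorem shrinkStep_cube (d : {d // M.Surviving d}) :
    shrinkStep hc hM (shrinkStep hc hM (shrinkStep hc hM d)) = d := by
  apply Subtype.ext
  by_cases h : M.InTriangle (M.rot.symm d.1)
  · have h1 := (inTriangle_shrinkStep hc hM d).2 h
    have h2 := (inTriangle_shrinkStep hc hM _).2 h1
    rw [shrinkStep_of_mem hc hM h2, shrinkStep_of_mem hc hM h1, shrinkStep_of_mem hc hM h]
    simp only [Equiv.symm_apply_apply]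
    rw [← Equiv.eq_symm_apply, Equiv.symm_apply_eq, Equiv.symm_apply_eq, Equiv.symm_apply_eq]
    exact (size_eq_three.1 h).1.symm
  · have h1 := fun h' => h ((inTriangle_shrinkStep hc hM d).1 h')
    have h2 := fun h' => h1 ((inTriangle_shrinkStep hc hM _).1 h')
    rw [shrinkStep_of_notMem hc hM h2, shrinkStep_of_notMem hc hM h1,
      shrinkStep_of_notMem hc hM h]
    exact (hc d.1).1

theorem shrinkStep_ne (d : {d // M.Surviving d}) : shrinkStep hc hM d ≠ d := fun h => by
  have h' := congrArg Subtype.val h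
  by_cases ht : M.InTriangle (M.rot.symm d.1)
  · rw [shrinkStep_of_mem hc hM ht, ← Equiv.eq_symm_apply, Equiv.symm_apply_eq] at h'
    exact (size_eq_three.1 ht).2 h'.symm
  · rw [shrinkStep_of_notMem hc hM ht] at h'
    exact absurd h' (hc.rot_ne _)

/-- The map obtained by shrinking all triangles to vertices. -/
noncomputable def shrink : CombMap where
  Dart := {d // M.Surviving d}
  rot :=
    { toFun := shrinkStep hc hM
      invFun := fun d => shrinkStep hc hM (shrinkStep hc hM d)
      left_inv := shrinkStep_cube hc hM
      right_inv := shrinkStep_cube hc hM }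
  opp := Function.Involutive.toPerm (fun d => ⟨M.opp d.1, d.2.opp⟩)
    fun d => Subtype.ext (M.opp_opp d.1)
  opp_opp d := Subtype.ext (M.opp_opp d.1)
  opp_ne d h := M.opp_ne d.1 (congrArg Subtype.val h)

theorem shrink_cubic : (shrink hc hM).Cubic := fun d =>
  ⟨shrinkStep_cube hc hM d, shrinkStep_ne hc hM d⟩

/-- The vertices to which the triangles are shrunk. -/
def shrinkCentres : Set (shrink hc hM).Vertex :=
  {v | ∃ d : {d // M.Surviving d}, M.InTriangle (M.rot.symm d.1) ∧ (shrink hc hM).vert d = v}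

theorem mem_shrinkCentres (d : {d // M.Surviving d}) :
    (shrink hc hM).vert d ∈ shrinkCentres hc hM ↔ M.InTriangle (M.rot.symm d.1) := by
  refine ⟨fun ⟨e, he, hv⟩ => ?_, fun h => ⟨d, h, rfl⟩⟩
  rcases (shrink_cubic hc hM).vert_eq hv with h | h | h
  · exact h ▸ he
  · rw [show d = shrinkStep hc hM e from h, inTriangle_shrinkStep]
    exact he
  · rw [show d = shrinkStep hc hM (shrinkStep hc hM e) from h, inTriangle_shrinkStep,
      inTriangle_shrinkStep]
    exact he

/-- A dart of the truncation of the shrunk map, as a dart of the original map. -/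
def unshrink : ((shrink hc hM).truncate (shrinkCentres hc hM)).Dart → M.Dart
  | Sum.inl d => d.1
  | Sum.inr (d, false) => M.rot d.1.1
  | Sum.inr (d, true) => M.rot (M.rot d.1.1)

theorem unshrink_rot (x : ((shrink hc hM).truncate (shrinkCentres hc hM)).Dart) :
    unshrink hc hM (((shrink hc hM).truncate (shrinkCentres hc hM)).rot x) =
      M.rot (unshrink hc hM x) := by
  revert x
  refine truncate_cases (fun d => ?_) (fun d h => ?_) fun d h => ?_
  · by_cases h : (shrink hc hM).vert d ∈ shrinkCentres hc hM
    · rw [truncate_rot_old_of_mem _ h]; rfl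
    · rw [truncate_rot_old_of_notMem _ h]
      exact shrinkStep_of_notMem hc hM fun h' => h ((mem_shrinkCentres hc hM d).2 h')
  · rfl
  · exact ((hc _).1).symm

theorem unshrink_opp (x : ((shrink hc hM).truncate (shrinkCentres hc hM)).Dart) :
    unshrink hc hM (((shrink hc hM).truncate (shrinkCentres hc hM)).opp x) =
      M.opp (unshrink hc hM x) := by
  have h1 : ∀ d h, unshrink hc hM (((shrink hc hM).truncate (shrinkCentres hc hM)).opp
      (truncNew d h false)) = M.opp (unshrink hc hM (truncNew d h false)) := by
    intro d h
    rw [truncate_opp_false]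
    show M.rot (M.rot (shrinkStep hc hM d).1) = M.opp (M.rot d.1)
    rw [shrinkStep_of_mem hc hM ((mem_shrinkCentres hc hM d).1 h), (hc _).1, next_symm_apply,
      ← hc.rot_rot, ← hc.rot_rot, (hc _).1]
  revert x
  refine truncate_cases (fun d => rfl) h1 fun d h => ?_
  have := h1 ((shrink hc hM).rot.symm d) (by rwa [vert_rot_symm])
  rw [← truncate_opp_true d h, CombMap.opp_opp] at this
  rw [this, M.opp_opp]

/-- The three kinds of darts of the truncation land in three disjoint classes: surviving darts,
darts opposite to a side of a triangle, and sides of triangles. -/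
theorem unshrink_injective : Function.Injective (unshrink hc hM) := by
  have hs : ∀ d h, unshrink hc hM (truncNew d h true) = M.rot.symm d.1 := fun d _ => hc.rot_rot d.1
  have hT : ∀ d h, M.InTriangle (unshrink hc hM (truncNew d h true)) := fun d h => by
    rw [hs]; exact (mem_shrinkCentres hc hM d).1 h
  have hF : ∀ d h, M.InTriangle (M.opp (unshrink hc hM (truncNew d h false))) := fun d h => by
    rw [← unshrink_opp, truncate_opp_false]; exact hT _ _
  have key : ∀ x y : ((shrink hc hM).truncate (shrinkCentres hc hM)).Dart,
      unshrink hc hM x = unshrink hc hM y → x = y := by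
    refine truncate_cases (fun d => ?_) (fun d h => ?_) fun d h => ?_
    · refine truncate_cases (fun e he => ?_) (fun e h' he => ?_) fun e h' he => ?_
      · exact congrArg _ (Subtype.ext he)
      · exact (d.2.2 (by have := hF e h'; rwa [← he] at this)).elim
      · exact (d.2.1 (by have := hT e h'; rwa [← he] at this)).elim
    · refine truncate_cases (fun e he => ?_) (fun e h' he => ?_) fun e h' he => ?_
      · exact (e.2.2 (by have := hF d h; rwa [he] at this)).elim
      · exact truncNew_inj.2 ⟨Subtype.ext (M.rot.injective he), rfl⟩
      · exact (hM _ (hT e h') (he ▸ hF d h)).elim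
    · refine truncate_cases (fun e he => ?_) (fun e h' he => ?_) fun e h' he => ?_
      · exact (e.2.1 (by have := hT d h; rwa [he] at this)).elim
      · exact (hM _ (hT d h) (he ▸ hF e h')).elim
      · exact truncNew_inj.2 ⟨Subtype.ext (M.rot.injective (M.rot.injective he)), rfl⟩
  exact fun x y => key x y

theorem unshrink_surjective : Function.Surjective (unshrink hc hM) := by
  have hT : ∀ e, M.InTriangle e → ∃ x, unshrink hc hM x = e := fun e he => by
    refine ⟨truncNew ⟨M.rot e, hM.surviving_rot hc he⟩
      ((mem_shrinkCentres hc hM _).2 (by rwa [Equiv.symm_apply_apply])) true, (hc e).1⟩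
  intro e
  by_cases h1 : M.InTriangle e
  · exact hT e h1
  by_cases h2 : M.InTriangle (M.opp e)
  · obtain ⟨x, hx⟩ := hT _ h2
    refine ⟨((shrink hc hM).truncate (shrinkCentres hc hM)).opp x, ?_⟩
    rw [unshrink_opp, hx, M.opp_opp]
  · exact ⟨truncOld _ ⟨e, h1, h2⟩, rfl⟩

end CombMap

/-! ### The fullerene obtained by shrinking -/

namespace CombMap

open Eis

variable {M : CombMap} {L : AddSubgroup Eis} {m n : ℕ}

theorem IsThree.exists_dev_of_formIV (h : M.IsThree n) (h4 : M.FormIV) :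
    ∃ L, Nonempty (Dev M L) ∧ ∀ j, unit j ∉ L := by
  obtain ⟨L, ⟨D⟩, -, rfl | hu⟩ := h.exists_dev
  · exact (D.not_formIV_of_top h4).elim
  · exact ⟨L, ⟨D⟩, hu⟩

namespace Dev

variable (D : Dev M L) (hu : ∀ j, unit j ∉ L)
include D hu

theorem trianglesApart : M.TrianglesApart := by
  intro d hd hd'
  obtain ⟨v, j, rfl⟩ := D.surj d
  rw [← D.isDev.2 v j] at hd'
  exact notMem_of_add_unit_mem hu (D.size_three_iff.1 hd') (D.size_three_iff.1 hd)

theorem eq_of_inTriangle_opp (h4 : M.FormIV) {d e : M.Dart} (hf : M.face d = M.face e)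
    (hd : M.InTriangle (M.opp d)) (he : M.InTriangle (M.opp e)) : d = e := by
  obtain ⟨v, j, rfl⟩ := D.surj d
  obtain ⟨i, rfl⟩ := D.exists_eq_of_face_eq hf.symm
  rw [← D.isDev.2] at hd he
  have hd' := D.size_three_iff.1 hd
  have h1 := h4.2 (M.face (D.φ v j)) (D.size_six_iff.2 (notMem_of_add_unit_mem hu hd'))
  rw [(D.ncard_adjTriangles_le_one_iff hu).1 h1 j i hd' (D.size_three_iff.1 he)]

end Dev

theorem face_eq_of_semiconj {M N : CombMap} {f : M.Dart → N.Dart}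
    (ho : ∀ d, f (M.opp d) = N.opp (f d)) (hr : ∀ d, f (M.rot d) = N.rot (f d)) {d e : M.Dart}
    (h : M.face d = M.face e) : N.face (f d) = N.face (f e) := by
  obtain ⟨k, -, rfl⟩ := exists_iterate_next_of_face_eq h
  have hn : Function.Semiconj f M.next N.next := fun d => by
    rw [next_apply, next_apply, hr, ho]
  rw [(hn.iterate_right k).eq, face_iterate_next]

section Shrink

variable (hc : M.Cubic) (hM : M.TrianglesApart)

/-- The truncation of the shrunk map is the original map. -/
noncomputable def unshrinkEquiv :
    ((shrink hc hM).truncate (shrinkCentres hc hM)).Dart ≃ M.Dart :=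
  Equiv.ofBijective _ ⟨unshrink_injective hc hM, unshrink_surjective hc hM⟩

theorem truncate_shrink_iso : ((shrink hc hM).truncate (shrinkCentres hc hM)).Iso M :=
  ⟨unshrinkEquiv hc hM, unshrink_opp hc hM, .inl (unshrink_rot hc hM)⟩

/-- The truncation of the shrunk map is `M` again, and the face of a surviving dart is not a
triangle. -/
theorem shrink_truncatesToHexagons (D : Dev M L) :
    (shrink hc hM).TruncatesToHexagons (shrinkCentres hc hM) := by
  intro d
  rw [← truncate_size_old]
  have h3 : ((shrink hc hM).truncate (shrinkCentres hc hM)).size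
      (((shrink hc hM).truncate (shrinkCentres hc hM)).face (truncOld _ d)) ≠ 3 := by
    rw [ne_eq, ← size_eq_three_of_equiv (e := unshrinkEquiv hc hM) (unshrink_opp hc hM)
      (unshrink_rot hc hM)]
    exact d.2.1
  rcases D.of_iso (truncate_shrink_iso hc hM) with ⟨⟨D'⟩⟩ | ⟨⟨D'⟩⟩
  exacts [(D'.sizes _).resolve_left h3, (D'.sizes _).resolve_left h3]

theorem eq_of_face_eq_of_mem_shrinkCentres
    (h : ∀ d e, M.face d = M.face e → M.InTriangle (M.opp d) → M.InTriangle (M.opp e) → d = e)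
    {d e : (shrink hc hM).Dart} (hf : (shrink hc hM).face d = (shrink hc hM).face e)
    (hd : (shrink hc hM).vert d ∈ shrinkCentres hc hM)
    (he : (shrink hc hM).vert e ∈ shrinkCentres hc hM) : d = e := by
  replace hd := (mem_shrinkCentres hc hM d).1 hd
  replace he := (mem_shrinkCentres hc hM e).1 he
  have h1 := face_eq_of_semiconj (unshrink_opp hc hM) (unshrink_rot hc hM)
    ((truncate_face_old_eq_iff (S := shrinkCentres hc hM)).2 hf)
  have h1' : M.face d.1 = M.face e.1 := h1
  apply Subtype.ext
  apply M.next.symm.injective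
  apply h _ _ (by rw [face_next_symm, face_next_symm, h1'])
  · rwa [next_symm_apply, M.opp_opp]
  · rwa [next_symm_apply, M.opp_opp]

end Shrink

section

variable {H : CombMap} {S : Set H.Vertex}

theorem connected_of_truncate_connected (hc : H.Cubic)
    (h : ∀ x y : (H.truncate S).Dart,
      ∃ g ∈ Subgroup.closure {(H.truncate S).rot, (H.truncate S).opp}, g x = y) :
    ∀ d e : H.Dart, ∃ g ∈ Subgroup.closure {H.rot, H.opp}, g d = e := by
  rw [connected_iff] at h ⊢
  rintro P hr ho ⟨d₀, h0⟩ d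
  let Q : (H.truncate S).Dart → Prop := fun x => match x with
    | Sum.inl d => P d
    | Sum.inr (d, _) => P d.1
  refine h Q ?_ ?_ ⟨truncOld S d₀, h0⟩ (truncOld S d)
  · refine truncate_cases (fun d hd => ?_) (fun d _ hd => hd) fun d _ hd => hd
    by_cases hS : H.vert d ∈ S
    · rw [truncate_rot_old_of_mem _ hS]; exact hd
    · rw [truncate_rot_old_of_notMem _ hS]; exact hr d hd
  · refine truncate_cases (fun d hd => ho d hd) (fun d _ hd => hr d hd) fun d _ hd => ?_
    show P (H.rot.symm d)
    rw [← hc.rot_rot]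
    exact hr _ (hr _ hd)

theorem TruncatesToHexagons.isTripleCentres (h : H.TruncatesToHexagons S)
    (hinj : ∀ d e, H.face d = H.face e → H.vert d ∈ S → H.vert e ∈ S → d = e) :
    H.IsTripleCentres S ∧ ∀ F, H.size F = 5 ∨ H.size F = 6 := by
  have hle : ∀ d, {e | H.face e = H.face d ∧ H.vert e ∈ S}.ncard ≤ 1 := fun d =>
    (Set.ncard_le_one (Set.toFinite _)).2 fun a ha b hb =>
      hinj a b (ha.1.trans hb.1.symm) ha.2 hb.2
  refine ⟨⟨fun d hd => ?_, fun F hF => ?_⟩, fun F => ?_⟩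
  · have h1 := h d
    have h2 := hle d
    have h3 : 0 < {e | H.face e = H.face d ∧ H.vert e ∈ S}.ncard :=
      (Set.ncard_pos (Set.toFinite _)).2 ⟨d, rfl, hd⟩
    omega
  · obtain ⟨d, rfl⟩ := face_surj F
    have h1 := h d
    have h3 : {e | H.face e = H.face d ∧ H.vert e ∈ S}.ncard ≠ 0 := by omega
    obtain ⟨a, ha, haS⟩ := Set.nonempty_of_ncard_ne_zero h3
    refine ⟨H.vert a, ⟨haS, a, rfl, ha⟩, ?_⟩
    rintro _ ⟨hS, b, rfl, hb⟩
    rw [hinj a b (ha.trans hb.symm) haS hS]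
  · obtain ⟨d, rfl⟩ := face_surj F
    have h1 := h d
    have h2 := hle d
    omega

/-- A cubic map that truncates to a map with isolated triangles is a fullerene. -/
theorem TruncatesToHexagons.isFullerene (hc : H.Cubic) (h : H.TruncatesToHexagons S)
    (hinj : ∀ d e, H.face d = H.face e → H.vert d ∈ S → H.vert e ∈ S → d = e)
    (hconn : ∀ d e : H.Dart, ∃ g ∈ Subgroup.closure {H.rot, H.opp}, g d = e)
    (hne : ∃ d, H.vert d ∈ S) : H.IsFullerene (Nat.card H.Vertex) := by
  obtain ⟨hS, hs⟩ := h.isTripleCentres hinj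
  obtain ⟨L, ⟨D⟩, hu, h12⟩ := h.exists_dev hc hconn hne
  have hdual := D.dualSimple fun j hj => (hu j hj).elim
  -- Old faces share the same old edges before and after truncation, so dual simplicity descends
  -- from the truncation.
  have hdH : H.DualSimple := by
    refine ⟨fun d hd => hdual.1 (truncOld S d) (truncate_face_old_eq_iff.2 hd), fun d e hf hf' => ?_⟩
    exact truncOld_injective (hdual.2 _ _ (truncate_face_old_eq_iff.2 hf)
      (truncate_face_old_eq_iff.2 hf'))
  have h2 : ∀ d, H.next (H.next d) ≠ d := by
    intro d hd
    have h1 := Function.IsPeriodicPt.minimalPeriod_le (f := H.next) (x := d) (n := 2) (by norm_num) hd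
    rw [← size_face] at h1
    rcases hs (H.face d) with h | h <;> omega
  -- Each of the 12 darts at centres lies on its own pentagon, and every pentagon is met.
  have h60 : {d | H.size (H.face d) = 5}.ncard = 60 := by
    rw [ncard_darts_of_size]
    have himg : H.face '' {d | H.vert d ∈ S} = {F | H.size F = 5} := by
      ext F
      refine ⟨?_, fun hF => ?_⟩
      · rintro ⟨d, hd, rfl⟩
        exact hS.1 d hd
      · obtain ⟨v, ⟨hv, d, rfl, hd⟩, -⟩ := hS.2 F hF
        exact ⟨d, hv, hd⟩
    have hI : Set.InjOn H.face {d | H.vert d ∈ S} := fun d hd e he hf => hinj d e hf hd he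
    rw [← himg, hI.ncard_image, h12]
  have hcard : 60 ≤ Nat.card H.Dart := by
    rw [← h60, ← Set.ncard_univ]
    exact Set.ncard_le_ncard (Set.subset_univ _)
  have hv := hc.card_dart
  exact ⟨⟨⟨hne.choose⟩, hconn, (euler_five_six hc hs).2 h60⟩, hdH.isSimple hc h2,
    hdH.isThreeConnected hc h2 hconn (by omega), cubic_iff.1 hc, hs, rfl⟩

theorem FaceAdj.symm {F G : M.Face} (h : M.FaceAdj F G) : M.FaceAdj G F := by
  obtain ⟨hne, d, rfl, rfl⟩ := h
  exact ⟨hne.symm, M.opp d, rfl, by rw [M.opp_opp]⟩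

theorem IsTripleCentres.pentagonsInTriples (hH : H.IsFullerene m) (hS : H.IsTripleCentres S) :
    H.PentagonsInTriples := by
  have hT := hS.truncatesToHexagons hH
  have hc := cubic_iff.2 hH.2.2.2.1
  obtain ⟨-, -, -, -, h12⟩ := hS.exists_dev hH
  let t : H.Vertex → Set H.Face := fun v => {F | ∃ d, H.vert d = v ∧ H.face d = F}
  have h5 : ∀ v ∈ S, ∀ F ∈ t v, H.size F = 5 := by
    rintro _ hv _ ⟨d, rfl, rfl⟩
    exact hS.1 d hv
  have huniq : ∀ v ∈ S, ∀ w ∈ S, ∀ F, F ∈ t v → F ∈ t w → v = w := fun v hv w hw F hF hF' =>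
    (hS.2 F (h5 v hv F hF)).unique ⟨hv, hF⟩ ⟨hw, hF'⟩
  have hSc : S.ncard = 4 := by
    have := Set.ncard_preimage_of_fibers H.vert S 3 fun v _ => hH.2.2.2.1 v
    rw [show H.vert ⁻¹' S = {d | H.vert d ∈ S} from rfl, h12] at this
    omega
  refine ⟨t '' S, ?_, ?_, ?_, ?_⟩
  · rw [Set.InjOn.ncard_image, hSc]
    intro v hv w hw h
    obtain ⟨d, hd⟩ := vert_surj v
    have hmem : H.face d ∈ t v := ⟨d, hd, rfl⟩
    exact huniq v hv w hw _ hmem (by have h' : t v = t w := h; rwa [← h'])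
  · rintro _ ⟨v, hv, rfl⟩ _ ⟨w, hw, rfl⟩ hne
    refine Set.disjoint_left.2 fun F hF hF' => hne ?_
    rw [huniq v hv w hw F hF hF']
  · ext F
    refine ⟨?_, fun hF => ?_⟩
    · rintro ⟨_, ⟨v, hv, rfl⟩, hF⟩
      exact h5 v hv F hF
    · obtain ⟨v, ⟨hv, hd⟩, -⟩ := hS.2 F hF
      exact ⟨_, ⟨v, hv, rfl⟩, hd⟩
  · rintro _ ⟨v, hv, rfl⟩
    obtain ⟨d, rfl⟩ := vert_surj v
    have hne : ∀ e, H.vert e = H.vert d → H.face e ≠ H.face (H.rot e) := by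
      intro e he hf
      have h1 : H.vert e ∈ S := he ▸ hv
      have := hT.eq_of_face_eq (by rw [hS.1 e h1]) hf h1 (by rwa [vert_rot])
      exact hc.rot_ne e this.symm
    have hadj : ∀ e, H.vert e = H.vert d → H.FaceAdj (H.face e) (H.face (H.rot e)) := fun e he =>
      ⟨hne e he, e, rfl, (face_rot e).symm⟩
    have a1 := hadj d rfl
    have a2 := hadj (H.rot d) (vert_rot d)
    have a3 := hadj (H.rot (H.rot d)) ((vert_rot _).trans (vert_rot d))
    rw [(hc d).1] at a3
    have ht : t (H.vert d) = {H.face d, H.face (H.rot d), H.face (H.rot (H.rot d))} := by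
      ext F
      refine ⟨?_, ?_⟩
      · rintro ⟨e, he, rfl⟩
        rcases hc.vert_eq he.symm with rfl | rfl | rfl <;> simp
      · rintro (rfl | rfl | rfl)
        exacts [⟨_, rfl, rfl⟩, ⟨_, vert_rot d, rfl⟩, ⟨_, (vert_rot _).trans (vert_rot d), rfl⟩]
    rw [ht]
    refine ⟨Set.ncard_eq_three.2 ⟨_, _, _, a1.1, a3.1.symm, a2.1, rfl⟩, ?_⟩
    rintro _ (rfl | rfl | rfl) _ (rfl | rfl | rfl) hFG
    exacts [absurd rfl hFG, a1, a3.symm, a1.symm, absurd rfl hFG, a2, a3, a2.symm, absurd rfl hFG]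

end

/-- The shrunk map is the fullerene: form (iv) says that each of its faces has at most one centre.
Any other fullerene with the same truncation is isomorphic to it because old darts are recognised by
the triangles. -/
theorem IsThree.exists_fullerene (h : M.IsThree n) (h4 : M.FormIV) :
    ∃ (m : ℕ) (H : CombMap), n = m + 8 ∧ H.IsFullerene m ∧ H.PentagonsInTriples ∧
      M.ShrinksTo H ∧
      ∀ (m' : ℕ) (H' : CombMap), H'.IsFullerene m' → H'.PentagonsInTriples →
        M.ShrinksTo H' → H'.Iso H := by
  have hc := cubic_iff.2 h.2.2.2.1
  obtain ⟨L, ⟨D⟩, hu⟩ := h.exists_dev_of_formIV h4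
  have hM := D.trianglesApart hu
  have hiso := truncate_shrink_iso hc hM
  have hT := shrink_truncatesToHexagons hc hM D
  have hcH := shrink_cubic hc hM
  have hinj := fun d e hf hd he => eq_of_face_eq_of_mem_shrinkCentres hc hM
    (fun d e hf hd he => D.eq_of_inTriangle_opp hu h4 hf hd he) (d := d) (e := e) hf hd he
  have hconn : ∀ d e : (shrink hc hM).Dart,
      ∃ g ∈ Subgroup.closure {(shrink hc hM).rot, (shrink hc hM).opp}, g d = e :=
    connected_of_truncate_connected hcH (S := shrinkCentres hc hM) (by
      rcases D.of_iso hiso with ⟨⟨D'⟩⟩ | ⟨⟨D'⟩⟩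
      exacts [D'.connected, D'.connected])
  have hne : ∃ d, (shrink hc hM).vert d ∈ shrinkCentres hc hM := by
    have ht : M.InTriangle (D.φ 0 0) := D.size_three_iff.2 (zero_mem L)
    refine ⟨⟨M.rot (D.φ 0 0), hM.surviving_rot hc ht⟩, ?_⟩
    refine (mem_shrinkCentres hc hM _).2 ?_
    rwa [Equiv.symm_apply_apply]
  have hH := hT.isFullerene hcH hinj hconn hne
  have hS := (hT.isTripleCentres hinj).1
  refine ⟨_, shrink hc hM, ?_, hH, hS.pentagonsInTriples hH, ⟨_, hS, hiso.symm⟩, ?_⟩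
  · obtain ⟨e, -⟩ := hiso
    have h1 := card_truncate_dart (H := shrink hc hM) (S := shrinkCentres hc hM)
    obtain ⟨-, -, -, -, h12⟩ := hS.exists_dev hH
    rw [Nat.card_congr e, hc.card_dart, hcH.card_dart, h12, h.2.2.2.2.2] at h1
    omega
  · rintro m' H' hH' - ⟨S', hS', hiso'⟩
    exact (hS'.truncatesToHexagons hH').iso_of_truncate_iso (cubic_iff.2 hH'.2.2.2.1) hcH hT
      (hiso'.symm.trans hiso.symm)

end CombMap

theorem theorem5p1 :
    -- the four forms are exhaustive and, with one exception, mutually exclusive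
    (∀ (n : ℕ) (M : CombMap), M.IsThree n →
      (M.FormI ∨ M.FormII ∨ M.FormIII ∨ M.FormIV) ∧
      ¬ (M.FormI ∧ M.FormII) ∧ ¬ (M.FormI ∧ M.FormIII) ∧ ¬ (M.FormI ∧ M.FormIV) ∧
      ¬ (M.FormII ∧ M.FormIV) ∧ ¬ (M.FormIII ∧ M.FormIV) ∧
      ((M.FormII ∧ M.FormIII) ↔ M.Iso CombMap.cubeTruncatedOppositeEdges)) ∧
    -- form (i)
    (CombMap.tetrahedron.IsThree 4 ∧ CombMap.truncatedTetrahedron.IsThree 12 ∧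
      ∀ (n : ℕ) (M : CombMap), M.IsThree n →
        ((∃ F, M.size F = 6 ∧ 2 < (M.adjTriangles F).ncard) ↔ M.Iso CombMap.truncatedTetrahedron)) ∧
    -- the case n = 16
    (CombMap.cubeTruncatedNonadjacent.IsThree 16 ∧ CombMap.cubeTruncatedOppositeEdges.IsThree 16 ∧
      ¬ CombMap.cubeTruncatedNonadjacent.Iso CombMap.cubeTruncatedOppositeEdges ∧
      CombMap.cubeTruncatedNonadjacent.FormII ∧ CombMap.cubeTruncatedOppositeEdges.FormII ∧
      CombMap.cubeTruncatedNonadjacent.HasPointGroup PointGroup.Td ∧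
      CombMap.cubeTruncatedOppositeEdges.HasPointGroup PointGroup.D2h ∧
      ∀ M : CombMap, M.IsThree 16 →
        M.Iso CombMap.cubeTruncatedNonadjacent ∨ M.Iso CombMap.cubeTruncatedOppositeEdges) ∧
    -- form (ii)
    ((∀ (n : ℕ) (M : CombMap), M.IsThree n → M.FormII →
        8 ∣ n ∧ 16 ≤ n ∧ (M.oppositeHexagons.ncard = 2 ∨ M.Iso CombMap.cubeTruncatedNonadjacent)) ∧
      (∀ n : ℕ, 24 ≤ n → n % 16 = 8 →
        ∃ M : CombMap, M.IsThree n ∧ M.FormII ∧ M.HasPointGroup PointGroup.D2 ∧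
          ∀ M' : CombMap, M'.IsThree n → M'.FormII → M'.Iso M) ∧
      (∀ n : ℕ, 32 ≤ n → n % 16 = 0 →
        ∃ M₁ M₂ : CombMap, M₁.IsThree n ∧ M₁.FormII ∧ M₁.HasPointGroup PointGroup.D2h ∧
          M₂.IsThree n ∧ M₂.FormII ∧ M₂.HasPointGroup PointGroup.D2d ∧ ¬ M₁.Iso M₂ ∧
          ∀ M' : CombMap, M'.IsThree n → M'.FormII → M'.Iso M₁ ∨ M'.Iso M₂)) ∧
    -- form (iii)
    ((∀ (n : ℕ) (M : CombMap), M.IsThree n → M.FormIII → 4 ∣ n ∧ 16 ≤ n) ∧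
      (∀ n : ℕ, 16 ≤ n → 4 ∣ n →
        ∃ M : CombMap, M.IsThree n ∧ M.FormIII ∧
          (Even (n / 4) → M.HasPointGroup PointGroup.D2h) ∧
          (Odd (n / 4) → M.HasPointGroup PointGroup.D2d) ∧
          ∀ M' : CombMap, M'.IsThree n → M'.FormIII → M'.Iso M)) ∧
    -- form (iv): up to isomorphism, shrinking the triangles is a bijection onto the fullerenes
    -- whose pentagons form four triples
    ((∀ (n : ℕ) (M : CombMap), M.IsThree n → M.FormIV →
        ∃ (m : ℕ) (H : CombMap), n = m + 8 ∧ H.IsFullerene m ∧ H.PentagonsInTriples ∧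
          M.ShrinksTo H ∧
          ∀ (m' : ℕ) (H' : CombMap), H'.IsFullerene m' → H'.PentagonsInTriples →
            M.ShrinksTo H' → H'.Iso H) ∧
      (∀ (m : ℕ) (H : CombMap), H.IsFullerene m → H.PentagonsInTriples →
        (∃ S, H.IsTripleCentres S) ∧
        (∀ S, H.IsTripleCentres S → (H.truncate S).IsThree (m + 8) ∧ (H.truncate S).FormIV) ∧
        (∀ S S', H.IsTripleCentres S → H.IsTripleCentres S' →
          (H.truncate S).Iso (H.truncate S')))) := by
  refine ⟨fun n M h => h.forms,
    ⟨CombMap.tetrahedron_isThree, ?_, fun n M h => h.two_lt_iff⟩,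
    ⟨?_, ?_, CombMap.cubes_not_iso, ?_, ?_, ?_, ?_, fun M h => h.sixteen⟩,
    ⟨fun n M h h2 => h.of_formII h2, fun n hn hn' => ?_, fun n hn hn' => ?_⟩,
    ⟨fun n M h h3 => ?_, fun n hn hn' => ?_⟩,
    fun n M h h4 => h.exists_fullerene h4,
    fun m H hH hP => ⟨hP.exists_isTripleCentres hH, fun S hS => hS.isThree hH,
      fun S S' hS hS' => hS.truncate_iso hH hS'⟩⟩
  · have ⟨D⟩ := CombMap.truncatedTetrahedron_dev
    exact D.isThree_skewLattice le_rfl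
  · have ⟨D⟩ := CombMap.cubeTruncatedNonadjacent_dev
    exact D.isThree_lattice_zero le_rfl
  · have ⟨D⟩ := CombMap.cubeTruncatedOppositeEdges_dev
    exact D.isThree_skewLattice (by norm_num)
  · have ⟨D⟩ := CombMap.cubeTruncatedNonadjacent_dev
    exact D.formII_lattice le_rfl
  · have ⟨D⟩ := CombMap.cubeTruncatedOppositeEdges_dev
    exact D.formII_of_skewLattice_four
  · have ⟨D⟩ := CombMap.cubeTruncatedNonadjacent_dev
    exact D.hasPointGroup_lattice_zero_two
  · have ⟨D⟩ := CombMap.cubeTruncatedOppositeEdges_dev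
    exact (D.hasPointGroup_skewLattice le_rfl).1 (by decide)
  · obtain ⟨m, rfl⟩ : 8 ∣ n := by omega
    exact CombMap.exists_formII_of_odd (by omega) (Nat.odd_iff.2 (by omega))
  · obtain ⟨m, rfl⟩ : 8 ∣ n := by omega
    exact CombMap.exists_formII_of_even (by omega) (Nat.even_iff.2 (by omega))
  · obtain ⟨k, hk, rfl, -⟩ := h.exists_skewLattice h3
    exact ⟨dvd_mul_right _ _, by omega⟩
  · obtain ⟨k, rfl⟩ := hn'
    rw [Nat.mul_div_cancel_left k (by norm_num)]
    exact CombMap.exists_formIII (by omega)
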